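/- Let $\mathcal C$ be a locally cartesian closed category: $\mathcal C$ has finite limits and, for every $f:I\to J$, the pullback functor $\Delta_f:\mathcal C/J\to\mathcal C/I$ has, besides its left adjoint $\Sigma_f$, a right adjoint $\Pi_f$. *Strong functors.* For $A\in\mathcal C$ and $x:X\to I$, let $A\odot x$ be the slice $A\times X\to X\to I$. A strength on a functor $F:\mathcal C/I\to\mathcal C/J$ is a family $\tau_{A,x}:A\odot F(x)\to F(A\odot x)$, natural in $A$ and $x$, satisfying the unit and associativity laws. A natural transformation between strong functors is strong if it commutes with the strengths. The functors $\Delta_f,\Sigma_f,\Pi_f$, and composites of these, carry canonical strengths. *Polynomial and linear functors.* A polynomial diagram $D$ from $I$ to $J$ is a diagram $I\xleftarrow{n}D\xrightarrow{d}A\xrightarrow{a}J$; its extension is $[\![D]\!]=\Sigma_a\Pi_d\Delta_n:\mathcal C/I\to\mathcal C/J$. A polynomial functor is a strong functor that is strongly naturally isomorphic to some $[\![D]\!]$. A span $R=(I\xleftarrow{l}R\xrightarrow{r}J)$ has a linear functor $\langle R\rangle=\Sigma_r\Delta_l$. *The category $\mathrm{PFSim}_{\mathcal C}$.* Objects are the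 polynomial endofunctors $P:\mathcal C/I\to\mathcal C/I$ on slices of $\mathcal C$. A strong simulation from $P_1$ (on $\mathcal C/I_1$) to $P_2$ (on $\mathcal C/I_2$) is a span $R$ from $I_1$ to $I_2$ together with a strong natural transformation $\rho:\langle R\rangle P_1\Rightarrow P_2\langle R\rangle$. Simulations $(R,\rho)$ and $(R',\rho')$ are equivalent if $P_2\varepsilon\circ\rho=\rho'\circ\varepsilon P_1$ for some strong natural isomorphism $\varepsilon:\langle R\rangle\cong\langle R'\rangle$. Morphisms are equivalence classes of strong simulations; composition is composition of spans by pullback together with pasting of cells along the canonical isomorphisms $\langle S\circ R\rangle\cong\langle S\rangle\langle R\rangle$. *The tensor.* For polynomial diagrams, $D_1\otimes D_2$ is the componentwise cartesian product, and for polynomial functors $P_i\cong[\![D_i]\!]$ one puts $P_1\otimes P_2=[\![D_1\otimes D_2]\!]$ (for a choice of representing diagrams), an endofunctor on $\mathcal C/(I_1\times I_2)$. There is a canonical natural family $P_1(x)\times P_2(y)\to(P_1\otimes P_2)(x\times y)$, where $x\times y$ over $I_1\times I_2$ is the product of the slices $x$ over $I_1$ and $y$ over $I_2$. On morphisms, $[(R,\sigma)]\otimes[(S,\tau)]=[(R\times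 S,\rho)]$ for a strong natural transformation $\rho:\langle R\times S\rangle(P_1\otimes P_2)\Rightarrow(P_1'\otimes P_2')\langle R\times S\rangle$ which along these canonical families restricts to $\sigma_x\times\tau_y$ at every $x\times y$. **Proposition.** Such $\rho$ exist, and $\mathrm{PFSim}_{\mathcal C}$ with the tensor $\otimes$ (on objects and on morphisms as above) is symmetric monoidal closed: $\otimes$ is the tensor product of a symmetric monoidal structure on $\mathrm{PFSim}_{\mathcal C}$, and there are a functor $\multimap:\mathrm{PFSim}_{\mathcal C}^{\mathrm{op}}\times\mathrm{PFSim}_{\mathcal C}\to\mathrm{PFSim}_{\mathcal C}$ and bijections $$\mathrm{PFSim}_{\mathcal C}[P_1\otimes P_2,\ P_3]\;\cong\;\mathrm{PFSim}_{\mathcal C}[P_1,\ P_2\multimap P_3]$$ natural in $P_1$ and $P_3$ (and also in $P_2$). -/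

import Mathlib

open CategoryTheory CategoryTheory.Limits

universe v u

noncomputable section

namespace PolySim

/-- A category is locally cartesian closed when it has finite limits and every pullback functor
`Over.pullback f` between slices has a right adjoint. -/
class LCCC (C : Type u) [Category.{v} C] : Prop extends HasFiniteLimits C where
  pullback_isLeftAdjoint : ∀ {I J : C} (f : I ⟶ J), (Over.pullback f).IsLeftAdjoint

attribute [instance] LCCC.pullback_isLeftAdjoint

variable {C : Type u} [Category.{v} C] [LCCC C]

/-! ### The action of `C` on its slices -/

/-- The slice `A ⊙ x`, i.e. the composite `A × X ⟶ X ⟶ I`, for `x : X ⟶ I`. -/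
def act (A : C) {I : C} (x : Over I) : Over I :=
  Over.mk ((prod.snd : A ⨯ x.left ⟶ x.left) ≫ x.hom)

/-- The projection `A × X ⟶ A`. -/
def actFst (A : C) {I : C} (x : Over I) : (act A x).left ⟶ A :=
  (prod.fst : A ⨯ x.left ⟶ A)

/-- The projection `A ⊙ x ⟶ x`. -/
def actProj (A : C) {I : C} (x : Over I) : act A x ⟶ x :=
  Over.homMk (prod.snd : A ⨯ x.left ⟶ x.left) rfl

/-- Morphisms into `A ⊙ x` are pairs. -/
def actLift {A : C} {I : C} {x z : Over I} (a : z.left ⟶ A) (g : z ⟶ x) : z ⟶ act A x :=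
  Over.homMk (prod.lift a g.left : z.left ⟶ A ⨯ x.left) (by
    change prod.lift a g.left ≫ prod.snd ≫ x.hom = z.hom
    rw [prod.lift_snd_assoc, Over.w])

@[simp] lemma actLift_fst {A : C} {I : C} {x z : Over I} (a : z.left ⟶ A) (g : z ⟶ x) :
    (actLift a g).left ≫ actFst A x = a := prod.lift_fst a g.left

@[simp] lemma actLift_proj {A : C} {I : C} {x z : Over I} (a : z.left ⟶ A) (g : z ⟶ x) :
    actLift a g ≫ actProj A x = g := by
  ext; exact prod.lift_snd a g.left

lemma act_ext {A : C} {I : C} {x z : Over I} {g h : z ⟶ act A x}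
    (h₁ : g.left ≫ actFst A x = h.left ≫ actFst A x)
    (h₂ : g ≫ actProj A x = h ≫ actProj A x) : g = h := by
  ext
  exact prod.hom_ext h₁ (congrArg (fun k => k.left) h₂)

/-- The action of `⊙` on morphisms. -/
def actMap {A B : C} (a : A ⟶ B) {I : C} {x y : Over I} (g : x ⟶ y) : act A x ⟶ act B y :=
  actLift (actFst A x ≫ a) (actProj A x ≫ g)

/-- The canonical morphism `(A × B) ⊙ x ⟶ A ⊙ (B ⊙ x)`. -/
def actAssoc (A B : C) {I : C} (x : Over I) : act (A ⨯ B) x ⟶ act A (act B x) :=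
  actLift (actFst (A ⨯ B) x ≫ prod.fst)
    (actLift (actFst (A ⨯ B) x ≫ prod.snd) (actProj (A ⨯ B) x))

lemma actMap_fst {A B : C} (a : A ⟶ B) {I : C} {x y : Over I} (g : x ⟶ y) :
    (actMap a g).left ≫ actFst B y = actFst A x ≫ a := actLift_fst _ _

lemma actMap_proj {A B : C} (a : A ⟶ B) {I : C} {x y : Over I} (g : x ⟶ y) :
    actMap a g ≫ actProj B y = actProj A x ≫ g := actLift_proj _ _

lemma act_comp_lift {A : C} {I : C} {w x z : Over I} (k : w ⟶ z) (a : z.left ⟶ A) (g : z ⟶ x) :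
    k ≫ actLift a g = actLift (k.left ≫ a) (k ≫ g) := by
  apply act_ext
  · rw [Over.comp_left, Category.assoc, actLift_fst, actLift_fst]
  · rw [Category.assoc, actLift_proj, actLift_proj]

lemma actLift_map {A B : C} {I : C} {x y z : Over I} (k : z.left ⟶ A) (h : z ⟶ x)
    (a : A ⟶ B) (g : x ⟶ y) : actLift k h ≫ actMap a g = actLift (k ≫ a) (h ≫ g) := by
  rw [actMap, act_comp_lift, ← Category.assoc, actLift_fst, ← Category.assoc, actLift_proj]

lemma actMap_comp {A B D : C} (a : A ⟶ B) (b : B ⟶ D) {I : C} {x y z : Over I}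
    (g : x ⟶ y) (h : y ⟶ z) : actMap (a ≫ b) (g ≫ h) = actMap a g ≫ actMap b h := by
  rw [actMap, actMap, actLift_map, Category.assoc, Category.assoc]

lemma actMap_id_comp (A : C) {I : C} {x y z : Over I}
    (g : x ⟶ y) (h : y ⟶ z) : actMap (𝟙 A) (g ≫ h) = actMap (𝟙 A) g ≫ actMap (𝟙 A) h := by
  rw [← actMap_comp, Category.comp_id]

@[simp] lemma actMap_id (A : C) {I : C} (x : Over I) : actMap (𝟙 A) (𝟙 x) = 𝟙 (act A x) := by
  apply act_ext
  · rw [actMap_fst, Category.comp_id, Over.id_left, Category.id_comp]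
  · rw [actMap_proj, Category.comp_id, Category.id_comp]

lemma actLift_assoc {A B : C} {I : C} {x z : Over I} (k : z.left ⟶ A ⨯ B) (h : z ⟶ x) :
    actLift k h ≫ actAssoc A B x = actLift (k ≫ prod.fst) (actLift (k ≫ prod.snd) h) := by
  rw [actAssoc, act_comp_lift, act_comp_lift, ← Category.assoc, actLift_fst, ← Category.assoc,
    actLift_fst, actLift_proj]

lemma actAssoc_natural (A B : C) {I : C} {x y : Over I} (g : x ⟶ y) :
    actMap (𝟙 (A ⨯ B)) g ≫ actAssoc A B y = actAssoc A B x ≫ actMap (𝟙 A) (actMap (𝟙 B) g) := by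
  rw [actMap, actLift_assoc, actAssoc, actLift_map, actLift_map]
  simp only [Category.comp_id]

/-! ### Strong functors between slices and strong natural transformations -/

/-- A functor between slices of `C` together with a strength
`τ_{A,x} : A ⊙ F(x) ⟶ F(A ⊙ x)`. The law `str_proj` is the unit law of a strength: by naturality
in `A`, it is equivalent to its special case where `A` is terminal. -/
structure StrongFunctor (I J : C) where
  toFunctor : Over I ⥤ Over J
  str : ∀ (A : C) (x : Over I), act A (toFunctor.obj x) ⟶ toFunctor.obj (act A x)
  str_natural : ∀ {A B : C} (a : A ⟶ B) {x y : Over I} (g : x ⟶ y),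
    actMap a (toFunctor.map g) ≫ str B y = str A x ≫ toFunctor.map (actMap a g)
  str_proj : ∀ (A : C) (x : Over I),
    str A x ≫ toFunctor.map (actProj A x) = actProj A (toFunctor.obj x)
  str_assoc : ∀ (A B : C) (x : Over I),
    str (A ⨯ B) x ≫ toFunctor.map (actAssoc A B x) =
      actAssoc A B (toFunctor.obj x) ≫ actMap (𝟙 A) (str B x) ≫ str A (act B x)

/-- A natural transformation between strong functors is strong when it is compatible with the
strengths. -/
@[ext]
structure StrongNat {I J : C} (F G : StrongFunctor I J) where
  app : ∀ x : Over I, F.toFunctor.obj x ⟶ G.toFunctor.obj x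
  naturality : ∀ {x y : Over I} (g : x ⟶ y),
    F.toFunctor.map g ≫ app y = app x ≫ G.toFunctor.map g
  strong : ∀ (A : C) (x : Over I),
    actMap (𝟙 A) (app x) ≫ G.str A x = F.str A x ≫ app (act A x)

/-- Strong functors between two given slices and strong natural transformations. -/
instance {I J : C} : Category (StrongFunctor I J) where
  Hom := StrongNat
  id F := ⟨fun x => 𝟙 _, by simp, by simp⟩
  comp α β := ⟨fun x => α.app x ≫ β.app x,
    fun g => by rw [← Category.assoc, α.naturality, Category.assoc, β.naturality, Category.assoc],
    fun A x => by
      rw [actMap_id_comp, Category.assoc, β.strong, ← Category.assoc, α.strong, Category.assoc]⟩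
  id_comp α := by apply StrongNat.ext; funext x; exact Category.id_comp _
  comp_id α := by apply StrongNat.ext; funext x; exact Category.comp_id _
  assoc α β γ := by apply StrongNat.ext; funext x; exact Category.assoc _ _ _

@[ext] lemma StrongFunctor.hom_ext {I J : C} {F G : StrongFunctor I J} {α β : F ⟶ G}
    (h : ∀ x, StrongNat.app α x = StrongNat.app β x) : α = β :=
  StrongNat.ext (funext h)

@[simp] lemma StrongFunctor.id_app {I J : C} (F : StrongFunctor I J) (x : Over I) :
    StrongNat.app (𝟙 F) x = 𝟙 _ := rfl
@[simp] lemma StrongFunctor.comp_app {I J : C} {F G H : StrongFunctor I J}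
    (α : F ⟶ G) (β : G ⟶ H) (x : Over I) :
    StrongNat.app (α ≫ β) x = StrongNat.app α x ≫ StrongNat.app β x := rfl

namespace StrongFunctor

/-- The identity functor of a slice. -/
@[simps] abbrev id (I : C) : StrongFunctor I I where
  toFunctor := 𝟭 _
  str A x := 𝟙 _
  str_natural := by simp
  str_proj := by simp
  str_assoc := by simp

/-- Composition of strong functors, in diagrammatic order. -/
@[simps] abbrev comp {I J K : C} (F : StrongFunctor I J) (G : StrongFunctor J K) :
    StrongFunctor I K where
  toFunctor := F.toFunctor ⋙ G.toFunctor
  str A x := G.str A (F.toFunctor.obj x) ≫ G.toFunctor.map (F.str A x)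
  str_natural a x y g := by
    dsimp
    rw [← Category.assoc, G.str_natural, Category.assoc, ← G.toFunctor.map_comp, F.str_natural,
      G.toFunctor.map_comp, Category.assoc]
  str_proj A x := by
    dsimp
    rw [Category.assoc, ← G.toFunctor.map_comp, F.str_proj, G.str_proj]
  str_assoc A B x := by
    dsimp
    rw [Category.assoc, ← G.toFunctor.map_comp, F.str_assoc, G.toFunctor.map_comp,
      ← Category.assoc, G.str_assoc, G.toFunctor.map_comp, actMap_id_comp]
    simp only [Category.assoc]
    rw [← Category.assoc (G.str A _) (G.toFunctor.map _), ← G.str_natural, Category.assoc]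

/-- The natural transformation `G(α)`. -/
def whiskerRight {I J K : C} {F F' : StrongFunctor I J} (α : F ⟶ F') (G : StrongFunctor J K) :
    F.comp G ⟶ F'.comp G where
  app x := G.toFunctor.map (StrongNat.app α x)
  naturality g := by
    dsimp
    rw [← G.toFunctor.map_comp, StrongNat.naturality, G.toFunctor.map_comp]
  strong A x := by
    dsimp
    rw [← Category.assoc, G.str_natural, Category.assoc, ← G.toFunctor.map_comp,
      StrongNat.strong, G.toFunctor.map_comp, Category.assoc]

/-- The natural transformation `α_F`. -/
def whiskerLeft {I J K : C} (F : StrongFunctor I J) {G G' : StrongFunctor J K} (α : G ⟶ G') :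
    F.comp G ⟶ F.comp G' where
  app x := StrongNat.app α (F.toFunctor.obj x)
  naturality g := StrongNat.naturality α _
  strong A x := by
    have h := StrongNat.strong α A (F.toFunctor.obj x)
    have h' := StrongNat.naturality α (F.str A x)
    dsimp
    rw [← Category.assoc, h, Category.assoc, Category.assoc]
    exact congrArg _ h'.symm

@[simp] lemma whiskerRight_app {I J K : C} {F F' : StrongFunctor I J} (α : F ⟶ F')
    (G : StrongFunctor J K) (x : Over I) :
    StrongNat.app (whiskerRight α G) x = G.toFunctor.map (StrongNat.app α x) := rfl
@[simp] lemma whiskerLeft_app {I J K : C} (F : StrongFunctor I J) {G G' : StrongFunctor J K}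
    (α : G ⟶ G') (x : Over I) :
    StrongNat.app (whiskerLeft F α) x = StrongNat.app α (F.toFunctor.obj x) := rfl

/-- `Σ_f`, with the canonical strength `A ⊙ Σ_f(x) = Σ_f(A ⊙ x)`. -/
def sigma {I J : C} (f : I ⟶ J) : StrongFunctor I J where
  toFunctor := Over.map f
  str A x := Over.homMk (𝟙 (A ⨯ x.left)) (by
    change 𝟙 _ ≫ ((prod.snd : A ⨯ x.left ⟶ x.left) ≫ x.hom) ≫ f =
      (prod.snd : A ⨯ x.left ⟶ x.left) ≫ x.hom ≫ f
    rw [Category.id_comp, Category.assoc])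
  str_natural a x y g := by
    ext; exact (Category.comp_id _).trans (Category.id_comp _).symm
  str_proj A x := by
    ext; exact Category.id_comp _
  str_assoc A B x := by
    ext
    refine (Category.id_comp _).trans (Eq.symm ?_)
    change (actAssoc A B x).left ≫ (actMap (𝟙 A) (𝟙 (act B x))).left ≫ 𝟙 _ = _
    rw [actMap_id, Category.comp_id, Over.id_left, Category.comp_id]
    rfl

/-- The projection `Δ_f(x) ⟶ x` on total objects. -/
def pullFst {I J : C} (f : I ⟶ J) (x : Over J) : ((Over.pullback f).obj x).left ⟶ x.left :=
  pullback.fst x.hom f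

lemma pullFst_hom {I J : C} (f : I ⟶ J) (x : Over J) :
    pullFst f x ≫ x.hom = ((Over.pullback f).obj x).hom ≫ f := pullback.condition

/-- Morphisms into `Δ_f(x)`. -/
def pullLift {I J : C} {f : I ⟶ J} {x : Over J} {z : Over I} (k : z.left ⟶ x.left)
    (w : k ≫ x.hom = z.hom ≫ f) : z ⟶ (Over.pullback f).obj x :=
  Over.homMk (pullback.lift k z.hom w) (pullback.lift_snd _ _ _)

@[simp] lemma pullLift_fst {I J : C} {f : I ⟶ J} {x : Over J} {z : Over I} (k : z.left ⟶ x.left)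
    (w : k ≫ x.hom = z.hom ≫ f) : (pullLift k w).left ≫ pullFst f x = k :=
  pullback.lift_fst _ _ _

lemma pullMap_fst {I J : C} (f : I ⟶ J) {x y : Over J} (g : x ⟶ y) :
    ((Over.pullback f).map g).left ≫ pullFst f y = pullFst f x ≫ g.left := by
  exact pullback.lift_fst _ _ _

lemma pull_ext {I J : C} {f : I ⟶ J} {x : Over J} {z : Over I}
    {g h : z ⟶ (Over.pullback f).obj x}
    (w : g.left ≫ pullFst f x = h.left ≫ pullFst f x) : g = h := by
  ext
  exact pullback.hom_ext w ((Over.w g).trans (Over.w h).symm)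

/-- The strength `A ⊙ Δ_f(x) ⟶ Δ_f(A ⊙ x)` of the pullback functor `Δ_f`, i.e.
`(a, x, i) ↦ ((a, x), i)`. -/
def deltaStr {I J : C} (f : I ⟶ J) (A : C) (x : Over J) :
    act A ((Over.pullback f).obj x) ⟶ (Over.pullback f).obj (act A x) :=
  pullLift (prod.map (𝟙 A) (pullFst f x)) (by
    change prod.map (𝟙 A) (pullFst f x) ≫ prod.snd ≫ x.hom =
      (prod.snd ≫ ((Over.pullback f).obj x).hom) ≫ f
    rw [prod.map_snd_assoc, pullFst_hom, Category.assoc])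

/-- The inverse of the strength of `Δ_f`. -/
def deltaStrInv {I J : C} (f : I ⟶ J) (A : C) (x : Over J) :
    (Over.pullback f).obj (act A x) ⟶ act A ((Over.pullback f).obj x) :=
  actLift (pullFst f (act A x) ≫ actFst A x) ((Over.pullback f).map (actProj A x))

lemma deltaStr_fst {I J : C} (f : I ⟶ J) (A : C) (x : Over J) :
    (deltaStr f A x).left ≫ pullFst f (act A x) = prod.map (𝟙 A) (pullFst f x) :=
  pullLift_fst _ _

lemma deltaStr_inv {I J : C} (f : I ⟶ J) (A : C) (x : Over J) :
    deltaStr f A x ≫ deltaStrInv f A x = 𝟙 _ := by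
  rw [deltaStrInv, act_comp_lift]
  apply act_ext
  · rw [actLift_fst, ← Category.assoc, deltaStr_fst, Over.id_left, Category.id_comp]
    exact (prod.map_fst _ _).trans (Category.comp_id _)
  · rw [actLift_proj, Category.id_comp]
    apply pull_ext
    rw [Over.comp_left, Category.assoc, pullMap_fst, ← Category.assoc, deltaStr_fst]
    exact prod.map_snd _ _

lemma deltaStrInv_natural {I J : C} (f : I ⟶ J) {A B : C} (a : A ⟶ B) {x y : Over J}
    (g : x ⟶ y) : (Over.pullback f).map (actMap a g) ≫ deltaStrInv f B y =
      deltaStrInv f A x ≫ actMap a ((Over.pullback f).map g) := by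
  rw [deltaStrInv, deltaStrInv, act_comp_lift, actLift_map, ← Functor.map_comp,
    ← Functor.map_comp, actMap_proj, ← Category.assoc, pullMap_fst, Category.assoc, actMap_fst,
    Category.assoc]

lemma deltaStrInv_proj {I J : C} (f : I ⟶ J) (A : C) (x : Over J) :
    deltaStrInv f A x ≫ actProj A _ = (Over.pullback f).map (actProj A x) :=
  actLift_proj _ _

lemma deltaStrInv_assoc {I J : C} (f : I ⟶ J) (A B : C) (x : Over J) :
    (Over.pullback f).map (actAssoc A B x) ≫ deltaStrInv f A (act B x) ≫
      actMap (𝟙 A) (deltaStrInv f B x) = deltaStrInv f (A ⨯ B) x ≫ actAssoc A B _ := by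
  have h₁ : actAssoc A B x ≫ actProj A (act B x) =
      actLift (actFst (A ⨯ B) x ≫ prod.snd) (actProj (A ⨯ B) x) := actLift_proj _ _
  rw [deltaStrInv, deltaStrInv, deltaStrInv, actLift_map, act_comp_lift, actLift_assoc,
    ← Category.assoc ((Over.pullback f).map _), ← Functor.map_comp, h₁, act_comp_lift,
    ← Functor.map_comp, actLift_proj]
  congr 1
  · rw [Category.comp_id, ← Category.assoc, pullMap_fst, Category.assoc, actAssoc, actLift_fst,
      Category.assoc]
  · congr 1
    rw [← Category.assoc, pullMap_fst, Category.assoc, actLift_fst, Category.assoc]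

lemma deltaStrInv_deltaStr {I J : C} (f : I ⟶ J) (A : C) (x : Over J) :
    deltaStrInv f A x ≫ deltaStr f A x = 𝟙 _ := by
  apply pull_ext
  have h := congrArg (fun k => k.left ≫ pullFst f x) (deltaStrInv_proj f A x)
  rw [Over.comp_left, Category.assoc, deltaStr_fst, Over.id_left, Category.id_comp]
  have e₁ : (prod.map (𝟙 A) (pullFst f x) : _ ⟶ A ⨯ x.left) ≫ prod.fst = prod.fst :=
    (prod.map_fst _ _).trans (Category.comp_id _)
  refine prod.hom_ext ?_ ?_
  · refine (Category.assoc _ _ _).trans ((congrArg _ e₁).trans ?_)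
    exact actLift_fst _ _
  · refine (Category.assoc _ _ _).trans ((congrArg _ (prod.map_snd _ _)).trans ?_)
    exact ((Category.assoc _ _ _).symm.trans h).trans (pullMap_fst _ _)

lemma deltaStr_hom_ext {I J : C} (f : I ⟶ J) {A : C} {x : Over J} {z : Over I}
    {g h : z ⟶ (Over.pullback f).obj (act A x)}
    (w : g ≫ deltaStrInv f A x = h ≫ deltaStrInv f A x) : g = h := by
  rw [← Category.comp_id g, ← Category.comp_id h, ← deltaStrInv_deltaStr, ← Category.assoc, w, Category.assoc]

/-- `Δ_f`, with its canonical strength. -/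
def delta {I J : C} (f : I ⟶ J) : StrongFunctor J I where
  toFunctor := Over.pullback f
  str := deltaStr f
  str_natural a x y g := by
    apply deltaStr_hom_ext
    rw [Category.assoc, deltaStr_inv, Category.comp_id, Category.assoc, deltaStrInv_natural,
      ← Category.assoc, deltaStr_inv, Category.id_comp]
  str_proj A x := by
    rw [← deltaStrInv_proj, ← Category.assoc, deltaStr_inv, Category.id_comp]
  str_assoc A B x := by
    apply deltaStr_hom_ext
    simp only [Category.assoc, deltaStr_inv, Category.comp_id]
    calc deltaStr f (A ⨯ B) x ≫ (Over.pullback f).map (actAssoc A B x) ≫ deltaStrInv f A (act B x)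
        = deltaStr f (A ⨯ B) x ≫ ((Over.pullback f).map (actAssoc A B x) ≫
            deltaStrInv f A (act B x) ≫ actMap (𝟙 A) (deltaStrInv f B x)) ≫
              actMap (𝟙 A) (deltaStr f B x) := by
          simp only [Category.assoc]
          rw [← actMap_id_comp, deltaStrInv_deltaStr, actMap_id, Category.comp_id]
      _ = _ := by
          rw [deltaStrInv_assoc, Category.assoc, ← Category.assoc, deltaStr_inv,
            Category.id_comp]

/-- The right adjoint `Π_f` of `Δ_f`. -/
abbrev piFunctor {I J : C} (f : I ⟶ J) : Over I ⥤ Over J := (Over.pullback f).rightAdjoint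

/-- The adjunction `Δ_f ⊣ Π_f`. -/
abbrev piAdj {I J : C} (f : I ⟶ J) : Over.pullback f ⊣ piFunctor f :=
  Adjunction.ofIsLeftAdjoint _

/-- The counit `Δ_f(Π_f(y)) ⟶ y`. -/
def piCounit {I J : C} (f : I ⟶ J) (y : Over I) :
    (Over.pullback f).obj ((piFunctor f).obj y) ⟶ y :=
  (piAdj f).counit.app y

/-- The strength `A ⊙ Π_f(y) ⟶ Π_f(A ⊙ y)`: the transpose of the composite
`Δ_f(A ⊙ Π_f(y)) ≅ A ⊙ Δ_f(Π_f(y)) ⟶ A ⊙ y`. -/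
def piStr {I J : C} (f : I ⟶ J) (A : C) (y : Over I) :
    act A ((piFunctor f).obj y) ⟶ (piFunctor f).obj (act A y) :=
  (piAdj f).homEquiv _ _
    (deltaStrInv f A ((piFunctor f).obj y) ≫ actMap (𝟙 A) (piCounit f y))

lemma pi_transpose {I J : C} (f : I ⟶ J) {x : Over J} {y : Over I}
    (g : x ⟶ (piFunctor f).obj y) : ((piAdj f).homEquiv x y).symm g =
      (Over.pullback f).map g ≫ piCounit f y :=
  Adjunction.homEquiv_counit _ _ _ _

lemma piStr_counit {I J : C} (f : I ⟶ J) (A : C) (y : Over I) :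
    (Over.pullback f).map (piStr f A y) ≫ piCounit f (act A y) =
      deltaStrInv f A ((piFunctor f).obj y) ≫ actMap (𝟙 A) (piCounit f y) := by
  rw [← pi_transpose, piStr, Equiv.symm_apply_apply]

lemma pi_hom_ext {I J : C} (f : I ⟶ J) {x : Over J} {y : Over I}
    {g h : x ⟶ (piFunctor f).obj y}
    (w : (Over.pullback f).map g ≫ piCounit f y =
      (Over.pullback f).map h ≫ piCounit f y) : g = h := by
  apply ((piAdj f).homEquiv _ _).symm.injective
  rw [pi_transpose, pi_transpose, w]

lemma pi_counit_naturality {I J : C} (f : I ⟶ J) {x y : Over I} (g : x ⟶ y) :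
    (Over.pullback f).map ((piFunctor f).map g) ≫ piCounit f y =
      piCounit f x ≫ g :=
  (piAdj f).counit.naturality g

/-- `Π_f`, with its canonical strength. -/
def pi {I J : C} (f : I ⟶ J) : StrongFunctor I J where
  toFunctor := piFunctor f
  str := piStr f
  str_natural {A B} a {x y} g := by
    apply pi_hom_ext
    rw [Functor.map_comp, Category.assoc, piStr_counit, Functor.map_comp, Category.assoc,
      pi_counit_naturality, ← Category.assoc, deltaStrInv_natural, ← Category.assoc, piStr_counit,
      Category.assoc, Category.assoc, ← actMap_comp, ← actMap_comp, pi_counit_naturality,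
      Category.comp_id, Category.id_comp]
  str_proj A x := by
    apply pi_hom_ext
    rw [Functor.map_comp, Category.assoc, pi_counit_naturality, ← Category.assoc, piStr_counit,
      Category.assoc, actMap_proj, ← Category.assoc, deltaStrInv_proj]
  str_assoc A B x := by
    apply pi_hom_ext
    rw [Functor.map_comp, Category.assoc, pi_counit_naturality, ← Category.assoc, piStr_counit,
      Category.assoc, actAssoc_natural, ← Category.assoc, ← deltaStrInv_assoc]
    simp only [Functor.map_comp, Category.assoc, piStr_counit]
    rw [← Category.assoc ((Over.pullback f).map (actMap _ _)), deltaStrInv_natural]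
    simp only [Category.assoc, ← actMap_id_comp, piStr_counit]

/-- A strong natural transformation with invertible components is an isomorphism. -/
def isoMk {I J : C} {F G : StrongFunctor I J} (α : F ⟶ G)
    (inv : ∀ x, G.toFunctor.obj x ⟶ F.toFunctor.obj x)
    (h₁ : ∀ x, StrongNat.app α x ≫ inv x = 𝟙 _) (h₂ : ∀ x, inv x ≫ StrongNat.app α x = 𝟙 _) :
    F ≅ G where
  hom := α
  inv :=
    { app := inv
      naturality := fun {x y} g => by
        rw [← Category.id_comp (G.toFunctor.map g ≫ inv y), ← h₂ x, Category.assoc,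
          ← Category.assoc (StrongNat.app α x), ← StrongNat.naturality, Category.assoc, h₁,
          Category.comp_id]
      strong := fun A x => by
        rw [← Category.comp_id (F.str A x), ← h₁ (act A x), ← Category.assoc (F.str A x),
          ← StrongNat.strong, ← Category.assoc, ← Category.assoc, ← actMap_id_comp, h₂, actMap_id,
          Category.id_comp] }
  hom_inv_id := hom_ext h₁
  inv_hom_id := hom_ext h₂

/-- Associativity of composition of strong functors. -/
def assoc {I J K L : C} (F : StrongFunctor I J) (G : StrongFunctor J K) (H : StrongFunctor K L) :
    (F.comp G).comp H ≅ F.comp (G.comp H) :=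
  isoMk { app := fun x => 𝟙 _
          naturality := fun g => (Category.comp_id _).trans (Category.id_comp _).symm
          strong := fun A x => by
            refine (congrArg (fun k => k ≫ _) (actMap_id _ _)).trans ?_
            refine (Category.id_comp _).trans (Eq.trans ?_ (Category.comp_id _).symm)
            simp } (fun x => 𝟙 _) (fun x => Category.id_comp _) (fun x => Category.id_comp _)

@[simp] lemma assoc_hom_app {I J K L : C} (F : StrongFunctor I J) (G : StrongFunctor J K)
    (H : StrongFunctor K L) (x : Over I) :
    StrongNat.app (assoc F G H).hom x = 𝟙 (H.toFunctor.obj (G.toFunctor.obj (F.toFunctor.obj x))) :=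
  rfl

@[simp] lemma assoc_inv_app {I J K L : C} (F : StrongFunctor I J) (G : StrongFunctor J K)
    (H : StrongFunctor K L) (x : Over I) :
    StrongNat.app (assoc F G H).inv x = 𝟙 (H.toFunctor.obj (G.toFunctor.obj (F.toFunctor.obj x))) :=
  rfl

end StrongFunctor

/-! ### Polynomial diagrams and their extensions -/

/-- A polynomial diagram `I ⟵ D ⟶ A ⟶ J`. -/
structure PolyDiagram (I J : C) where
  D : C
  A : C
  n : D ⟶ I
  d : D ⟶ A
  a : A ⟶ J

namespace PolyDiagram

/-- The extension `Σ_a Π_d Δ_n` of a polynomial diagram, as a strong functor. -/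
def ext {I J : C} (P : PolyDiagram I J) : StrongFunctor I J :=
  ((StrongFunctor.delta P.n).comp (StrongFunctor.pi P.d)).comp (StrongFunctor.sigma P.a)

/-- The pointwise product of two polynomial diagrams. -/
def tensor {I J I' J' : C} (P : PolyDiagram I J) (Q : PolyDiagram I' J') :
    PolyDiagram (I ⨯ I') (J ⨯ J') where
  D := P.D ⨯ Q.D
  A := P.A ⨯ Q.A
  n := prod.map P.n Q.n
  d := prod.map P.d Q.d
  a := prod.map P.a Q.a

end PolyDiagram

/-! ### Spans and linear functors -/

/-- A span `I ⟵ R ⟶ J`. -/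
structure LinSpan (I J : C) where
  R : C
  l : R ⟶ I
  r : R ⟶ J

namespace LinSpan

/-- The linear functor `Σ_r Δ_l` of a span `(l, r)`: the extension of the polynomial diagram
`I ⟵ R ⟶ R ⟶ J` with middle arrow the identity. -/
def linear {I J : C} (S : LinSpan I J) : StrongFunctor I J :=
  (StrongFunctor.delta S.l).comp (StrongFunctor.sigma S.r)

/-- The identity span. -/
def id (I : C) : LinSpan I I := ⟨I, 𝟙 I, 𝟙 I⟩

/-- Composition of spans by pullback. -/
def comp {I J K : C} (S : LinSpan I J) (T : LinSpan J K) : LinSpan I K :=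
  ⟨pullback S.r T.l, pullback.fst S.r T.l ≫ S.l, pullback.snd S.r T.l ≫ T.r⟩

section
variable {I J K : C} (S : LinSpan I J) (T : LinSpan J K)

/-- The first projection of a composite span. -/
def compFst : (S.comp T).R ⟶ S.R := pullback.fst S.r T.l

/-- The second projection of a composite span. -/
def compSnd : (S.comp T).R ⟶ T.R := pullback.snd S.r T.l

lemma comp_condition : S.compFst T ≫ S.r = S.compSnd T ≫ T.l := pullback.condition

lemma comp_l : (S.comp T).l = S.compFst T ≫ S.l := rfl

lemma comp_r : (S.comp T).r = S.compSnd T ≫ T.r := rfl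

variable {S T} in
/-- Morphisms into the apex of a composite span. -/
def compPair {Z : C} (k : Z ⟶ S.R) (m : Z ⟶ T.R) (w : k ≫ S.r = m ≫ T.l) : Z ⟶ (S.comp T).R :=
  pullback.lift k m w

lemma compPair_fst {Z : C} (k : Z ⟶ S.R) (m : Z ⟶ T.R) (w : k ≫ S.r = m ≫ T.l) :
    compPair k m w ≫ S.compFst T = k := pullback.lift_fst _ _ _

lemma compPair_snd {Z : C} (k : Z ⟶ S.R) (m : Z ⟶ T.R) (w : k ≫ S.r = m ≫ T.l) :
    compPair k m w ≫ S.compSnd T = m := pullback.lift_snd _ _ _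

variable {S T} in
lemma comp_ext {Z : C} {g h : Z ⟶ (S.comp T).R} (h₁ : g ≫ S.compFst T = h ≫ S.compFst T)
    (h₂ : g ≫ S.compSnd T = h ≫ S.compSnd T) : g = h := pullback.hom_ext h₁ h₂

end

/-- The pointwise product of two spans. -/
def prod {I J I' J' : C} (S : LinSpan I J) (T : LinSpan I' J') : LinSpan (I ⨯ I') (J ⨯ J') :=
  ⟨S.R ⨯ T.R, Limits.prod.map S.l T.l, Limits.prod.map S.r T.r⟩

section
variable {I J K : C} (S : LinSpan I J) (T : LinSpan J K)

/-- The projection from the total object of `Σ_r Δ_l(x)` to that of `x`. -/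
def linFst (x : Over I) : (S.linear.toFunctor.obj x).left ⟶ x.left := pullback.fst x.hom S.l

/-- The projection from the total object of `Σ_r Δ_l(x)` to the apex. -/
def linMid (x : Over I) : (S.linear.toFunctor.obj x).left ⟶ S.R := pullback.snd x.hom S.l

lemma lin_condition (x : Over I) : S.linFst x ≫ x.hom = S.linMid x ≫ S.l := pullback.condition

lemma lin_hom (x : Over I) : (S.linear.toFunctor.obj x).hom = S.linMid x ≫ S.r := rfl

variable {S} in
/-- Morphisms into the total object of `Σ_r Δ_l(x)`. -/
def linPair {x : Over I} {Z : C} (k : Z ⟶ x.left) (m : Z ⟶ S.R) (w : k ≫ x.hom = m ≫ S.l) :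
    Z ⟶ (S.linear.toFunctor.obj x).left := pullback.lift k m w

@[simp] lemma linPair_fst {x : Over I} {Z : C} (k : Z ⟶ x.left) (m : Z ⟶ S.R)
    (w : k ≫ x.hom = m ≫ S.l) : linPair k m w ≫ S.linFst x = k := pullback.lift_fst _ _ _

@[simp] lemma linPair_mid {x : Over I} {Z : C} (k : Z ⟶ x.left) (m : Z ⟶ S.R)
    (w : k ≫ x.hom = m ≫ S.l) : linPair k m w ≫ S.linMid x = m := pullback.lift_snd _ _ _

variable {S} in
lemma lin_ext {x : Over I} {Z : C} {g h : Z ⟶ (S.linear.toFunctor.obj x).left}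
    (h₁ : g ≫ S.linFst x = h ≫ S.linFst x) (h₂ : g ≫ S.linMid x = h ≫ S.linMid x) : g = h :=
  pullback.hom_ext h₁ h₂

lemma linMap_fst {x y : Over I} (g : x ⟶ y) :
    (S.linear.toFunctor.map g).left ≫ S.linFst y = S.linFst x ≫ g.left := StrongFunctor.pullMap_fst S.l g

lemma linMap_mid {x y : Over I} (g : x ⟶ y) :
    (S.linear.toFunctor.map g).left ≫ S.linMid y = S.linMid x :=
  Over.w ((Over.pullback S.l).map g)

lemma linStr_fst_fst (A : C) (x : Over I) :
    (S.linear.str A x).left ≫ S.linFst (act A x) ≫ actFst A x =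
      actFst A (S.linear.toFunctor.obj x) := by
  have h : (S.linear.str A x).left ≫ S.linFst (act A x) = Limits.prod.map (𝟙 A) (S.linFst x) := by
    refine Eq.trans ?_ (StrongFunctor.deltaStr_fst S.l A x)
    exact congrArg (fun k => k ≫ _) (Category.id_comp _)
  refine (Category.assoc _ _ _).symm.trans ((congrArg (fun k => k ≫ _) h).trans ?_)
  exact (Limits.prod.map_fst _ _).trans (Category.comp_id _)

lemma linStr_fst_proj (A : C) (x : Over I) :
    (S.linear.str A x).left ≫ S.linFst (act A x) ≫ (actProj A x).left =
      (actProj A (S.linear.toFunctor.obj x)).left ≫ S.linFst x := by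
  have h : (S.linear.str A x).left ≫ S.linFst (act A x) = Limits.prod.map (𝟙 A) (S.linFst x) := by
    refine Eq.trans ?_ (StrongFunctor.deltaStr_fst S.l A x)
    exact congrArg (fun k => k ≫ _) (Category.id_comp _)
  refine (Category.assoc _ _ _).symm.trans ((congrArg (fun k => k ≫ _) h).trans ?_)
  exact Limits.prod.map_snd _ _

lemma linStr_mid (A : C) (x : Over I) :
    (S.linear.str A x).left ≫ S.linMid (act A x) =
      (actProj A (S.linear.toFunctor.obj x)).left ≫ S.linMid x := by
  refine Eq.trans ?_ (Over.w (StrongFunctor.deltaStr S.l A x))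
  exact congrArg (fun k => k ≫ _) (Category.id_comp _)

lemma actLeft_ext {A : C} {x : Over I} {Z : C} {g h : Z ⟶ (act A x).left}
    (h₁ : g ≫ actFst A x = h ≫ actFst A x)
    (h₂ : g ≫ (actProj A x).left = h ≫ (actProj A x).left) : g = h :=
  Limits.prod.hom_ext h₁ h₂

lemma actMap_left_proj {A B : C} (a : A ⟶ B) {x y : Over I} (g : x ⟶ y) :
    (actMap a g).left ≫ (actProj B y).left = (actProj A x).left ≫ g.left := by
  rw [← Over.comp_left, actMap_proj, Over.comp_left]

/-- The total component of the comparison between `Σ Δ` of a composite span and the composite of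
the two functors `Σ Δ`. -/
def compTo (x : Over I) : ((S.comp T).linear.toFunctor.obj x).left ⟶
    (T.linear.toFunctor.obj (S.linear.toFunctor.obj x)).left :=
  linPair (linPair ((S.comp T).linFst x) ((S.comp T).linMid x ≫ S.compFst T)
      (by rw [lin_condition, comp_l, Category.assoc]))
    ((S.comp T).linMid x ≫ S.compSnd T) (by
      rw [lin_hom, ← Category.assoc, linPair_mid, Category.assoc, Category.assoc, comp_condition])

/-- The total component of the inverse comparison. -/
def compFrom (x : Over I) : (T.linear.toFunctor.obj (S.linear.toFunctor.obj x)).left ⟶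
    ((S.comp T).linear.toFunctor.obj x).left :=
  linPair (T.linFst _ ≫ S.linFst x)
    (compPair (T.linFst _ ≫ S.linMid x) (T.linMid _) (by
      rw [Category.assoc, ← lin_hom, lin_condition])) (by
      rw [comp_l, ← Category.assoc, compPair_fst, Category.assoc, Category.assoc, lin_condition])

lemma compTo_fst_fst (x : Over I) :
    S.compTo T x ≫ T.linFst _ ≫ S.linFst x = (S.comp T).linFst x := by
  rw [compTo, ← Category.assoc, linPair_fst, linPair_fst]

lemma compTo_fst_mid (x : Over I) :
    S.compTo T x ≫ T.linFst _ ≫ S.linMid x = (S.comp T).linMid x ≫ S.compFst T := by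
  rw [compTo, ← Category.assoc, linPair_fst, linPair_mid]

lemma compTo_mid (x : Over I) :
    S.compTo T x ≫ T.linMid _ = (S.comp T).linMid x ≫ S.compSnd T := by
  rw [compTo, linPair_mid]

lemma compFrom_fst (x : Over I) :
    S.compFrom T x ≫ (S.comp T).linFst x = T.linFst _ ≫ S.linFst x := linPair_fst _ _ _ _

lemma compFrom_mid_fst (x : Over I) :
    S.compFrom T x ≫ (S.comp T).linMid x ≫ S.compFst T = T.linFst _ ≫ S.linMid x := by
  rw [← Category.assoc, compFrom, linPair_mid, compPair_fst]

lemma compFrom_mid_snd (x : Over I) :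
    S.compFrom T x ≫ (S.comp T).linMid x ≫ S.compSnd T = T.linMid _ := by
  rw [← Category.assoc, compFrom, linPair_mid, compPair_snd]

variable {S T} in
lemma compTarget_ext {x : Over I} {Z : C}
    {g h : Z ⟶ (T.linear.toFunctor.obj (S.linear.toFunctor.obj x)).left}
    (h₁ : g ≫ T.linFst _ ≫ S.linFst x = h ≫ T.linFst _ ≫ S.linFst x)
    (h₂ : g ≫ T.linFst _ ≫ S.linMid x = h ≫ T.linFst _ ≫ S.linMid x)
    (h₃ : g ≫ T.linMid _ = h ≫ T.linMid _) : g = h :=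
  lin_ext (lin_ext (by simpa only [Category.assoc] using h₁)
    (by simpa only [Category.assoc] using h₂)) h₃

lemma compTo_compFrom (x : Over I) : S.compTo T x ≫ S.compFrom T x = 𝟙 _ := by
  apply lin_ext
  · rw [Category.assoc, compFrom_fst, compTo_fst_fst, Category.id_comp]
  · rw [Category.id_comp]
    apply comp_ext
    · rw [Category.assoc, Category.assoc, compFrom_mid_fst, compTo_fst_mid]
    · rw [Category.assoc, Category.assoc, compFrom_mid_snd, compTo_mid]

lemma compFrom_compTo (x : Over I) : S.compFrom T x ≫ S.compTo T x = 𝟙 _ := by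
  apply compTarget_ext
  · rw [Category.assoc, compTo_fst_fst, compFrom_fst, Category.id_comp]
  · rw [Category.assoc, compTo_fst_mid, compFrom_mid_fst, Category.id_comp]
  · rw [Category.assoc, compTo_mid, compFrom_mid_snd, Category.id_comp]

lemma compTo_hom (x : Over I) :
    S.compTo T x ≫ (T.linear.toFunctor.obj (S.linear.toFunctor.obj x)).hom =
      ((S.comp T).linear.toFunctor.obj x).hom := by
  rw [lin_hom, ← Category.assoc, compTo_mid, Category.assoc, lin_hom, comp_r]

/-- The comparison between `Σ Δ` of a composite span and the composite of the two functors. -/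
def compHom (x : Over I) : (S.comp T).linear.toFunctor.obj x ⟶
    T.linear.toFunctor.obj (S.linear.toFunctor.obj x) :=
  Over.homMk (S.compTo T x) (S.compTo_hom T x)

lemma compHom_left (x : Over I) : (S.compHom T x).left = S.compTo T x := rfl

lemma compHom_natural {x y : Over I} (g : x ⟶ y) :
    (S.comp T).linear.toFunctor.map g ≫ S.compHom T y =
      S.compHom T x ≫ T.linear.toFunctor.map (S.linear.toFunctor.map g) := by
  ext
  rw [Over.comp_left, Over.comp_left, compHom_left, compHom_left]
  apply compTarget_ext
  · rw [Category.assoc, Category.assoc, compTo_fst_fst, linMap_fst,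
      ← Category.assoc _ (T.linFst _), linMap_fst, Category.assoc, linMap_fst,
      ← Category.assoc (T.linFst _), ← Category.assoc, compTo_fst_fst]
  · rw [Category.assoc, Category.assoc, compTo_fst_mid, ← Category.assoc, linMap_mid,
      ← Category.assoc _ (T.linFst _), linMap_fst, Category.assoc, linMap_mid, compTo_fst_mid]
  · rw [Category.assoc, Category.assoc, compTo_mid, ← Category.assoc, linMap_mid, linMap_mid,
      compTo_mid]

lemma compHom_strong (A : C) (x : Over I) :
    actMap (𝟙 A) (S.compHom T x) ≫ T.linear.str A (S.linear.toFunctor.obj x) ≫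
        T.linear.toFunctor.map (S.linear.str A x) =
      (S.comp T).linear.str A x ≫ S.compHom T (act A x) := by
  ext
  rw [Over.comp_left, Over.comp_left, Over.comp_left, compHom_left]
  apply compTarget_ext
  · apply actLeft_ext
    · simp only [Category.assoc]
      rw [← Category.assoc _ (T.linFst _), linMap_fst]
      simp only [Category.assoc]
      rw [linStr_fst_fst, linStr_fst_fst, actMap_fst, Category.comp_id]
      rw [← Category.assoc (T.linFst _), ← Category.assoc (S.compTo T _), compTo_fst_fst,
        linStr_fst_fst]
    · simp only [Category.assoc]
      rw [← Category.assoc _ (T.linFst _), linMap_fst]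
      simp only [Category.assoc]
      rw [linStr_fst_proj, ← Category.assoc (T.linFst _), ← Category.assoc (T.linear.str _ _).left,
        linStr_fst_proj, ← Category.assoc, ← Category.assoc, actMap_left_proj, compHom_left,
        Category.assoc, Category.assoc, compTo_fst_fst]
      rw [← Category.assoc (T.linFst _), ← Category.assoc (S.compTo T _), compTo_fst_fst,
        linStr_fst_proj]
  · simp only [Category.assoc]
    rw [← Category.assoc _ (T.linFst _), linMap_fst]
    simp only [Category.assoc]
    rw [linStr_mid, compTo_fst_mid, ← Category.assoc (T.linFst _),
      ← Category.assoc (T.linear.str _ _).left, linStr_fst_proj, ← Category.assoc,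
      ← Category.assoc, actMap_left_proj, compHom_left, Category.assoc, Category.assoc,
      compTo_fst_mid, ← Category.assoc (LinSpan.linear _ |>.str _ _).left, linStr_mid,
      Category.assoc]
  · simp only [Category.assoc]
    rw [linMap_mid, linStr_mid, compTo_mid, ← Category.assoc, actMap_left_proj, compHom_left,
      Category.assoc, compTo_mid, ← Category.assoc (LinSpan.linear _ |>.str _ _).left, linStr_mid,
      Category.assoc]

/-- The Beck-Chevalley isomorphism between the linear functor of a composite span and the
composite of the linear functors. -/
def linearComp : (S.comp T).linear ≅ S.linear.comp T.linear :=
  StrongFunctor.isoMk ⟨S.compHom T, S.compHom_natural T, S.compHom_strong T⟩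
    (fun x => Over.homMk (S.compFrom T x) (by
      change S.compFrom T x ≫ ((S.comp T).linear.toFunctor.obj x).hom =
        (T.linear.toFunctor.obj (S.linear.toFunctor.obj x)).hom
      rw [← compTo_hom, ← Category.assoc, compFrom_compTo, Category.id_comp]))
    (fun x => by ext; exact S.compTo_compFrom T x)
    (fun x => by ext; exact S.compFrom_compTo T x)

lemma id_condition (x : Over I) :
    (LinSpan.id I).linFst x ≫ x.hom = ((LinSpan.id I).linear.toFunctor.obj x).hom :=
  (lin_condition _ x)

/-- The comparison between the linear functor of the identity span and the identity. -/
def idHom (x : Over I) : (LinSpan.id I).linear.toFunctor.obj x ⟶ x :=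
  Over.homMk ((LinSpan.id I).linFst x) (id_condition x)

lemma idHom_strong (A : C) (x : Over I) :
    actMap (𝟙 A) (idHom x) ≫ 𝟙 _ = (LinSpan.id I).linear.str A x ≫ idHom (act A x) := by
  rw [Category.comp_id]
  apply act_ext
  · rw [actMap_fst, Category.comp_id, Over.comp_left, Category.assoc]
    exact (linStr_fst_fst _ A x).symm
  · rw [actMap_proj, Category.assoc]
    ext
    exact (linStr_fst_proj _ A x).symm

/-- The linear functor of the identity span is the identity functor. -/
def linearId (I : C) : (LinSpan.id I).linear ≅ StrongFunctor.id I :=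
  StrongFunctor.isoMk
    { app := idHom
      naturality := fun {x y} g => by
        ext
        exact linMap_fst _ g
      strong := idHom_strong }
    (fun x => Over.homMk (linPair (S := LinSpan.id I) (𝟙 x.left) x.hom
        ((Category.id_comp _).trans (Category.comp_id _).symm))
      ((Category.assoc _ _ _).symm.trans
        ((congrArg (fun k => k ≫ 𝟙 I) (linPair_mid _ _ _ _)).trans (Category.comp_id _))))
    (fun x => by
      ext
      apply lin_ext
      · refine (Category.assoc _ _ _).trans ((congrArg _ (linPair_fst _ _ _ _)).trans ?_)
        exact (Category.comp_id _).trans (Category.id_comp _).symm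
      · refine (Category.assoc _ _ _).trans ((congrArg _ (linPair_mid _ _ _ _)).trans ?_)
        exact (lin_condition _ x).trans ((Category.comp_id _).trans (Category.id_comp _).symm))
    (fun x => by
      ext
      exact linPair_fst _ _ _ _)

end

end LinSpan

/-! ### Simulations -/

section
open StrongFunctor

variable {I J K L : C}

/-- Equivalence of two cells `ρ : L F ⟶ G L` and `ρ' : L' F ⟶ G L'`: the equality
`Gε ∘ ρ = ρ' ∘ εF` for some strong natural isomorphism `ε : L ≅ L'`. -/
def CellEquiv {F : StrongFunctor I I} {G : StrongFunctor J J} {L L' : StrongFunctor I J}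
    (ρ : F.comp L ⟶ L.comp G) (ρ' : F.comp L' ⟶ L'.comp G) : Prop :=
  ∃ ε : L ≅ L', ρ ≫ whiskerRight ε.hom G = whiskerLeft F ε.hom ≫ ρ'

/-- Vertical pasting of cells `ρ : L F ⟶ G L` and `σ : M G ⟶ H M`, giving
`M L F ⟶ M G L ⟶ H M L`. -/
def pasteCell {F : StrongFunctor I I} {G : StrongFunctor J J} {H : StrongFunctor K K}
    {L : StrongFunctor I J} {M : StrongFunctor J K}
    (ρ : F.comp L ⟶ L.comp G) (σ : G.comp M ⟶ M.comp H) :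
    F.comp (L.comp M) ⟶ (L.comp M).comp H :=
  (assoc F L M).inv ≫ whiskerRight ρ M ≫ (assoc L G M).hom ≫ whiskerLeft L σ ≫ (assoc L M H).inv

/-- Transport of a cell on `L'` to a cell on `L` along an isomorphism `L ≅ L'`. -/
def transportCell {F : StrongFunctor I I} {G : StrongFunctor J J} {L L' : StrongFunctor I J}
    (ε : L ≅ L') (ρ : F.comp L' ⟶ L'.comp G) : F.comp L ⟶ L.comp G :=
  whiskerLeft F ε.hom ≫ ρ ≫ whiskerRight ε.inv G

/-- The identity cell. -/
def idCell (F : StrongFunctor I I) :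
    F.comp (StrongFunctor.id I) ⟶ (StrongFunctor.id I).comp F where
  app x := 𝟙 (F.toFunctor.obj x)
  naturality g := (Category.comp_id _).trans (Category.id_comp _).symm
  strong A x := by
    refine (congrArg (fun k => k ≫ _) (actMap_id _ _)).trans ?_
    refine (Category.id_comp _).trans (Eq.trans ?_ (Category.comp_id _).symm)
    simp

end

/-- A (strong) simulation from `F` to `G`: a span together with a strong natural transformation
`⟨R⟩ F ⟶ G ⟨R⟩`, where `⟨R⟩` is the linear functor of the span. -/
structure Simulation {I J : C} (F : StrongFunctor I I) (G : StrongFunctor J J) where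
  span : LinSpan I J
  cell : F.comp span.linear ⟶ span.linear.comp G

namespace CellEquiv
open StrongFunctor
variable {I J K L : C}

lemma whiskerRight_comp {F F' F'' : StrongFunctor I J} (α : F ⟶ F') (β : F' ⟶ F'')
    (G : StrongFunctor J K) : whiskerRight (α ≫ β) G = whiskerRight α G ≫ whiskerRight β G := by
  ext1 x; exact G.toFunctor.map_comp _ _

lemma whiskerRight_id (F : StrongFunctor I J) (G : StrongFunctor J K) :
    whiskerRight (𝟙 F) G = 𝟙 (F.comp G) := by
  ext1 x; exact G.toFunctor.map_id _

lemma whiskerLeft_comp (F : StrongFunctor I J) {G G' G'' : StrongFunctor J K} (α : G ⟶ G')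
    (β : G' ⟶ G'') : whiskerLeft F (α ≫ β) = whiskerLeft F α ≫ whiskerLeft F β := rfl

lemma whiskerLeft_id (F : StrongFunctor I J) (G : StrongFunctor J K) :
    whiskerLeft F (𝟙 G) = 𝟙 (F.comp G) := rfl

lemma pasteCell_app {F : StrongFunctor I I} {G : StrongFunctor J J} {H : StrongFunctor K K}
    {L : StrongFunctor I J} {M : StrongFunctor J K}
    (ρ : F.comp L ⟶ L.comp G) (σ : G.comp M ⟶ M.comp H) (x : Over I) :
    StrongNat.app (pasteCell ρ σ) x =
      M.toFunctor.map (StrongNat.app ρ x) ≫ StrongNat.app σ (L.toFunctor.obj x) := by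
  refine (Category.id_comp _).trans ?_
  refine congrArg (fun k => M.toFunctor.map (StrongNat.app ρ x) ≫ k) ?_
  exact (Category.id_comp _).trans (Category.comp_id _)

lemma refl {F : StrongFunctor I I} {G : StrongFunctor J J} {L : StrongFunctor I J}
    (ρ : F.comp L ⟶ L.comp G) : CellEquiv ρ ρ := by
  refine ⟨Iso.refl _, ?_⟩
  rw [Iso.refl_hom, whiskerRight_id, whiskerLeft_id, Category.comp_id, Category.id_comp]

lemma symm {F : StrongFunctor I I} {G : StrongFunctor J J} {L L' : StrongFunctor I J}
    {ρ : F.comp L ⟶ L.comp G} {ρ' : F.comp L' ⟶ L'.comp G} (h : CellEquiv ρ ρ') :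
    CellEquiv ρ' ρ := by
  obtain ⟨ε, h⟩ := h
  refine ⟨ε.symm, ?_⟩
  rw [Iso.symm_hom]
  calc ρ' ≫ whiskerRight ε.inv G
      = whiskerLeft F ε.inv ≫ (whiskerLeft F ε.hom ≫ ρ') ≫ whiskerRight ε.inv G := by
        rw [← Category.assoc, ← Category.assoc, ← whiskerLeft_comp, ε.inv_hom_id, whiskerLeft_id,
          Category.id_comp]
    _ = whiskerLeft F ε.inv ≫ ρ := by
        rw [← h, Category.assoc, ← whiskerRight_comp, ε.hom_inv_id, whiskerRight_id,
          Category.comp_id]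

lemma trans {F : StrongFunctor I I} {G : StrongFunctor J J} {L L' L'' : StrongFunctor I J}
    {ρ : F.comp L ⟶ L.comp G} {ρ' : F.comp L' ⟶ L'.comp G} {ρ'' : F.comp L'' ⟶ L''.comp G}
    (h : CellEquiv ρ ρ') (h' : CellEquiv ρ' ρ'') : CellEquiv ρ ρ'' := by
  obtain ⟨ε, h⟩ := h
  obtain ⟨ε', h'⟩ := h'
  refine ⟨ε ≪≫ ε', ?_⟩
  rw [Iso.trans_hom, whiskerRight_comp, whiskerLeft_comp, ← Category.assoc, h, Category.assoc, h',
    Category.assoc]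

lemma transport {F : StrongFunctor I I} {G : StrongFunctor J J} {L L' : StrongFunctor I J}
    (ε : L ≅ L') (ρ : F.comp L' ⟶ L'.comp G) : CellEquiv (transportCell ε ρ) ρ := by
  refine ⟨ε, ?_⟩
  rw [transportCell, Category.assoc, Category.assoc, ← whiskerRight_comp, ε.inv_hom_id,
    whiskerRight_id, Category.comp_id]

/-- Horizontal composition of isomorphisms of strong functors. -/
def hcompIso {L L' : StrongFunctor I J} {M M' : StrongFunctor J K} (ε : L ≅ L') (ε' : M ≅ M') :
    L.comp M ≅ L'.comp M' where
  hom := whiskerRight ε.hom M ≫ whiskerLeft L' ε'.hom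
  inv := whiskerLeft L' ε'.inv ≫ whiskerRight ε.inv M
  hom_inv_id := by
    rw [Category.assoc, ← Category.assoc (whiskerLeft _ _), ← whiskerLeft_comp, ε'.hom_inv_id,
      whiskerLeft_id, Category.id_comp, ← whiskerRight_comp, ε.hom_inv_id, whiskerRight_id]
  inv_hom_id := by
    rw [Category.assoc, ← Category.assoc (whiskerRight _ _), ← whiskerRight_comp, ε.inv_hom_id,
      whiskerRight_id, Category.id_comp, ← whiskerLeft_comp, ε'.inv_hom_id, whiskerLeft_id]

lemma paste {F : StrongFunctor I I} {G : StrongFunctor J J} {H : StrongFunctor K K}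
    {L L' : StrongFunctor I J} {M M' : StrongFunctor J K}
    {ρ : F.comp L ⟶ L.comp G} {ρ' : F.comp L' ⟶ L'.comp G}
    {σ : G.comp M ⟶ M.comp H} {σ' : G.comp M' ⟶ M'.comp H}
    (h : CellEquiv ρ ρ') (h' : CellEquiv σ σ') :
    CellEquiv (pasteCell ρ σ) (pasteCell ρ' σ') := by
  obtain ⟨ε, h⟩ := h
  obtain ⟨ε', h'⟩ := h'
  refine ⟨hcompIso ε ε', ?_⟩
  ext1 x
  have e₁ : StrongNat.app ρ x ≫ G.toFunctor.map (StrongNat.app ε.hom x) =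
      StrongNat.app ε.hom (F.toFunctor.obj x) ≫ StrongNat.app ρ' x :=
    congrArg (fun k => StrongNat.app k x) h
  have e₂ : StrongNat.app σ (L'.toFunctor.obj x) ≫
        H.toFunctor.map (StrongNat.app ε'.hom (L'.toFunctor.obj x)) =
      StrongNat.app ε'.hom (G.toFunctor.obj (L'.toFunctor.obj x)) ≫
        StrongNat.app σ' (L'.toFunctor.obj x) :=
    congrArg (fun k => StrongNat.app k (L'.toFunctor.obj x)) h'
  have e₃ : M.toFunctor.map (G.toFunctor.map (StrongNat.app ε.hom x)) ≫
        StrongNat.app σ (L'.toFunctor.obj x) =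
      StrongNat.app σ (L.toFunctor.obj x) ≫
        H.toFunctor.map (M.toFunctor.map (StrongNat.app ε.hom x)) :=
    StrongNat.naturality σ (StrongNat.app ε.hom x)
  have e₄ : M.toFunctor.map (StrongNat.app ρ' x) ≫
        StrongNat.app ε'.hom (G.toFunctor.obj (L'.toFunctor.obj x)) =
      StrongNat.app ε'.hom (L'.toFunctor.obj (F.toFunctor.obj x)) ≫
        M'.toFunctor.map (StrongNat.app ρ' x) :=
    StrongNat.naturality ε'.hom (StrongNat.app ρ' x)
  rw [StrongFunctor.comp_app, StrongFunctor.comp_app, pasteCell_app, pasteCell_app]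
  change (M.toFunctor.map (StrongNat.app ρ x) ≫ StrongNat.app σ (L.toFunctor.obj x)) ≫
      H.toFunctor.map (M.toFunctor.map (StrongNat.app ε.hom x) ≫
        StrongNat.app ε'.hom (L'.toFunctor.obj x)) =
    (M.toFunctor.map (StrongNat.app ε.hom (F.toFunctor.obj x)) ≫
      StrongNat.app ε'.hom (L'.toFunctor.obj (F.toFunctor.obj x))) ≫
        M'.toFunctor.map (StrongNat.app ρ' x) ≫ StrongNat.app σ' (L'.toFunctor.obj x)
  rw [H.toFunctor.map_comp, Category.assoc, ← Category.assoc (StrongNat.app σ _), ← e₃,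
    Category.assoc, e₂, ← Category.assoc, ← M.toFunctor.map_comp, e₁, M.toFunctor.map_comp,
    Category.assoc, ← Category.assoc (M.toFunctor.map (StrongNat.app ρ' x)), e₄]
  simp only [Category.assoc]

/-- Equivalence of cells, tested on components. -/
lemma of_app {F : StrongFunctor I I} {G : StrongFunctor J J} {L L' : StrongFunctor I J}
    {ρ : F.comp L ⟶ L.comp G} {ρ' : F.comp L' ⟶ L'.comp G} (ε : L ≅ L')
    (h : ∀ x, StrongNat.app ρ x ≫ G.toFunctor.map (StrongNat.app ε.hom x) =
      StrongNat.app ε.hom (F.toFunctor.obj x) ≫ StrongNat.app ρ' x) : CellEquiv ρ ρ' :=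
  ⟨ε, StrongFunctor.hom_ext h⟩

lemma paste_assoc {F : StrongFunctor I I} {G : StrongFunctor J J} {H : StrongFunctor K K}
    {E : StrongFunctor L L} {P : StrongFunctor I J} {Q : StrongFunctor J K} {R : StrongFunctor K L}
    (ρ : F.comp P ⟶ P.comp G) (σ : G.comp Q ⟶ Q.comp H) (τ : H.comp R ⟶ R.comp E) :
    CellEquiv (pasteCell (pasteCell ρ σ) τ) (pasteCell ρ (pasteCell σ τ)) := by
  refine of_app (assoc P Q R) fun x => ?_
  rw [pasteCell_app, pasteCell_app, pasteCell_app, pasteCell_app]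
  refine (congrArg _ (E.toFunctor.map_id _)).trans ?_
  refine (Category.comp_id _).trans (Eq.trans ?_ (Category.id_comp _).symm)
  rw [R.toFunctor.map_comp, Category.assoc]
  rfl

lemma id_paste {F : StrongFunctor I I} {G : StrongFunctor J J} {L : StrongFunctor I J}
    (ρ : F.comp L ⟶ L.comp G) : CellEquiv (pasteCell (idCell F) ρ) ρ := by
  refine of_app (isoMk ⟨fun x => 𝟙 (L.toFunctor.obj x), ?_, ?_⟩ (fun x => 𝟙 (L.toFunctor.obj x))
    (fun x => Category.id_comp _) (fun x => Category.id_comp _)) fun x => ?_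
  · intro x y g
    exact (Category.comp_id _).trans (Category.id_comp _).symm
  · intro A x
    refine (congrArg (fun k => k ≫ _) (actMap_id _ _)).trans ?_
    refine (Category.id_comp _).trans (Eq.trans ?_ (Category.comp_id _).symm)
    simp
  · rw [pasteCell_app]
    refine (congrArg _ (G.toFunctor.map_id _)).trans ?_
    refine (Category.comp_id _).trans (Eq.trans ?_ (Category.id_comp _).symm)
    exact (congrArg (fun k => k ≫ StrongNat.app ρ x) (L.toFunctor.map_id _)).trans
      (Category.id_comp _)

lemma paste_id {F : StrongFunctor I I} {G : StrongFunctor J J} {L : StrongFunctor I J}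
    (ρ : F.comp L ⟶ L.comp G) : CellEquiv (pasteCell ρ (idCell G)) ρ := by
  refine of_app (isoMk ⟨fun x => 𝟙 (L.toFunctor.obj x), ?_, ?_⟩ (fun x => 𝟙 (L.toFunctor.obj x))
    (fun x => Category.id_comp _) (fun x => Category.id_comp _)) fun x => ?_
  · intro x y g
    exact (Category.comp_id _).trans (Category.id_comp _).symm
  · intro A x
    refine (congrArg (fun k => k ≫ _) (actMap_id _ _)).trans ?_
    refine (Category.id_comp _).trans (Eq.trans ?_ (Category.comp_id _).symm)
    simp
  · rw [pasteCell_app]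
    refine (congrArg _ (G.toFunctor.map_id _)).trans ?_
    refine (Category.comp_id _).trans (Eq.trans ?_ (Category.id_comp _).symm)
    exact Category.comp_id _

end CellEquiv

namespace Simulation
open StrongFunctor

variable {I J K L : C} {F : StrongFunctor I I} {G : StrongFunctor J J} {H : StrongFunctor K K}
  {E : StrongFunctor L L}

/-- Simulations are considered up to isomorphism of their linear functors. -/
instance setoid (F : StrongFunctor I I) (G : StrongFunctor J J) : Setoid (Simulation F G) where
  r s t := CellEquiv s.cell t.cell
  iseqv := ⟨fun _ => .refl _, fun h => h.symm, fun h h' => h.trans h'⟩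

/-- The identity simulation. -/
def id (F : StrongFunctor I I) : Simulation F F :=
  ⟨LinSpan.id I, transportCell (LinSpan.linearId I) (idCell F)⟩

/-- Composition of simulations: spans are composed by pullback and cells are pasted, up to the
canonical isomorphism `⟨S ∘ R⟩ ≅ ⟨S⟩⟨R⟩`. -/
def comp (s : Simulation F G) (t : Simulation G H) : Simulation F H :=
  ⟨s.span.comp t.span, transportCell (s.span.linearComp t.span) (pasteCell s.cell t.cell)⟩

lemma comp_congr {s s' : Simulation F G} {t t' : Simulation G H} (h : s ≈ s') (h' : t ≈ t') :
    s.comp t ≈ s'.comp t' :=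
  ((CellEquiv.transport _ _).trans (CellEquiv.paste h h')).trans (CellEquiv.transport _ _).symm

lemma comp_assoc (s : Simulation F G) (t : Simulation G H) (w : Simulation H E) :
    (s.comp t).comp w ≈ s.comp (t.comp w) :=
  ((((CellEquiv.transport _ _).trans (CellEquiv.paste (CellEquiv.transport _ _) (.refl _))).trans
    (CellEquiv.paste_assoc _ _ _)).trans
      (CellEquiv.paste (.refl _) (CellEquiv.transport _ _).symm)).trans
        (CellEquiv.transport _ _).symm

lemma id_comp (s : Simulation F G) : (Simulation.id F).comp s ≈ s :=
  ((CellEquiv.transport _ _).trans (CellEquiv.paste (CellEquiv.transport _ _) (.refl _))).trans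
    (CellEquiv.id_paste _)

lemma comp_id (s : Simulation F G) : s.comp (Simulation.id G) ≈ s :=
  ((CellEquiv.transport _ _).trans (CellEquiv.paste (.refl _) (CellEquiv.transport _ _))).trans
    (CellEquiv.paste_id _)

end Simulation

/-! ### The category of polynomial endofunctors and simulations -/

variable (C) in
/-- A polynomial endofunctor on a slice of `C`: a strong endofunctor of some slice that is
isomorphic, as a strong functor, to the extension of a polynomial diagram. -/
structure PFSim where
  base : C
  fn : StrongFunctor base base
  isPoly : ∃ D : PolyDiagram base base, Nonempty (fn ≅ D.ext)

namespace PFSim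

/-- Morphisms of `PFSim` are equivalence classes of strong simulations. -/
instance : Category (PFSim C) where
  Hom P Q := Quotient (Simulation.setoid P.fn Q.fn)
  id P := Quotient.mk _ (Simulation.id P.fn)
  comp f g := Quotient.map₂ Simulation.comp
    (fun _ _ h _ _ h' => Simulation.comp_congr h h') f g
  id_comp f := by
    induction f using Quotient.inductionOn
    exact Quotient.sound (Simulation.id_comp _)
  comp_id f := by
    induction f using Quotient.inductionOn
    exact Quotient.sound (Simulation.comp_id _)
  assoc f g h := by
    induction f using Quotient.inductionOn
    induction g using Quotient.inductionOn
    induction h using Quotient.inductionOn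
    exact Quotient.sound (Simulation.comp_assoc _ _ _)

/-- The morphism of `PFSim` given by a simulation. -/
def homMk {P Q : PFSim C} (s : Simulation P.fn Q.fn) : P ⟶ Q := Quotient.mk _ s

/-- A polynomial diagram representing a polynomial functor. -/
def rep (P : PFSim C) : PolyDiagram P.base P.base := P.isPoly.choose

/-- The isomorphism from a polynomial functor to the extension of its representation. -/
def repIso (P : PFSim C) : P.fn ≅ P.rep.ext := P.isPoly.choose_spec.some

/-- The tensor product of polynomial functors: the extension of the pointwise product of
representing polynomial diagrams. -/
def tensor (P Q : PFSim C) : PFSim C where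
  base := P.base ⨯ Q.base
  fn := (P.rep.tensor Q.rep).ext
  isPoly := ⟨_, ⟨Iso.refl _⟩⟩

end PFSim

/-! ### The external product `x ⊡ y` and the tensor product of simulations -/

section Box
open StrongFunctor

/-- The external product `x × y`, over `I × J`, of two slices `x` over `I` and `y` over `J`. -/
def box {I J : C} (x : Over I) (y : Over J) : Over (I ⨯ J) :=
  Over.mk (prod.map x.hom y.hom)

/-- The first projection of an external product. -/
def boxFst {I J : C} (x : Over I) (y : Over J) : (box x y).left ⟶ x.left :=
  (prod.fst : x.left ⨯ y.left ⟶ x.left)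

/-- The second projection of an external product. -/
def boxSnd {I J : C} (x : Over I) (y : Over J) : (box x y).left ⟶ y.left :=
  (prod.snd : x.left ⨯ y.left ⟶ y.left)

lemma boxFst_hom {I J : C} (x : Over I) (y : Over J) :
    boxFst x y ≫ x.hom = (box x y).hom ≫ prod.fst := (prod.map_fst _ _).symm

lemma boxSnd_hom {I J : C} (x : Over I) (y : Over J) :
    boxSnd x y ≫ y.hom = (box x y).hom ≫ prod.snd := (prod.map_snd _ _).symm

/-- The action of the external product on morphisms. -/
def boxMap {I J : C} {x x' : Over I} {y y' : Over J} (g : x ⟶ x') (h : y ⟶ y') :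
    box x y ⟶ box x' y' :=
  Over.homMk (prod.map g.left h.left) (by
    change prod.map g.left h.left ≫ prod.map x'.hom y'.hom = prod.map x.hom y.hom
    rw [prod.map_map, Over.w, Over.w])

variable {I J K L : C}

/-- The canonical isomorphism `Σ_f(x) × Σ_g(y) = Σ_{f × g}(x × y)`. -/
def sigmaBox (f : I ⟶ K) (g : J ⟶ L) (x : Over I) (y : Over J) :
    box ((Over.map f).obj x) ((Over.map g).obj y) ⟶
      (Over.map (prod.map f g)).obj (box x y) :=
  Over.homMk (𝟙 (x.left ⨯ y.left)) (by
    change 𝟙 (x.left ⨯ y.left) ≫ prod.map x.hom y.hom ≫ prod.map f g =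
      prod.map (x.hom ≫ f) (y.hom ≫ g)
    rw [Category.id_comp, prod.map_map])

/-- The canonical morphism `Δ_f(x) × Δ_g(y) ⟶ Δ_{f × g}(x × y)`. -/
def deltaBox (f : K ⟶ I) (g : L ⟶ J) (x : Over I) (y : Over J) :
    box ((Over.pullback f).obj x) ((Over.pullback g).obj y) ⟶
      (Over.pullback (prod.map f g)).obj (box x y) :=
  pullLift (prod.map (pullFst f x) (pullFst g y)) (by
    change prod.map (pullFst f x) (pullFst g y) ≫ prod.map x.hom y.hom =
      prod.map ((Over.pullback f).obj x).hom ((Over.pullback g).obj y).hom ≫ prod.map f g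
    rw [prod.map_map, prod.map_map, pullFst_hom, pullFst_hom])

/-- The canonical morphism `Δ_{f × g}(x × y) ⟶ Δ_f(x) × Δ_g(y)`, inverse to `deltaBox`. -/
def deltaBoxInv (f : K ⟶ I) (g : L ⟶ J) (x : Over I) (y : Over J) :
    (Over.pullback (prod.map f g)).obj (box x y) ⟶
      box ((Over.pullback f).obj x) ((Over.pullback g).obj y) :=
  Over.homMk (prod.lift
    (pullback.lift (pullFst (prod.map f g) (box x y) ≫ boxFst x y)
      (((Over.pullback (prod.map f g)).obj (box x y)).hom ≫ prod.fst) (by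
        rw [Category.assoc, boxFst_hom, ← Category.assoc, pullFst_hom, Category.assoc,
          Category.assoc, prod.map_fst]))
    (pullback.lift (pullFst (prod.map f g) (box x y) ≫ boxSnd x y)
      (((Over.pullback (prod.map f g)).obj (box x y)).hom ≫ prod.snd) (by
        rw [Category.assoc, boxSnd_hom, ← Category.assoc, pullFst_hom, Category.assoc,
          Category.assoc, prod.map_snd])))
    (by
      refine (prod.lift_map _ _ _ _).trans ?_
      refine (congrArg₂ prod.lift (pullback.lift_snd _ _ _) (pullback.lift_snd _ _ _)).trans ?_
      apply prod.hom_ext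
      · exact prod.lift_fst _ _
      · exact prod.lift_snd _ _)

/-- The canonical morphism `Π_f(x) × Π_g(y) ⟶ Π_{f × g}(x × y)`, sending a pair of sections
`(h₁, h₂)` to `h₁ × h₂`. -/
def piBox (f : I ⟶ K) (g : J ⟶ L) (x : Over I) (y : Over J) :
    box ((piFunctor f).obj x) ((piFunctor g).obj y) ⟶
      (piFunctor (prod.map f g)).obj (box x y) :=
  (piAdj (prod.map f g)).homEquiv _ _
    (deltaBoxInv f g ((piFunctor f).obj x) ((piFunctor g).obj y) ≫
      boxMap (piCounit f x) (piCounit g y))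

/-- The canonical morphism `⟦P⟧(x) × ⟦Q⟧(y) ⟶ ⟦P ⊗ Q⟧(x × y)`. -/
def polyBox (P : PolyDiagram I K) (Q : PolyDiagram J L) (x : Over I) (y : Over J) :
    box (P.ext.toFunctor.obj x) (Q.ext.toFunctor.obj y) ⟶
      (P.tensor Q).ext.toFunctor.obj (box x y) :=
  sigmaBox P.a Q.a _ _ ≫ (Over.map (prod.map P.a Q.a)).map
    (piBox P.d Q.d _ _ ≫ (piFunctor (prod.map P.d Q.d)).map (deltaBox P.n Q.n x y))

/-- The canonical morphism `⟨R⟩(x) × ⟨S⟩(y) ⟶ ⟨R × S⟩(x × y)` for linear functors. -/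
def linearBox (R : LinSpan I K) (S : LinSpan J L) (x : Over I) (y : Over J) :
    box (R.linear.toFunctor.obj x) (S.linear.toFunctor.obj y) ⟶
      (R.prod S).linear.toFunctor.obj (box x y) :=
  sigmaBox R.r S.r _ _ ≫ (Over.map (prod.map R.r S.r)).map (deltaBox R.l S.l x y)

namespace PFSim

/-- The canonical morphism `P(x) × Q(y) ⟶ (P ⊗ Q)(x × y)`. -/
def tensorBox (P Q : PFSim C) (x : Over P.base) (y : Over Q.base) :
    box (P.fn.toFunctor.obj x) (Q.fn.toFunctor.obj y) ⟶
      (P.tensor Q).fn.toFunctor.obj (box x y) :=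
  boxMap (StrongNat.app P.repIso.hom x) (StrongNat.app Q.repIso.hom y) ≫ polyBox P.rep Q.rep x y

/-- For simulations `s = (R, σ) : P → P'` and `t = (S, τ) : Q → Q'`, a strong natural transformation
`ρ : ⟨R × S⟩ (P ⊗ Q) ⟶ (P' ⊗ Q') ⟨R × S⟩` is the tensor of `σ` and `τ` when it restricts to
`σ_x × τ_y` on external products `x × y`, i.e. when the two composites
`⟨R⟩P(x) × ⟨S⟩Q(y) ⟶ (P' ⊗ Q')⟨R × S⟩(x × y)` agree. -/
def IsTensorCell {P P' Q Q' : PFSim C} (s : Simulation P.fn P'.fn) (t : Simulation Q.fn Q'.fn)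
    (ρ : (P.tensor Q).fn.comp (s.span.prod t.span).linear ⟶
      (s.span.prod t.span).linear.comp (P'.tensor Q').fn) : Prop :=
  ∀ (x : Over P.base) (y : Over Q.base),
    linearBox s.span t.span (P.fn.toFunctor.obj x) (Q.fn.toFunctor.obj y) ≫
        (s.span.prod t.span).linear.toFunctor.map (tensorBox P Q x y) ≫
          StrongNat.app ρ (box x y) =
      boxMap (StrongNat.app s.cell x) (StrongNat.app t.cell y) ≫
        tensorBox P' Q' (s.span.linear.toFunctor.obj x) (t.span.linear.toFunctor.obj y) ≫
          (P'.tensor Q').fn.toFunctor.map (linearBox s.span t.span x y)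

end PFSim

end Box

end PolySim

end

/-!
A strong simulation between extensions of polynomial diagrams is a strategy. Given a span `S` from
`I` to `J`, a strong natural transformation `⟨S⟩ ⟦P⟧ ⟶ ⟦Q⟧ ⟨S⟩` says how, in related states, an
action of `P` is answered by an action of `Q`, a response to the latter is translated back into a
response to the former, and the new states are again related. `SimData P Q S` records these three
operations on generalized elements. Generalized elements of `⟦P⟧(x)` are pairs of a shape and a
family of values (`elt`, `ev`), so data yield a strong natural transformation (`SimData.cell`,
`cell_realizes`). Conversely each element of `⟦P⟧(x)` is the image of the generic element of its
shape, whose values are the positions over the stage, so by naturality a transformation is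
determined by its values there (`core_classify`). These values encode data because they lie over
the current stage, which is what the strength provides (`core_stage`, `ofCell_realizes`). Under
this correspondence, a strong natural isomorphism `⟨S⟩ ≅ ⟨S'⟩` is an isomorphism of spans, so
equivalence of simulations becomes an isomorphism of spans along which the data agree
(`along_of_cellEquiv`, `Along.cellEquiv`), and pasting of cells becomes composition of strategies
(`comp_realizes`). Hence `PFSim C` is equivalent to the category `Diag C` of polynomial diagrams and classes of such data (`fullyFaithful`).

In `Diag C` the tensor product is the componentwise product, and all operations of data are formed
componentwise (`SimData.tensor`). The structural isomorphisms are graphs of isomorphisms of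
diagrams, and their coherence and naturality reduce to identities between projections of products
(`Square.along`). A strategy from `N ⊗ P` to `Q` answers an action `(b, a)` by an action of `Q`
and translates responses `d` into responses `(b', a')`. For fixed `b` this prescribes, for each `a`,
an action of `Q` together with an `a'` for each `d`: an action of the internal hom
`PolyDiagram.ihom P Q`, which is therefore a dependent product of a dependent sum of dependent
products, and whose responses are the pairs `(a, d)`. The remaining component `b'` and the next
state are the translation of that response. Currying is thus bijective (`uncurryHom_bijective`).

The structure is transported to `PFSim C` along the fully faithful functor (`transportMonoidal`,
`exists_internalHom`). That the tensor product of `[(R, σ)]` and `[(S, τ)]` restricts to `σ_x × τ_y`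
on external products is a comparison of values of generalized elements (`val_tensor`,
`isTensorCell_tensorCell`).
-/

noncomputable section

set_option linter.unusedSectionVars false

namespace PolySim

variable {C : Type u} [Category.{v} C] [LCCC C]

/-! ### Generalized elements of the extension of a polynomial diagram -/

namespace StrongFunctor

variable {I J : C} (f : I ⟶ J)

/-- The generalized element of `Δ_f(q)` given by a pair. -/
def pullPair {q : Over J} {Z : C} (e : Z ⟶ q.left) (δ : Z ⟶ I) (h : δ ≫ f = e ≫ q.hom) :
    Z ⟶ ((Over.pullback f).obj q).left :=
  pullback.lift e δ h.symm

variable {f}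

lemma pullPair_fst {q : Over J} {Z : C} (e : Z ⟶ q.left) (δ : Z ⟶ I) (h : δ ≫ f = e ≫ q.hom) :
    pullPair f e δ h ≫ pullFst f q = e := pullback.lift_fst _ _ _

lemma pullPair_hom {q : Over J} {Z : C} (e : Z ⟶ q.left) (δ : Z ⟶ I) (h : δ ≫ f = e ≫ q.hom) :
    pullPair f e δ h ≫ ((Over.pullback f).obj q).hom = δ := pullback.lift_snd _ _ _

lemma pullElt_ext {q : Over J} {Z : C} {u v : Z ⟶ ((Over.pullback f).obj q).left}
    (h₁ : u ≫ pullFst f q = v ≫ pullFst f q)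
    (h₂ : u ≫ ((Over.pullback f).obj q).hom = v ≫ ((Over.pullback f).obj q).hom) : u = v :=
  pullback.hom_ext h₁ h₂

lemma pullPair_map {q q' : Over J} (k : q ⟶ q') {Z : C} (e : Z ⟶ q.left) (δ : Z ⟶ I)
    (h : δ ≫ f = e ≫ q.hom) :
    pullPair f e δ h ≫ ((Over.pullback f).map k).left =
      pullPair f (e ≫ k.left) δ (by rw [h, Category.assoc, Over.w]) := by
  apply pullElt_ext
  · rw [Category.assoc, pullMap_fst, ← Category.assoc, pullPair_fst, pullPair_fst]
  · rw [Category.assoc, Over.w, pullPair_hom, pullPair_hom]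

lemma comp_pullPair {q : Over J} {Y Z : C} (t : Y ⟶ Z) (e : Z ⟶ q.left) (δ : Z ⟶ I)
    (h : δ ≫ f = e ≫ q.hom) :
    t ≫ pullPair f e δ h = pullPair f (t ≫ e) (t ≫ δ) (by rw [Category.assoc, h, Category.assoc]) := by
  apply pullElt_ext
  · rw [Category.assoc, pullPair_fst, pullPair_fst]
  · rw [Category.assoc, pullPair_hom, pullPair_hom]

/-- The value at `δ` of a generalized element `e` of `Π_f(y)`. -/
def piEv {y : Over I} {Z : C} (e : Z ⟶ ((piFunctor f).obj y).left) (δ : Z ⟶ I)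
    (h : δ ≫ f = e ≫ ((piFunctor f).obj y).hom) : Z ⟶ y.left :=
  pullPair f e δ h ≫ (piCounit f y).left

lemma piEv_hom {y : Over I} {Z : C} (e : Z ⟶ ((piFunctor f).obj y).left) (δ : Z ⟶ I)
    (h : δ ≫ f = e ≫ ((piFunctor f).obj y).hom) : piEv e δ h ≫ y.hom = δ := by
  rw [piEv, Category.assoc, Over.w, pullPair_hom]

lemma comp_piEv {y : Over I} {Y Z : C} (t : Y ⟶ Z) (e : Z ⟶ ((piFunctor f).obj y).left)
    (δ : Z ⟶ I) (h : δ ≫ f = e ≫ ((piFunctor f).obj y).hom) :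
    t ≫ piEv e δ h = piEv (t ≫ e) (t ≫ δ) (by rw [Category.assoc, h, Category.assoc]) := by
  rw [piEv, piEv, ← Category.assoc, comp_pullPair]

/-- The values of a morphism into `Π_f(y)` are given by its transpose. -/
lemma piEv_left {x : Over J} {y : Over I} (g : x ⟶ (piFunctor f).obj y) {Z : C} (t : Z ⟶ x.left)
    (δ : Z ⟶ I) (h : δ ≫ f = t ≫ x.hom) :
    piEv (t ≫ g.left) δ (by rw [h, Category.assoc, Over.w]) =
      pullPair f t δ h ≫ ((Over.pullback f).map g ≫ piCounit f y).left := by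
  rw [Over.comp_left, ← Category.assoc (pullPair f t δ h), pullPair_map]
  rfl

/-- A generalized element of `Π_f(y)` is determined by its values at all later stages. -/
lemma piElt_ext {y : Over I} {Z : C} {e e' : Z ⟶ ((piFunctor f).obj y).left}
    (hs : e ≫ ((piFunctor f).obj y).hom = e' ≫ ((piFunctor f).obj y).hom)
    (hv : ∀ {Y : C} (t : Y ⟶ Z) (δ : Y ⟶ I) (h : δ ≫ f = (t ≫ e) ≫ ((piFunctor f).obj y).hom)
      (h' : δ ≫ f = (t ≫ e') ≫ ((piFunctor f).obj y).hom),
        piEv (t ≫ e) δ h = piEv (t ≫ e') δ h') : e = e' := by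
  let z : Over J := Over.mk (e ≫ ((piFunctor f).obj y).hom)
  let g : z ⟶ (piFunctor f).obj y := Over.homMk e rfl
  let g' : z ⟶ (piFunctor f).obj y := Over.homMk e' hs.symm
  suffices H : g = g' from congrArg (fun k => k.left) H
  apply pi_hom_ext
  ext
  have aux : ∀ k : z ⟶ (piFunctor f).obj y, ((Over.pullback f).map k ≫ piCounit f y).left =
      piEv (pullFst f z ≫ k.left) ((Over.pullback f).obj z).hom
        (by rw [← pullFst_hom, Category.assoc, Over.w]) := by
    intro k
    rw [piEv_left k _ _ (pullFst_hom f z).symm]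
    have : pullPair f (pullFst f z) ((Over.pullback f).obj z).hom (pullFst_hom f z).symm = 𝟙 _ := by
      apply pullElt_ext
      · rw [pullPair_fst, Category.id_comp]
      · rw [pullPair_hom, Category.id_comp]
    rw [this, Category.id_comp]
  rw [aux, aux]
  exact hv _ _ _ _

/-- The generalized element of `Π_f(y)` over `a` with prescribed values. -/
def piMk {y : Over I} {Z : C} (a : Z ⟶ J) (k : (Over.pullback f).obj (Over.mk a) ⟶ y) :
    Z ⟶ ((piFunctor f).obj y).left :=
  ((piAdj f).homEquiv (Over.mk a) y k).left

lemma piMk_hom {y : Over I} {Z : C} (a : Z ⟶ J) (k : (Over.pullback f).obj (Over.mk a) ⟶ y) :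
    piMk a k ≫ ((piFunctor f).obj y).hom = a := Over.w _

lemma piEv_mk {y : Over I} {Z : C} (a : Z ⟶ J) (k : (Over.pullback f).obj (Over.mk a) ⟶ y)
    {Y : C} (t : Y ⟶ Z) (e : Y ⟶ ((piFunctor f).obj y).left) (he : e = t ≫ piMk a k) (δ : Y ⟶ I)
    (h : δ ≫ f = e ≫ ((piFunctor f).obj y).hom) :
    piEv e δ h = pullPair (q := Over.mk a) f t δ
      (by rw [h, he, Category.assoc, piMk_hom]; rfl) ≫ k.left := by
  subst he
  refine (piEv_left ((piAdj f).homEquiv (Over.mk a) y k) t δ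
    (by rw [h, Category.assoc, piMk_hom]; rfl)).trans ?_
  rw [← pi_transpose, Equiv.symm_apply_apply]

/-- Since `piEv` depends on a proof about its element, that element is a variable `e'`, which can
be instantiated up to a propositional equality. -/
lemma piEv_map {y y' : Over I} (g : y ⟶ y') {Z : C} (e : Z ⟶ ((piFunctor f).obj y).left)
    (e' : Z ⟶ ((piFunctor f).obj y').left) (he : e' = e ≫ ((piFunctor f).map g).left) (δ : Z ⟶ I)
    (h : δ ≫ f = e' ≫ ((piFunctor f).obj y').hom) :
    piEv e' δ h = piEv e δ (by rw [h, he, Category.assoc, Over.w]) ≫ g.left := by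
  subst he
  have w : δ ≫ f = e ≫ ((piFunctor f).obj y).hom := by rw [h, Category.assoc, Over.w]
  rw [piEv_left _ _ _ w, pi_counit_naturality, Over.comp_left, piEv, Category.assoc]

lemma piEv_str_fst (B : C) (y : Over I) {Z : C} (e : Z ⟶ (act B ((piFunctor f).obj y)).left)
    (e' : Z ⟶ ((piFunctor f).obj (act B y)).left) (he : e' = e ≫ (piStr f B y).left)
    (δ : Z ⟶ I) (h : δ ≫ f = e' ≫ ((piFunctor f).obj (act B y)).hom) :
    piEv e' δ h ≫ actFst B y = e ≫ actFst B _ := by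
  subst he
  have w : δ ≫ f = e ≫ (act B ((piFunctor f).obj y)).hom := by rw [h, Category.assoc, Over.w]
  rw [piEv_left _ _ _ w, piStr_counit, Over.comp_left,
    Category.assoc, Category.assoc, actMap_fst, Category.comp_id, deltaStrInv, actLift_fst,
    ← Category.assoc, pullPair_fst]

end StrongFunctor

namespace PolyDiagram
open StrongFunctor

variable {I J : C} (P : PolyDiagram I J)

/-- The projection from the total object of `⟦P⟧(x)` to the object `A` of shapes. -/
def shape (x : Over I) : (P.ext.toFunctor.obj x).left ⟶ P.A :=
  ((piFunctor P.d).obj ((Over.pullback P.n).obj x)).hom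

lemma shape_a (x : Over I) : P.shape x ≫ P.a = (P.ext.toFunctor.obj x).hom := rfl

variable {P}

/-- The value at a position `δ` of a generalized element `e` of `⟦P⟧(x)`. -/
def ev {x : Over I} {Z : C} (e : Z ⟶ (P.ext.toFunctor.obj x).left) (δ : Z ⟶ P.D)
    (h : δ ≫ P.d = e ≫ P.shape x) : Z ⟶ x.left :=
  piEv (f := P.d) (y := (Over.pullback P.n).obj x) e δ h ≫ pullFst P.n x

lemma ev_congr {x : Over I} {Z : C} {e e' : Z ⟶ (P.ext.toFunctor.obj x).left} {δ δ' : Z ⟶ P.D}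
    {h : δ ≫ P.d = e ≫ P.shape x} (he : e = e') (hδ : δ = δ') :
    ev e δ h = ev e' δ' (by rw [← he, ← hδ, h]) := by
  subst he hδ; rfl

lemma ev_hom {x : Over I} {Z : C} (e : Z ⟶ (P.ext.toFunctor.obj x).left) (δ : Z ⟶ P.D)
    (h : δ ≫ P.d = e ≫ P.shape x) : ev e δ h ≫ x.hom = δ ≫ P.n := by
  have := piEv_hom (f := P.d) (y := (Over.pullback P.n).obj x) e δ h
  rw [ev, Category.assoc, pullFst_hom]
  exact (Category.assoc _ _ _).symm.trans (congrArg (fun k => k ≫ P.n) this)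

lemma comp_ev {x : Over I} {Y Z : C} (t : Y ⟶ Z) (e : Z ⟶ (P.ext.toFunctor.obj x).left)
    (δ : Z ⟶ P.D) (h : δ ≫ P.d = e ≫ P.shape x) :
    t ≫ ev e δ h = ev (t ≫ e) (t ≫ δ) (by rw [Category.assoc, h, Category.assoc]) :=
  (Category.assoc _ _ _).symm.trans
    (congrArg (fun k => k ≫ pullFst P.n x) (comp_piEv (f := P.d) t e δ h))

/-- A generalized element of `⟦P⟧(x)` is determined by its shape and its values. -/
lemma elt_ext {x : Over I} {Z : C} {e e' : Z ⟶ (P.ext.toFunctor.obj x).left}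
    (hs : e ≫ P.shape x = e' ≫ P.shape x)
    (hv : ∀ {Y : C} (t : Y ⟶ Z) (δ : Y ⟶ P.D) (h : δ ≫ P.d = (t ≫ e) ≫ P.shape x)
      (h' : δ ≫ P.d = (t ≫ e') ≫ P.shape x), ev (t ≫ e) δ h = ev (t ≫ e') δ h') : e = e' := by
  refine piElt_ext (f := P.d) (y := (Over.pullback P.n).obj x) hs fun t δ h h' => ?_
  apply pullElt_ext
  · exact hv t δ h h'
  · rw [piEv_hom, piEv_hom]

/-- The generalized element of `⟦P⟧(x)` with a given shape and a given family of values. Only the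
member of the family at the generic position, on the pullback of `P.d` along `a`, enters the
definition; the other members are recovered from it when the family is natural, see `ev_elt`. -/
def elt {x : Over I} {Z : C} (a : Z ⟶ P.A)
    (h : ∀ {Y : C} (t : Y ⟶ Z) (δ : Y ⟶ P.D), δ ≫ P.d = t ≫ a → (Y ⟶ x.left))
    (hx : ∀ {Y : C} (t : Y ⟶ Z) (δ : Y ⟶ P.D) (w : δ ≫ P.d = t ≫ a), h t δ w ≫ x.hom = δ ≫ P.n) :
    Z ⟶ (P.ext.toFunctor.obj x).left :=
  piMk (f := P.d) (y := (Over.pullback P.n).obj x) a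
    (pullLift (h (pullFst P.d (Over.mk a)) ((Over.pullback P.d).obj (Over.mk a)).hom
      (pullFst_hom P.d (Over.mk a)).symm) (hx _ _ _))

section elt
variable {x : Over I} {Z : C} (a : Z ⟶ P.A)
    (h : ∀ {Y : C} (t : Y ⟶ Z) (δ : Y ⟶ P.D), δ ≫ P.d = t ≫ a → (Y ⟶ x.left))
    (hx : ∀ {Y : C} (t : Y ⟶ Z) (δ : Y ⟶ P.D) (w : δ ≫ P.d = t ≫ a), h t δ w ≫ x.hom = δ ≫ P.n)

lemma elt_shape : elt a h hx ≫ P.shape x = a :=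
  piMk_hom (f := P.d) (y := (Over.pullback P.n).obj x) a _

lemma ev_elt (hn : ∀ {X Y : C} (s : X ⟶ Y) (t : Y ⟶ Z) (δ : Y ⟶ P.D) (w : δ ≫ P.d = t ≫ a),
      s ≫ h t δ w = h (s ≫ t) (s ≫ δ) (by rw [Category.assoc, w, Category.assoc]))
    {Y : C} (t : Y ⟶ Z) (e : Y ⟶ (P.ext.toFunctor.obj x).left) (he : e = t ≫ elt a h hx)
    (δ : Y ⟶ P.D) (w : δ ≫ P.d = e ≫ P.shape x) :
    ev e δ w = h t δ (by rw [w, he, Category.assoc, elt_shape]) := by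
  have w' : δ ≫ P.d = t ≫ (Over.mk a).hom := by rw [w, he, Category.assoc, elt_shape]; rfl
  refine (congrArg (fun k => k ≫ pullFst P.n x)
    (piEv_mk (f := P.d) (y := (Over.pullback P.n).obj x) a _ t e he δ w)).trans ?_
  rw [Category.assoc, pullLift_fst]
  refine (hn _ _ _ _).trans ?_
  have e1 : pullPair P.d t δ w' ≫ pullFst P.d (Over.mk a) = t := pullPair_fst _ _ _
  have e2 : pullPair P.d t δ w' ≫ ((Over.pullback P.d).obj (Over.mk a)).hom = δ :=
    pullPair_hom _ _ _
  congr 1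

end elt

lemma map_shape {x y : Over I} (g : x ⟶ y) :
    (P.ext.toFunctor.map g).left ≫ P.shape y = P.shape x :=
  Over.w ((piFunctor P.d).map ((Over.pullback P.n).map g))

/-- Morphisms of slices act on values by composition. -/
lemma ev_map {x y : Over I} (g : x ⟶ y) {Z : C} (e : Z ⟶ (P.ext.toFunctor.obj x).left)
    (e' : Z ⟶ (P.ext.toFunctor.obj y).left) (he : e' = e ≫ (P.ext.toFunctor.map g).left)
    (δ : Z ⟶ P.D) (h : δ ≫ P.d = e' ≫ P.shape y) :
    ev e' δ h = ev e δ (by rw [h, he, Category.assoc, map_shape]) ≫ g.left := by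
  refine (congrArg (fun k => k ≫ pullFst P.n y)
    (piEv_map (f := P.d) ((Over.pullback P.n).map g) e e' he δ h)).trans ?_
  rw [Category.assoc, pullMap_fst, ← Category.assoc]
  rfl

lemma str_shape (B : C) (x : Over I) : (P.ext.str B x).left ≫ P.shape (act B x) =
    (actProj B (P.ext.toFunctor.obj x)).left ≫ P.shape x := by
  refine (congrArg (fun k => k ≫ _) (Category.id_comp _)).trans ?_
  exact Over.w (((StrongFunctor.delta P.n).comp (StrongFunctor.pi P.d)).str B x)

/-- The strength pairs every value with the same parameter. -/
lemma ev_str_fst (B : C) (x : Over I) {Z : C} (e : Z ⟶ (act B (P.ext.toFunctor.obj x)).left)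
    (e' : Z ⟶ (P.ext.toFunctor.obj (act B x)).left) (he : e' = e ≫ (P.ext.str B x).left)
    (δ : Z ⟶ P.D) (h : δ ≫ P.d = e' ≫ P.shape (act B x)) :
    ev e' δ h ≫ actFst B x = e ≫ actFst B (P.ext.toFunctor.obj x) := by
  let y := (Over.pullback P.n).obj x
  have hs : (P.ext.str B x).left =
      (piStr P.d B y).left ≫ ((piFunctor P.d).map (deltaStr P.n B x)).left := Category.id_comp _
  let e₁ : Z ⟶ ((piFunctor P.d).obj (act B y)).left :=
    (show Z ⟶ (act B ((piFunctor P.d).obj y)).left from e) ≫ (piStr P.d B y).left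
  have h₁ : e' = e₁ ≫ ((piFunctor P.d).map (deltaStr P.n B x)).left := by
    rw [he, hs]; exact (Category.assoc _ _ _).symm
  have e1 : (deltaStr P.n B x).left ≫ pullFst P.n (act B x) ≫ actFst B x = actFst B _ := by
    rw [← Category.assoc, deltaStr_fst]
    exact (prod.map_fst _ _).trans (Category.comp_id _)
  have h₂ : δ ≫ P.d = e₁ ≫ ((piFunctor P.d).obj (act B y)).hom := by
    refine h.trans ((congrArg (fun k => k ≫ P.shape _) h₁).trans ((Category.assoc _ _ _).trans ?_))
    exact congrArg (fun k => e₁ ≫ k) (Over.w ((piFunctor P.d).map (deltaStr P.n B x)))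
  have k₁ : piEv (f := P.d) (y := (Over.pullback P.n).obj (act B x)) e' δ h =
      piEv e₁ δ h₂ ≫ (deltaStr P.n B x).left :=
    piEv_map (f := P.d) (deltaStr P.n B x) e₁ e' h₁ δ h
  have k₂ : piEv e₁ δ h₂ ≫ actFst B y = e ≫ actFst B (P.ext.toFunctor.obj x) :=
    piEv_str_fst (f := P.d) B y e e₁ rfl δ h₂
  rw [← k₂, ev, k₁, Category.assoc, Category.assoc, e1]

lemma ev_str_proj (B : C) (x : Over I) {Z : C} (e : Z ⟶ (act B (P.ext.toFunctor.obj x)).left)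
    (e' : Z ⟶ (P.ext.toFunctor.obj (act B x)).left) (he : e' = e ≫ (P.ext.str B x).left)
    (δ : Z ⟶ P.D) (h : δ ≫ P.d = e' ≫ P.shape (act B x)) :
    ev e' δ h ≫ (actProj B x).left = ev (e ≫ (actProj B (P.ext.toFunctor.obj x)).left) δ
        (by rw [h, he, Category.assoc, str_shape, Category.assoc]) := by
  rw [← ev_map (actProj B x) e' (e ≫ (actProj B (P.ext.toFunctor.obj x)).left)]
  rw [he, Category.assoc, ← Over.comp_left, P.ext.str_proj]

end PolyDiagram

/-! ### Simulations in terms of generalized elements -/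

/-- Combinatorial data of a simulation along the span `S` between the extensions of the
polynomial diagrams `P` and `Q`, phrased on generalized elements: an action `a` of `P` in a state
related by `r` is simulated by the action `act r a` of `Q`; a response `d` to that action is
turned into the response `resp r a d` to `a`, and the resulting states are related by `next r a
d`. All operations are natural in the stage `Z`. -/
structure SimData {I J : C} (P : PolyDiagram I I) (Q : PolyDiagram J J) (S : LinSpan I J) where
  act : ∀ {Z : C} (r : Z ⟶ S.R) (a : Z ⟶ P.A), r ≫ S.l = a ≫ P.a → (Z ⟶ Q.A)
  comp_act : ∀ {Y Z : C} (t : Y ⟶ Z) (r : Z ⟶ S.R) (a : Z ⟶ P.A) (h : r ≫ S.l = a ≫ P.a),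
    t ≫ act r a h = act (t ≫ r) (t ≫ a) (by rw [Category.assoc, h, Category.assoc])
  act_a : ∀ {Z : C} (r : Z ⟶ S.R) (a : Z ⟶ P.A) (h : r ≫ S.l = a ≫ P.a),
    act r a h ≫ Q.a = r ≫ S.r
  resp : ∀ {Z : C} (r : Z ⟶ S.R) (a : Z ⟶ P.A) (h : r ≫ S.l = a ≫ P.a) (d : Z ⟶ Q.D),
    d ≫ Q.d = act r a h → (Z ⟶ P.D)
  comp_resp : ∀ {Y Z : C} (t : Y ⟶ Z) (r : Z ⟶ S.R) (a : Z ⟶ P.A) (h : r ≫ S.l = a ≫ P.a)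
    (d : Z ⟶ Q.D) (w : d ≫ Q.d = act r a h), t ≫ resp r a h d w =
      resp (t ≫ r) (t ≫ a) (by rw [Category.assoc, h, Category.assoc]) (t ≫ d)
        (by rw [Category.assoc, w, comp_act])
  resp_d : ∀ {Z : C} (r : Z ⟶ S.R) (a : Z ⟶ P.A) (h : r ≫ S.l = a ≫ P.a) (d : Z ⟶ Q.D)
    (w : d ≫ Q.d = act r a h), resp r a h d w ≫ P.d = a
  next : ∀ {Z : C} (r : Z ⟶ S.R) (a : Z ⟶ P.A) (h : r ≫ S.l = a ≫ P.a) (d : Z ⟶ Q.D),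
    d ≫ Q.d = act r a h → (Z ⟶ S.R)
  comp_next : ∀ {Y Z : C} (t : Y ⟶ Z) (r : Z ⟶ S.R) (a : Z ⟶ P.A) (h : r ≫ S.l = a ≫ P.a)
    (d : Z ⟶ Q.D) (w : d ≫ Q.d = act r a h), t ≫ next r a h d w =
      next (t ≫ r) (t ≫ a) (by rw [Category.assoc, h, Category.assoc]) (t ≫ d)
        (by rw [Category.assoc, w, comp_act])
  next_l : ∀ {Z : C} (r : Z ⟶ S.R) (a : Z ⟶ P.A) (h : r ≫ S.l = a ≫ P.a) (d : Z ⟶ Q.D)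
    (w : d ≫ Q.d = act r a h), next r a h d w ≫ S.l = resp r a h d w ≫ P.n
  next_r : ∀ {Z : C} (r : Z ⟶ S.R) (a : Z ⟶ P.A) (h : r ≫ S.l = a ≫ P.a) (d : Z ⟶ Q.D)
    (w : d ≫ Q.d = act r a h), next r a h d w ≫ S.r = d ≫ Q.n

/-- The component of a cell `L F ⟶ G L`, with the composites of functors unfolded in its type. -/
def cellApp {I J : C} {F : StrongFunctor I I} {G : StrongFunctor J J} {L : StrongFunctor I J}
    (ρ : F.comp L ⟶ L.comp G) (x : Over I) :
    L.toFunctor.obj (F.toFunctor.obj x) ⟶ G.toFunctor.obj (L.toFunctor.obj x) :=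
  StrongNat.app ρ x

section cellApp
variable {I J : C} {F : StrongFunctor I I} {G : StrongFunctor J J} {L : StrongFunctor I J}

lemma cellApp_natural (ρ : F.comp L ⟶ L.comp G) {x y : Over I} (g : x ⟶ y) :
    L.toFunctor.map (F.toFunctor.map g) ≫ cellApp ρ y =
      cellApp ρ x ≫ G.toFunctor.map (L.toFunctor.map g) :=
  StrongNat.naturality ρ g

lemma cellApp_strong (ρ : F.comp L ⟶ L.comp G) (B : C) (x : Over I) :
    actMap (𝟙 B) (cellApp ρ x) ≫ G.str B (L.toFunctor.obj x) ≫ G.toFunctor.map (L.str B x) =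
      (L.str B (F.toFunctor.obj x) ≫ L.toFunctor.map (F.str B x)) ≫ cellApp ρ (act B x) :=
  StrongNat.strong ρ B x

lemma cell_ext {ρ ρ' : F.comp L ⟶ L.comp G} (h : ∀ x, cellApp ρ x = cellApp ρ' x) : ρ = ρ' :=
  StrongFunctor.hom_ext h

end cellApp

/-- The generalized element `(b, e)` of `B ⊙ x`. -/
def actPair {I B : C} {x : Over I} {Z : C} (b : Z ⟶ B) (e : Z ⟶ x.left) : Z ⟶ (act B x).left :=
  prod.lift b e

@[simp] lemma actPair_fst {I B : C} {x : Over I} {Z : C} (b : Z ⟶ B) (e : Z ⟶ x.left) :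
    actPair b e ≫ actFst B x = b := prod.lift_fst _ _

@[simp] lemma actPair_proj {I B : C} {x : Over I} {Z : C} (b : Z ⟶ B) (e : Z ⟶ x.left) :
    actPair b e ≫ (actProj B x).left = e := prod.lift_snd _ _

lemma actLeft_hom {I B : C} (x : Over I) : (actProj B x).left ≫ x.hom = (act B x).hom :=
  Over.w (actProj B x)

namespace SimData
open PolyDiagram LinSpan

variable {I J : C} {P : PolyDiagram I I} {Q : PolyDiagram J J} {S : LinSpan I J}

section congr
variable (s : SimData P Q S) {Z : C} {r r' : Z ⟶ S.R} {a a' : Z ⟶ P.A} {d d' : Z ⟶ Q.D}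

lemma act_congr (hr : r = r') (ha : a = a') (h : r ≫ S.l = a ≫ P.a) (h' : r' ≫ S.l = a' ≫ P.a) :
    s.act r a h = s.act r' a' h' := by subst hr ha; rfl

lemma resp_congr (hr : r = r') (ha : a = a') (hd : d = d') (h : r ≫ S.l = a ≫ P.a)
    (h' : r' ≫ S.l = a' ≫ P.a) (w : d ≫ Q.d = s.act r a h) (w' : d' ≫ Q.d = s.act r' a' h') :
    s.resp r a h d w = s.resp r' a' h' d' w' := by subst hr ha hd; rfl

lemma next_congr (hr : r = r') (ha : a = a') (hd : d = d') (h : r ≫ S.l = a ≫ P.a)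
    (h' : r' ≫ S.l = a' ≫ P.a) (w : d ≫ Q.d = s.act r a h) (w' : d' ≫ Q.d = s.act r' a' h') :
    s.next r a h d w = s.next r' a' h' d' w' := by subst hr ha hd; rfl

end congr

lemma shape_cond {x : Over I} {Z : C} {r : Z ⟶ S.R} {p : Z ⟶ (P.ext.toFunctor.obj x).left}
    (w : p ≫ (P.ext.toFunctor.obj x).hom = r ≫ S.l) : r ≫ S.l = (p ≫ P.shape x) ≫ P.a := by
  rw [← w, Category.assoc, shape_a]

section val
variable (s : SimData P Q S) {x : Over I}

/-- The value, at the generalized element `(r, p)` of `⟨S⟩⟦P⟧(x)`, of the transformation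
`⟨S⟩⟦P⟧ ⟶ ⟦Q⟧⟨S⟩` encoded by `s`. -/
def val {Z : C} (r : Z ⟶ S.R) (p : Z ⟶ (P.ext.toFunctor.obj x).left)
    (w : p ≫ (P.ext.toFunctor.obj x).hom = r ≫ S.l) :
    Z ⟶ (Q.ext.toFunctor.obj (S.linear.toFunctor.obj x)).left :=
  elt (s.act r (p ≫ P.shape x) (shape_cond w))
    (fun {Y} t d h => linPair
      (ev (t ≫ p) (s.resp (t ≫ r) ((t ≫ p) ≫ P.shape x)
        (shape_cond (by rw [Category.assoc, w, Category.assoc])) d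
        (by rw [h, comp_act]; exact s.act_congr rfl (Category.assoc _ _ _).symm _ _))
        (resp_d _ _ _ _ _ _))
      (s.next (t ≫ r) ((t ≫ p) ≫ P.shape x)
        (shape_cond (by rw [Category.assoc, w, Category.assoc])) d
        (by rw [h, comp_act]; exact s.act_congr rfl (Category.assoc _ _ _).symm _ _))
      (by rw [ev_hom, next_l]))
    (fun {Y} t d h => by rw [lin_hom, ← Category.assoc, linPair_mid, next_r])

variable {Z : C} (r : Z ⟶ S.R) (p : Z ⟶ (P.ext.toFunctor.obj x).left)
    (w : p ≫ (P.ext.toFunctor.obj x).hom = r ≫ S.l)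

lemma val_shape : s.val r p w ≫ Q.shape _ = s.act r (p ≫ P.shape x) (shape_cond w) :=
  elt_shape _ _ (fun {Y} t d h => by rw [lin_hom, ← Category.assoc, linPair_mid, next_r])

lemma ev_val {Y : C} (t : Y ⟶ Z) (e : Y ⟶ (Q.ext.toFunctor.obj (S.linear.toFunctor.obj x)).left)
    (he : e = t ≫ s.val r p w) (d : Y ⟶ Q.D) (h : d ≫ Q.d = e ≫ Q.shape _)
    (p' : Y ⟶ (P.ext.toFunctor.obj x).left) (hp' : p' = t ≫ p)
    (w₁ : (t ≫ r) ≫ S.l = (p' ≫ P.shape x) ≫ P.a)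
    (w₂ : d ≫ Q.d = s.act (t ≫ r) (p' ≫ P.shape x) w₁) :
    ev e d h = linPair (ev p' (s.resp (t ≫ r) (p' ≫ P.shape x) w₁ d w₂) (resp_d _ _ _ _ _ _))
      (s.next (t ≫ r) (p' ≫ P.shape x) w₁ d w₂) (by rw [ev_hom, next_l]) := by
  subst hp'
  refine ev_elt _ _ (fun {Y} t d h => by rw [lin_hom, ← Category.assoc, linPair_mid, next_r]) ?_
    t e he d h
  intro X Y s' t d w
  apply lin_ext
  · rw [Category.assoc, linPair_fst, linPair_fst, comp_ev]
    refine ev_congr (Category.assoc _ _ _).symm ?_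
    rw [comp_resp]
    exact s.resp_congr (Category.assoc _ _ _).symm (by simp only [Category.assoc]) rfl _ _ _ _
  · rw [Category.assoc, linPair_mid, linPair_mid, comp_next]
    exact s.next_congr (Category.assoc _ _ _).symm (by simp only [Category.assoc]) rfl _ _ _ _

lemma ev_val_mid (d : Z ⟶ Q.D) (h : d ≫ Q.d = s.val r p w ≫ Q.shape _) :
    ev (s.val r p w) d h ≫ S.linMid x = s.next r (p ≫ P.shape x) (shape_cond w) d
      (by rw [h, val_shape]) := by
  rw [s.ev_val r p w (𝟙 Z) _ (Category.id_comp _).symm d h p (Category.id_comp _).symm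
    (by rw [Category.id_comp, shape_cond w])
    (by rw [h, val_shape]; exact s.act_congr (Category.id_comp _).symm rfl _ _), linPair_mid]
  exact s.next_congr (Category.id_comp _) rfl rfl _ _ _ _

lemma ev_val_fst (d : Z ⟶ Q.D) (h : d ≫ Q.d = s.val r p w ≫ Q.shape _) :
    ev (s.val r p w) d h ≫ S.linFst x = ev p (s.resp r (p ≫ P.shape x) (shape_cond w) d
      (by rw [h, val_shape])) (resp_d _ _ _ _ _ _) := by
  rw [s.ev_val r p w (𝟙 Z) _ (Category.id_comp _).symm d h p (Category.id_comp _).symm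
    (by rw [Category.id_comp, shape_cond w])
    (by rw [h, val_shape]; exact s.act_congr (Category.id_comp _).symm rfl _ _), linPair_fst]
  exact ev_congr rfl (s.resp_congr (Category.id_comp _) rfl rfl _ _ _ _)

/-- The value of the encoded transformation is characterized by its shape and by the two
components of its values. -/
lemma eq_val {e : Z ⟶ (Q.ext.toFunctor.obj (S.linear.toFunctor.obj x)).left}
    (hs : e ≫ Q.shape _ = s.act r (p ≫ P.shape x) (shape_cond w))
    (hm : ∀ {Y : C} (t : Y ⟶ Z) (d : Y ⟶ Q.D) (h : d ≫ Q.d = (t ≫ e) ≫ Q.shape _)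
      (w₁ : (t ≫ r) ≫ S.l = ((t ≫ p) ≫ P.shape x) ≫ P.a)
      (w₂ : d ≫ Q.d = s.act (t ≫ r) ((t ≫ p) ≫ P.shape x) w₁),
      ev (t ≫ e) d h ≫ S.linMid x = s.next (t ≫ r) ((t ≫ p) ≫ P.shape x) w₁ d w₂)
    (hf : ∀ {Y : C} (t : Y ⟶ Z) (d : Y ⟶ Q.D) (h : d ≫ Q.d = (t ≫ e) ≫ Q.shape _)
      (w₁ : (t ≫ r) ≫ S.l = ((t ≫ p) ≫ P.shape x) ≫ P.a)
      (w₂ : d ≫ Q.d = s.act (t ≫ r) ((t ≫ p) ≫ P.shape x) w₁),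
      ev (t ≫ e) d h ≫ S.linFst x =
        ev (t ≫ p) (s.resp (t ≫ r) ((t ≫ p) ≫ P.shape x) w₁ d w₂) (resp_d _ _ _ _ _ _)) :
    e = s.val r p w := by
  refine elt_ext (hs.trans (s.val_shape r p w).symm) fun {Y} t d h h' => ?_
  have w₁ : (t ≫ r) ≫ S.l = ((t ≫ p) ≫ P.shape x) ≫ P.a :=
    shape_cond (by rw [Category.assoc, w, Category.assoc])
  have w₂ : d ≫ Q.d = s.act (t ≫ r) ((t ≫ p) ≫ P.shape x) w₁ := by
    rw [h', Category.assoc, val_shape, comp_act]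
    exact s.act_congr rfl (Category.assoc _ _ _).symm _ _
  rw [s.ev_val r p w t _ rfl d h' _ rfl w₁ w₂]
  apply lin_ext
  · rw [hf t d h w₁ w₂, linPair_fst]
  · rw [hm t d h w₁ w₂, linPair_mid]

lemma comp_val {Y : C} (t : Y ⟶ Z) : t ≫ s.val r p w =
    s.val (t ≫ r) (t ≫ p) (by rw [Category.assoc, w, Category.assoc]) := by
  apply eq_val
  · rw [Category.assoc, val_shape, comp_act]
    exact s.act_congr rfl (Category.assoc _ _ _).symm _ _
  · intro X t' d h w₁ w₂
    have e₁ : t' ≫ t ≫ p = (t' ≫ t) ≫ p := (Category.assoc _ _ _).symm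
    have w₃ : ((t' ≫ t) ≫ r) ≫ S.l = ((t' ≫ t ≫ p) ≫ P.shape x) ≫ P.a := by
      rw [Category.assoc t', w₁]
    rw [s.ev_val r p w (t' ≫ t) _ (Category.assoc _ _ _).symm d h (t' ≫ t ≫ p) e₁ w₃
      (by rw [w₂]; exact s.act_congr (Category.assoc _ _ _).symm rfl _ _), linPair_mid]
    exact s.next_congr (Category.assoc _ _ _) rfl rfl _ _ _ _
  · intro X t' d h w₁ w₂
    have e₁ : t' ≫ t ≫ p = (t' ≫ t) ≫ p := (Category.assoc _ _ _).symm
    have w₃ : ((t' ≫ t) ≫ r) ≫ S.l = ((t' ≫ t ≫ p) ≫ P.shape x) ≫ P.a := by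
      rw [Category.assoc t', w₁]
    rw [s.ev_val r p w (t' ≫ t) _ (Category.assoc _ _ _).symm d h (t' ≫ t ≫ p) e₁ w₃
      (by rw [w₂]; exact s.act_congr (Category.assoc _ _ _).symm rfl _ _), linPair_fst]
    exact ev_congr rfl (s.resp_congr (Category.assoc _ _ _) rfl rfl _ _ _ _)

lemma val_hom : s.val r p w ≫ (Q.ext.toFunctor.obj (S.linear.toFunctor.obj x)).hom = r ≫ S.r := by
  rw [← shape_a, ← Category.assoc, val_shape, act_a]

lemma val_congr {r' : Z ⟶ S.R} {p' : Z ⟶ (P.ext.toFunctor.obj x).left} (hr : r = r')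
    (hp : p = p') : s.val r p w = s.val r' p' (by rw [← hr, ← hp, w]) := by
  subst hr hp; rfl

end val

/-- The cell `ρ` is the one encoded by `s`: both agree on all generalized elements. -/
def Realizes (s : SimData P Q S) (ρ : P.ext.comp S.linear ⟶ S.linear.comp Q.ext) : Prop :=
  ∀ (x : Over I) {Z : C} (r : Z ⟶ S.R) (p : Z ⟶ (P.ext.toFunctor.obj x).left)
    (w : p ≫ (P.ext.toFunctor.obj x).hom = r ≫ S.l),
    linPair p r w ≫ (cellApp ρ x).left = s.val r p w

lemma Realizes.eq {s : SimData P Q S} {ρ ρ' : P.ext.comp S.linear ⟶ S.linear.comp Q.ext}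
    (h : s.Realizes ρ) (h' : s.Realizes ρ') : ρ = ρ' := by
  refine cell_ext fun x => ?_
  ext
  have := (h x (S.linMid _) (S.linFst _) (S.lin_condition _)).trans
    (h' x (S.linMid _) (S.linFst _) (S.lin_condition _)).symm
  have e : linPair (S.linFst (P.ext.toFunctor.obj x)) (S.linMid (P.ext.toFunctor.obj x))
      (S.lin_condition _) = 𝟙 _ :=
    lin_ext (by rw [linPair_fst, Category.id_comp]) (by rw [linPair_mid, Category.id_comp])
  rwa [e, Category.id_comp, Category.id_comp] at this

/-- Naturality of the transformation encoded by `s`. -/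
lemma val_map (s : SimData P Q S) {x y : Over I} (g : x ⟶ y) {Z : C} (r : Z ⟶ S.R)
    (p : Z ⟶ (P.ext.toFunctor.obj x).left) (w : p ≫ (P.ext.toFunctor.obj x).hom = r ≫ S.l) :
    s.val r p w ≫ (Q.ext.toFunctor.map (S.linear.toFunctor.map g)).left =
      s.val r (p ≫ (P.ext.toFunctor.map g).left) (by rw [Category.assoc, Over.w, w]) := by
  have e₁ : (p ≫ (P.ext.toFunctor.map g).left) ≫ P.shape y = p ≫ P.shape x := by
    rw [Category.assoc, map_shape]
  apply eq_val
  · rw [Category.assoc, map_shape, val_shape]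
    exact s.act_congr rfl e₁.symm _ _
  · intro Y t d h w₁ w₂
    rw [ev_map _ (t ≫ s.val r p w) _ (Category.assoc _ _ _).symm, Category.assoc, linMap_mid,
      ev_congr (s.comp_val r p w t) rfl, ev_val_mid]
    exact s.next_congr rfl (by rw [Category.assoc, Category.assoc, e₁]) rfl _ _ _ _
  · intro Y t d h w₁ w₂
    rw [ev_map _ (t ≫ s.val r p w) _ (Category.assoc _ _ _).symm, Category.assoc, linMap_fst,
      ev_congr (s.comp_val r p w t) rfl, ← Category.assoc, ev_val_fst,
      ev_map g (t ≫ p) (t ≫ p ≫ (P.ext.toFunctor.map g).left) (Category.assoc _ _ _).symm]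
    refine congrArg (fun k => k ≫ g.left) (ev_congr rfl ?_)
    exact s.resp_congr rfl (by rw [Category.assoc, Category.assoc, e₁]) rfl _ _ _ _

/-- Strength of the transformation encoded by `s`. -/
lemma val_str (s : SimData P Q S) (B : C) (x : Over I) {Z : C} (b : Z ⟶ B) (r : Z ⟶ S.R)
    (p : Z ⟶ (P.ext.toFunctor.obj x).left) (w : p ≫ (P.ext.toFunctor.obj x).hom = r ≫ S.l) :
    actPair b (s.val r p w) ≫ (Q.ext.str B _).left ≫ (Q.ext.toFunctor.map (S.linear.str B x)).left =
      s.val r (actPair b p ≫ (P.ext.str B x).left) (by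
        rw [Category.assoc, Over.w, ← actLeft_hom, ← Category.assoc, actPair_proj, w]) := by
  have e₁ : (actPair b p ≫ (P.ext.str B x).left) ≫ P.shape _ = p ≫ P.shape x := by
    rw [Category.assoc, str_shape, ← Category.assoc, actPair_proj]
  have e₂ : ∀ {Y : C} (t : Y ⟶ Z), (t ≫ actPair b (s.val r p w)) ≫ (actProj B _).left =
      s.val (t ≫ r) (t ≫ p) (by rw [Category.assoc, w, Category.assoc]) := fun t => by
    rw [Category.assoc, actPair_proj, comp_val]
  apply eq_val
  · rw [Category.assoc, Category.assoc, map_shape, str_shape, ← Category.assoc, actPair_proj,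
      val_shape]
    exact s.act_congr rfl e₁.symm _ _
  · intro Y t d h w₁ w₂
    rw [ev_map (S.linear.str B x) (t ≫ actPair b (s.val r p w) ≫ (Q.ext.str B _).left) _
      (by simp only [Category.assoc]), Category.assoc, linStr_mid, ← Category.assoc,
      ev_str_proj B _ (t ≫ actPair b (s.val r p w)) _ (by simp only [Category.assoc]),
      ev_congr (e₂ t) rfl, ev_val_mid]
    exact s.next_congr rfl (by rw [Category.assoc, Category.assoc, e₁]) rfl _ _ _ _
  · intro Y t d h w₁ w₂
    have h₀ : d ≫ Q.d = (t ≫ actPair b (s.val r p w) ≫ (Q.ext.str B _).left) ≫ Q.shape _ := by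
      rw [h]; simp only [Category.assoc, map_shape]
    have h₁ : d ≫ Q.d = s.val (t ≫ r) (t ≫ p) (by rw [Category.assoc, w, Category.assoc]) ≫
        Q.shape _ := by
      rw [h₀, ← e₂ t]; simp only [Category.assoc, str_shape]
    rw [ev_map (S.linear.str B x) (t ≫ actPair b (s.val r p w) ≫ (Q.ext.str B _).left) _
      (by simp only [Category.assoc])]
    apply actLeft_ext
    · simp only [Category.assoc]
      rw [linStr_fst_fst, ev_str_fst B _ (t ≫ actPair b (s.val r p w)) _
        (by simp only [Category.assoc]),
        ev_str_fst B x (t ≫ actPair b p) _ (by simp only [Category.assoc])]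
      simp only [Category.assoc, actPair_fst]
    · simp only [Category.assoc]
      rw [linStr_fst_proj, ← Category.assoc,
        ev_str_proj B _ (t ≫ actPair b (s.val r p w)) _ (by simp only [Category.assoc]),
        ev_str_proj B x (t ≫ actPair b p) _ (by simp only [Category.assoc]),
        ev_congr (e₂ t) rfl, ev_val_fst]
      refine ev_congr (by rw [Category.assoc, actPair_proj]) ?_
      exact s.resp_congr rfl (by rw [Category.assoc, ← e₁]; simp only [Category.assoc]) rfl _ _ _ _

/-- The strong natural transformation `⟨S⟩⟦P⟧ ⟶ ⟦Q⟧⟨S⟩` encoded by `s`. -/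
def cell (s : SimData P Q S) : P.ext.comp S.linear ⟶ S.linear.comp Q.ext where
  app x := Over.homMk (U := S.linear.toFunctor.obj (P.ext.toFunctor.obj x))
    (V := Q.ext.toFunctor.obj (S.linear.toFunctor.obj x))
    (s.val (S.linMid _) (S.linFst _) (S.lin_condition _)) (by rw [val_hom, lin_hom])
  naturality {x y} g := by
    ext
    refine Eq.trans ?_ (s.val_map g (S.linMid _) (S.linFst _) (S.lin_condition _)).symm
    refine (s.comp_val _ _ (S.lin_condition _) _).trans ?_
    exact s.val_congr _ _ _ (linMap_mid _ _) (linMap_fst _ _)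
  strong B x := by
    ext
    have h := s.val_str B x (actFst B (S.linear.toFunctor.obj (P.ext.toFunctor.obj x)))
      ((actProj B _).left ≫ S.linMid _) ((actProj B _).left ≫ S.linFst _)
      (by rw [Category.assoc, lin_condition, Category.assoc])
    refine (Eq.trans ?_ h).trans ?_
    · refine congrArg (fun k => k ≫ (Q.ext.str B (S.linear.toFunctor.obj x)).left ≫
        (Q.ext.toFunctor.map (S.linear.str B x)).left) ?_
      apply actLeft_ext
      · exact (actMap_fst _ _).trans ((Category.comp_id _).trans (actPair_fst _ _).symm)
      · exact (actMap_left_proj _ _).trans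
          ((s.comp_val _ _ (S.lin_condition _) _).trans (actPair_proj _ _).symm)
    · refine Eq.trans ?_ (s.comp_val (S.linMid _) (S.linFst _) (S.lin_condition _) _).symm
      refine s.val_congr _ _ _ ?_ ?_
      · change _ = ((S.linear.str B _).left ≫ (S.linear.toFunctor.map (P.ext.str B x)).left) ≫ _
        rw [Category.assoc, linMap_mid, linStr_mid]
      · change _ = ((S.linear.str B _).left ≫ (S.linear.toFunctor.map (P.ext.str B x)).left) ≫ _
        rw [Category.assoc, linMap_fst, ← Category.assoc]
        refine congrArg (fun k => k ≫ (P.ext.str B x).left) ?_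
        apply actLeft_ext
        · rw [Category.assoc, linStr_fst_fst, actPair_fst]
        · rw [Category.assoc, linStr_fst_proj, actPair_proj]

lemma cell_realizes (s : SimData P Q S) : s.Realizes s.cell := by
  intro x Z r p w
  refine (s.comp_val _ _ (S.lin_condition _) _).trans ?_
  exact s.val_congr _ _ _ (linPair_mid _ _ _ _) (linPair_fst _ _ _ _)

end SimData

/-! ### Every cell between extensions is encoded by unique data -/

namespace PolyDiagram
variable {I J : C} {P : PolyDiagram I J} {Z : C}

/-- The slice of positions over the generalized shape `a`. -/
def posObj (a : Z ⟶ P.A) : Over I := Over.mk (pullback.fst P.d a ≫ P.n)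

/-- The underlying position. -/
def posFst (a : Z ⟶ P.A) : (posObj a).left ⟶ P.D := pullback.fst P.d a

/-- The underlying point of the stage. -/
def posSnd (a : Z ⟶ P.A) : (posObj a).left ⟶ Z := pullback.snd P.d a

lemma pos_condition (a : Z ⟶ P.A) : posFst a ≫ P.d = posSnd a ≫ a := pullback.condition

lemma pos_hom (a : Z ⟶ P.A) : posFst a ≫ P.n = (posObj a).hom := rfl

/-- Generalized elements of the slice of positions. -/
def posPair {a : Z ⟶ P.A} {Y : C} (δ : Y ⟶ P.D) (t : Y ⟶ Z) (w : δ ≫ P.d = t ≫ a) :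
    Y ⟶ (posObj a).left := pullback.lift δ t w

lemma posPair_fst {a : Z ⟶ P.A} {Y : C} (δ : Y ⟶ P.D) (t : Y ⟶ Z) (w : δ ≫ P.d = t ≫ a) :
    posPair δ t w ≫ posFst a = δ := pullback.lift_fst _ _ _

lemma posPair_snd {a : Z ⟶ P.A} {Y : C} (δ : Y ⟶ P.D) (t : Y ⟶ Z) (w : δ ≫ P.d = t ≫ a) :
    posPair δ t w ≫ posSnd a = t := pullback.lift_snd _ _ _

lemma pos_ext {a : Z ⟶ P.A} {Y : C} {u v : Y ⟶ (posObj a).left}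
    (h₁ : u ≫ posFst a = v ≫ posFst a) (h₂ : u ≫ posSnd a = v ≫ posSnd a) : u = v :=
  pullback.hom_ext h₁ h₂

/-- The generic generalized element of shape `a`, whose value at a position is that position.
Every element of shape `a` is its image under a unique morphism of slices, see `gen_classify`. -/
def gen (a : Z ⟶ P.A) : Z ⟶ (P.ext.toFunctor.obj (posObj a)).left :=
  elt a (fun t δ w => posPair δ t w) (fun t δ w => by rw [← pos_hom, ← Category.assoc, posPair_fst])

lemma gen_shape (a : Z ⟶ P.A) : gen a ≫ P.shape _ = a :=
  elt_shape _ _ (fun t δ w => by rw [← pos_hom, ← Category.assoc, posPair_fst])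

lemma ev_gen (a : Z ⟶ P.A) {Y : C} (t : Y ⟶ Z)
    (e : Y ⟶ (P.ext.toFunctor.obj (posObj a)).left) (he : e = t ≫ gen a)
    (δ : Y ⟶ P.D) (w : δ ≫ P.d = e ≫ P.shape _) :
    ev e δ w = posPair δ t (by rw [w, he, Category.assoc, gen_shape]) := by
  refine ev_elt _ _ (fun t δ w => by rw [← pos_hom, ← Category.assoc, posPair_fst]) ?_ t e he δ w
  intro X Y s t δ w
  apply pos_ext
  · rw [Category.assoc, posPair_fst, posPair_fst]
  · rw [Category.assoc, posPair_snd, posPair_snd]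

/-- The morphism of slices classifying a generalized element of `⟦P⟧(x)`. -/
def classify {x : Over I} (p : Z ⟶ (P.ext.toFunctor.obj x).left) (a : Z ⟶ P.A)
    (h : p ≫ P.shape x = a) : posObj a ⟶ x :=
  Over.homMk (ev (posSnd a ≫ p) (posFst a) (by rw [pos_condition, Category.assoc, h]))
    (by rw [ev_hom, pos_hom])

lemma posPair_classify {x : Over I} (p : Z ⟶ (P.ext.toFunctor.obj x).left) (a : Z ⟶ P.A)
    (h : p ≫ P.shape x = a) {Y : C} (δ : Y ⟶ P.D) (t : Y ⟶ Z) (w : δ ≫ P.d = t ≫ a) :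
    posPair δ t w ≫ (classify p a h).left = ev (t ≫ p) δ (by rw [w, Category.assoc, h]) := by
  refine (comp_ev _ _ _ _).trans (ev_congr ?_ (posPair_fst _ _ _))
  rw [← Category.assoc, posPair_snd]

lemma gen_classify {x : Over I} (p : Z ⟶ (P.ext.toFunctor.obj x).left) (a : Z ⟶ P.A)
    (h : p ≫ P.shape x = a) : gen a ≫ (P.ext.toFunctor.map (classify p a h)).left = p := by
  apply elt_ext
  · rw [Category.assoc, map_shape, gen_shape, h]
  · intro Y t δ w w'
    rw [ev_map (classify p a h) (t ≫ gen a) _ (Category.assoc _ _ _).symm, ev_gen a t _ rfl,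
      posPair_classify]

/-- Marking every position over `a` by the stage it lies over has the same effect on the generic
element as applying the strength to it. -/
lemma gen_str (a : Z ⟶ P.A) :
    gen a ≫ (P.ext.toFunctor.map (actLift (posSnd a) (𝟙 (posObj a)))).left =
      actPair (𝟙 Z) (gen a) ≫ (P.ext.str Z (posObj a)).left := by
  apply elt_ext
  · rw [Category.assoc, map_shape, Category.assoc, str_shape, ← Category.assoc (actPair _ _),
      actPair_proj]
  · intro Y t δ w w'
    rw [ev_map _ (t ≫ gen a) _ (Category.assoc _ _ _).symm, ev_gen a t _ rfl]
    apply LinSpan.actLeft_ext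
    · rw [ev_str_fst Z _ (t ≫ actPair (𝟙 Z) (gen a)) _ (Category.assoc _ _ _).symm,
        Category.assoc, actLift_fst, posPair_snd, Category.assoc, actPair_fst, Category.comp_id]
    · rw [ev_str_proj Z _ (t ≫ actPair (𝟙 Z) (gen a)) _ (Category.assoc _ _ _).symm,
        Category.assoc, ← Over.comp_left, actLift_proj, ev_gen a t]
      · rw [Over.id_left, Category.comp_id]
      · rw [Category.assoc, actPair_proj]

end PolyDiagram

namespace SimData
open PolyDiagram LinSpan

variable {I J : C} {P : PolyDiagram I I} {Q : PolyDiagram J J} {S : LinSpan I J}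

section ofCell
variable (ρ : P.ext.comp S.linear ⟶ S.linear.comp Q.ext) {Z : C}

lemma gen_cond {r : Z ⟶ S.R} {a : Z ⟶ P.A} (h : r ≫ S.l = a ≫ P.a) :
    gen a ≫ (P.ext.toFunctor.obj (posObj a)).hom = r ≫ S.l := by
  rw [← shape_a, ← Category.assoc, gen_shape, h]

/-- The image of the generic element under a cell. -/
def core (r : Z ⟶ S.R) (a : Z ⟶ P.A) (h : r ≫ S.l = a ≫ P.a) :
    Z ⟶ (Q.ext.toFunctor.obj (S.linear.toFunctor.obj (posObj a))).left :=
  linPair (gen a) r (gen_cond h) ≫ (cellApp ρ (posObj a)).left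

/-- By naturality a cell is determined by its values at generic elements. -/
lemma core_classify {x : Over I} (r : Z ⟶ S.R) (p : Z ⟶ (P.ext.toFunctor.obj x).left)
    (w : p ≫ (P.ext.toFunctor.obj x).hom = r ≫ S.l) (a : Z ⟶ P.A) (ha : p ≫ P.shape x = a)
    (h : r ≫ S.l = a ≫ P.a) :
    linPair p r w ≫ (cellApp ρ x).left = core ρ r a h ≫
      (Q.ext.toFunctor.map (S.linear.toFunctor.map (classify p a ha))).left := by
  rw [core, Category.assoc, ← Over.comp_left, ← cellApp_natural, Over.comp_left,
    ← Category.assoc]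
  congr 1
  apply lin_ext
  · rw [linPair_fst, Category.assoc, linMap_fst, ← Category.assoc, linPair_fst, gen_classify]
  · rw [linPair_mid, Category.assoc, linMap_mid, linPair_mid]

lemma core_str (r : Z ⟶ S.R) (a : Z ⟶ P.A) (h : r ≫ S.l = a ≫ P.a) :
    core ρ r a h ≫ (Q.ext.toFunctor.map (S.linear.toFunctor.map
      (actLift (posSnd a) (𝟙 (posObj a))))).left =
    (actPair (𝟙 Z) (core ρ r a h) ≫ (Q.ext.str Z _).left) ≫
      (Q.ext.toFunctor.map (S.linear.str Z (posObj a))).left := by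
  have e := congrArg (fun k => actPair (𝟙 Z) (linPair (gen a) r (gen_cond h)) ≫ k.left)
    (cellApp_strong ρ Z (posObj a))
  simp only [Over.comp_left] at e
  refine Eq.trans ?_ (e.symm.trans ?_)
  · rw [core, Category.assoc, ← Over.comp_left, ← cellApp_natural, Over.comp_left,
      ← Category.assoc, ← Category.assoc]
    congr 1
    apply lin_ext
    · rw [Category.assoc, linMap_fst, ← Category.assoc, linPair_fst, gen_str]
      simp only [Category.assoc]
      rw [linMap_fst, ← Category.assoc (S.linear.str _ _).left, ← Category.assoc]
      refine congrArg (fun k => k ≫ (P.ext.str _ _).left) ?_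
      apply actLeft_ext
      · rw [Category.assoc, Category.assoc, linStr_fst_fst, actPair_fst, actPair_fst]
      · rw [Category.assoc, Category.assoc, linStr_fst_proj, ← Category.assoc, actPair_proj,
          actPair_proj, linPair_fst]
    · simp only [Category.assoc]
      rw [linMap_mid, linPair_mid, linMap_mid, linStr_mid, ← Category.assoc, actPair_proj,
        linPair_mid]
  · rw [← Category.assoc, ← Category.assoc]
    refine congrArg (fun k => (k ≫ (Q.ext.str _ _).left) ≫ (Q.ext.toFunctor.map _).left) ?_
    apply actLeft_ext
    · rw [Category.assoc, actMap_fst, Category.comp_id, actPair_fst, actPair_fst]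
    · rw [Category.assoc, actMap_left_proj, ← Category.assoc, actPair_proj, actPair_proj, core]

/-- The positions of `P` produced by a cell from the generic element lie over the current stage.
Naturality alone does not give this: it is where the strength of the cell is used. -/
lemma core_stage (r : Z ⟶ S.R) (a : Z ⟶ P.A) (h : r ≫ S.l = a ≫ P.a) (d : Z ⟶ Q.D)
    (w : d ≫ Q.d = core ρ r a h ≫ Q.shape _) :
    (ev (core ρ r a h) d w ≫ S.linFst _) ≫ posSnd a = 𝟙 Z := by
  have w₁ : d ≫ Q.d = (core ρ r a h ≫ (Q.ext.toFunctor.map (S.linear.toFunctor.map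
      (actLift (posSnd a) (𝟙 (posObj a))))).left) ≫ Q.shape _ := by
    rw [w, Category.assoc, map_shape]
  have w₂ := w₁
  rw [core_str] at w₂
  have e := ev_congr (h := w₁) (core_str ρ r a h) rfl
  have e' := congrArg (fun k => k ≫ S.linFst _ ≫ actFst Z (posObj a)) e
  rw [ev_map _ (core ρ r a h) _ rfl, ev_map _ (actPair (𝟙 Z) (core ρ r a h) ≫ _) _ rfl] at e'
  simp only [Category.assoc] at e'
  rw [linStr_fst_fst, ev_str_fst Z _ (actPair (𝟙 Z) (core ρ r a h)) _ rfl, actPair_fst,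
    ← Category.assoc _ (S.linFst _), linMap_fst] at e'
  simp only [Category.assoc, actLift_fst] at e'
  rw [Category.assoc]
  exact e'

/-- Reindexing the image of the generic element. Both elements live over different slices of
positions, which are compared by a classifying morphism. -/
lemma comp_core {Y : C} (t : Y ⟶ Z) (r : Z ⟶ S.R) (a : Z ⟶ P.A) (h : r ≫ S.l = a ≫ P.a)
    (h' : (t ≫ r) ≫ S.l = (t ≫ a) ≫ P.a) :
    t ≫ core ρ r a h = core ρ (t ≫ r) (t ≫ a) h' ≫
      (Q.ext.toFunctor.map (S.linear.toFunctor.map (classify (t ≫ gen a) (t ≫ a)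
        (by rw [Category.assoc, gen_shape])))).left := by
  rw [← core_classify ρ (t ≫ r) (t ≫ gen a) (by rw [Category.assoc, gen_cond h, Category.assoc])]
  rw [core, ← Category.assoc]
  congr 1
  apply lin_ext
  · rw [Category.assoc, linPair_fst, linPair_fst]
  · rw [Category.assoc, linPair_mid, linPair_mid]

lemma classify_posFst {Y : C} (t : Y ⟶ Z) (a : Z ⟶ P.A) :
    (classify (t ≫ gen a) (t ≫ a) (by rw [Category.assoc, gen_shape])).left ≫ posFst a =
      posFst (t ≫ a) := by
  refine (congrArg (fun k => k ≫ posFst a)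
    (ev_gen a (posSnd (t ≫ a) ≫ t) _ (Category.assoc _ _ _).symm _ _)).trans ?_
  exact posPair_fst _ _ _

/-- The data encoding a given cell, read off from the images of the generic elements. -/
def ofCell : SimData P Q S where
  act r a h := core ρ r a h ≫ Q.shape _
  comp_act t r a h := by
    rw [← Category.assoc, comp_core ρ t r a h, Category.assoc, map_shape]
  act_a r a h := by
    rw [Category.assoc, shape_a, core, Category.assoc, Over.w, lin_hom, ← Category.assoc,
      linPair_mid]
  resp r a h d w := (ev (core ρ r a h) d w ≫ S.linFst _) ≫ posFst a
  comp_resp t r a h d w := by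
    have h' : (t ≫ r) ≫ S.l = (t ≫ a) ≫ P.a := by rw [Category.assoc, h, Category.assoc]
    rw [← Category.assoc, ← Category.assoc, comp_ev, ev_map _ _ _ (comp_core ρ t r a h h'),
      Category.assoc (ev _ _ _), linMap_fst]
    simp only [Category.assoc, classify_posFst]
  resp_d r a h d w := by
    rw [Category.assoc, pos_condition, ← Category.assoc, core_stage, Category.id_comp]
  next r a h d w := ev (core ρ r a h) d w ≫ S.linMid _
  comp_next t r a h d w := by
    have h' : (t ≫ r) ≫ S.l = (t ≫ a) ≫ P.a := by rw [Category.assoc, h, Category.assoc]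
    rw [← Category.assoc, comp_ev, ev_map _ _ _ (comp_core ρ t r a h h'), Category.assoc,
      linMap_mid]
  next_l r a h d w := by
    rw [Category.assoc, ← lin_condition, Category.assoc, pos_hom, Category.assoc]
  next_r r a h d w := by
    rw [Category.assoc, ← lin_hom, ev_hom]

/-- Every strong natural transformation `⟨S⟩⟦P⟧ ⟶ ⟦Q⟧⟨S⟩` is encoded by simulation data. -/
lemma ofCell_realizes : (ofCell ρ).Realizes ρ := by
  intro x Z r p w
  have e := core_classify ρ r p w _ rfl (shape_cond w)
  apply eq_val
  · rw [e, Category.assoc, map_shape]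
    rfl
  · intro Y t d h w₁ w₂
    have e' : t ≫ linPair p r w ≫ (cellApp ρ x).left =
        core ρ (t ≫ r) ((t ≫ p) ≫ P.shape x) w₁ ≫ (Q.ext.toFunctor.map (S.linear.toFunctor.map
          (classify (t ≫ p) _ rfl))).left := by
      rw [← core_classify ρ (t ≫ r) (t ≫ p) (by rw [Category.assoc, w, Category.assoc]),
        ← Category.assoc]
      congr 1
      apply lin_ext
      · rw [Category.assoc, linPair_fst, linPair_fst]
      · rw [Category.assoc, linPair_mid, linPair_mid]
    rw [ev_map _ _ _ e', Category.assoc, linMap_mid]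
    rfl
  · intro Y t d h w₁ w₂
    have e' : t ≫ linPair p r w ≫ (cellApp ρ x).left =
        core ρ (t ≫ r) ((t ≫ p) ≫ P.shape x) w₁ ≫ (Q.ext.toFunctor.map (S.linear.toFunctor.map
          (classify (t ≫ p) _ rfl))).left := by
      rw [← core_classify ρ (t ≫ r) (t ≫ p) (by rw [Category.assoc, w, Category.assoc]),
        ← Category.assoc]
      congr 1
      apply lin_ext
      · rw [Category.assoc, linPair_fst, linPair_fst]
      · rw [Category.assoc, linPair_mid, linPair_mid]
    rw [ev_map _ _ _ e', Category.assoc, linMap_fst, ← Category.assoc]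
    refine (comp_ev _ _ _ _).trans (ev_congr ?_ rfl)
    rw [← Category.assoc, core_stage, Category.id_comp]

end ofCell

end SimData

/-! ### Equivalence of simulations in terms of data -/

namespace LinSpan
variable {I J : C} {S S' S'' : LinSpan I J}

/-- The map of apexes underlying a strong natural transformation between linear functors. -/
def apexMap (ε : S.linear ⟶ S'.linear) : S.R ⟶ S'.R :=
  linPair (S := S) (x := Over.mk S.l) (𝟙 S.R) (𝟙 S.R) rfl ≫ (StrongNat.app ε (Over.mk S.l)).left ≫
    S'.linMid _

/-- The strength forces a strong natural transformation between linear functors to preserve the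
`x`-component of an element. -/
lemma app_generic_fst (ε : S.linear ⟶ S'.linear) {Z : C} (r : Z ⟶ S.R) :
    (linPair (S := S) (x := Over.mk (r ≫ S.l)) (𝟙 Z) r (Category.id_comp _) ≫
      (StrongNat.app ε (Over.mk (r ≫ S.l))).left) ≫ S'.linFst _ = 𝟙 Z := by
  set x : Over I := Over.mk (r ≫ S.l)
  set e : Z ⟶ (S.linear.toFunctor.obj x).left := linPair (𝟙 Z) r (Category.id_comp _)
  let k : x ⟶ act Z x := actLift (𝟙 Z) (𝟙 x)
  have h₁ : e ≫ (S.linear.toFunctor.map k).left = actPair (𝟙 Z) e ≫ (S.linear.str Z x).left := by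
    apply lin_ext
    · rw [Category.assoc, linMap_fst, ← Category.assoc, linPair_fst, Category.assoc]
      apply actLeft_ext
      · rw [Category.assoc, actLift_fst, Category.assoc, Category.assoc, linStr_fst_fst,
          actPair_fst, Category.id_comp]
      · rw [Category.assoc, ← Over.comp_left, actLift_proj, Category.assoc, Category.assoc,
          linStr_fst_proj, ← Category.assoc, actPair_proj, linPair_fst, Over.id_left]
        exact Category.id_comp _
    · rw [Category.assoc, linMap_mid, Category.assoc, linStr_mid, ← Category.assoc, actPair_proj]
  have h₂ := congrArg (fun m => actPair (𝟙 Z) e ≫ m.left) (StrongNat.strong ε Z x)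
  have h₃ := congrArg (fun m => e ≫ m.left) (StrongNat.naturality ε k)
  simp only [Over.comp_left] at h₂ h₃
  rw [← Category.assoc, h₁, Category.assoc, ← h₂] at h₃
  have h₄ := congrArg (fun m => m ≫ S'.linFst _ ≫ actFst Z x) h₃
  simp only [Category.assoc] at h₄
  rw [linStr_fst_fst, actMap_fst, Category.comp_id, actPair_fst,
    ← Category.assoc _ (S'.linFst _), linMap_fst, Category.assoc, actLift_fst] at h₄
  rw [Category.assoc, h₄]
  exact congrArg (fun m => e ≫ (StrongNat.app ε x).left ≫ m) (Category.comp_id _).symm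

/-- A strong natural transformation between linear functors acts on elements by its map of
apexes. -/
lemma app_eq (ε : S.linear ⟶ S'.linear) {x : Over I} {Z : C} (p : Z ⟶ x.left) (r : Z ⟶ S.R)
    (w : p ≫ x.hom = r ≫ S.l) : ∃ w', linPair p r w ≫ (StrongNat.app ε x).left =
      linPair (S := S') p (r ≫ apexMap ε) w' := by
  have key : ∀ (y : Over I) (g : Over.mk (r ≫ S.l) ⟶ y) (q : Z ⟶ y.left) (hq : g.left = q),
      linPair q r (by rw [← hq]; exact Over.w g) ≫ (StrongNat.app ε y).left =
        (linPair (x := Over.mk (r ≫ S.l)) (𝟙 Z) r (Category.id_comp _) ≫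
          (StrongNat.app ε (Over.mk (r ≫ S.l))).left) ≫ (S'.linear.toFunctor.map g).left := by
    intro y g q hq
    rw [Category.assoc, ← Over.comp_left, ← StrongNat.naturality, Over.comp_left, ← Category.assoc]
    congr 1
    apply lin_ext
    · rw [linPair_fst, Category.assoc, linMap_fst, ← Category.assoc, linPair_fst, ← hq]
      exact (Category.id_comp _).symm
    · rw [linPair_mid, Category.assoc, linMap_mid, linPair_mid]
  have h₁ : (linPair p r w ≫ (StrongNat.app ε x).left) ≫ S'.linFst x = p := by
    rw [key x (Over.homMk p w) p rfl, Category.assoc, linMap_fst, ← Category.assoc,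
      app_generic_fst]
    exact Category.id_comp _
  have h₂ : (linPair p r w ≫ (StrongNat.app ε x).left) ≫ S'.linMid x = r ≫ apexMap ε := by
    rw [key x (Over.homMk p w) p rfl, Category.assoc, linMap_mid]
    have h := congrArg (fun m => m ≫ S'.linMid _) (key (Over.mk S.l) (Over.homMk r rfl) r rfl)
    rw [Category.assoc _ (S'.linear.toFunctor.map _).left, linMap_mid] at h
    rw [← h, apexMap]
    simp only [← Category.assoc]
    congr 2
    apply lin_ext
    · rw [linPair_fst, Category.assoc, linPair_fst, Category.comp_id]
    · rw [linPair_mid, Category.assoc, linPair_mid, Category.comp_id]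
  refine ⟨?_, ?_⟩
  · rw [← h₁, ← h₂, Category.assoc, Category.assoc, lin_condition]
    simp only [Category.assoc]
  · apply lin_ext
    · exact h₁.trans (linPair_fst _ _ _ _).symm
    · exact h₂.trans (linPair_mid _ _ _ _).symm

lemma apexMap_l (ε : S.linear ⟶ S'.linear) : apexMap ε ≫ S'.l = S.l := by
  obtain ⟨w, -⟩ := app_eq ε (x := Over.mk S.l) (𝟙 S.R) (𝟙 S.R) rfl
  rw [Category.id_comp, Category.id_comp] at w
  exact w.symm

lemma apexMap_r (ε : S.linear ⟶ S'.linear) : apexMap ε ≫ S'.r = S.r := by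
  rw [apexMap, Category.assoc, Category.assoc, ← lin_hom, Over.w, lin_hom, ← Category.assoc,
    linPair_mid, Category.id_comp]

lemma apexMap_comp (ε : S.linear ⟶ S'.linear) (ε' : S'.linear ⟶ S''.linear) :
    apexMap (ε ≫ ε') = apexMap ε ≫ apexMap ε' := by
  obtain ⟨w, h⟩ := app_eq ε (x := Over.mk S.l) (𝟙 S.R) (𝟙 S.R) rfl
  obtain ⟨w', h'⟩ := app_eq ε' (x := Over.mk S.l) (𝟙 S.R) (𝟙 S.R ≫ apexMap ε) w
  rw [apexMap, StrongFunctor.comp_app, Over.comp_left, ← Category.assoc, ← Category.assoc, h, h',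
    linPair_mid, Category.id_comp]

lemma apexMap_id : apexMap (𝟙 S.linear) = 𝟙 S.R := by
  rw [apexMap, StrongFunctor.id_app, Over.id_left, Category.id_comp, linPair_mid]

/-- The isomorphism of apexes underlying a strong isomorphism of linear functors. -/
def apexIso (ε : S.linear ≅ S'.linear) : S.R ≅ S'.R where
  hom := apexMap ε.hom
  inv := apexMap ε.inv
  hom_inv_id := by rw [← apexMap_comp, ε.hom_inv_id, apexMap_id]
  inv_hom_id := by rw [← apexMap_comp, ε.inv_hom_id, apexMap_id]

/-- The action of a map of spans on elements of the linear functors. -/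
def linMapSpan (f : S.R ⟶ S'.R) (hl : f ≫ S'.l = S.l) (x : Over I) :
    (S.linear.toFunctor.obj x).left ⟶ (S'.linear.toFunctor.obj x).left :=
  linPair (S.linFst x) (S.linMid x ≫ f) (by rw [lin_condition, Category.assoc, hl])

/-- The strong natural transformation induced by a map of spans. -/
def linearMap (f : S.R ⟶ S'.R) (hl : f ≫ S'.l = S.l) (hr : f ≫ S'.r = S.r) :
    S.linear ⟶ S'.linear where
  app x := Over.homMk (linMapSpan f hl x) (by
    rw [lin_hom, linMapSpan, ← Category.assoc, linPair_mid, Category.assoc, hr, lin_hom])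
  naturality {x y} g := by
    ext
    change (S.linear.toFunctor.map g).left ≫ linMapSpan f hl y =
      linMapSpan f hl x ≫ (S'.linear.toFunctor.map g).left
    apply lin_ext
    · rw [Category.assoc, Category.assoc, linMap_fst, linMapSpan, linPair_fst, linMap_fst,
        linMapSpan, ← Category.assoc, linPair_fst]
    · rw [Category.assoc, Category.assoc, linMap_mid, linMapSpan, linPair_mid, ← Category.assoc,
        linMap_mid, linMapSpan, linPair_mid]
  strong B x := by
    ext
    let φ : S.linear.toFunctor.obj x ⟶ S'.linear.toFunctor.obj x :=
      Over.homMk (linMapSpan f hl x) (by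
        rw [lin_hom, linMapSpan, ← Category.assoc, linPair_mid, Category.assoc, hr, lin_hom])
    change (actMap (𝟙 B) φ).left ≫ (S'.linear.str B x).left =
      (S.linear.str B x).left ≫ linMapSpan f hl (act B x)
    have hφ : φ.left = linMapSpan f hl x := rfl
    apply lin_ext
    · apply actLeft_ext
      · simp only [Category.assoc]
        rw [linStr_fst_fst, actMap_fst, Category.comp_id, linMapSpan, ← Category.assoc (linPair _ _ _),
          linPair_fst, linStr_fst_fst]
      · simp only [Category.assoc]
        rw [linStr_fst_proj, ← Category.assoc, actMap_left_proj, Category.assoc, hφ, linMapSpan,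
          linPair_fst, linMapSpan, ← Category.assoc (linPair _ _ _), linPair_fst, linStr_fst_proj]
    · simp only [Category.assoc]
      rw [linStr_mid, ← Category.assoc, actMap_left_proj, Category.assoc, hφ, linMapSpan,
        linPair_mid, linMapSpan, linPair_mid, ← Category.assoc (S.linear.str _ _).left, linStr_mid,
        Category.assoc]

lemma linPair_linMapSpan (f : S.R ⟶ S'.R) (hl : f ≫ S'.l = S.l) {x : Over I} {Z : C}
    (p : Z ⟶ x.left) (r : Z ⟶ S.R) (w : p ≫ x.hom = r ≫ S.l) :
    linPair p r w ≫ linMapSpan f hl x =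
      linPair p (r ≫ f) (by rw [w, Category.assoc, hl]) := by
  apply lin_ext
  · rw [Category.assoc, linMapSpan, linPair_fst, linPair_fst, linPair_fst]
  · rw [Category.assoc, linMapSpan, linPair_mid, linPair_mid, ← Category.assoc, linPair_mid]

/-- The strong isomorphism induced by an isomorphism of spans. -/
def linearIso (f : S.R ≅ S'.R) (hl : f.hom ≫ S'.l = S.l) (hr : f.hom ≫ S'.r = S.r) :
    S.linear ≅ S'.linear where
  hom := linearMap f.hom hl hr
  inv := linearMap f.inv (by rw [← hl, f.inv_hom_id_assoc]) (by rw [← hr, f.inv_hom_id_assoc])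
  hom_inv_id := by
    ext x
    refine (linPair_linMapSpan f.inv (by rw [← hl, f.inv_hom_id_assoc]) _ _ _).trans ?_
    apply lin_ext
    · rw [linPair_fst]; exact (Category.id_comp _).symm
    · rw [linPair_mid, Category.assoc, f.hom_inv_id, Category.comp_id]
      exact (Category.id_comp _).symm
  inv_hom_id := by
    ext x
    refine (linPair_linMapSpan f.hom hl _ _ _).trans ?_
    apply lin_ext
    · rw [linPair_fst]; exact (Category.id_comp _).symm
    · rw [linPair_mid, Category.assoc, f.inv_hom_id, Category.comp_id]
      exact (Category.id_comp _).symm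

end LinSpan

namespace SimData
open PolyDiagram LinSpan

variable {I J : C} {P : PolyDiagram I I} {Q : PolyDiagram J J} {S S' : LinSpan I J}

/-- The simulation data `s` and `s'` correspond to each other along the map `f` of spans. -/
structure Along (f : S.R ⟶ S'.R) (s : SimData P Q S) (s' : SimData P Q S') : Prop where
  l : f ≫ S'.l = S.l
  r : f ≫ S'.r = S.r
  act : ∀ {Z : C} (r : Z ⟶ S.R) (a : Z ⟶ P.A) (h : r ≫ S.l = a ≫ P.a)
    (h' : (r ≫ f) ≫ S'.l = a ≫ P.a), s.act r a h = s'.act (r ≫ f) a h'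
  resp : ∀ {Z : C} (r : Z ⟶ S.R) (a : Z ⟶ P.A) (h : r ≫ S.l = a ≫ P.a)
    (h' : (r ≫ f) ≫ S'.l = a ≫ P.a) (d : Z ⟶ Q.D) (w : d ≫ Q.d = s.act r a h)
    (w' : d ≫ Q.d = s'.act (r ≫ f) a h'), s.resp r a h d w = s'.resp (r ≫ f) a h' d w'
  next : ∀ {Z : C} (r : Z ⟶ S.R) (a : Z ⟶ P.A) (h : r ≫ S.l = a ≫ P.a)
    (h' : (r ≫ f) ≫ S'.l = a ≫ P.a) (d : Z ⟶ Q.D) (w : d ≫ Q.d = s.act r a h)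
    (w' : d ≫ Q.d = s'.act (r ≫ f) a h'), s.next r a h d w ≫ f = s'.next (r ≫ f) a h' d w'

lemma cellEquiv_app {ρ : P.ext.comp S.linear ⟶ S.linear.comp Q.ext}
    {ρ' : P.ext.comp S'.linear ⟶ S'.linear.comp Q.ext} (ε : S.linear ≅ S'.linear)
    (h : ρ ≫ StrongFunctor.whiskerRight ε.hom Q.ext = StrongFunctor.whiskerLeft P.ext ε.hom ≫ ρ')
    (x : Over I) : cellApp ρ x ≫ Q.ext.toFunctor.map (StrongNat.app ε.hom x) =
      StrongNat.app ε.hom (P.ext.toFunctor.obj x) ≫ cellApp ρ' x :=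
  congrArg (fun k => StrongNat.app k x) h

/-- Transport of encoded transformations along a map of spans. -/
lemma Along.val {f : S.R ⟶ S'.R} {s : SimData P Q S} {s' : SimData P Q S'} (h : Along f s s')
    {x : Over I} (φ : S.linear.toFunctor.obj x ⟶ S'.linear.toFunctor.obj x)
    (hφ : φ.left = linMapSpan f h.l x) {Z : C} (r : Z ⟶ S.R)
    (p : Z ⟶ (P.ext.toFunctor.obj x).left) (w : p ≫ (P.ext.toFunctor.obj x).hom = r ≫ S.l) :
    s.val r p w ≫ (Q.ext.toFunctor.map φ).left =
      s'.val (r ≫ f) p (by rw [w, Category.assoc, h.l]) := by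
  have hl := h.l
  have hφ₁ : φ.left ≫ S'.linFst x = S.linFst x := by rw [hφ, linMapSpan, linPair_fst]
  have hφ₂ : φ.left ≫ S'.linMid x = S.linMid x ≫ f := by rw [hφ, linMapSpan, linPair_mid]
  apply eq_val
  · rw [Category.assoc, map_shape, val_shape]
    exact h.act _ _ _ _
  · intro Y t d h₀ w₁ w₂
    have w₃ : (t ≫ r) ≫ S.l = ((t ≫ p) ≫ P.shape x) ≫ P.a :=
      shape_cond (by rw [Category.assoc, w, Category.assoc])
    rw [ev_map φ (t ≫ s.val r p w) _ (Category.assoc _ _ _).symm, Category.assoc, hφ₂,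
      ← Category.assoc, ev_congr (s.comp_val r p w t) rfl, ev_val_mid]
    refine (h.next _ _ _ ?_ _ _ ?_).trans (s'.next_congr (Category.assoc _ _ _) rfl rfl _ _ _ _)
    · rw [← w₁]; simp only [Category.assoc]
    · rw [w₂]; exact s'.act_congr (Category.assoc _ _ _).symm rfl _ _
  · intro Y t d h₀ w₁ w₂
    rw [ev_map φ (t ≫ s.val r p w) _ (Category.assoc _ _ _).symm, Category.assoc, hφ₁,
      ev_congr (s.comp_val r p w t) rfl, ev_val_fst]
    refine ev_congr rfl ((h.resp _ _ _ ?_ _ _ ?_).trans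
      (s'.resp_congr (Category.assoc _ _ _) rfl rfl _ _ _ _))
    · rw [← w₁]; simp only [Category.assoc]
    · rw [w₂]; exact s'.act_congr (Category.assoc _ _ _).symm rfl _ _

/-- Data that correspond along an isomorphism of spans encode equivalent cells. -/
lemma Along.cellEquiv {f : S.R ≅ S'.R} {s : SimData P Q S} {s' : SimData P Q S'}
    (h : Along f.hom s s') : CellEquiv s.cell s'.cell := by
  refine CellEquiv.of_app (linearIso f h.l h.r) fun x => ?_
  ext
  refine (h.val (StrongNat.app (linearIso f h.l h.r).hom x) rfl _ _ (S.lin_condition _)).trans ?_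
  refine Eq.trans ?_ (s'.comp_val _ _ (S'.lin_condition _) _).symm
  refine s'.val_congr _ _ _ ?_ ?_
  · exact (linPair_mid _ _ _ _).symm
  · exact (linPair_fst _ _ _ _).symm

/-- Data that encode equivalent cells correspond to each other along an isomorphism of spans. The
values of the data are recovered from the cells by evaluation at generic elements. -/
lemma along_of_cellEquiv {ρ : P.ext.comp S.linear ⟶ S.linear.comp Q.ext}
    {ρ' : P.ext.comp S'.linear ⟶ S'.linear.comp Q.ext} {s : SimData P Q S} {s' : SimData P Q S'}
    (hs : s.Realizes ρ) (hs' : s'.Realizes ρ') (h : CellEquiv ρ ρ') :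
    ∃ f : S.R ≅ S'.R, Along f.hom s s' := by
  obtain ⟨ε, h⟩ := h
  set f := apexIso ε
  have hl : f.hom ≫ S'.l = S.l := apexMap_l ε.hom
  have hε : ∀ {x : Over I} {Z : C} (p : Z ⟶ x.left) (r : Z ⟶ S.R) (w : p ≫ x.hom = r ≫ S.l),
      linPair p r w ≫ (StrongNat.app ε.hom x).left =
        linPair p (r ≫ f.hom) (by rw [w, Category.assoc, hl]) := by
    intro x Z p r w
    obtain ⟨w', e⟩ := app_eq ε.hom p r w
    exact e
  have hε₁ : ∀ x : Over I, (StrongNat.app ε.hom x).left ≫ S'.linFst x = S.linFst x := by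
    intro x
    have e := hε (x := x) (S.linFst x) (S.linMid x) (S.lin_condition x)
    rw [show linPair (S.linFst x) (S.linMid x) (S.lin_condition x) = 𝟙 _ from
      lin_ext (by rw [linPair_fst, Category.id_comp]) (by rw [linPair_mid, Category.id_comp]),
      Category.id_comp] at e
    rw [e, linPair_fst]
  have hε₂ : ∀ x : Over I, (StrongNat.app ε.hom x).left ≫ S'.linMid x = S.linMid x ≫ f.hom := by
    intro x
    have e := hε (x := x) (S.linFst x) (S.linMid x) (S.lin_condition x)
    rw [show linPair (S.linFst x) (S.linMid x) (S.lin_condition x) = 𝟙 _ from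
      lin_ext (by rw [linPair_fst, Category.id_comp]) (by rw [linPair_mid, Category.id_comp]),
      Category.id_comp] at e
    rw [e, linPair_mid]
  have key : ∀ {Z : C} (r : Z ⟶ S.R) (a : Z ⟶ P.A) (h : r ≫ S.l = a ≫ P.a)
      (h' : (r ≫ f.hom) ≫ S'.l = a ≫ P.a),
      s.val r (gen a) (gen_cond h) ≫
        (Q.ext.toFunctor.map (StrongNat.app ε.hom (posObj a))).left =
        s'.val (r ≫ f.hom) (gen a) (gen_cond h') := by
    intro Z r a h₁ h₂
    rw [← hs, ← hs', Category.assoc, ← Over.comp_left, cellEquiv_app ε h, Over.comp_left,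
      ← Category.assoc, hε]
  have hact : ∀ {Z : C} (r : Z ⟶ S.R) (a : Z ⟶ P.A) (h : r ≫ S.l = a ≫ P.a)
      (h' : (r ≫ f.hom) ≫ S'.l = a ≫ P.a), s.act r a h = s'.act (r ≫ f.hom) a h' := by
    intro Z r a h h'
    have e := congrArg (fun k => k ≫ Q.shape _) (key r a h h')
    simp only [Category.assoc] at e
    rw [map_shape, val_shape, val_shape] at e
    refine (s.act_congr rfl (gen_shape a).symm _ _).trans
      (e.trans (s'.act_congr rfl (gen_shape a) _ _))
  have hw : ∀ {Z : C} (r : Z ⟶ S.R) (a : Z ⟶ P.A) (h : r ≫ S.l = a ≫ P.a)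
      (d : Z ⟶ Q.D), d ≫ Q.d = s.act r a h →
      d ≫ Q.d = s.val r (gen a) (gen_cond h) ≫ Q.shape _ := by
    intro Z r a h d w
    rw [w, val_shape]
    exact s.act_congr rfl (gen_shape a).symm _ _
  have hev : ∀ {Z : C} (r : Z ⟶ S.R) (a : Z ⟶ P.A) (h : r ≫ S.l = a ≫ P.a)
      (h' : (r ≫ f.hom) ≫ S'.l = a ≫ P.a) (d : Z ⟶ Q.D)
      (w : d ≫ Q.d = s.val r (gen a) (gen_cond h) ≫ Q.shape _)
      (w' : d ≫ Q.d = s'.val (r ≫ f.hom) (gen a) (gen_cond h') ≫ Q.shape _),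
      ev (s.val r (gen a) (gen_cond h)) d w ≫ (StrongNat.app ε.hom (posObj a)).left =
        ev (s'.val (r ≫ f.hom) (gen a) (gen_cond h')) d w' := by
    intro Z r a h h' d w w'
    exact (ev_map _ _ _ (key r a h h').symm _ _).symm
  refine ⟨f, hl, apexMap_r ε.hom, hact, ?_, ?_⟩
  · intro Z r a h h' d w w'
    have w₁ := hw r a h d w
    have w₂ : d ≫ Q.d = s'.val (r ≫ f.hom) (gen a) (gen_cond h') ≫ Q.shape _ := by
      rw [w', val_shape]; exact s'.act_congr rfl (gen_shape a).symm _ _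
    have e := congrArg (fun k => (k ≫ S'.linFst _) ≫ posFst a) (hev r a h h' d w₁ w₂)
    rw [Category.assoc (ev _ _ _), hε₁, ev_val_fst, ev_val_fst,
      ev_gen a (𝟙 Z) _ (Category.id_comp _).symm, ev_gen a (𝟙 Z) _ (Category.id_comp _).symm,
      posPair_fst, posPair_fst] at e
    refine (s.resp_congr rfl (gen_shape a).symm rfl _ _ _ _).trans
      (e.trans (s'.resp_congr rfl (gen_shape a) rfl _ _ _ _))
  · intro Z r a h h' d w w'
    have w₁ := hw r a h d w
    have w₂ : d ≫ Q.d = s'.val (r ≫ f.hom) (gen a) (gen_cond h') ≫ Q.shape _ := by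
      rw [w', val_shape]; exact s'.act_congr rfl (gen_shape a).symm _ _
    have e := congrArg (fun k => k ≫ S'.linMid _) (hev r a h h' d w₁ w₂)
    rw [Category.assoc (ev _ _ _), hε₂, ← Category.assoc, ev_val_mid, ev_val_mid] at e
    refine (congrArg (fun k => k ≫ f.hom) (s.next_congr rfl (gen_shape a).symm rfl _ _ _ _)).trans
      (e.trans (s'.next_congr rfl (gen_shape a) rfl _ _ _ _))

end SimData

/-! ### Composition and identities of simulation data -/

namespace SimData
open PolyDiagram LinSpan

section comp
variable {I J K : C} {P : PolyDiagram I I} {Q : PolyDiagram J J} {N : PolyDiagram K K}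
  {S : LinSpan I J} {T : LinSpan J K}

lemma comp_fst_cond {Z : C} {r : Z ⟶ (S.comp T).R} {a : Z ⟶ P.A}
    (h : r ≫ (S.comp T).l = a ≫ P.a) : (r ≫ S.compFst T) ≫ S.l = a ≫ P.a := by
  rw [← h, comp_l, Category.assoc]

section
variable (s : SimData P Q S) (t : SimData Q N T)

/-- The intermediate action of a composite simulation. -/
def midAct {Z : C} (r : Z ⟶ (S.comp T).R) (a : Z ⟶ P.A) (h : r ≫ (S.comp T).l = a ≫ P.a) :
    Z ⟶ Q.A := s.act (r ≫ S.compFst T) a (comp_fst_cond h)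

lemma comp_midAct {Y Z : C} (y : Y ⟶ Z) (r : Z ⟶ (S.comp T).R) (a : Z ⟶ P.A)
    (h : r ≫ (S.comp T).l = a ≫ P.a) (h' : (y ≫ r) ≫ (S.comp T).l = (y ≫ a) ≫ P.a) :
    y ≫ s.midAct r a h = s.midAct (y ≫ r) (y ≫ a) h' := by
  rw [midAct, midAct, comp_act]
  exact s.act_congr (Category.assoc _ _ _).symm rfl _ _

lemma mid_cond {Z : C} (r : Z ⟶ (S.comp T).R) (a : Z ⟶ P.A)
    (h : r ≫ (S.comp T).l = a ≫ P.a) : (r ≫ S.compSnd T) ≫ T.l = s.midAct r a h ≫ Q.a := by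
  rw [midAct, act_a, Category.assoc, Category.assoc, comp_condition]

/-- The intermediate response of a composite simulation. -/
def midResp {Z : C} (r : Z ⟶ (S.comp T).R) (a : Z ⟶ P.A) (h : r ≫ (S.comp T).l = a ≫ P.a)
    (d : Z ⟶ N.D) (w : d ≫ N.d = t.act (r ≫ S.compSnd T) (s.midAct r a h) (s.mid_cond r a h)) :
    Z ⟶ Q.D := t.resp (r ≫ S.compSnd T) (s.midAct r a h) (s.mid_cond r a h) d w

lemma midResp_d {Z : C} (r : Z ⟶ (S.comp T).R) (a : Z ⟶ P.A) (h : r ≫ (S.comp T).l = a ≫ P.a)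
    (d : Z ⟶ N.D) (w : d ≫ N.d = t.act (r ≫ S.compSnd T) (s.midAct r a h) (s.mid_cond r a h)) :
    s.midResp t r a h d w ≫ Q.d = s.act (r ≫ S.compFst T) a (comp_fst_cond h) :=
  t.resp_d _ _ _ _ _

lemma comp_midResp {Y Z : C} (y : Y ⟶ Z) (r : Z ⟶ (S.comp T).R) (a : Z ⟶ P.A)
    (h : r ≫ (S.comp T).l = a ≫ P.a) (h' : (y ≫ r) ≫ (S.comp T).l = (y ≫ a) ≫ P.a)
    (d : Z ⟶ N.D) (w : d ≫ N.d = t.act (r ≫ S.compSnd T) (s.midAct r a h) (s.mid_cond r a h))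
    (w' : (y ≫ d) ≫ N.d = t.act ((y ≫ r) ≫ S.compSnd T) (s.midAct (y ≫ r) (y ≫ a) h')
      (s.mid_cond (y ≫ r) (y ≫ a) h')) :
    y ≫ s.midResp t r a h d w = s.midResp t (y ≫ r) (y ≫ a) h' (y ≫ d) w' := by
  rw [midResp, midResp, comp_resp]
  exact t.resp_congr (Category.assoc _ _ _).symm (s.comp_midAct y r a h h') rfl _ _ _ _

lemma resp_comp_aux {Y Z : C} (y : Y ⟶ Z) (r : Z ⟶ (S.comp T).R) (a : Z ⟶ P.A)
    (h : r ≫ (S.comp T).l = a ≫ P.a) (h' : (y ≫ r) ≫ (S.comp T).l = (y ≫ a) ≫ P.a)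
    (d : Z ⟶ N.D) (w : d ≫ N.d = t.act (r ≫ S.compSnd T) (s.midAct r a h) (s.mid_cond r a h))
    (w' : (y ≫ d) ≫ N.d = t.act ((y ≫ r) ≫ S.compSnd T) (s.midAct (y ≫ r) (y ≫ a) h')
      (s.mid_cond (y ≫ r) (y ≫ a) h')) :
    y ≫ s.resp (r ≫ S.compFst T) a (comp_fst_cond h) (s.midResp t r a h d w)
        (s.midResp_d t r a h d w) =
      s.resp ((y ≫ r) ≫ S.compFst T) (y ≫ a) (comp_fst_cond h')
        (s.midResp t (y ≫ r) (y ≫ a) h' (y ≫ d) w')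
        (s.midResp_d t (y ≫ r) (y ≫ a) h' (y ≫ d) w') := by
  have e := s.comp_midResp t y r a h h' d w w'
  have e' := (Category.assoc y r (S.compFst T)).symm
  rw [comp_resp]
  exact s.resp_congr e' rfl e _ _ _ _

lemma next_comp_aux {Y Z : C} (y : Y ⟶ Z) (r : Z ⟶ (S.comp T).R) (a : Z ⟶ P.A)
    (h : r ≫ (S.comp T).l = a ≫ P.a) (h' : (y ≫ r) ≫ (S.comp T).l = (y ≫ a) ≫ P.a)
    (d : Z ⟶ N.D) (w : d ≫ N.d = t.act (r ≫ S.compSnd T) (s.midAct r a h) (s.mid_cond r a h))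
    (w' : (y ≫ d) ≫ N.d = t.act ((y ≫ r) ≫ S.compSnd T) (s.midAct (y ≫ r) (y ≫ a) h')
      (s.mid_cond (y ≫ r) (y ≫ a) h')) :
    y ≫ s.next (r ≫ S.compFst T) a (comp_fst_cond h) (s.midResp t r a h d w)
        (s.midResp_d t r a h d w) =
      s.next ((y ≫ r) ≫ S.compFst T) (y ≫ a) (comp_fst_cond h')
        (s.midResp t (y ≫ r) (y ≫ a) h' (y ≫ d) w')
        (s.midResp_d t (y ≫ r) (y ≫ a) h' (y ≫ d) w') := by
  have e := s.comp_midResp t y r a h h' d w w'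
  have e' := (Category.assoc y r (S.compFst T)).symm
  rw [comp_next]
  exact s.next_congr e' rfl e _ _ _ _

lemma next_cond {Z : C} (r : Z ⟶ (S.comp T).R) (a : Z ⟶ P.A) (h : r ≫ (S.comp T).l = a ≫ P.a)
    (d : Z ⟶ N.D) (w : d ≫ N.d = t.act (r ≫ S.compSnd T) (s.midAct r a h) (s.mid_cond r a h)) :
    s.next (r ≫ S.compFst T) a (comp_fst_cond h) (s.midResp t r a h d w)
        (s.midResp_d t r a h d w) ≫ S.r =
      t.next (r ≫ S.compSnd T) (s.midAct r a h) (s.mid_cond r a h) d w ≫ T.l := by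
  rw [next_r, midResp, next_l]

/-- Composition of simulation data: actions are translated forward through `s` and `t`, responses
backward through `t` and `s`. -/
def comp : SimData P N (S.comp T) where
  act r a h := t.act (r ≫ S.compSnd T) (s.midAct r a h) (s.mid_cond r a h)
  comp_act y r a h := by
    rw [comp_act]
    exact t.act_congr (Category.assoc _ _ _).symm (s.comp_midAct y r a h _) _ _
  act_a r a h := by rw [act_a, comp_r, Category.assoc]
  resp r a h d w := s.resp (r ≫ S.compFst T) a (comp_fst_cond h) (s.midResp t r a h d w)
    (s.midResp_d t r a h d w)
  comp_resp y r a h d w := s.resp_comp_aux t y r a h _ d w _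
  resp_d r a h d w := s.resp_d _ _ _ _ _
  next r a h d w := compPair
    (s.next (r ≫ S.compFst T) a (comp_fst_cond h) (s.midResp t r a h d w) (s.midResp_d t r a h d w))
    (t.next (r ≫ S.compSnd T) (s.midAct r a h) (s.mid_cond r a h) d w)
    (s.next_cond t r a h d w)
  comp_next y r a h d w := by
    apply comp_ext
    · rw [Category.assoc, compPair_fst, compPair_fst]
      exact s.next_comp_aux t y r a h _ d w _
    · rw [Category.assoc, compPair_snd, compPair_snd, comp_next]
      exact t.next_congr (Category.assoc _ _ _).symm (s.comp_midAct y r a h _) rfl _ _ _ _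
  next_l r a h d w := by rw [comp_l, ← Category.assoc, compPair_fst, next_l]
  next_r r a h d w := by rw [comp_r, ← Category.assoc, compPair_snd, next_r]

end

section valVal
variable (s : SimData P Q S) (t : SimData Q N T) {x : Over I} {Z : C} {r₁ : Z ⟶ S.R} {r₂ : Z ⟶ T.R}
  {p : Z ⟶ (P.ext.toFunctor.obj x).left} (w₁ : p ≫ (P.ext.toFunctor.obj x).hom = r₁ ≫ S.l)
  {q : Z ⟶ (Q.ext.toFunctor.obj (S.linear.toFunctor.obj x)).left} (hq : q = s.val r₁ p w₁)
  (w₂ : q ≫ (Q.ext.toFunctor.obj (S.linear.toFunctor.obj x)).hom = r₂ ≫ T.l)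
  {d : Z ⟶ N.D} (h : d ≫ N.d = t.val r₂ q w₂ ≫ N.shape _)
  (c₂ : r₂ ≫ T.l = s.act r₁ (p ≫ P.shape x) (shape_cond w₁) ≫ Q.a)
  (hd : d ≫ N.d = t.act r₂ (s.act r₁ (p ≫ P.shape x) (shape_cond w₁)) c₂)
include hq

lemma ev_val_val_mid : ev (t.val r₂ q w₂) d h ≫ T.linMid _ =
    t.next r₂ (s.act r₁ (p ≫ P.shape x) (shape_cond w₁)) c₂ d hd := by
  rw [ev_val_mid]
  exact t.next_congr rfl (by rw [hq, val_shape]) rfl _ _ _ _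

lemma ev_val_val_fst_mid : ev (t.val r₂ q w₂) d h ≫ T.linFst _ ≫ S.linMid x =
    s.next r₁ (p ≫ P.shape x) (shape_cond w₁)
      (t.resp r₂ (s.act r₁ (p ≫ P.shape x) (shape_cond w₁)) c₂ d hd) (t.resp_d _ _ _ _ _) := by
  have e : q ≫ Q.shape _ = s.act r₁ (p ≫ P.shape x) (shape_cond w₁) := by rw [hq, val_shape]
  subst hq
  rw [← Category.assoc, ev_val_fst, ev_val_mid]
  exact s.next_congr rfl rfl (t.resp_congr rfl e rfl _ _ _ _) _ _ _ _

lemma ev_val_val_fst_fst : ev (t.val r₂ q w₂) d h ≫ T.linFst _ ≫ S.linFst x =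
    ev p (s.resp r₁ (p ≫ P.shape x) (shape_cond w₁)
      (t.resp r₂ (s.act r₁ (p ≫ P.shape x) (shape_cond w₁)) c₂ d hd) (t.resp_d _ _ _ _ _))
        (s.resp_d _ _ _ _ _) := by
  have e : q ≫ Q.shape _ = s.act r₁ (p ≫ P.shape x) (shape_cond w₁) := by rw [hq, val_shape]
  subst hq
  rw [← Category.assoc, ev_val_fst, ev_val_fst]
  exact ev_congr rfl (s.resp_congr rfl rfl (t.resp_congr rfl e rfl _ _ _ _) _ _ _ _)

end valVal

/-- Composition of data encodes the pasting of cells. -/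
lemma comp_realizes (s : SimData P Q S) (t : SimData Q N T) :
    (s.comp t).Realizes (transportCell (S.linearComp T) (pasteCell s.cell t.cell)) := by
  intro x Z r p w
  have w₁ : p ≫ (P.ext.toFunctor.obj x).hom = (r ≫ S.compFst T) ≫ S.l := by
    rw [w, comp_l, Category.assoc]
  have w₂ : s.val (r ≫ S.compFst T) p w₁ ≫
      (Q.ext.toFunctor.obj (S.linear.toFunctor.obj x)).hom = (r ≫ S.compSnd T) ≫ T.l := by
    rw [val_hom, Category.assoc, Category.assoc, comp_condition]
  have e₀ : cellApp (transportCell (S.linearComp T) (pasteCell s.cell t.cell)) x =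
      S.compHom T (P.ext.toFunctor.obj x) ≫ T.linear.toFunctor.map (cellApp s.cell x) ≫
        cellApp t.cell (S.linear.toFunctor.obj x) ≫
          N.ext.toFunctor.map (StrongNat.app (S.linearComp T).inv x) := by
    refine (congrArg (fun k => StrongNat.app (S.linearComp T).hom (P.ext.toFunctor.obj x) ≫
      k ≫ N.ext.toFunctor.map (StrongNat.app (S.linearComp T).inv x))
      (CellEquiv.pasteCell_app s.cell t.cell x)).trans ?_
    exact congrArg _ (Category.assoc _ _ _)
  have e₁ : linPair p r w ≫ (S.compHom T (P.ext.toFunctor.obj x)).left =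
      linPair (linPair p (r ≫ S.compFst T) w₁) (r ≫ S.compSnd T) (by
        rw [lin_hom, ← Category.assoc, linPair_mid, Category.assoc, Category.assoc,
          comp_condition]) := by
    rw [compHom_left]
    apply compTarget_ext
    · rw [Category.assoc, compTo_fst_fst, linPair_fst, ← Category.assoc, linPair_fst, linPair_fst]
    · rw [Category.assoc, compTo_fst_mid, ← Category.assoc, linPair_mid, ← Category.assoc,
        linPair_fst, linPair_mid]
    · rw [Category.assoc, compTo_mid, ← Category.assoc, linPair_mid, linPair_mid]
  have e₂ : linPair (linPair p (r ≫ S.compFst T) w₁) (r ≫ S.compSnd T) (by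
        rw [lin_hom, ← Category.assoc, linPair_mid, Category.assoc, Category.assoc,
          comp_condition]) ≫ (T.linear.toFunctor.map (cellApp s.cell x)).left =
      linPair (s.val (r ≫ S.compFst T) p w₁) (r ≫ S.compSnd T) w₂ := by
    apply lin_ext
    · rw [Category.assoc, linMap_fst, ← Category.assoc, linPair_fst, linPair_fst,
        s.cell_realizes]
    · rw [Category.assoc, linMap_mid, linPair_mid, linPair_mid]
  have hinv : (StrongNat.app (S.linearComp T).inv x).left = S.compFrom T x := rfl
  rw [e₀, Over.comp_left, Over.comp_left, Over.comp_left, ← Category.assoc, e₁, ← Category.assoc,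
    e₂, ← Category.assoc, t.cell_realizes]
  set q := s.val (r ≫ S.compFst T) p w₁ with hq
  apply eq_val
  · rw [Category.assoc, map_shape, val_shape]
    exact t.act_congr rfl (s.val_shape _ _ _) _ _
  all_goals
    intro Y y d h w₃ w₄
    have w₁' : (y ≫ p) ≫ (P.ext.toFunctor.obj x).hom = ((y ≫ r) ≫ S.compFst T) ≫ S.l := by
      rw [Category.assoc, w₁]; simp only [Category.assoc]
    have hq' : y ≫ q = s.val ((y ≫ r) ≫ S.compFst T) (y ≫ p) w₁' := by
      rw [hq, comp_val]
      exact s.val_congr _ _ _ (Category.assoc _ _ _).symm rfl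
    have w₂' : (y ≫ q) ≫ (Q.ext.toFunctor.obj (S.linear.toFunctor.obj x)).hom =
        ((y ≫ r) ≫ S.compSnd T) ≫ T.l := by
      rw [Category.assoc, w₂]; simp only [Category.assoc]
    have et : y ≫ t.val (r ≫ S.compSnd T) q w₂ = t.val ((y ≫ r) ≫ S.compSnd T) (y ≫ q) w₂' := by
      rw [comp_val]
      exact t.val_congr _ _ _ (Category.assoc _ _ _).symm rfl
    have h₀ : d ≫ N.d = t.val ((y ≫ r) ≫ S.compSnd T) (y ≫ q) w₂' ≫ N.shape _ := by
      rw [← et, h, Category.assoc, Category.assoc, map_shape]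
      exact (Category.assoc _ _ _).symm
    rw [ev_map _ (t.val ((y ≫ r) ≫ S.compSnd T) (y ≫ q) w₂') _
      (by rw [← et]; exact (Category.assoc _ _ _).symm), hinv]
  · apply comp_ext
    · refine Eq.trans ?_ (compPair_fst _ _ _ _ _).symm
      rw [Category.assoc, Category.assoc, compFrom_mid_fst]
      exact s.ev_val_val_fst_mid t w₁' hq' w₂' h₀ _ _
    · refine Eq.trans ?_ (compPair_snd _ _ _ _ _).symm
      rw [Category.assoc, Category.assoc, compFrom_mid_snd]
      exact s.ev_val_val_mid t w₁' hq' w₂' h₀ _ _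
  · rw [Category.assoc, compFrom_fst]
    exact s.ev_val_val_fst_fst t w₁' hq' w₂' h₀ _ _

end comp

end SimData

/-- An isomorphism between polynomial endodiagrams on possibly different bases. -/
structure PolyIso {I J : C} (P : PolyDiagram I I) (Q : PolyDiagram J J) where
  base : I ≅ J
  D : P.D ≅ Q.D
  A : P.A ≅ Q.A
  n : D.hom ≫ Q.n = P.n ≫ base.hom
  d : D.hom ≫ Q.d = P.d ≫ A.hom
  a : A.hom ≫ Q.a = P.a ≫ base.hom

namespace PolyIso
variable {I J K : C} {P : PolyDiagram I I} {Q : PolyDiagram J J} {N : PolyDiagram K K}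

lemma n_inv (e : PolyIso P Q) : e.D.inv ≫ P.n = Q.n ≫ e.base.inv := by
  rw [Iso.inv_comp_eq, ← Category.assoc, e.n, Category.assoc, e.base.hom_inv_id, Category.comp_id]

lemma d_inv (e : PolyIso P Q) : e.D.inv ≫ P.d = Q.d ≫ e.A.inv := by
  rw [Iso.inv_comp_eq, ← Category.assoc, e.d, Category.assoc, e.A.hom_inv_id, Category.comp_id]

lemma a_inv (e : PolyIso P Q) : e.A.inv ≫ P.a = Q.a ≫ e.base.inv := by
  rw [Iso.inv_comp_eq, ← Category.assoc, e.a, Category.assoc, e.base.hom_inv_id, Category.comp_id]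

/-- The identity isomorphism. -/
@[simps] def refl (P : PolyDiagram I I) : PolyIso P P where
  base := Iso.refl _
  D := Iso.refl _
  A := Iso.refl _
  n := by simp
  d := by simp
  a := by simp

/-- The inverse isomorphism. -/
@[simps] def symm (e : PolyIso P Q) : PolyIso Q P where
  base := e.base.symm
  D := e.D.symm
  A := e.A.symm
  n := e.n_inv
  d := e.d_inv
  a := e.a_inv

/-- Composition of isomorphisms. -/
@[simps] def trans (e : PolyIso P Q) (e' : PolyIso Q N) : PolyIso P N where
  base := e.base ≪≫ e'.base
  D := e.D ≪≫ e'.D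
  A := e.A ≪≫ e'.A
  n := by simp [e'.n, reassoc_of% e.n]
  d := by simp [e'.d, reassoc_of% e.d]
  a := by simp [e'.a, reassoc_of% e.a]

/-- The span given by the graph of the isomorphism of bases. -/
def graphSpan (e : PolyIso P Q) : LinSpan I J := ⟨I, 𝟙 I, e.base.hom⟩

/-- The simulation given by the graph of an isomorphism of diagrams. -/
def graph (e : PolyIso P Q) : SimData P Q e.graphSpan where
  act r a h := a ≫ e.A.hom
  comp_act t r a h := (Category.assoc _ _ _).symm
  act_a r a h := by
    rw [Category.assoc, e.a, ← Category.assoc, ← h, Category.assoc]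
    exact congrArg _ (Category.id_comp _)
  resp r a h d w := d ≫ e.D.inv
  comp_resp t r a h d w := (Category.assoc _ _ _).symm
  resp_d r a h d w := by
    rw [Category.assoc, e.d_inv, ← Category.assoc, w, Category.assoc, e.A.hom_inv_id,
      Category.comp_id]
  next r a h d w := d ≫ Q.n ≫ e.base.inv
  comp_next t r a h d w := (Category.assoc _ _ _).symm
  next_l r a h d w := by
    rw [Category.assoc d e.D.inv, e.n_inv]
    exact Category.comp_id _
  next_r r a h d w := by
    change (d ≫ Q.n ≫ e.base.inv) ≫ e.base.hom = _
    simp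

open PolyDiagram LinSpan in
/-- The graph of the identity encodes the identity simulation. -/
lemma refl_realizes (P : PolyDiagram I I) : (refl P).graph.Realizes
    (transportCell (LinSpan.linearId I) (idCell P.ext)) := by
  intro x Z r p w
  have e₀ : cellApp (transportCell (LinSpan.linearId I) (idCell P.ext)) x =
      LinSpan.idHom (P.ext.toFunctor.obj x) ≫
        P.ext.toFunctor.map (StrongNat.app (LinSpan.linearId I).inv x) :=
    congrArg (fun k => LinSpan.idHom (P.ext.toFunctor.obj x) ≫ k) (Category.id_comp
      (P.ext.toFunctor.map (StrongNat.app (LinSpan.linearId I).inv x)))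
  let ι : x ⟶ (LinSpan.id I).linear.toFunctor.obj x := StrongNat.app (LinSpan.linearId I).inv x
  have h₁ : ι.left ≫ (LinSpan.id I).linFst x = 𝟙 _ := linPair_fst (LinSpan.id I) _ _ _
  have h₂ : ι.left ≫ (LinSpan.id I).linMid x = x.hom := linPair_mid (LinSpan.id I) _ _ _
  have h₃ : linPair (S := LinSpan.id I) p r w ≫ (LinSpan.idHom (P.ext.toFunctor.obj x)).left = p :=
    linPair_fst (LinSpan.id I) _ _ _
  have e₁ : linPair (S := LinSpan.id I) p r w ≫
      (cellApp (transportCell (LinSpan.linearId I) (idCell P.ext)) x).left =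
      p ≫ (P.ext.toFunctor.map ι).left := by
    rw [e₀, Over.comp_left, ← Category.assoc, h₃]
  refine e₁.trans ?_
  apply (refl P).graph.eq_val r p w
  · refine (Category.assoc _ _ _).trans ((congrArg (fun k => p ≫ k) (map_shape ι)).trans ?_)
    exact (Category.comp_id _).symm
  · intro Y t d h w₁ w₂
    refine (congrArg (fun k => k ≫ _) (ev_map ι (t ≫ p) _ (Category.assoc _ _ _).symm d h)).trans ?_
    refine (Category.assoc _ _ _).trans ((congrArg _ h₂).trans ?_)
    refine (ev_hom _ _ _).trans ?_
    exact congrArg (fun k => d ≫ k) (Category.comp_id _).symm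
  · intro Y t d h w₁ w₂
    refine (congrArg (fun k => k ≫ _) (ev_map ι (t ≫ p) _ (Category.assoc _ _ _).symm d h)).trans ?_
    refine (Category.assoc _ _ _).trans ((congrArg _ h₁).trans ?_)
    rw [Category.comp_id]
    exact ev_congr rfl (Category.comp_id _).symm

end PolyIso

/-! ### The category of diagrams -/

variable (C) in
/-- Polynomial endodiagrams, as objects of a category equivalent to `PFSim C`. They are used in
place of polynomial functors since a diagram, unlike a functor, determines its shapes and
positions on the nose. -/
structure Diag where
  base : C
  diag : PolyDiagram base base

namespace Diag

/-- The polynomial functor of a diagram. -/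
def fn (D : Diag C) : PFSim C := ⟨D.base, D.diag.ext, ⟨D.diag, ⟨Iso.refl _⟩⟩⟩

/-- Morphisms of diagrams are the morphisms of their extensions. -/
instance : Category (Diag C) where
  Hom D E := D.fn ⟶ E.fn
  id D := 𝟙 D.fn
  comp f g := CategoryStruct.comp (obj := PFSim C) f g
  id_comp f := Category.id_comp (obj := PFSim C) f
  comp_id f := Category.comp_id (obj := PFSim C) f
  assoc f g h := Category.assoc (obj := PFSim C) f g h

end Diag

namespace SimData
variable {D E F : Diag C} {S S' : LinSpan D.base E.base}

/-- The morphism of diagrams given by simulation data. -/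
def hom (s : SimData D.diag E.diag S) : D ⟶ E :=
  PFSim.homMk (P := D.fn) (Q := E.fn) ⟨S, s.cell⟩

lemma hom_eq {s : SimData D.diag E.diag S} {s' : SimData D.diag E.diag S'} {f : S.R ≅ S'.R}
    (h : Along f.hom s s') : s.hom = s'.hom := Quotient.sound h.cellEquiv

/-- Equal morphisms of diagrams are given by data that correspond along an isomorphism of spans. -/
lemma exists_along {s : SimData D.diag E.diag S} {s' : SimData D.diag E.diag S'}
    (h : s.hom = s'.hom) : ∃ f : S.R ≅ S'.R, Along f.hom s s' :=
  along_of_cellEquiv s.cell_realizes s'.cell_realizes (Quotient.exact h)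

/-- Every morphism of diagrams is given by simulation data. -/
lemma exists_hom_eq (f : D ⟶ E) : ∃ (S : LinSpan D.base E.base) (s : SimData D.diag E.diag S),
    s.hom = f := by
  induction f using Quotient.inductionOn with
  | h f =>
    refine ⟨f.span, ofCell f.cell, ?_⟩
    exact congrArg (fun c => PFSim.homMk (P := D.fn) (Q := E.fn) ⟨f.span, c⟩)
      ((cell_realizes _).eq (ofCell_realizes f.cell))

lemma hom_comp (s : SimData D.diag E.diag S) {T : LinSpan E.base F.base}
    (t : SimData E.diag F.diag T) : s.hom ≫ t.hom = (s.comp t).hom :=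
  congrArg (fun c => PFSim.homMk (P := D.fn) (Q := F.fn) ⟨S.comp T, c⟩)
    ((comp_realizes s t).eq (cell_realizes _))

lemma graph_refl (D : Diag C) : (PolyIso.refl D.diag).graph.hom = 𝟙 D :=
  congrArg (fun c => PFSim.homMk (P := D.fn) (Q := D.fn) ⟨LinSpan.id D.base, c⟩)
    ((cell_realizes _).eq (PolyIso.refl_realizes D.diag))

end SimData

/-! ### Tensor products of simulation data -/

namespace PolyDiagram
variable {I J I' J' : C} {P : PolyDiagram I J} {Q : PolyDiagram I' J'}

variable (P Q) in
/-- The first projection on shapes. -/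
def fstA : (P.tensor Q).A ⟶ P.A := prod.fst

variable (P Q) in
/-- The second projection on shapes. -/
def sndA : (P.tensor Q).A ⟶ Q.A := prod.snd

variable (P Q) in
/-- The first projection on positions. -/
def fstD : (P.tensor Q).D ⟶ P.D := prod.fst

variable (P Q) in
/-- The second projection on positions. -/
def sndD : (P.tensor Q).D ⟶ Q.D := prod.snd

/-- Pairs of shapes. -/
def pairA {Z : C} (a : Z ⟶ P.A) (b : Z ⟶ Q.A) : Z ⟶ (P.tensor Q).A := prod.lift a b

/-- Pairs of positions. -/
def pairD {Z : C} (a : Z ⟶ P.D) (b : Z ⟶ Q.D) : Z ⟶ (P.tensor Q).D := prod.lift a b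

section
variable {Z : C} (a : Z ⟶ P.A) (b : Z ⟶ Q.A) (d : Z ⟶ P.D) (e : Z ⟶ Q.D)

@[simp] lemma pairA_fst : pairA a b ≫ fstA P Q = a := prod.lift_fst _ _
@[simp] lemma pairA_snd : pairA a b ≫ sndA P Q = b := prod.lift_snd _ _
@[simp] lemma pairD_fst : pairD d e ≫ fstD P Q = d := prod.lift_fst _ _
@[simp] lemma pairD_snd : pairD d e ≫ sndD P Q = e := prod.lift_snd _ _

lemma tensorA_ext {a b : Z ⟶ (P.tensor Q).A} (h₁ : a ≫ fstA P Q = b ≫ fstA P Q)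
    (h₂ : a ≫ sndA P Q = b ≫ sndA P Q) : a = b := prod.hom_ext h₁ h₂

lemma tensorD_ext {a b : Z ⟶ (P.tensor Q).D} (h₁ : a ≫ fstD P Q = b ≫ fstD P Q)
    (h₂ : a ≫ sndD P Q = b ≫ sndD P Q) : a = b := prod.hom_ext h₁ h₂

lemma comp_pairA {Y : C} (t : Y ⟶ Z) : t ≫ pairA a b = pairA (t ≫ a) (t ≫ b) :=
  prod.comp_lift _ _ _

lemma comp_pairD {Y : C} (t : Y ⟶ Z) : t ≫ pairD d e = pairD (t ≫ d) (t ≫ e) :=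
  prod.comp_lift _ _ _

end

lemma tensor_a_fst : (P.tensor Q).a ≫ prod.fst = fstA P Q ≫ P.a := prod.map_fst _ _
lemma tensor_a_snd : (P.tensor Q).a ≫ prod.snd = sndA P Q ≫ Q.a := prod.map_snd _ _
lemma tensor_n_fst : (P.tensor Q).n ≫ prod.fst = fstD P Q ≫ P.n := prod.map_fst _ _
lemma tensor_n_snd : (P.tensor Q).n ≫ prod.snd = sndD P Q ≫ Q.n := prod.map_snd _ _
lemma tensor_d_fst : (P.tensor Q).d ≫ fstA P Q = fstD P Q ≫ P.d := prod.map_fst _ _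
lemma tensor_d_snd : (P.tensor Q).d ≫ sndA P Q = sndD P Q ≫ Q.d := prod.map_snd _ _

end PolyDiagram

namespace LinSpan
variable {I J I' J' : C} {S : LinSpan I J} {T : LinSpan I' J'}

variable (S T) in
/-- The first projection from the apex of a product of spans. -/
def fstR : (S.prod T).R ⟶ S.R := prod.fst

variable (S T) in
/-- The second projection from the apex of a product of spans. -/
def sndR : (S.prod T).R ⟶ T.R := prod.snd

/-- Pairs in the apex of a product of spans. -/
def pairR {Z : C} (r : Z ⟶ S.R) (r' : Z ⟶ T.R) : Z ⟶ (S.prod T).R := prod.lift r r'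

section
variable {Z : C} (r : Z ⟶ S.R) (r' : Z ⟶ T.R)

@[simp] lemma pairR_fst : pairR r r' ≫ fstR S T = r := prod.lift_fst _ _
@[simp] lemma pairR_snd : pairR r r' ≫ sndR S T = r' := prod.lift_snd _ _

lemma prodR_ext {a b : Z ⟶ (S.prod T).R} (h₁ : a ≫ fstR S T = b ≫ fstR S T)
    (h₂ : a ≫ sndR S T = b ≫ sndR S T) : a = b := prod.hom_ext h₁ h₂

lemma comp_pairR {Y : C} (t : Y ⟶ Z) : t ≫ pairR r r' = pairR (t ≫ r) (t ≫ r') :=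
  prod.comp_lift _ _ _

end

lemma prod_l_fst : (S.prod T).l ≫ Limits.prod.fst = fstR S T ≫ S.l := prod.map_fst _ _
lemma prod_l_snd : (S.prod T).l ≫ Limits.prod.snd = sndR S T ≫ T.l := prod.map_snd _ _
lemma prod_r_fst : (S.prod T).r ≫ Limits.prod.fst = fstR S T ≫ S.r := prod.map_fst _ _
lemma prod_r_snd : (S.prod T).r ≫ Limits.prod.snd = sndR S T ≫ T.r := prod.map_snd _ _

end LinSpan

namespace SimData
open PolyDiagram LinSpan

variable {I J I' J' : C} {P : PolyDiagram I I} {Q : PolyDiagram J J} {S : LinSpan I J}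
  {P' : PolyDiagram I' I'} {Q' : PolyDiagram J' J'} {T : LinSpan I' J'}

lemma fst_cond {Z : C} {r : Z ⟶ (S.prod T).R} {a : Z ⟶ (P.tensor P').A}
    (h : r ≫ (S.prod T).l = a ≫ (P.tensor P').a) :
    (r ≫ fstR S T) ≫ S.l = (a ≫ fstA P P') ≫ P.a := by
  rw [Category.assoc, Category.assoc, ← prod_l_fst, ← tensor_a_fst, ← Category.assoc, h,
    Category.assoc]

lemma snd_cond {Z : C} {r : Z ⟶ (S.prod T).R} {a : Z ⟶ (P.tensor P').A}
    (h : r ≫ (S.prod T).l = a ≫ (P.tensor P').a) :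
    (r ≫ sndR S T) ≫ T.l = (a ≫ sndA P P') ≫ P'.a := by
  rw [Category.assoc, Category.assoc, ← prod_l_snd, ← tensor_a_snd, ← Category.assoc, h,
    Category.assoc]

lemma d_fst_cond {Z : C} {d : Z ⟶ (P.tensor P').D} {a : Z ⟶ P.A} {b : Z ⟶ P'.A}
    (w : d ≫ (P.tensor P').d = pairA a b) : (d ≫ fstD P P') ≫ P.d = a := by
  rw [Category.assoc, ← tensor_d_fst, ← Category.assoc, w, pairA_fst]

lemma d_snd_cond {Z : C} {d : Z ⟶ (P.tensor P').D} {a : Z ⟶ P.A} {b : Z ⟶ P'.A}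
    (w : d ≫ (P.tensor P').d = pairA a b) : (d ≫ sndD P P') ≫ P'.d = b := by
  rw [Category.assoc, ← tensor_d_snd, ← Category.assoc, w, pairA_snd]

section
variable (s : SimData P Q S) {Y Z : C} (y : Y ⟶ Z) {r : Z ⟶ S.R} {a : Z ⟶ P.A} {d : Z ⟶ Q.D}
  {r' : Y ⟶ S.R} {a' : Y ⟶ P.A} {d' : Y ⟶ Q.D}

lemma comp_act_eq (hr : y ≫ r = r') (ha : y ≫ a = a') (h : r ≫ S.l = a ≫ P.a)
    (h' : r' ≫ S.l = a' ≫ P.a) : y ≫ s.act r a h = s.act r' a' h' := by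
  subst hr ha; exact s.comp_act _ _ _ _

lemma comp_resp_eq (hr : y ≫ r = r') (ha : y ≫ a = a') (hd : y ≫ d = d')
    (h : r ≫ S.l = a ≫ P.a) (h' : r' ≫ S.l = a' ≫ P.a) (w : d ≫ Q.d = s.act r a h)
    (w' : d' ≫ Q.d = s.act r' a' h') : y ≫ s.resp r a h d w = s.resp r' a' h' d' w' := by
  subst hr ha hd; exact s.comp_resp _ _ _ _ _ _

lemma comp_next_eq (hr : y ≫ r = r') (ha : y ≫ a = a') (hd : y ≫ d = d')
    (h : r ≫ S.l = a ≫ P.a) (h' : r' ≫ S.l = a' ≫ P.a) (w : d ≫ Q.d = s.act r a h)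
    (w' : d' ≫ Q.d = s.act r' a' h') : y ≫ s.next r a h d w = s.next r' a' h' d' w' := by
  subst hr ha hd; exact s.comp_next _ _ _ _ _ _

end

/-- The tensor product of simulation data: all operations are performed in parallel on pairs. -/
def tensor (s : SimData P Q S) (t : SimData P' Q' T) :
    SimData (P.tensor P') (Q.tensor Q') (S.prod T) where
  act r a h := pairA (s.act (r ≫ fstR S T) (a ≫ fstA P P') (fst_cond h))
    (t.act (r ≫ sndR S T) (a ≫ sndA P P') (snd_cond h))
  comp_act y r a h := (comp_pairA _ _ _).trans (congrArg₂ pairA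
    (s.comp_act_eq y (Category.assoc _ _ _).symm (Category.assoc _ _ _).symm _ _)
    (t.comp_act_eq y (Category.assoc _ _ _).symm (Category.assoc _ _ _).symm _ _))
  act_a r a h := by
    apply prod.hom_ext
    · rw [Category.assoc, tensor_a_fst, ← Category.assoc, pairA_fst, act_a, Category.assoc,
        Category.assoc, prod_r_fst]
    · rw [Category.assoc, tensor_a_snd, ← Category.assoc, pairA_snd, act_a, Category.assoc,
        Category.assoc, prod_r_snd]
  resp r a h d w := pairD
    (s.resp (r ≫ fstR S T) (a ≫ fstA P P') (fst_cond h) (d ≫ fstD Q Q') (d_fst_cond w))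
    (t.resp (r ≫ sndR S T) (a ≫ sndA P P') (snd_cond h) (d ≫ sndD Q Q') (d_snd_cond w))
  comp_resp y r a h d w := (comp_pairD _ _ _).trans (congrArg₂ pairD
    (s.comp_resp_eq y (Category.assoc _ _ _).symm (Category.assoc _ _ _).symm
      (Category.assoc _ _ _).symm (fst_cond h) _ (d_fst_cond w) _)
    (t.comp_resp_eq y (Category.assoc _ _ _).symm (Category.assoc _ _ _).symm
      (Category.assoc _ _ _).symm (snd_cond h) _ (d_snd_cond w) _))
  resp_d r a h d w := by
    apply tensorA_ext
    · rw [Category.assoc, tensor_d_fst, ← Category.assoc, pairD_fst, resp_d]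
    · rw [Category.assoc, tensor_d_snd, ← Category.assoc, pairD_snd, resp_d]
  next r a h d w := pairR
    (s.next (r ≫ fstR S T) (a ≫ fstA P P') (fst_cond h) (d ≫ fstD Q Q') (d_fst_cond w))
    (t.next (r ≫ sndR S T) (a ≫ sndA P P') (snd_cond h) (d ≫ sndD Q Q') (d_snd_cond w))
  comp_next y r a h d w := (comp_pairR _ _ _).trans (congrArg₂ pairR
    (s.comp_next_eq y (Category.assoc _ _ _).symm (Category.assoc _ _ _).symm
      (Category.assoc _ _ _).symm (fst_cond h) _ (d_fst_cond w) _)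
    (t.comp_next_eq y (Category.assoc _ _ _).symm (Category.assoc _ _ _).symm
      (Category.assoc _ _ _).symm (snd_cond h) _ (d_snd_cond w) _))
  next_l r a h d w := by
    apply prod.hom_ext
    · rw [Category.assoc, Category.assoc, prod_l_fst, tensor_n_fst, ← Category.assoc,
        ← Category.assoc, pairR_fst, pairD_fst, next_l]
    · rw [Category.assoc, Category.assoc, prod_l_snd, tensor_n_snd, ← Category.assoc,
        ← Category.assoc, pairR_snd, pairD_snd, next_l]
  next_r r a h d w := by
    apply prod.hom_ext
    · rw [Category.assoc, Category.assoc, prod_r_fst, tensor_n_fst, ← Category.assoc,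
        ← Category.assoc, pairR_fst, next_r]
    · rw [Category.assoc, Category.assoc, prod_r_snd, tensor_n_snd, ← Category.assoc,
        ← Category.assoc, pairR_snd, next_r]

/-- The product of two isomorphisms of apexes. -/
def prodApex {S' : LinSpan I J} {T' : LinSpan I' J'} (f : S.R ≅ S'.R) (g : T.R ≅ T'.R) :
    (S.prod T).R ≅ (S'.prod T').R := prod.mapIso f g

lemma prodApex_fst {S' : LinSpan I J} {T' : LinSpan I' J'} (f : S.R ≅ S'.R) (g : T.R ≅ T'.R) :
    (prodApex f g).hom ≫ fstR S' T' = fstR S T ≫ f.hom := prod.map_fst _ _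

lemma prodApex_snd {S' : LinSpan I J} {T' : LinSpan I' J'} (f : S.R ≅ S'.R) (g : T.R ≅ T'.R) :
    (prodApex f g).hom ≫ sndR S' T' = sndR S T ≫ g.hom := prod.map_snd _ _

lemma Along.tensor {S' : LinSpan I J} {T' : LinSpan I' J'} {s : SimData P Q S}
    {t : SimData P' Q' T} {s' : SimData P Q S'} {t' : SimData P' Q' T'} {f : S.R ≅ S'.R}
    {g : T.R ≅ T'.R} (hs : Along f.hom s s') (ht : Along g.hom t t') :
    Along (prodApex f g).hom (s.tensor t) (s'.tensor t') := by
  have e₁ : ∀ {Z : C} (r : Z ⟶ (S.prod T).R),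
      (r ≫ fstR S T) ≫ f.hom = (r ≫ (prodApex f g).hom) ≫ fstR S' T' := fun r => by
    rw [Category.assoc, Category.assoc, prodApex_fst]
  have e₂ : ∀ {Z : C} (r : Z ⟶ (S.prod T).R),
      (r ≫ sndR S T) ≫ g.hom = (r ≫ (prodApex f g).hom) ≫ sndR S' T' := fun r => by
    rw [Category.assoc, Category.assoc, prodApex_snd]
  refine ⟨?_, ?_, ?_, ?_, ?_⟩
  · apply prod.hom_ext
    · rw [Category.assoc, prod_l_fst, ← Category.assoc, prodApex_fst, Category.assoc, hs.l,
        prod_l_fst]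
    · rw [Category.assoc, prod_l_snd, ← Category.assoc, prodApex_snd, Category.assoc, ht.l,
        prod_l_snd]
  · apply prod.hom_ext
    · rw [Category.assoc, prod_r_fst, ← Category.assoc, prodApex_fst, Category.assoc, hs.r,
        prod_r_fst]
    · rw [Category.assoc, prod_r_snd, ← Category.assoc, prodApex_snd, Category.assoc, ht.r,
        prod_r_snd]
  · intro Z r a h h'
    have k₁ : ((r ≫ fstR S T) ≫ f.hom) ≫ S'.l = (a ≫ fstA P P') ≫ P.a := by
      rw [e₁]; exact fst_cond h'
    have k₂ : ((r ≫ sndR S T) ≫ g.hom) ≫ T'.l = (a ≫ sndA P P') ≫ P'.a := by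
      rw [e₂]; exact snd_cond h'
    exact congrArg₂ pairA
      ((hs.act _ _ _ k₁).trans (s'.act_congr (e₁ r) rfl _ _))
      ((ht.act _ _ _ k₂).trans (t'.act_congr (e₂ r) rfl _ _))
  · intro Z r a h h' d w w'
    have k₁ : ((r ≫ fstR S T) ≫ f.hom) ≫ S'.l = (a ≫ fstA P P') ≫ P.a := by
      rw [e₁]; exact fst_cond h'
    have k₂ : ((r ≫ sndR S T) ≫ g.hom) ≫ T'.l = (a ≫ sndA P P') ≫ P'.a := by
      rw [e₂]; exact snd_cond h'
    exact congrArg₂ pairD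
      ((hs.resp _ _ _ k₁ _ _ ((d_fst_cond w).trans (hs.act _ _ _ _))).trans
        (s'.resp_congr (e₁ r) rfl rfl _ _ _ _))
      ((ht.resp _ _ _ k₂ _ _ ((d_snd_cond w).trans (ht.act _ _ _ _))).trans
        (t'.resp_congr (e₂ r) rfl rfl _ _ _ _))
  · intro Z r a h h' d w w'
    have k₁ : ((r ≫ fstR S T) ≫ f.hom) ≫ S'.l = (a ≫ fstA P P') ≫ P.a := by
      rw [e₁]; exact fst_cond h'
    have k₂ : ((r ≫ sndR S T) ≫ g.hom) ≫ T'.l = (a ≫ sndA P P') ≫ P'.a := by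
      rw [e₂]; exact snd_cond h'
    apply prodR_ext
    · rw [Category.assoc, prodApex_fst]
      refine (Category.assoc _ _ _).symm.trans ((congrArg (fun k => k ≫ f.hom)
        (pairR_fst _ _)).trans (Eq.trans ?_ (pairR_fst _ _).symm))
      exact (hs.next _ _ _ k₁ _ _ ((d_fst_cond w).trans (hs.act _ _ _ _))).trans
        (s'.next_congr (e₁ r) rfl rfl _ _ _ _)
    · rw [Category.assoc, prodApex_snd]
      refine (Category.assoc _ _ _).symm.trans ((congrArg (fun k => k ≫ g.hom)
        (pairR_snd _ _)).trans (Eq.trans ?_ (pairR_snd _ _).symm))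
      exact (ht.next _ _ _ k₂ _ _ ((d_snd_cond w).trans (ht.act _ _ _ _))).trans
        (t'.next_congr (e₂ r) rfl rfl _ _ _ _)

section interchange
variable {K K' : C} {N : PolyDiagram K K} {N' : PolyDiagram K' K'} {U : LinSpan J K}
  {V : LinSpan J' K'}

variable (S T U V) in
/-- The interchange isomorphism between the apexes of a composite of products and of a product of
composites. -/
def interchange : ((S.prod T).comp (U.prod V)).R ≅ ((S.comp U).prod (T.comp V)).R where
  hom := pairR
    (compPair ((S.prod T).compFst (U.prod V) ≫ fstR S T) ((S.prod T).compSnd (U.prod V) ≫ fstR U V)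
      (by rw [Category.assoc, ← prod_r_fst, Category.assoc, ← prod_l_fst, ← Category.assoc,
        comp_condition, Category.assoc]))
    (compPair ((S.prod T).compFst (U.prod V) ≫ sndR S T) ((S.prod T).compSnd (U.prod V) ≫ sndR U V)
      (by rw [Category.assoc, ← prod_r_snd, Category.assoc, ← prod_l_snd, ← Category.assoc,
        comp_condition, Category.assoc]))
  inv := compPair
    (pairR (fstR _ _ ≫ S.compFst U) (sndR _ _ ≫ T.compFst V))
    (pairR (fstR _ _ ≫ S.compSnd U) (sndR _ _ ≫ T.compSnd V)) (by
      apply prod.hom_ext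
      · rw [Category.assoc, Category.assoc, prod_r_fst, prod_l_fst, ← Category.assoc,
          ← Category.assoc, pairR_fst, pairR_fst, Category.assoc, comp_condition, Category.assoc]
      · rw [Category.assoc, Category.assoc, prod_r_snd, prod_l_snd, ← Category.assoc,
          ← Category.assoc, pairR_snd, pairR_snd, Category.assoc, comp_condition, Category.assoc])
  hom_inv_id := by
    apply comp_ext <;> apply prodR_ext <;>
    simp only [Category.assoc, Category.id_comp, compPair_fst, compPair_snd, comp_pairR,
      pairR_fst, pairR_snd] <;> simp only [← Category.assoc, pairR_fst, pairR_snd, compPair_fst,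
        compPair_snd]
  inv_hom_id := by
    apply prodR_ext <;> apply comp_ext <;>
    simp only [Category.assoc, Category.id_comp, compPair_fst, compPair_snd, comp_pairR,
      pairR_fst, pairR_snd] <;> simp only [← Category.assoc, pairR_fst, pairR_snd, compPair_fst,
        compPair_snd]

lemma interchange_fst_fst : (interchange S T U V).hom ≫ fstR _ _ ≫ S.compFst U =
    (S.prod T).compFst (U.prod V) ≫ fstR S T := by
  rw [interchange, ← Category.assoc, pairR_fst, compPair_fst]
lemma interchange_fst_snd : (interchange S T U V).hom ≫ fstR _ _ ≫ S.compSnd U =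
    (S.prod T).compSnd (U.prod V) ≫ fstR U V := by
  rw [interchange, ← Category.assoc, pairR_fst, compPair_snd]
lemma interchange_snd_fst : (interchange S T U V).hom ≫ sndR _ _ ≫ T.compFst V =
    (S.prod T).compFst (U.prod V) ≫ sndR S T := by
  rw [interchange, ← Category.assoc, pairR_snd, compPair_fst]
lemma interchange_snd_snd : (interchange S T U V).hom ≫ sndR _ _ ≫ T.compSnd V =
    (S.prod T).compSnd (U.prod V) ≫ sndR U V := by
  rw [interchange, ← Category.assoc, pairR_snd, compPair_snd]

end interchange

end SimData

namespace SimData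
open PolyDiagram LinSpan

section interchange
variable {I J K I' J' K' : C} {P : PolyDiagram I I} {Q : PolyDiagram J J} {N : PolyDiagram K K}
  {P' : PolyDiagram I' I'} {Q' : PolyDiagram J' J'} {N' : PolyDiagram K' K'}
  {S : LinSpan I J} {T : LinSpan I' J'} {U : LinSpan J K} {V : LinSpan J' K'}

section
variable {Z : C} (r : Z ⟶ ((S.prod T).comp (U.prod V)).R)

lemma interchange_cond₁₁ : (r ≫ (S.prod T).compFst (U.prod V)) ≫ fstR S T =
    ((r ≫ (interchange S T U V).hom) ≫ fstR _ _) ≫ S.compFst U := by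
  simp only [Category.assoc, interchange_fst_fst]

lemma interchange_cond₁₂ : (r ≫ (S.prod T).compSnd (U.prod V)) ≫ fstR U V =
    ((r ≫ (interchange S T U V).hom) ≫ fstR _ _) ≫ S.compSnd U := by
  simp only [Category.assoc, interchange_fst_snd]

lemma interchange_cond₂₁ : (r ≫ (S.prod T).compFst (U.prod V)) ≫ sndR S T =
    ((r ≫ (interchange S T U V).hom) ≫ sndR _ _) ≫ T.compFst V := by
  simp only [Category.assoc, interchange_snd_fst]

lemma interchange_cond₂₂ : (r ≫ (S.prod T).compSnd (U.prod V)) ≫ sndR U V =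
    ((r ≫ (interchange S T U V).hom) ≫ sndR _ _) ≫ T.compSnd V := by
  simp only [Category.assoc, interchange_snd_snd]

end

variable (s : SimData P Q S) (t : SimData P' Q' T) (s' : SimData Q N U) (t' : SimData Q' N' V)
  {Z : C} {r : Z ⟶ ((S.prod T).comp (U.prod V)).R} {a : Z ⟶ (P.tensor P').A}
  (h : r ≫ ((S.prod T).comp (U.prod V)).l = a ≫ (P.tensor P').a)
  (h₁ : ((r ≫ (interchange S T U V).hom) ≫ fstR _ _) ≫ (S.comp U).l = (a ≫ fstA P P') ≫ P.a)
  (h₂ : ((r ≫ (interchange S T U V).hom) ≫ sndR _ _) ≫ (T.comp V).l = (a ≫ sndA P P') ≫ P'.a)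

lemma tensor_midAct_fst : (s.tensor t).midAct r a h ≫ fstA Q Q' =
    s.midAct ((r ≫ (interchange S T U V).hom) ≫ fstR _ _) (a ≫ fstA P P') h₁ :=
  (pairA_fst _ _).trans (s.act_congr (interchange_cond₁₁ r) rfl _ _)

lemma tensor_midAct_snd : (s.tensor t).midAct r a h ≫ sndA Q Q' =
    t.midAct ((r ≫ (interchange S T U V).hom) ≫ sndR _ _) (a ≫ sndA P P') h₂ :=
  (pairA_snd _ _).trans (t.act_congr (interchange_cond₂₁ r) rfl _ _)

variable {d : Z ⟶ (N.tensor N').D} (w : d ≫ (N.tensor N').d =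
    (s'.tensor t').act (r ≫ (S.prod T).compSnd (U.prod V)) ((s.tensor t).midAct r a h)
      ((s.tensor t).mid_cond r a h))
  (w₁ : (d ≫ fstD N N') ≫ N.d = s'.act (((r ≫ (interchange S T U V).hom) ≫ fstR _ _) ≫ S.compSnd U)
    (s.midAct _ _ h₁) (s.mid_cond _ _ h₁))
  (w₂ : (d ≫ sndD N N') ≫ N'.d = t'.act (((r ≫ (interchange S T U V).hom) ≫ sndR _ _) ≫ T.compSnd V)
    (t.midAct _ _ h₂) (t.mid_cond _ _ h₂))

lemma tensor_midResp_fst : (s.tensor t).midResp (s'.tensor t') r a h d w ≫ fstD Q Q' =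
    s.midResp s' _ _ h₁ (d ≫ fstD N N') w₁ :=
  (pairD_fst _ _).trans (s'.resp_congr (interchange_cond₁₂ r) (s.tensor_midAct_fst t h h₁) rfl
    (by rw [tensor_midAct_fst s t h h₁, interchange_cond₁₂]; exact s.mid_cond _ _ h₁) _
    (d_fst_cond w) _)

lemma tensor_midResp_snd : (s.tensor t).midResp (s'.tensor t') r a h d w ≫ sndD Q Q' =
    t.midResp t' _ _ h₂ (d ≫ sndD N N') w₂ :=
  (pairD_snd _ _).trans (t'.resp_congr (interchange_cond₂₂ r) (s.tensor_midAct_snd t h h₂) rfl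
    (by rw [tensor_midAct_snd s t h h₂, interchange_cond₂₂]; exact t.mid_cond _ _ h₂) _
    (d_snd_cond w) _)

/-- The tensor product of data is compatible with composition, up to the interchange of spans. -/
lemma along_interchange : Along (interchange S T U V).hom
    ((s.tensor t).comp (s'.tensor t')) ((s.comp s').tensor (t.comp t')) := by
  refine ⟨?_, ?_, ?_, ?_, ?_⟩
  · apply prod.hom_ext
    · rw [Category.assoc, prod_l_fst, comp_l,
        reassoc_of% interchange_fst_fst (S := S) (T := T) (U := U) (V := V), comp_l,
        Category.assoc, prod_l_fst]
    · rw [Category.assoc, prod_l_snd, comp_l,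
        reassoc_of% interchange_snd_fst (S := S) (T := T) (U := U) (V := V), comp_l,
        Category.assoc, prod_l_snd]
  · apply prod.hom_ext
    · rw [Category.assoc, prod_r_fst, comp_r,
        reassoc_of% interchange_fst_snd (S := S) (T := T) (U := U) (V := V), comp_r,
        Category.assoc, prod_r_fst]
    · rw [Category.assoc, prod_r_snd, comp_r,
        reassoc_of% interchange_snd_snd (S := S) (T := T) (U := U) (V := V), comp_r,
        Category.assoc, prod_r_snd]
  · intro Z r a h h'
    have h₁ := fst_cond h'
    have h₂ := snd_cond h'
    exact congrArg₂ pairA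
      (s'.act_congr (interchange_cond₁₂ r) (s.tensor_midAct_fst t h h₁)
        (by rw [tensor_midAct_fst s t h h₁, interchange_cond₁₂]; exact s.mid_cond _ _ h₁) _)
      (t'.act_congr (interchange_cond₂₂ r) (s.tensor_midAct_snd t h h₂)
        (by rw [tensor_midAct_snd s t h h₂, interchange_cond₂₂]; exact t.mid_cond _ _ h₂) _)
  · intro Z r a h h' d w w'
    have h₁ := fst_cond h'
    have h₂ := snd_cond h'
    have w₁ := d_fst_cond w'
    have w₂ := d_snd_cond w'
    exact congrArg₂ pairD
      (s.resp_congr (interchange_cond₁₁ r) rfl (s.tensor_midResp_fst t s' t' h h₁ w w₁)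
        (by rw [interchange_cond₁₁]; exact comp_fst_cond h₁) (comp_fst_cond h₁)
        (d_fst_cond ((s.tensor t).midResp_d (s'.tensor t') r a h d w)) (s.midResp_d _ _ _ h₁ _ w₁))
      (t.resp_congr (interchange_cond₂₁ r) rfl (s.tensor_midResp_snd t s' t' h h₂ w w₂)
        (by rw [interchange_cond₂₁]; exact comp_fst_cond h₂) (comp_fst_cond h₂)
        (d_snd_cond ((s.tensor t).midResp_d (s'.tensor t') r a h d w)) (t.midResp_d _ _ _ h₂ _ w₂))
  · intro Z r a h h' d w w'
    have h₁ := fst_cond h'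
    have h₂ := snd_cond h'
    have w₁ := d_fst_cond w'
    have w₂ := d_snd_cond w'
    apply prodR_ext <;> apply comp_ext
    · rw [Category.assoc, Category.assoc, interchange_fst_fst, ← Category.assoc]
      refine (congrArg (fun k => k ≫ fstR S T) (compPair_fst _ _ _ _ _)).trans ?_
      refine (pairR_fst _ _).trans (Eq.trans ?_ ((congrArg (fun k => k ≫ S.compFst U)
        (pairR_fst _ _)).trans (compPair_fst _ _ _ _ _)).symm)
      exact s.next_congr (interchange_cond₁₁ r) rfl (s.tensor_midResp_fst t s' t' h h₁ w w₁)
        (by rw [interchange_cond₁₁]; exact comp_fst_cond h₁) (comp_fst_cond h₁)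
        (d_fst_cond ((s.tensor t).midResp_d (s'.tensor t') r a h d w)) (s.midResp_d _ _ _ h₁ _ w₁)
    · rw [Category.assoc, Category.assoc, interchange_fst_snd, ← Category.assoc]
      refine (congrArg (fun k => k ≫ fstR U V) (compPair_snd _ _ _ _ _)).trans ?_
      refine (pairR_fst _ _).trans (Eq.trans ?_ ((congrArg (fun k => k ≫ S.compSnd U)
        (pairR_fst _ _)).trans (compPair_snd _ _ _ _ _)).symm)
      exact s'.next_congr (interchange_cond₁₂ r) (s.tensor_midAct_fst t h h₁) rfl
        (by rw [tensor_midAct_fst s t h h₁, interchange_cond₁₂]; exact s.mid_cond _ _ h₁) _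
        (d_fst_cond w) w₁
    · rw [Category.assoc, Category.assoc, interchange_snd_fst, ← Category.assoc]
      refine (congrArg (fun k => k ≫ sndR S T) (compPair_fst _ _ _ _ _)).trans ?_
      refine (pairR_snd _ _).trans (Eq.trans ?_ ((congrArg (fun k => k ≫ T.compFst V)
        (pairR_snd _ _)).trans (compPair_fst _ _ _ _ _)).symm)
      exact t.next_congr (interchange_cond₂₁ r) rfl (s.tensor_midResp_snd t s' t' h h₂ w w₂)
        (by rw [interchange_cond₂₁]; exact comp_fst_cond h₂) (comp_fst_cond h₂)
        (d_snd_cond ((s.tensor t).midResp_d (s'.tensor t') r a h d w)) (t.midResp_d _ _ _ h₂ _ w₂)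
    · rw [Category.assoc, Category.assoc, interchange_snd_snd, ← Category.assoc]
      refine (congrArg (fun k => k ≫ sndR U V) (compPair_snd _ _ _ _ _)).trans ?_
      refine (pairR_snd _ _).trans (Eq.trans ?_ ((congrArg (fun k => k ≫ T.compSnd V)
        (pairR_snd _ _)).trans (compPair_snd _ _ _ _ _)).symm)
      exact t'.next_congr (interchange_cond₂₂ r) (s.tensor_midAct_snd t h h₂) rfl
        (by rw [tensor_midAct_snd s t h h₂, interchange_cond₂₂]; exact t.mid_cond _ _ h₂) _
        (d_snd_cond w) w₂

end interchange

end SimData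

/-! ### Graphs of isomorphisms of diagrams -/

namespace PolyIso
variable {I J : C} {P : PolyDiagram I I} {Q : PolyDiagram J J} (e : PolyIso P Q)

/-- The identification of the base with the apex of the graph. -/
def toGraph : I ⟶ e.graphSpan.R := 𝟙 I

lemma toGraph_l : e.toGraph ≫ e.graphSpan.l = 𝟙 I := Category.id_comp _
lemma l_toGraph : e.graphSpan.l ≫ e.toGraph = 𝟙 _ := Category.id_comp _
lemma toGraph_r : e.toGraph ≫ e.graphSpan.r = e.base.hom := Category.id_comp _
lemma graph_l_base : e.graphSpan.l ≫ e.base.hom = e.graphSpan.r := Category.id_comp _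

lemma graphSpan_hom_ext {Z : C} {r r' : Z ⟶ e.graphSpan.R}
    (h : r ≫ e.graphSpan.l = r' ≫ e.graphSpan.l) : r = r' := by
  rw [← Category.comp_id r, ← l_toGraph, ← Category.assoc, h, Category.assoc, l_toGraph,
    Category.comp_id]

end PolyIso

namespace SimData
open PolyDiagram LinSpan PolyIso

section square
variable {I J I' J' : C} {P : PolyDiagram I I} {Q : PolyDiagram J J} {S : LinSpan I J}
  {P' : PolyDiagram I' I'} {Q' : PolyDiagram J' J'} {S' : LinSpan I' J'}

/-- Simulation data `s` and `s'` correspond to each other along isomorphisms `e` and `e'` of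
diagrams and a map `f` of apexes. -/
structure Square (e : PolyIso P P') (e' : PolyIso Q Q') (f : S.R ⟶ S'.R) (s : SimData P Q S)
    (s' : SimData P' Q' S') : Prop where
  l : f ≫ S'.l = S.l ≫ e.base.hom
  r : f ≫ S'.r = S.r ≫ e'.base.hom
  act : ∀ {Z : C} (r : Z ⟶ S.R) (a : Z ⟶ P.A) (h : r ≫ S.l = a ≫ P.a)
    (h' : (r ≫ f) ≫ S'.l = (a ≫ e.A.hom) ≫ P'.a),
    s.act r a h ≫ e'.A.hom = s'.act (r ≫ f) (a ≫ e.A.hom) h'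
  resp : ∀ {Z : C} (r : Z ⟶ S.R) (a : Z ⟶ P.A) (h : r ≫ S.l = a ≫ P.a)
    (h' : (r ≫ f) ≫ S'.l = (a ≫ e.A.hom) ≫ P'.a) (d : Z ⟶ Q.D) (w : d ≫ Q.d = s.act r a h)
    (w' : (d ≫ e'.D.hom) ≫ Q'.d = s'.act (r ≫ f) (a ≫ e.A.hom) h'),
    s.resp r a h d w ≫ e.D.hom = s'.resp (r ≫ f) (a ≫ e.A.hom) h' (d ≫ e'.D.hom) w'
  next : ∀ {Z : C} (r : Z ⟶ S.R) (a : Z ⟶ P.A) (h : r ≫ S.l = a ≫ P.a)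
    (h' : (r ≫ f) ≫ S'.l = (a ≫ e.A.hom) ≫ P'.a) (d : Z ⟶ Q.D) (w : d ≫ Q.d = s.act r a h)
    (w' : (d ≫ e'.D.hom) ≫ Q'.d = s'.act (r ≫ f) (a ≫ e.A.hom) h'),
    s.next r a h d w ≫ f = s'.next (r ≫ f) (a ≫ e.A.hom) h' (d ≫ e'.D.hom) w'

section apex
variable (S S') in
/-- The comparison of the two composites of a span with a graph, induced by an isomorphism of
apexes. -/
def squareApex (e : PolyIso P P') (e' : PolyIso Q Q') (f : S.R ≅ S'.R)
    (hl : f.hom ≫ S'.l = S.l ≫ e.base.hom) :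
    (S.comp e'.graphSpan).R ≅ (e.graphSpan.comp S').R where
  hom := compPair (S.compFst e'.graphSpan ≫ S.l ≫ e.toGraph) (S.compFst e'.graphSpan ≫ f.hom)
    (by rw [Category.assoc, Category.assoc, Category.assoc, hl, toGraph_r])
  inv := compPair (e.graphSpan.compSnd S' ≫ f.inv)
    (e.graphSpan.compSnd S' ≫ f.inv ≫ S.r ≫ e'.toGraph) (by
      simp only [Category.assoc, toGraph_l, Category.comp_id])
  hom_inv_id := by
    have k := S.comp_condition e'.graphSpan
    apply comp_ext
    · rw [Category.assoc, compPair_fst, ← Category.assoc, compPair_snd, Category.assoc,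
        f.hom_inv_id, Category.comp_id, Category.id_comp]
    · rw [Category.assoc, compPair_snd, ← Category.assoc, compPair_snd, Category.assoc,
        f.hom_inv_id_assoc, Category.id_comp, ← Category.assoc, k, Category.assoc, l_toGraph,
        Category.comp_id]
  inv_hom_id := by
    have k := e.graphSpan.comp_condition S'
    have k' : f.inv ≫ S.l ≫ e.base.hom = S'.l := by rw [← hl, f.inv_hom_id_assoc]
    apply comp_ext
    · apply e.graphSpan_hom_ext
      rw [← cancel_mono e.base.hom]
      simp only [Category.assoc, compPair_fst, toGraph_l, Category.comp_id, Category.id_comp]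
      rw [← Category.assoc, compPair_fst, Category.assoc, k', ← k, graph_l_base]
    · rw [Category.assoc, compPair_snd, ← Category.assoc, compPair_fst, Category.assoc,
        f.inv_hom_id, Category.comp_id, Category.id_comp]

end apex

/-- A square of data and isomorphisms commutes, up to an isomorphism of spans, when the
isomorphisms are replaced by their graphs. -/
lemma Square.along {e : PolyIso P P'} {e' : PolyIso Q Q'} {f : S.R ≅ S'.R} {s : SimData P Q S}
    {s' : SimData P' Q' S'} (h : Square e e' f.hom s s') :
    Along (squareApex S S' e e' f h.l).hom (s.comp e'.graph) (e.graph.comp s') := by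
  have eF : (squareApex S S' e e' f h.l).hom ≫ e.graphSpan.compFst S' =
    S.compFst e'.graphSpan ≫ S.l ≫ e.toGraph := compPair_fst _ _ _ _ _
  have eS : (squareApex S S' e e' f h.l).hom ≫ e.graphSpan.compSnd S' =
    S.compFst e'.graphSpan ≫ f.hom := compPair_snd _ _ _ _ _
  have eS' : ∀ {Z : C} (r : Z ⟶ (S.comp e'.graphSpan).R),
      (r ≫ (squareApex S S' e e' f h.l).hom) ≫ e.graphSpan.compSnd S' =
        (r ≫ S.compFst e'.graphSpan) ≫ f.hom := fun r => by
    rw [Category.assoc, eS, Category.assoc]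
  have hc : ∀ {Z : C} (r : Z ⟶ (S.comp e'.graphSpan).R) (a : Z ⟶ P.A),
      r ≫ (S.comp e'.graphSpan).l = a ≫ P.a →
      ((r ≫ S.compFst e'.graphSpan) ≫ f.hom) ≫ S'.l = (a ≫ e.A.hom) ≫ P'.a := fun r a k => by
    rw [Category.assoc, h.l, Category.assoc a, e.a, ← Category.assoc, comp_fst_cond k,
      Category.assoc]
  have hd : ∀ {Z : C} (d : Z ⟶ Q'.D), d = (d ≫ e'.D.inv) ≫ e'.D.hom := fun d => by
    rw [Category.assoc, e'.D.inv_hom_id, Category.comp_id]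
  have hw : ∀ {Z : C} (d : Z ⟶ Q'.D) (a : Z ⟶ Q.A), d ≫ Q'.d = a ≫ e'.A.hom →
      (d ≫ e'.D.inv) ≫ Q.d = a := fun d a k => by
    rw [Category.assoc, e'.d_inv, ← Category.assoc, k, Category.assoc, e'.A.hom_inv_id,
      Category.comp_id]
  have hresp : ∀ {Z : C} (r : Z ⟶ (S.comp e'.graphSpan).R) (a : Z ⟶ P.A)
      (k : r ≫ (S.comp e'.graphSpan).l = a ≫ P.a)
      (k' : (r ≫ (squareApex S S' e e' f h.l).hom) ≫ (e.graphSpan.comp S').l = a ≫ P.a)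
      (d : Z ⟶ Q'.D) (w : d ≫ Q'.d = (s.comp e'.graph).act r a k)
      (w' : d ≫ Q'.d = (e.graph.comp s').act _ a k'),
      (s.comp e'.graph).resp r a k d w = (e.graph.comp s').resp _ a k' d w' := by
    intro Z r a k k' d w w'
    have e₁ := h.resp (r ≫ S.compFst _) a (comp_fst_cond k) (hc r a k) (d ≫ e'.D.inv) (hw _ _ w)
      (by rw [← hd]; exact w.trans (h.act _ _ _ _))
    have e₂ := e₁.trans (s'.resp_congr (eS' r).symm rfl (hd d).symm _ (e.graph.mid_cond _ _ k') _ w')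
    refine Eq.trans ?_ (congrArg (fun k => k ≫ e.D.inv) e₂)
    rw [Category.assoc, e.D.hom_inv_id, Category.comp_id]
    rfl
  refine ⟨?_, ?_, ?_, hresp, ?_⟩
  · rw [comp_l, ← Category.assoc, eF, Category.assoc, Category.assoc, toGraph_l, Category.comp_id,
      comp_l]
  · rw [comp_r, ← Category.assoc, eS, Category.assoc, h.r, ← Category.assoc, comp_condition,
      Category.assoc, graph_l_base, comp_r]
  · intro Z r a k k'
    exact (h.act _ _ (comp_fst_cond k) (hc r a k)).trans
      (s'.act_congr (eS' r).symm rfl _ (e.graph.mid_cond _ _ k'))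
  · intro Z r a k k' d w w'
    apply comp_ext
    · apply e.graphSpan_hom_ext
      have e₁ := (s.comp e'.graph).next_l _ a k d w
      rw [hresp r a k k' d w w', ← (e.graph.comp s').next_l _ a k' d w', comp_l, comp_l] at e₁
      simp only [Category.assoc, reassoc_of% eF, toGraph_l, Category.comp_id, e₁]
    · rw [Category.assoc, eS, ← Category.assoc]
      refine (congrArg (fun k => k ≫ f.hom) (compPair_fst _ _ _ _ _)).trans
        (Eq.trans ?_ (compPair_snd _ _ _ _ _).symm)
      exact (h.next (r ≫ S.compFst _) a (comp_fst_cond k) (hc r a k) (d ≫ e'.D.inv) (hw _ _ w)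
        (by rw [← hd]; exact w.trans (h.act _ _ _ _))).trans
        (s'.next_congr (eS' r).symm rfl (hd d).symm _ (e.graph.mid_cond _ _ k') _ w')

end square

lemma hom_square {D D' E E' : Diag C} {S : LinSpan D.base E.base} {S' : LinSpan D'.base E'.base}
    {e : PolyIso D.diag D'.diag} {e' : PolyIso E.diag E'.diag} {f : S.R ≅ S'.R}
    {s : SimData D.diag E.diag S} {s' : SimData D'.diag E'.diag S'}
    (h : Square e e' f.hom s s') : s.hom ≫ e'.graph.hom = e.graph.hom ≫ s'.hom := by
  rw [hom_comp, hom_comp]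
  exact hom_eq h.along

end SimData

namespace PolyIso
open SimData

@[ext] lemma ext {I J : C} {P : PolyDiagram I I} {Q : PolyDiagram J J} {e e' : PolyIso P Q}
    (h₁ : e.base = e'.base) (h₂ : e.D = e'.D) (h₃ : e.A = e'.A) : e = e' := by
  cases e; cases e'; cases h₁; cases h₂; cases h₃; rfl

/-- Graphs are compatible with composition. This is the naturality square of `e'` and the
identity along the composite isomorphism. -/
lemma graph_trans {D E F : Diag C} (e : PolyIso D.diag E.diag) (e' : PolyIso E.diag F.diag) :
    e.graph.hom ≫ e'.graph.hom = (e.trans e').graph.hom := by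
  refine (hom_square (E' := F) (e := e.trans e') (e' := e') (s := e.graph) (s' := (refl F.diag).graph)
    (f := e.base ≪≫ e'.base) ?_).trans ?_
  · refine ⟨?_, ?_, ?_, ?_, ?_⟩
    · exact (Category.comp_id _).trans (Category.id_comp _).symm
    · exact Category.comp_id _
    · intro Z r a h h'
      simp [graph]
    · intro Z r a h h' d w w'
      simp [graph]
    · intro Z r a h h' d w w'
      change (d ≫ E.diag.n ≫ e.base.inv) ≫ e.base.hom ≫ e'.base.hom =
        (d ≫ e'.D.hom) ≫ F.diag.n ≫ 𝟙 F.base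
      simp [e'.n]
  · rw [graph_refl, Category.comp_id]

/-- The tensor product of isomorphisms of diagrams. -/
def tensor {I J I' J' : C} {P : PolyDiagram I I} {Q : PolyDiagram J J}
    {P' : PolyDiagram I' I'} {Q' : PolyDiagram J' J'} (e : PolyIso P Q) (e' : PolyIso P' Q') :
    PolyIso (P.tensor P') (Q.tensor Q') where
  base := prod.mapIso e.base e'.base
  D := prod.mapIso e.D e'.D
  A := prod.mapIso e.A e'.A
  n := by
    change prod.map _ _ ≫ prod.map _ _ = prod.map _ _ ≫ prod.map _ _
    simp [e.n, e'.n]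
  d := by
    change prod.map _ _ ≫ prod.map _ _ = prod.map _ _ ≫ prod.map _ _
    simp [e.d, e'.d]
  a := by
    change prod.map _ _ ≫ prod.map _ _ = prod.map _ _ ≫ prod.map _ _
    simp [e.a, e'.a]

lemma lift_eq_comp_map {X Y X' Y' Z : C} (a : Z ⟶ X ⨯ Y) (f : X ⟶ X') (g : Y ⟶ Y') :
    prod.lift ((a ≫ prod.fst) ≫ f) ((a ≫ prod.snd) ≫ g) = a ≫ prod.map f g := by
  apply prod.hom_ext
  · rw [prod.lift_fst, Category.assoc, Category.assoc, prod.map_fst]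
  · rw [prod.lift_snd, Category.assoc, Category.assoc, prod.map_snd]

lemma along_tensor {I J I' J' : C} {P : PolyDiagram I I} {Q : PolyDiagram J J}
    {P' : PolyDiagram I' I'} {Q' : PolyDiagram J' J'} (e : PolyIso P Q) (e' : PolyIso P' Q') :
    Along (Iso.refl (I ⨯ I')).hom (e.graph.tensor e'.graph) (e.tensor e').graph := by
  refine ⟨?_, ?_, ?_, ?_, ?_⟩
  · exact (Category.comp_id _).trans prod.map_id_id.symm
  · exact Category.id_comp _
  · intro Z r a h h'
    exact lift_eq_comp_map (X := P.A) (Y := P'.A) a e.A.hom e'.A.hom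
  · intro Z r a h h' d w w'
    exact lift_eq_comp_map (X := Q.D) (Y := Q'.D) d e.D.inv e'.D.inv
  · intro Z r a h h' d w w'
    refine (Category.comp_id _).trans ?_
    refine (lift_eq_comp_map (X := Q.D) (Y := Q'.D) d (Q.n ≫ e.base.inv)
      (Q'.n ≫ e'.base.inv)).trans ?_
    exact congrArg (fun k => d ≫ k) (prod.map_map _ _ _ _).symm

end PolyIso

/-! ### The symmetric monoidal category of diagrams -/

section product
variable {X Y W X' Y' W' Z : C}

variable (X Y W) in
lemma associator_fst : (Limits.prod.associator X Y W).hom ≫ prod.fst = prod.fst ≫ prod.fst :=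
  prod.lift_fst _ _

variable (X Y W) in
lemma associator_snd_fst :
    (Limits.prod.associator X Y W).hom ≫ prod.snd ≫ prod.fst = prod.fst ≫ prod.snd := by
  have h : (Limits.prod.associator X Y W).hom ≫ prod.snd = prod.lift (prod.fst ≫ prod.snd) prod.snd :=
    prod.lift_snd _ _
  rw [← Category.assoc, h, prod.lift_fst]

variable (X Y W) in
lemma associator_snd_snd :
    (Limits.prod.associator X Y W).hom ≫ prod.snd ≫ prod.snd = prod.snd := by
  have h : (Limits.prod.associator X Y W).hom ≫ prod.snd = prod.lift (prod.fst ≫ prod.snd) prod.snd :=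
    prod.lift_snd _ _
  rw [← Category.assoc, h, prod.lift_snd]

lemma lift_associator (x : Z ⟶ X) (y : Z ⟶ Y) (w : Z ⟶ W) :
    prod.lift (prod.lift x y) w ≫ (Limits.prod.associator X Y W).hom =
      prod.lift x (prod.lift y w) := by
  apply prod.hom_ext
  · rw [Category.assoc, associator_fst, prod.lift_fst_assoc, prod.lift_fst, prod.lift_fst]
  · apply prod.hom_ext
    · rw [Category.assoc, Category.assoc, associator_snd_fst, prod.lift_fst_assoc, prod.lift_snd,
        prod.lift_snd, prod.lift_fst]
    · rw [Category.assoc, Category.assoc, associator_snd_snd, prod.lift_snd, prod.lift_snd,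
        prod.lift_snd]

lemma comp_associator_fst (x : Z ⟶ (X ⨯ Y) ⨯ W) :
    (x ≫ prod.fst) ≫ prod.fst = (x ≫ (Limits.prod.associator X Y W).hom) ≫ prod.fst := by
  rw [Category.assoc, Category.assoc, associator_fst]

lemma comp_associator_snd_fst (x : Z ⟶ (X ⨯ Y) ⨯ W) : (x ≫ prod.fst) ≫ prod.snd =
    ((x ≫ (Limits.prod.associator X Y W).hom) ≫ prod.snd) ≫ prod.fst := by
  simp only [Category.assoc, associator_snd_fst]

lemma comp_associator_snd_snd (x : Z ⟶ (X ⨯ Y) ⨯ W) :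
    x ≫ prod.snd = ((x ≫ (Limits.prod.associator X Y W).hom) ≫ prod.snd) ≫ prod.snd := by
  simp only [Category.assoc, associator_snd_snd]

lemma lift_braiding (x : Z ⟶ X) (y : Z ⟶ Y) :
    prod.lift x y ≫ (prod.braiding X Y).hom = prod.lift y x := by
  rw [prod.braiding, prod.comp_lift, prod.lift_fst, prod.lift_snd]

lemma comp_braiding_fst (x : Z ⟶ X ⨯ Y) :
    x ≫ prod.snd = (x ≫ (prod.braiding X Y).hom) ≫ prod.fst := by
  rw [prod.braiding, Category.assoc, prod.lift_fst]

lemma comp_braiding_snd (x : Z ⟶ X ⨯ Y) :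
    x ≫ prod.fst = (x ≫ (prod.braiding X Y).hom) ≫ prod.snd := by
  rw [prod.braiding, Category.assoc, prod.lift_snd]

variable (X Y W)

lemma braiding_hexagon : (Limits.prod.associator X Y W).hom ≫ (prod.braiding X (Y ⨯ W)).hom ≫
      (Limits.prod.associator Y W X).hom =
    prod.map (prod.braiding X Y).hom (𝟙 W) ≫ (Limits.prod.associator Y X W).hom ≫
      prod.map (𝟙 Y) (prod.braiding X W).hom := by
  have h : prod.lift (prod.lift (prod.fst ≫ prod.fst) (prod.fst ≫ prod.snd)) prod.snd =
      𝟙 ((X ⨯ Y) ⨯ W) := by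
    apply prod.hom_ext
    · rw [prod.lift_fst, Category.id_comp]
      apply prod.hom_ext
      · rw [prod.lift_fst]
      · rw [prod.lift_snd]
    · rw [prod.lift_snd, Category.id_comp]
  rw [← cancel_epi (𝟙 _), ← h, ← Category.assoc, lift_associator, ← Category.assoc, lift_braiding,
    lift_associator, ← Category.assoc, prod.lift_map, lift_braiding, ← Category.assoc,
    lift_associator, prod.lift_map, lift_braiding, Category.comp_id, Category.comp_id]

end product

namespace PolyDiagram
variable {I J K : C} (P : PolyDiagram I I) (Q : PolyDiagram J J) (N : PolyDiagram K K)

/-- The associativity isomorphism of the product of diagrams. -/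
def associator : PolyIso ((P.tensor Q).tensor N) (P.tensor (Q.tensor N)) where
  base := Limits.prod.associator I J K
  D := Limits.prod.associator P.D Q.D N.D
  A := Limits.prod.associator P.A Q.A N.A
  n := (prod.associator_naturality _ _ _).symm
  d := (prod.associator_naturality _ _ _).symm
  a := (prod.associator_naturality _ _ _).symm

/-- The symmetry of the product of diagrams. -/
def braiding : PolyIso (P.tensor Q) (Q.tensor P) where
  base := prod.braiding I J
  D := prod.braiding P.D Q.D
  A := prod.braiding P.A Q.A
  n := (braid_natural _ _).symm
  d := (braid_natural _ _).symm
  a := (braid_natural _ _).symm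

variable (C) in
/-- The unit diagram, all of whose objects are terminal. -/
def unit : PolyDiagram (⊤_ C) (⊤_ C) := ⟨⊤_ C, ⊤_ C, 𝟙 _, 𝟙 _, 𝟙 _⟩

/-- The left unit isomorphism of the product of diagrams. -/
def leftUnitor : PolyIso ((unit C).tensor P) P where
  base := prod.leftUnitor I
  D := prod.leftUnitor P.D
  A := prod.leftUnitor P.A
  n := (prod.leftUnitor_hom_naturality _).symm
  d := (prod.leftUnitor_hom_naturality _).symm
  a := (prod.leftUnitor_hom_naturality _).symm

/-- The right unit isomorphism of the product of diagrams. -/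
def rightUnitor : PolyIso (P.tensor (unit C)) P where
  base := prod.rightUnitor I
  D := prod.rightUnitor P.D
  A := prod.rightUnitor P.A
  n := (prod.rightUnitor_hom_naturality _).symm
  d := (prod.rightUnitor_hom_naturality _).symm
  a := (prod.rightUnitor_hom_naturality _).symm

end PolyDiagram

namespace SimData
open PolyDiagram LinSpan

section
variable {I J I' J' I'' J'' : C} {P : PolyDiagram I I} {Q : PolyDiagram J J} {S : LinSpan I J}
  {P' : PolyDiagram I' I'} {Q' : PolyDiagram J' J'} {T : LinSpan I' J'}
  {P'' : PolyDiagram I'' I''} {Q'' : PolyDiagram J'' J''} {U : LinSpan I'' J''}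
  (s : SimData P Q S) (t : SimData P' Q' T) (u : SimData P'' Q'' U)

lemma square_associator : Square (associator P P' P'') (associator Q Q' Q'')
    (Limits.prod.associator S.R T.R U.R).hom ((s.tensor t).tensor u) (s.tensor (t.tensor u)) := by
  refine ⟨(prod.associator_naturality _ _ _).symm, (prod.associator_naturality _ _ _).symm,
    ?_, ?_, ?_⟩
  · intro Z r a h h'
    refine (lift_associator (s.act _ _ (fst_cond (fst_cond h))) (t.act _ _ (snd_cond (fst_cond h)))
      (u.act _ _ (snd_cond h))).trans ?_
    exact congrArg₂ pairA
      (s.act_congr (comp_associator_fst _) (comp_associator_fst _) _ _) (congrArg₂ pairA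
      (t.act_congr (comp_associator_snd_fst _) (comp_associator_snd_fst _) _ _)
      (u.act_congr (comp_associator_snd_snd _) (comp_associator_snd_snd _) _ _))
  · intro Z r a h h' d w w'
    refine (lift_associator (s.resp _ _ (fst_cond (fst_cond h)) _ (d_fst_cond (d_fst_cond w)))
      (t.resp _ _ (snd_cond (fst_cond h)) _ (d_snd_cond (d_fst_cond w)))
      (u.resp _ _ (snd_cond h) _ (d_snd_cond w))).trans ?_
    exact congrArg₂ pairD
      (s.resp_congr (comp_associator_fst _) (comp_associator_fst _) (comp_associator_fst _) _ _ _ _)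
      (congrArg₂ pairD
      (t.resp_congr (comp_associator_snd_fst _) (comp_associator_snd_fst _)
        (comp_associator_snd_fst _) _ _ _ _)
      (u.resp_congr (comp_associator_snd_snd _) (comp_associator_snd_snd _)
        (comp_associator_snd_snd _) _ _ _ _))
  · intro Z r a h h' d w w'
    refine (lift_associator (s.next _ _ (fst_cond (fst_cond h)) _ (d_fst_cond (d_fst_cond w)))
      (t.next _ _ (snd_cond (fst_cond h)) _ (d_snd_cond (d_fst_cond w)))
      (u.next _ _ (snd_cond h) _ (d_snd_cond w))).trans ?_
    exact congrArg₂ pairR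
      (s.next_congr (comp_associator_fst _) (comp_associator_fst _) (comp_associator_fst _) _ _ _ _)
      (congrArg₂ pairR
      (t.next_congr (comp_associator_snd_fst _) (comp_associator_snd_fst _)
        (comp_associator_snd_fst _) _ _ _ _)
      (u.next_congr (comp_associator_snd_snd _) (comp_associator_snd_snd _)
        (comp_associator_snd_snd _) _ _ _ _))

lemma square_braiding : Square (braiding P P') (braiding Q Q')
    (prod.braiding S.R T.R).hom (s.tensor t) (t.tensor s) := by
  refine ⟨(braid_natural _ _).symm, (braid_natural _ _).symm, ?_, ?_, ?_⟩
  · intro Z r a h h'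
    refine (lift_braiding (s.act _ _ (fst_cond h)) (t.act _ _ (snd_cond h))).trans ?_
    exact congrArg₂ pairA
      (t.act_congr (comp_braiding_fst _) (comp_braiding_fst _) _ _)
      (s.act_congr (comp_braiding_snd _) (comp_braiding_snd _) _ _)
  · intro Z r a h h' d w w'
    refine (lift_braiding (s.resp _ _ (fst_cond h) _ (d_fst_cond w))
      (t.resp _ _ (snd_cond h) _ (d_snd_cond w))).trans ?_
    exact congrArg₂ pairD
      (t.resp_congr (comp_braiding_fst _) (comp_braiding_fst _) (comp_braiding_fst _) _ _ _ _)
      (s.resp_congr (comp_braiding_snd _) (comp_braiding_snd _) (comp_braiding_snd _) _ _ _ _)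
  · intro Z r a h h' d w w'
    refine (lift_braiding (s.next _ _ (fst_cond h) _ (d_fst_cond w))
      (t.next _ _ (snd_cond h) _ (d_snd_cond w))).trans ?_
    exact congrArg₂ pairR
      (t.next_congr (comp_braiding_fst _) (comp_braiding_fst _) (comp_braiding_fst _) _ _ _ _)
      (s.next_congr (comp_braiding_snd _) (comp_braiding_snd _) (comp_braiding_snd _) _ _ _ _)

lemma square_leftUnitor : Square (leftUnitor P) (leftUnitor Q)
    (prod.leftUnitor S.R).hom ((PolyIso.refl (unit C)).graph.tensor s) s := by
  refine ⟨?_, ?_, ?_, ?_, ?_⟩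
  · exact (prod.leftUnitor_hom_naturality S.l).symm
  · exact (prod.leftUnitor_hom_naturality S.r).symm
  · intro Z r a h h'
    exact pairA_snd _ _
  · intro Z r a h h' d w w'
    exact pairD_snd _ _
  · intro Z r a h h' d w w'
    exact pairR_snd _ _

lemma square_rightUnitor : Square (rightUnitor P) (rightUnitor Q)
    (prod.rightUnitor S.R).hom (s.tensor (PolyIso.refl (unit C)).graph) s := by
  refine ⟨?_, ?_, ?_, ?_, ?_⟩
  · exact (prod.rightUnitor_hom_naturality S.l).symm
  · exact (prod.rightUnitor_hom_naturality S.r).symm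
  · intro Z r a h h'
    exact pairA_fst _ _
  · intro Z r a h h' d w w'
    exact pairD_fst _ _
  · intro Z r a h h' d w w'
    exact pairR_fst _ _

end

end SimData

namespace Diag
open SimData PolyDiagram MonoidalCategory

/-- The product of diagrams. -/
def tensor (D E : Diag C) : Diag C := ⟨D.base ⨯ E.base, D.diag.tensor E.diag⟩

variable (C) in
/-- The unit for the product of diagrams. -/
def unit : Diag C := ⟨⊤_ C, PolyDiagram.unit C⟩

variable {D E F D' E' F' D'' E'' : Diag C}

variable (D E F) in
/-- The associativity isomorphism. -/
def assocIso : PolyIso ((D.tensor E).tensor F).diag (D.tensor (E.tensor F)).diag :=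
  PolyDiagram.associator D.diag E.diag F.diag

variable (D E) in
/-- The symmetry. -/
def braidIso : PolyIso (D.tensor E).diag (E.tensor D).diag := PolyDiagram.braiding D.diag E.diag

variable (D) in
/-- The left unit isomorphism. -/
def leftIso : PolyIso ((unit C).tensor D).diag D.diag := PolyDiagram.leftUnitor D.diag

variable (D) in
/-- The right unit isomorphism. -/
def rightIso : PolyIso (D.tensor (unit C)).diag D.diag := PolyDiagram.rightUnitor D.diag

/-- The product of isomorphisms. -/
def prodIso (e : PolyIso D.diag E.diag) (e' : PolyIso D'.diag E'.diag) :
    PolyIso (D.tensor D').diag (E.tensor E').diag := e.tensor e'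

/-- The morphism in `Diag C` given by the graph of an isomorphism of diagrams. -/
def ofIso (e : PolyIso D.diag E.diag) : D ⟶ E := e.graph.hom

lemma ofIso_refl (D : Diag C) : ofIso (PolyIso.refl D.diag) = 𝟙 D := SimData.graph_refl D

lemma ofIso_trans (e : PolyIso D.diag E.diag) (e' : PolyIso E.diag F.diag) :
    ofIso e ≫ ofIso e' = ofIso (e.trans e') := PolyIso.graph_trans e e'

/-- The isomorphism in `Diag C` given by an isomorphism of diagrams. -/
def graphIso (e : PolyIso D.diag E.diag) : D ≅ E where
  hom := ofIso e
  inv := ofIso e.symm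
  hom_inv_id := by
    rw [ofIso_trans, ← ofIso_refl]
    exact congrArg ofIso (PolyIso.ext e.base.self_symm_id e.D.self_symm_id e.A.self_symm_id)
  inv_hom_id := by
    rw [ofIso_trans, ← ofIso_refl]
    exact congrArg ofIso (PolyIso.ext e.base.symm_self_id e.D.symm_self_id e.A.symm_self_id)

/-- The tensor product of simulation data, as a morphism. -/
def tensorData {S : LinSpan D.base E.base} {S' : LinSpan D'.base E'.base}
    (s : SimData D.diag E.diag S) (s' : SimData D'.diag E'.diag S') : D.tensor D' ⟶ E.tensor E' :=
  SimData.hom (D := D.tensor D') (E := E.tensor E') (s.tensor s')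

lemma tensorData_congr {S T : LinSpan D.base E.base} {S' T' : LinSpan D'.base E'.base}
    {s : SimData D.diag E.diag S} {s' : SimData D'.diag E'.diag S'}
    {t : SimData D.diag E.diag T} {t' : SimData D'.diag E'.diag T'} (h : s.hom = t.hom)
    (h' : s'.hom = t'.hom) : tensorData s s' = tensorData t t' := by
  obtain ⟨f, hf⟩ := exists_along h
  obtain ⟨g, hg⟩ := exists_along h'
  exact SimData.hom_eq (D := D.tensor D') (E := E.tensor E') (hf.tensor hg)

/-- The tensor product of morphisms of diagrams, computed on representing data; the choice of
data is immaterial by `tensorData_congr`. -/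
def tensorHom (f : D ⟶ E) (g : D' ⟶ E') : D.tensor D' ⟶ E.tensor E' :=
  tensorData (exists_hom_eq f).choose_spec.choose (exists_hom_eq g).choose_spec.choose

lemma tensorHom_hom {S : LinSpan D.base E.base} {S' : LinSpan D'.base E'.base}
    (s : SimData D.diag E.diag S) (s' : SimData D'.diag E'.diag S') :
    tensorHom s.hom s'.hom = tensorData s s' :=
  tensorData_congr (exists_hom_eq s.hom).choose_spec.choose_spec
    (exists_hom_eq s'.hom).choose_spec.choose_spec

lemma tensorHom_ofIso (e : PolyIso D.diag E.diag) (e' : PolyIso D'.diag E'.diag) :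
    tensorHom (ofIso e) (ofIso e') =
      ofIso (prodIso e e') :=
  (tensorHom_hom e.graph e'.graph).trans
    (SimData.hom_eq (D := D.tensor D') (E := E.tensor E') (PolyIso.along_tensor e e'))

lemma tensorHom_id (D E : Diag C) : tensorHom (𝟙 D) (𝟙 E) = 𝟙 (D.tensor E) := by
  rw [← ofIso_refl, ← ofIso_refl, tensorHom_ofIso, ← ofIso_refl]
  refine congrArg ofIso (PolyIso.ext ?_ ?_ ?_) <;> ext1 <;> exact prod.map_id_id

lemma tensorHom_comp (f : D ⟶ E) (f' : D' ⟶ E') (g : E ⟶ F) (g' : E' ⟶ F') :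
    tensorHom f f' ≫ tensorHom g g' = tensorHom (f ≫ g) (f' ≫ g') := by
  obtain ⟨S, s, rfl⟩ := exists_hom_eq f
  obtain ⟨S', s', rfl⟩ := exists_hom_eq f'
  obtain ⟨T, t, rfl⟩ := exists_hom_eq g
  obtain ⟨T', t', rfl⟩ := exists_hom_eq g'
  rw [tensorHom_hom, tensorHom_hom, SimData.hom_comp, SimData.hom_comp, tensorHom_hom]
  refine (SimData.hom_comp (D := D.tensor D') (E := E.tensor E') (F := F.tensor F') _ _).trans ?_
  exact SimData.hom_eq (D := D.tensor D') (E := F.tensor F') (along_interchange s s' t t')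

instance : MonoidalCategoryStruct (Diag C) where
  tensorObj := tensor
  tensorUnit := unit C
  tensorHom := tensorHom
  whiskerLeft D _ _ f := tensorHom (𝟙 D) f
  whiskerRight f E := tensorHom f (𝟙 E)
  associator D E F := graphIso (assocIso D E F)
  leftUnitor D := graphIso (leftIso D)
  rightUnitor D := graphIso (rightIso D)

instance : MonoidalCategory (Diag C) := MonoidalCategory.ofTensorHom
  (id_tensorHom_id := tensorHom_id)
  (id_tensorHom := fun _ _ _ _ => rfl)
  (tensorHom_id := fun _ _ => rfl)
  (tensorHom_comp_tensorHom := tensorHom_comp)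
  (associator_naturality := by
    intro D D' D'' E E' E'' f f' f''
    obtain ⟨S, s, rfl⟩ := exists_hom_eq f
    obtain ⟨S', s', rfl⟩ := exists_hom_eq f'
    obtain ⟨S'', s'', rfl⟩ := exists_hom_eq f''
    change tensorHom (tensorHom _ _) _ ≫ _ = _ ≫ tensorHom _ (tensorHom _ _)
    rw [tensorHom_hom, tensorHom_hom]
    refine (congrArg (fun k => k ≫ _) (tensorHom_hom (D := D.tensor D') (E := E.tensor E')
      (s.tensor s') s'')).trans (Eq.trans ?_ (congrArg (fun k => _ ≫ k)
      (tensorHom_hom (D' := D'.tensor D'') (E' := E'.tensor E'') s (s'.tensor s''))).symm)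
    exact SimData.hom_square (D := (D.tensor D').tensor D'') (E := (E.tensor E').tensor E'')
      (D' := D.tensor (D'.tensor D'')) (E' := E.tensor (E'.tensor E''))
      (square_associator s s' s''))
  (leftUnitor_naturality := by
    intro D E f
    obtain ⟨S, s, rfl⟩ := exists_hom_eq f
    change tensorHom _ _ ≫ _ = _
    rw [← ofIso_refl]
    refine (congrArg (fun k => k ≫ _) (tensorHom_hom _ s)).trans ?_
    exact SimData.hom_square (D := (unit C).tensor D) (E := (unit C).tensor E)
      (square_leftUnitor s))
  (rightUnitor_naturality := by
    intro D E f
    obtain ⟨S, s, rfl⟩ := exists_hom_eq f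
    change tensorHom _ _ ≫ _ = _
    rw [← ofIso_refl]
    refine (congrArg (fun k => k ≫ _) (tensorHom_hom s _)).trans ?_
    exact SimData.hom_square (D := D.tensor (unit C)) (E := E.tensor (unit C))
      (square_rightUnitor s))
  (pentagon := by
    intro D E F G
    change tensorHom (ofIso (assocIso D E F)) (𝟙 G) ≫ ofIso (assocIso D (E.tensor F) G) ≫
      tensorHom (𝟙 D) (ofIso (assocIso E F G)) =
        ofIso (assocIso (D.tensor E) F G) ≫ ofIso (assocIso D E (F.tensor G))
    rw [← ofIso_refl, ← ofIso_refl, tensorHom_ofIso, tensorHom_ofIso, ofIso_trans, ofIso_trans,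
      ofIso_trans]
    refine congrArg ofIso (PolyIso.ext ?_ ?_ ?_) <;> ext1 <;> exact prod.pentagon _ _ _ _)
  (triangle := by
    intro D E
    change ofIso (assocIso D (unit C) E) ≫ tensorHom (𝟙 D) (ofIso (leftIso E)) =
      tensorHom (ofIso (rightIso D)) (𝟙 E)
    rw [← ofIso_refl, ← ofIso_refl, tensorHom_ofIso, tensorHom_ofIso, ofIso_trans]
    refine congrArg ofIso (PolyIso.ext ?_ ?_ ?_) <;> ext1 <;> exact prod.triangle _ _)

lemma braid_naturality (f : D ⟶ E) (f' : D' ⟶ E') :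
    tensorHom f f' ≫ ofIso (braidIso E E') = ofIso (braidIso D D') ≫ tensorHom f' f := by
  obtain ⟨S, s, rfl⟩ := exists_hom_eq f
  obtain ⟨S', s', rfl⟩ := exists_hom_eq f'
  rw [tensorHom_hom, tensorHom_hom]
  exact SimData.hom_square (D := D.tensor D') (E := E.tensor E') (D' := D'.tensor D)
    (E' := E'.tensor E) (square_braiding s s')

lemma braid_braid (D E : Diag C) : ofIso (braidIso D E) ≫ ofIso (braidIso E D) = 𝟙 _ := by
  rw [ofIso_trans, ← ofIso_refl]
  refine congrArg ofIso (PolyIso.ext ?_ ?_ ?_) <;> ext1 <;> exact prod.symmetry' _ _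

lemma hexagon (D E F : Diag C) :
    ofIso (assocIso D E F) ≫ ofIso (braidIso D (E.tensor F)) ≫ ofIso (assocIso E F D) =
    tensorHom (ofIso (braidIso D E)) (𝟙 F) ≫ ofIso (assocIso E D F) ≫
      tensorHom (𝟙 E) (ofIso (braidIso D F)) := by
  rw [← ofIso_refl, ← ofIso_refl, tensorHom_ofIso, tensorHom_ofIso, ofIso_trans, ofIso_trans,
    ofIso_trans, ofIso_trans]
  refine congrArg ofIso (PolyIso.ext ?_ ?_ ?_) <;> ext1 <;> exact braiding_hexagon _ _ _

/-- The symmetry of the product of diagrams, as an isomorphism in `Diag C`. -/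
def braid (D E : Diag C) : D.tensor E ≅ E.tensor D where
  hom := ofIso (braidIso D E)
  inv := ofIso (braidIso E D)
  hom_inv_id := braid_braid D E
  inv_hom_id := braid_braid E D

instance : SymmetricCategory (Diag C) where
  braiding D E := braid D E
  braiding_naturality_right _ _ _ _ := braid_naturality _ _
  braiding_naturality_left _ _ := braid_naturality _ _
  hexagon_forward D E F := hexagon D E F
  hexagon_reverse D E F := by
    refine (Iso.inv_eq_inv ((α_ D E F).symm ≪≫ braid (D ⊗ E) F ≪≫ (α_ F D E).symm)
      (whiskerLeftIso D (braid E F) ≪≫ (α_ D F E).symm ≪≫ whiskerRightIso (braid D F) E)).mp ?_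
    exact (Category.assoc _ _ _).trans ((hexagon F D E).trans (Category.assoc _ _ _).symm)
  symmetry D E := braid_braid D E

end Diag

/-! ### The internal hom of polynomial diagrams -/

namespace PolyDiagram
variable {J K : C} (P : PolyDiagram J J) (Q : PolyDiagram K K)

/-- The polynomial diagram sending a family `X ⟶ P.A` to the family, over `(a, k)`, of the pairs of
a shape `b` of `Q` over `k` and a map from the positions of `b` to the fibre of `X` over `a`. -/
abbrev innerPoly : PolyDiagram P.A (P.A ⨯ K) where
  D := P.A ⨯ Q.D
  A := P.A ⨯ Q.A
  n := prod.fst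
  d := prod.map (𝟙 _) Q.d
  a := prod.map (𝟙 _) Q.a

/-- The polynomial diagram of the dependent product along `P.A × K ⟶ J × K`. -/
abbrev outerPoly : PolyDiagram (P.A ⨯ K) (J ⨯ K) where
  D := P.A ⨯ K
  A := J ⨯ K
  n := 𝟙 _
  d := prod.map P.a (𝟙 K)
  a := 𝟙 _

/-- The family, over `(a, k)`, of the pairs of a shape `b` of `Q` over `k` and a map from the
positions of `b` to those of `a`. -/
abbrev inner : Over (P.A ⨯ K) := (innerPoly P Q).ext.toFunctor.obj (Over.mk P.d)

/-- The shapes of the internal hom from `P` to `Q`: over `(j, k)`, the dependent product of `inner`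
over the shapes of `P` over `j`. -/
def homA : C := ((outerPoly P (K := K)).ext.toFunctor.obj (inner P Q)).left

/-- The base point of a shape of the internal hom. -/
def homa : homA P Q ⟶ J ⨯ K := (outerPoly P (K := K)).shape (inner P Q)

variable {P Q} {Y Z : C}

section
variable (α : Z ⟶ homA P Q) (a : Z ⟶ P.A) (h : a ≫ P.a = (α ≫ homa P Q) ≫ prod.fst)

/-- The value of a shape of the internal hom at a shape of `P`. -/
def innerElt : Z ⟶ (inner P Q).left :=
  ev (P := outerPoly P) (x := inner P Q) α (prod.lift a ((α ≫ homa P Q) ≫ prod.snd)) (by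
    rw [prod.lift_map, h, Category.comp_id]
    apply prod.hom_ext
    · rw [prod.lift_fst]; rfl
    · rw [prod.lift_snd]; rfl)

lemma innerElt_shape : innerElt α a h ≫ (innerPoly P Q).shape _ =
    prod.lift a (innerElt α a h ≫ (innerPoly P Q).shape _ ≫ prod.snd) := by
  have e : (innerElt α a h ≫ (innerPoly P Q).shape (Over.mk P.d)) ≫ prod.map (𝟙 _) Q.a =
      prod.lift a ((α ≫ homa P Q) ≫ prod.snd) := by
    refine (Category.assoc _ _ _).trans ((ev_hom (P := outerPoly P) (x := inner P Q) α _ _).trans ?_)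
    exact Category.comp_id _
  apply prod.hom_ext
  · have e' := congrArg (fun k => k ≫ prod.fst) e
    simp only [Category.assoc, prod.map_fst, Category.comp_id] at e'
    rw [prod.lift_fst, Category.assoc, e', prod.lift_fst]
  · rw [prod.lift_snd, Category.assoc]

/-- The action component of a shape of the internal hom. -/
def homAct : Z ⟶ Q.A := innerElt α a h ≫ (innerPoly P Q).shape _ ≫ prod.snd

lemma homAct_a : homAct α a h ≫ Q.a = (α ≫ homa P Q) ≫ prod.snd := by
  have e : (innerElt α a h ≫ (innerPoly P Q).shape (Over.mk P.d)) ≫ prod.map (𝟙 _) Q.a =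
      prod.lift a ((α ≫ homa P Q) ≫ prod.snd) := by
    refine (Category.assoc _ _ _).trans ((ev_hom (P := outerPoly P) (x := inner P Q) α _ _).trans ?_)
    exact Category.comp_id _
  rw [← prod.lift_snd a ((α ≫ homa P Q) ≫ prod.snd), ← e, Category.assoc _ (prod.map _ _),
    prod.map_snd, homAct]
  simp only [Category.assoc]

variable (d : Z ⟶ Q.D) (w : d ≫ Q.d = homAct α a h)

/-- The response component of a shape of the internal hom. -/
def homResp : Z ⟶ P.D :=
  ev (P := innerPoly P Q) (x := Over.mk P.d) (innerElt α a h) (prod.lift a d) (by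
    rw [innerElt_shape, prod.lift_map, w, Category.comp_id, homAct])

lemma homResp_d : homResp α a h d w ≫ P.d = a :=
  (ev_hom (P := innerPoly P Q) (x := Over.mk P.d) _ _ _).trans (prod.lift_fst _ _)

end

lemma comp_innerElt (t : Y ⟶ Z) {α : Z ⟶ homA P Q} {a : Z ⟶ P.A} {α' : Y ⟶ homA P Q} {a' : Y ⟶ P.A}
    (hα : t ≫ α = α') (ha : t ≫ a = a') (h : a ≫ P.a = (α ≫ homa P Q) ≫ prod.fst)
    (h' : a' ≫ P.a = (α' ≫ homa P Q) ≫ prod.fst) : t ≫ innerElt α a h = innerElt α' a' h' := by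
  subst hα ha
  refine (comp_ev (P := outerPoly P) (x := inner P Q) t _ _ _).trans (ev_congr rfl ?_)
  rw [prod.comp_lift]
  simp only [Category.assoc]

lemma comp_homAct (t : Y ⟶ Z) {α : Z ⟶ homA P Q} {a : Z ⟶ P.A} {α' : Y ⟶ homA P Q} {a' : Y ⟶ P.A}
    (hα : t ≫ α = α') (ha : t ≫ a = a') (h : a ≫ P.a = (α ≫ homa P Q) ≫ prod.fst)
    (h' : a' ≫ P.a = (α' ≫ homa P Q) ≫ prod.fst) : t ≫ homAct α a h = homAct α' a' h' := by
  rw [homAct, ← Category.assoc, comp_innerElt t hα ha h h', homAct]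

lemma comp_homResp (t : Y ⟶ Z) {α : Z ⟶ homA P Q} {a : Z ⟶ P.A} {α' : Y ⟶ homA P Q} {a' : Y ⟶ P.A}
    {d : Z ⟶ Q.D} {d' : Y ⟶ Q.D}
    (hα : t ≫ α = α') (ha : t ≫ a = a') (hd : t ≫ d = d')
    (h : a ≫ P.a = (α ≫ homa P Q) ≫ prod.fst)
    (h' : a' ≫ P.a = (α' ≫ homa P Q) ≫ prod.fst) (w : d ≫ Q.d = homAct α a h)
    (w' : d' ≫ Q.d = homAct α' a' h') : t ≫ homResp α a h d w = homResp α' a' h' d' w' := by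
  refine (comp_ev (P := innerPoly P Q) (x := Over.mk P.d) t _ _ _).trans
    (ev_congr (comp_innerElt t hα ha h h') ?_)
  rw [prod.comp_lift, ha, hd]

lemma homAct_congr {α α' : Z ⟶ homA P Q} {a a' : Z ⟶ P.A} (hα : α = α') (ha : a = a')
    (h : a ≫ P.a = (α ≫ homa P Q) ≫ prod.fst) (h' : a' ≫ P.a = (α' ≫ homa P Q) ≫ prod.fst) :
    homAct α a h = homAct α' a' h' := by subst hα ha; rfl

lemma homResp_congr {α α' : Z ⟶ homA P Q} {a a' : Z ⟶ P.A} {d d' : Z ⟶ Q.D} (hα : α = α')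
    (ha : a = a') (hd : d = d') (h : a ≫ P.a = (α ≫ homa P Q) ≫ prod.fst)
    (h' : a' ≫ P.a = (α' ≫ homa P Q) ≫ prod.fst) (w : d ≫ Q.d = homAct α a h)
    (w' : d' ≫ Q.d = homAct α' a' h') : homResp α a h d w = homResp α' a' h' d' w' := by
  subst hα ha hd; rfl

lemma inner_ext {e e' : Z ⟶ (inner P Q).left}
    (hs : e ≫ (innerPoly P Q).shape _ = e' ≫ (innerPoly P Q).shape _)
    (hv : ∀ {Y : C} (t : Y ⟶ Z) (δ : Y ⟶ P.A ⨯ Q.D)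
      (h : δ ≫ prod.map (𝟙 _) Q.d = (t ≫ e) ≫ (innerPoly P Q).shape _)
      (h' : δ ≫ prod.map (𝟙 _) Q.d = (t ≫ e') ≫ (innerPoly P Q).shape _),
        ev (P := innerPoly P Q) (x := Over.mk P.d) (t ≫ e) δ h =
          ev (P := innerPoly P Q) (x := Over.mk P.d) (t ≫ e') δ h') : e = e' :=
  elt_ext (P := innerPoly P Q) (x := Over.mk P.d) hs hv

/-- A shape of the internal hom is determined by its base point and its two components. -/
lemma homA_ext {α β : Z ⟶ homA P Q} (hb : α ≫ homa P Q = β ≫ homa P Q)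
    (hact : ∀ {Y : C} (t : Y ⟶ Z) (a : Y ⟶ P.A) (h : a ≫ P.a = ((t ≫ α) ≫ homa P Q) ≫ prod.fst)
      (h' : a ≫ P.a = ((t ≫ β) ≫ homa P Q) ≫ prod.fst),
      homAct (t ≫ α) a h = homAct (t ≫ β) a h')
    (hresp : ∀ {Y : C} (t : Y ⟶ Z) (a : Y ⟶ P.A) (h : a ≫ P.a = ((t ≫ α) ≫ homa P Q) ≫ prod.fst)
      (h' : a ≫ P.a = ((t ≫ β) ≫ homa P Q) ≫ prod.fst) (d : Y ⟶ Q.D)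
      (w : d ≫ Q.d = homAct (t ≫ α) a h) (w' : d ≫ Q.d = homAct (t ≫ β) a h'),
      homResp (t ≫ α) a h d w = homResp (t ≫ β) a h' d w') : α = β := by
  refine elt_ext (P := outerPoly P) (x := inner P Q) hb fun {Y} t δ h h' => ?_
  have ha : ∀ γ : Y ⟶ homA P Q, δ ≫ prod.map P.a (𝟙 K) = γ ≫ homa P Q →
      (δ ≫ prod.fst) ≫ P.a = (γ ≫ homa P Q) ≫ prod.fst ∧
        δ = prod.lift (δ ≫ prod.fst) ((γ ≫ homa P Q) ≫ prod.snd) := fun γ k => by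
    refine ⟨by rw [← k, Category.assoc, Category.assoc, prod.map_fst], ?_⟩
    rw [← k, Category.assoc, prod.map_snd, Category.comp_id]
    apply prod.hom_ext
    · rw [prod.lift_fst]
    · rw [prod.lift_snd]
  obtain ⟨h₁, e₁⟩ := ha (t ≫ α) h
  obtain ⟨h₂, e₂⟩ := ha (t ≫ β) h'
  have key : innerElt (t ≫ α) (δ ≫ prod.fst) h₁ = innerElt (t ≫ β) (δ ≫ prod.fst) h₂ := by
    refine inner_ext ?_ fun {X} s δ' k k' => ?_
    · rw [innerElt_shape, innerElt_shape]
      exact congrArg _ (hact t _ h₁ h₂)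
    · have c : ∀ γ : Y ⟶ homA P Q, (δ ≫ prod.fst) ≫ P.a = (γ ≫ homa P Q) ≫ prod.fst →
          (s ≫ δ ≫ prod.fst) ≫ P.a = ((s ≫ γ) ≫ homa P Q) ≫ prod.fst := fun γ k => by
        rw [Category.assoc, k]; simp only [Category.assoc]
      have e₃ : δ' = prod.lift (s ≫ δ ≫ prod.fst) (δ' ≫ prod.snd) := by
        have k₁ := congrArg (fun m => m ≫ prod.fst) k
        simp only [Category.assoc, prod.map_fst, Category.comp_id, innerElt_shape, prod.lift_fst] at k₁
        rw [← k₁]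
        apply prod.hom_ext
        · rw [prod.lift_fst]
        · rw [prod.lift_snd]
      have w : ∀ (γ : Y ⟶ homA P Q) (m : (δ ≫ prod.fst) ≫ P.a = (γ ≫ homa P Q) ≫ prod.fst),
          δ' ≫ prod.map (𝟙 _) Q.d = (s ≫ innerElt γ (δ ≫ prod.fst) m) ≫ (innerPoly P Q).shape _ →
          (δ' ≫ prod.snd) ≫ Q.d = homAct (s ≫ γ) (s ≫ δ ≫ prod.fst) (c γ m) := fun γ m k => by
        have k₁ := congrArg (fun m => m ≫ prod.snd) k
        simp only [Category.assoc, prod.map_snd] at k₁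
        rw [Category.assoc, k₁, ← comp_homAct s rfl rfl m, homAct]
      refine (ev_congr (comp_innerElt s rfl rfl h₁ (c _ h₁)) e₃).trans (Eq.trans ?_
        (ev_congr (comp_innerElt s rfl rfl h₂ (c _ h₂)) e₃).symm)
      have q₁ : s ≫ t ≫ α = (s ≫ t) ≫ α := (Category.assoc _ _ _).symm
      have q₂ : s ≫ t ≫ β = (s ≫ t) ≫ β := (Category.assoc _ _ _).symm
      have h₁' : (s ≫ δ ≫ prod.fst) ≫ P.a = (((s ≫ t) ≫ α) ≫ homa P Q) ≫ prod.fst := by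
        rw [← q₁]; exact c _ h₁
      have h₂' : (s ≫ δ ≫ prod.fst) ≫ P.a = (((s ≫ t) ≫ β) ≫ homa P Q) ≫ prod.fst := by
        rw [← q₂]; exact c _ h₂
      exact (homResp_congr q₁ rfl rfl (c _ h₁) h₁' (w _ _ k)
        ((w _ _ k).trans (homAct_congr q₁ rfl _ _))).trans ((hresp (s ≫ t) _ h₁' h₂' _ _
          ((w _ _ k').trans (homAct_congr q₂ rfl _ _))).trans
          (homResp_congr q₂ rfl rfl (c _ h₂) h₂' (w _ _ k') _).symm)
  exact (ev_congr rfl e₁).trans (key.trans (ev_congr rfl e₂).symm)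

lemma position_eq {a : Z ⟶ P.A} {b : Z ⟶ Q.A} {δ : Y ⟶ P.A ⨯ Q.D} {t : Y ⟶ Z}
    (w : δ ≫ prod.map (𝟙 _) Q.d = t ≫ prod.lift a b) :
    δ ≫ prod.fst = t ≫ a ∧ (δ ≫ prod.snd) ≫ Q.d = t ≫ b := by
  have k₁ := congrArg (fun m => m ≫ prod.fst) w
  have k₂ := congrArg (fun m => m ≫ prod.snd) w
  simp only [Category.assoc, prod.map_fst, prod.map_snd, Category.comp_id, prod.lift_fst,
    prod.lift_snd] at k₁ k₂
  exact ⟨k₁, by rw [Category.assoc, k₂]⟩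

section innerMk
variable (a : Z ⟶ P.A) (b : Z ⟶ Q.A)
  (g : ∀ {Y : C} (t : Y ⟶ Z) (d : Y ⟶ Q.D), d ≫ Q.d = t ≫ b → (Y ⟶ P.D))

lemma innerMk_aux
    (g_d : ∀ {Y : C} (t : Y ⟶ Z) (d : Y ⟶ Q.D) (w : d ≫ Q.d = t ≫ b), g t d w ≫ P.d = t ≫ a)
    {Y : C} (t : Y ⟶ Z) (δ : Y ⟶ P.A ⨯ Q.D)
    (w : δ ≫ prod.map (𝟙 _) Q.d = t ≫ prod.lift a b) :
    g t (δ ≫ prod.snd) (position_eq w).2 ≫ P.d = δ ≫ prod.fst := by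
  rw [g_d, (position_eq w).1]

variable (g_d : ∀ {Y : C} (t : Y ⟶ Z) (d : Y ⟶ Q.D) (w : d ≫ Q.d = t ≫ b), g t d w ≫ P.d = t ≫ a)

/-- The element of `inner` with given components. -/
def innerMk : Z ⟶ (inner P Q).left :=
  elt (P := innerPoly P Q) (x := Over.mk P.d) (prod.lift a b)
    (fun {_} t δ w => g t (δ ≫ prod.snd) (position_eq w).2) (innerMk_aux a b g g_d)

lemma innerMk_shape : innerMk a b g g_d ≫ (innerPoly P Q).shape _ = prod.lift a b :=
  elt_shape (P := innerPoly P Q) _ _ (innerMk_aux a b g g_d)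

lemma ev_innerMk (comp_g : ∀ {X Y : C} (s : X ⟶ Y) (t : Y ⟶ Z) (d : Y ⟶ Q.D)
      (w : d ≫ Q.d = t ≫ b) (w' : (s ≫ d) ≫ Q.d = (s ≫ t) ≫ b),
      s ≫ g t d w = g (s ≫ t) (s ≫ d) w')
    {Y : C} (t : Y ⟶ Z) (e : Y ⟶ (inner P Q).left) (he : e = t ≫ innerMk a b g g_d)
    (δ : Y ⟶ P.A ⨯ Q.D) (w : δ ≫ prod.map (𝟙 _) Q.d = e ≫ (innerPoly P Q).shape _)
    (d : Y ⟶ Q.D) (hd : δ ≫ prod.snd = d) (w' : d ≫ Q.d = t ≫ b) :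
    ev (P := innerPoly P Q) (x := Over.mk P.d) e δ w = g t d w' := by
  subst hd
  refine ev_elt (P := innerPoly P Q) (x := Over.mk P.d) _ _ (innerMk_aux a b g g_d) ?_ t e he δ w
  intro _ _ s t δ w
  refine (comp_g s t _ _ ?_).trans ?_
  · rw [Category.assoc, (position_eq w).2, Category.assoc]
  · congr 1
    exact (Category.assoc _ _ _).symm

end innerMk

section mk
variable (jk : Z ⟶ J ⨯ K)
  (f : ∀ {Y : C} (t : Y ⟶ Z) (a : Y ⟶ P.A), a ≫ P.a = (t ≫ jk) ≫ prod.fst → (Y ⟶ Q.A))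
  (f_a : ∀ {Y : C} (t : Y ⟶ Z) (a : Y ⟶ P.A) (h : a ≫ P.a = (t ≫ jk) ≫ prod.fst),
    f t a h ≫ Q.a = (t ≫ jk) ≫ prod.snd)
  (comp_f : ∀ {X Y : C} (s : X ⟶ Y) (t : Y ⟶ Z) (a : Y ⟶ P.A)
    (h : a ≫ P.a = (t ≫ jk) ≫ prod.fst) (h' : (s ≫ a) ≫ P.a = ((s ≫ t) ≫ jk) ≫ prod.fst),
    s ≫ f t a h = f (s ≫ t) (s ≫ a) h')
  (g : ∀ {Y : C} (t : Y ⟶ Z) (a : Y ⟶ P.A) (h : a ≫ P.a = (t ≫ jk) ≫ prod.fst) (d : Y ⟶ Q.D),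
    d ≫ Q.d = f t a h → (Y ⟶ P.D))
  (g_d : ∀ {Y : C} (t : Y ⟶ Z) (a : Y ⟶ P.A) (h : a ≫ P.a = (t ≫ jk) ≫ prod.fst) (d : Y ⟶ Q.D)
    (w : d ≫ Q.d = f t a h), g t a h d w ≫ P.d = a)
  (comp_g : ∀ {X Y : C} (s : X ⟶ Y) (t : Y ⟶ Z) (a : Y ⟶ P.A)
    (h : a ≫ P.a = (t ≫ jk) ≫ prod.fst) (h' : (s ≫ a) ≫ P.a = ((s ≫ t) ≫ jk) ≫ prod.fst)
    (d : Y ⟶ Q.D) (w : d ≫ Q.d = f t a h) (w' : (s ≫ d) ≫ Q.d = f (s ≫ t) (s ≫ a) h'),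
    s ≫ g t a h d w = g (s ≫ t) (s ≫ a) h' (s ≫ d) w')

include f_a comp_f g_d comp_g in
/-- Shapes of the internal hom with prescribed natural components exist. -/
lemma exists_homA : ∃ α : Z ⟶ homA P Q, α ≫ homa P Q = jk ∧
    ∀ {Y : C} (t : Y ⟶ Z) (a : Y ⟶ P.A) (h : a ≫ P.a = (t ≫ jk) ≫ prod.fst)
      (h' : a ≫ P.a = ((t ≫ α) ≫ homa P Q) ≫ prod.fst),
      homAct (t ≫ α) a h' = f t a h ∧ ∀ (d : Y ⟶ Q.D) (w : d ≫ Q.d = f t a h)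
        (w' : d ≫ Q.d = homAct (t ≫ α) a h'), homResp (t ≫ α) a h' d w' = g t a h d w := by
  have c : ∀ {Y : C} (t : Y ⟶ Z) (δ : Y ⟶ P.A ⨯ K), δ ≫ prod.map P.a (𝟙 K) = t ≫ jk →
      (δ ≫ prod.fst) ≫ P.a = (t ≫ jk) ≫ prod.fst ∧ δ ≫ prod.snd = (t ≫ jk) ≫ prod.snd :=
    fun t δ k => by
      rw [← k]; simp only [Category.assoc, prod.map_fst, prod.map_snd, Category.comp_id, and_self]
  have c' : ∀ {X Y : C} (s : X ⟶ Y) (t : Y ⟶ Z) (a : Y ⟶ P.A), a ≫ P.a = (t ≫ jk) ≫ prod.fst →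
      (s ≫ a) ≫ P.a = ((s ≫ t) ≫ jk) ≫ prod.fst := fun s t a k => by
    rw [Category.assoc, k]; simp only [Category.assoc]
  have w' : ∀ {X Y : C} (s : X ⟶ Y) (t : Y ⟶ Z) (a : Y ⟶ P.A) (h : a ≫ P.a = (t ≫ jk) ≫ prod.fst)
      (d : X ⟶ Q.D), d ≫ Q.d = s ≫ f t a h → d ≫ Q.d = f (s ≫ t) (s ≫ a) (c' s t a h) :=
    fun s t a h d k => k.trans (comp_f s t a h _)
  let F : ∀ {Y : C} (t : Y ⟶ Z) (a : Y ⟶ P.A), a ≫ P.a = (t ≫ jk) ≫ prod.fst →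
      (Y ⟶ (inner P Q).left) := fun t a h => innerMk a (f t a h)
    (fun s d k => g (s ≫ t) (s ≫ a) (c' s t a h) d (w' s t a h d k)) (fun s d k => g_d _ _ _ _ _)
  have g_congr : ∀ {X : C} {t t' : X ⟶ Z} {a a' : X ⟶ P.A} {d d' : X ⟶ Q.D} (_ : t = t') (_ : a = a')
      (_ : d = d') (h : a ≫ P.a = (t ≫ jk) ≫ prod.fst) (h' : a' ≫ P.a = (t' ≫ jk) ≫ prod.fst)
      (w : d ≫ Q.d = f t a h) (w' : d' ≫ Q.d = f t' a' h'), g t a h d w = g t' a' h' d' w' := by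
    intro X t t' a a' d d' e₁ e₂ e₃ h h' w w'
    subst e₁ e₂ e₃; rfl
  have comp_G : ∀ {Y : C} (t : Y ⟶ Z) (a : Y ⟶ P.A) (h : a ≫ P.a = (t ≫ jk) ≫ prod.fst) {X X' : C}
      (s : X ⟶ X') (t' : X' ⟶ Y) (d : X' ⟶ Q.D) (w : d ≫ Q.d = t' ≫ f t a h)
      (k : (s ≫ d) ≫ Q.d = (s ≫ t') ≫ f t a h),
      s ≫ g (t' ≫ t) (t' ≫ a) (c' t' t a h) d (w' t' t a h d w) =
        g ((s ≫ t') ≫ t) ((s ≫ t') ≫ a) (c' (s ≫ t') t a h) (s ≫ d) (w' (s ≫ t') t a h _ k) := by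
    intro Y t a h X X' s t' d w k
    rw [comp_g s _ _ _ (c' s _ _ (c' t' t a h)) _ _ (by
      rw [Category.assoc, w' t' t a h d w, comp_f])]
    exact g_congr (Category.assoc _ _ _).symm (Category.assoc _ _ _).symm rfl _ _ _ _
  have F_congr : ∀ {X : C} {t t' : X ⟶ Z} {a a' : X ⟶ P.A} (_ : t = t') (_ : a = a')
      (h : a ≫ P.a = (t ≫ jk) ≫ prod.fst) (h' : a' ≫ P.a = (t' ≫ jk) ≫ prod.fst),
      F t a h = F t' a' h' := by
    intro X t t' a a' e₁ e₂ h h'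
    subst e₁ e₂; rfl
  have F_hom : ∀ {Y : C} (t : Y ⟶ Z) (a : Y ⟶ P.A) (h : a ≫ P.a = (t ≫ jk) ≫ prod.fst),
      F t a h ≫ (inner P Q).hom = prod.lift a ((t ≫ jk) ≫ prod.snd) := fun t a h => by
    refine (Category.assoc _ _ _).symm.trans ((congrArg (fun k => k ≫ prod.map (𝟙 _) Q.a)
      (innerMk_shape a (f t a h) _ _)).trans ?_)
    rw [prod.lift_map, Category.comp_id, f_a]
  have hx : ∀ {Y : C} (t : Y ⟶ Z) (δ : Y ⟶ P.A ⨯ K) (k : δ ≫ prod.map P.a (𝟙 K) = t ≫ jk),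
      F t (δ ≫ prod.fst) (c t δ k).1 ≫ (inner P Q).hom = δ ≫ 𝟙 _ := fun t δ k => by
    rw [F_hom, ← (c t δ k).2, Category.comp_id]
    apply prod.hom_ext
    · rw [prod.lift_fst]
    · rw [prod.lift_snd]
  have comp_F : ∀ {X Y : C} (s : X ⟶ Y) (t : Y ⟶ Z) (a : Y ⟶ P.A)
      (h : a ≫ P.a = (t ≫ jk) ≫ prod.fst), s ≫ F t a h = F (s ≫ t) (s ≫ a) (c' s t a h) := by
    intro X Y s t a h
    refine inner_ext ?_ fun {X'} s' δ k k' => ?_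
    · rw [Category.assoc, innerMk_shape, innerMk_shape, prod.comp_lift, comp_f s t a h (c' s t a h)]
    · have k₁ : δ ≫ prod.map (𝟙 _) Q.d = (s' ≫ s) ≫ prod.lift a (f t a h) := by
        rw [k, Category.assoc, Category.assoc, innerMk_shape, Category.assoc]
      have k₂ : δ ≫ prod.map (𝟙 _) Q.d =
          s' ≫ prod.lift (s ≫ a) (f (s ≫ t) (s ≫ a) (c' s t a h)) := by
        rw [k', Category.assoc, innerMk_shape]
      rw [ev_innerMk a _ _ _ (comp_G t a h) (s' ≫ s) _ (Category.assoc _ _ _).symm δ k _ rfl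
          (position_eq k₁).2, ev_innerMk (s ≫ a) _ _ _ (comp_G (s ≫ t) (s ≫ a) (c' s t a h)) s' _ rfl
          δ k' _ rfl (position_eq k₂).2]
      exact g_congr (Category.assoc _ _ _) (Category.assoc _ _ _) rfl _ _ _ _
  let α : Z ⟶ homA P Q := elt (P := outerPoly P) (x := inner P Q) jk
    (fun {Y} t δ k => F t (δ ≫ prod.fst) (c t δ k).1) hx
  have hα : α ≫ homa P Q = jk := elt_shape (P := outerPoly P) (x := inner P Q) _ _ hx
  have e : ∀ {Y : C} (t : Y ⟶ Z) (a : Y ⟶ P.A) (h : a ≫ P.a = (t ≫ jk) ≫ prod.fst)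
      (h' : a ≫ P.a = ((t ≫ α) ≫ homa P Q) ≫ prod.fst), innerElt (t ≫ α) a h' = F t a h := by
    intro Y t a h h'
    refine (ev_elt (P := outerPoly P) (x := inner P Q) jk _ hx ?_ t (t ≫ α) rfl _ _).trans ?_
    · intro X Y s t δ k
      rw [comp_F]
      exact F_congr rfl (Category.assoc _ _ _).symm _ _
    · exact F_congr rfl (prod.lift_fst _ _) _ _
  refine ⟨α, hα, fun {Y} t a h h' => ⟨?_, fun d w w' => ?_⟩⟩
  · rw [homAct, e t a h h', ← Category.assoc, innerMk_shape, prod.lift_snd]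
  · have k : d ≫ Q.d = 𝟙 Y ≫ f t a h := by rw [w, Category.id_comp]
    refine (ev_congr (e t a h h') rfl).trans ?_
    refine (ev_innerMk a _ _ _ (comp_G t a h) (𝟙 _) _ (Category.id_comp _).symm _ _ d
      (prod.lift_snd _ _) k).trans ?_
    exact g_congr (Category.id_comp _) (Category.id_comp _) rfl _ _ _ _

end mk

end PolyDiagram

namespace PolyDiagram
variable {J K : C} (P : PolyDiagram J J) (Q : PolyDiagram K K)

/-- The pairs of a shape of the internal hom and a shape of `P` over the same base point. -/
abbrev homPair : C := pullback (homa P Q ≫ prod.fst) P.a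

lemma homPair_cond : pullback.snd (homa P Q ≫ prod.fst) P.a ≫ P.a =
    (pullback.fst (homa P Q ≫ prod.fst) P.a ≫ homa P Q) ≫ prod.fst := by
  rw [← pullback.condition, Category.assoc]

/-- The generic action component of the internal hom. -/
def homPairAct : homPair P Q ⟶ Q.A :=
  homAct (pullback.fst (homa P Q ≫ prod.fst) P.a) (pullback.snd _ _) (homPair_cond P Q)

/-- The positions of the internal hom: triples of a shape `α` of the internal hom, a shape `a` of
`P`, and a position of the shape of `Q` assigned to `a` by `α`. -/
abbrev homD : C := pullback (homPairAct P Q) Q.d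

/-- The first component of a position of the internal hom. -/
def homD₁ : homD P Q ⟶ homA P Q := pullback.fst (homPairAct P Q) Q.d ≫ pullback.fst _ _

/-- The second component of a position of the internal hom. -/
def homD₂ : homD P Q ⟶ P.A := pullback.fst (homPairAct P Q) Q.d ≫ pullback.snd _ _

/-- The third component of a position of the internal hom. -/
def homD₃ : homD P Q ⟶ Q.D := pullback.snd (homPairAct P Q) Q.d

variable {P Q} {Y Z : C}

lemma homD_cond (δ : Z ⟶ homD P Q) :
    (δ ≫ homD₂ P Q) ≫ P.a = ((δ ≫ homD₁ P Q) ≫ homa P Q) ≫ prod.fst := by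
  have := homPair_cond P Q
  simp only [homD₁, homD₂, Category.assoc] at this ⊢
  rw [this]

lemma homD_w (δ : Z ⟶ homD P Q) :
    (δ ≫ homD₃ P Q) ≫ Q.d = homAct (δ ≫ homD₁ P Q) (δ ≫ homD₂ P Q) (homD_cond δ) := by
  have e : homD₃ P Q ≫ Q.d = pullback.fst (homPairAct P Q) Q.d ≫ homPairAct P Q :=
    pullback.condition.symm
  rw [Category.assoc, e, ← Category.assoc]
  exact comp_homAct _ (Category.assoc _ _ _) (Category.assoc _ _ _) _ _

/-- The position of the internal hom with given components. -/
def homPos (α : Z ⟶ homA P Q) (a : Z ⟶ P.A) (h : a ≫ P.a = (α ≫ homa P Q) ≫ prod.fst)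
    (d : Z ⟶ Q.D) (w : d ≫ Q.d = homAct α a h) : Z ⟶ homD P Q :=
  pullback.lift (pullback.lift α a (by rw [h, Category.assoc])) d (by
    rw [w, homPairAct]
    exact comp_homAct _ (pullback.lift_fst _ _ _) (pullback.lift_snd _ _ _) _ _)

section
variable (α : Z ⟶ homA P Q) (a : Z ⟶ P.A) (h : a ≫ P.a = (α ≫ homa P Q) ≫ prod.fst)
    (d : Z ⟶ Q.D) (w : d ≫ Q.d = homAct α a h)

lemma homPos₁ : homPos α a h d w ≫ homD₁ P Q = α := by
  rw [homPos, homD₁, pullback.lift_fst_assoc, pullback.lift_fst]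
lemma homPos₂ : homPos α a h d w ≫ homD₂ P Q = a := by
  rw [homPos, homD₂, pullback.lift_fst_assoc, pullback.lift_snd]
lemma homPos₃ : homPos α a h d w ≫ homD₃ P Q = d := by
  rw [homPos, homD₃, pullback.lift_snd]

end

lemma homD_ext {δ δ' : Z ⟶ homD P Q} (h₁ : δ ≫ homD₁ P Q = δ' ≫ homD₁ P Q)
    (h₂ : δ ≫ homD₂ P Q = δ' ≫ homD₂ P Q) (h₃ : δ ≫ homD₃ P Q = δ' ≫ homD₃ P Q) : δ = δ' := by
  apply pullback.hom_ext
  · apply pullback.hom_ext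
    · simpa only [homD₁, Category.assoc] using h₁
    · simpa only [homD₂, Category.assoc] using h₂
  · exact h₃

variable (P Q) in
/-- The internal hom of polynomial diagrams. Its base points are pairs `(j, k)`. A shape over
`(j, k)` is a translation of the shapes of `P` over `j` into shapes of `Q` over `k`, with a
translation of positions in the opposite direction. A position consists of a shape of `P` and a
position of its translation, and it leads to the pair of the two resulting base points. -/
abbrev ihom : PolyDiagram (J ⨯ K) (J ⨯ K) where
  D := homD P Q
  A := homA P Q
  n := prod.lift (homResp (𝟙 _ ≫ homD₁ P Q) (𝟙 _ ≫ homD₂ P Q) (homD_cond _) (𝟙 _ ≫ homD₃ P Q)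
    (homD_w _) ≫ P.n) (homD₃ P Q ≫ Q.n)
  d := homD₁ P Q
  a := homa P Q

lemma ihom_n_fst (δ : Z ⟶ homD P Q) {α : Z ⟶ homA P Q} {a : Z ⟶ P.A} {d : Z ⟶ Q.D}
    (hα : δ ≫ homD₁ P Q = α) (ha : δ ≫ homD₂ P Q = a) (hd : δ ≫ homD₃ P Q = d)
    (h : a ≫ P.a = (α ≫ homa P Q) ≫ prod.fst) (w : d ≫ Q.d = homAct α a h) :
    (δ ≫ (ihom P Q).n) ≫ prod.fst = homResp α a h d w ≫ P.n := by
  refine (Category.assoc _ _ _).trans ((congrArg (fun k => δ ≫ k) (prod.lift_fst _ _)).trans ?_)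
  rw [← Category.assoc]
  refine congrArg (fun k => k ≫ P.n) (comp_homResp δ ?_ ?_ ?_ _ _ _ _)
  · rw [Category.id_comp, hα]
  · rw [Category.id_comp, ha]
  · rw [Category.id_comp, hd]

lemma ihom_n_snd (δ : Z ⟶ homD P Q) :
    (δ ≫ (ihom P Q).n) ≫ prod.snd = (δ ≫ homD₃ P Q) ≫ Q.n := by
  refine (Category.assoc _ _ _).trans ((congrArg (fun k => δ ≫ k) (prod.lift_snd _ _)).trans ?_)
  rw [← Category.assoc]

lemma homPos_congr {α α' : Z ⟶ homA P Q} {a a' : Z ⟶ P.A} {d d' : Z ⟶ Q.D} (hα : α = α')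
    (ha : a = a') (hd : d = d') (h : a ≫ P.a = (α ≫ homa P Q) ≫ prod.fst)
    (h' : a' ≫ P.a = (α' ≫ homa P Q) ≫ prod.fst) (w : d ≫ Q.d = homAct α a h)
    (w' : d' ≫ Q.d = homAct α' a' h') : homPos α a h d w = homPos α' a' h' d' w' := by
  subst hα ha hd; rfl

lemma comp_homPos (t : Y ⟶ Z) {α : Z ⟶ homA P Q} {a : Z ⟶ P.A} {α' : Y ⟶ homA P Q} {a' : Y ⟶ P.A}
    {d : Z ⟶ Q.D} {d' : Y ⟶ Q.D}
    (hα : t ≫ α = α') (ha : t ≫ a = a') (hd : t ≫ d = d')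
    (h : a ≫ P.a = (α ≫ homa P Q) ≫ prod.fst)
    (h' : a' ≫ P.a = (α' ≫ homa P Q) ≫ prod.fst) (w : d ≫ Q.d = homAct α a h)
    (w' : d' ≫ Q.d = homAct α' a' h') : t ≫ homPos α a h d w = homPos α' a' h' d' w' := by
  apply homD_ext
  · rw [Category.assoc, homPos₁, homPos₁, hα]
  · rw [Category.assoc, homPos₂, homPos₂, ha]
  · rw [Category.assoc, homPos₃, homPos₃, hd]

end PolyDiagram

/-! ### Currying of simulations -/

namespace LinSpan
variable {L J K : C}

/-- The span from `L × J` to `K` corresponding to a span from `L` to `J × K`. -/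
abbrev uncurry (S : LinSpan L (J ⨯ K)) : LinSpan (L ⨯ J) K :=
  ⟨S.R, prod.lift S.l (S.r ≫ prod.fst), S.r ≫ prod.snd⟩

/-- The span from `L` to `J × K` corresponding to a span from `L × J` to `K`. -/
abbrev curry (S : LinSpan (L ⨯ J) K) : LinSpan L (J ⨯ K) :=
  ⟨S.R, S.l ≫ prod.fst, prod.lift (S.l ≫ prod.snd) S.r⟩

lemma uncurry_l_fst (S : LinSpan L (J ⨯ K)) : S.uncurry.l ≫ Limits.prod.fst = S.l :=
  prod.lift_fst _ _

lemma uncurry_l_snd (S : LinSpan L (J ⨯ K)) :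
    S.uncurry.l ≫ Limits.prod.snd = S.r ≫ Limits.prod.fst :=
  prod.lift_snd _ _

lemma curry_r_fst (S : LinSpan (L ⨯ J) K) :
    S.curry.r ≫ Limits.prod.fst = S.l ≫ Limits.prod.snd :=
  prod.lift_fst _ _

lemma curry_r_snd (S : LinSpan (L ⨯ J) K) : S.curry.r ≫ Limits.prod.snd = S.r :=
  prod.lift_snd _ _

end LinSpan

namespace SimData
open PolyDiagram LinSpan

variable {L J K : C} {N : PolyDiagram L L} {P : PolyDiagram J J} {Q : PolyDiagram K K}
  {S : LinSpan L (J ⨯ K)} {Y Z : C}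

section uncurry

lemma uncurry_cond₁ {r : Z ⟶ S.R} {x : Z ⟶ (N.tensor P).A}
    (h : r ≫ S.uncurry.l = x ≫ (N.tensor P).a) : r ≫ S.l = (x ≫ fstA N P) ≫ N.a := by
  rw [Category.assoc, ← tensor_a_fst, ← uncurry_l_fst, ← Category.assoc, ← Category.assoc, ← h]

variable (u : SimData N (ihom P Q) S)

lemma uncurry_cond₂ {r : Z ⟶ S.R} {x : Z ⟶ (N.tensor P).A}
    (h : r ≫ S.uncurry.l = x ≫ (N.tensor P).a) : (x ≫ sndA N P) ≫ P.a =
      ((u.act r (x ≫ fstA N P) (uncurry_cond₁ h)) ≫ homa P Q) ≫ prod.fst := by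
  rw [Category.assoc, ← tensor_a_snd, ← Category.assoc, ← h]
  refine Eq.trans ?_ (congrArg (fun k => k ≫ prod.fst) (u.act_a r _ (uncurry_cond₁ h))).symm
  rw [Category.assoc, Category.assoc]
  exact congrArg (fun k => r ≫ k) S.uncurry_l_snd

section
variable (r : Z ⟶ S.R) (x : Z ⟶ (N.tensor P).A) (h : r ≫ S.uncurry.l = x ≫ (N.tensor P).a)

/-- The action of an uncurried simulation. -/
def uncurryAct : Z ⟶ Q.A := homAct _ _ (u.uncurry_cond₂ h)

variable (d : Z ⟶ Q.D) (w : d ≫ Q.d = u.uncurryAct r x h)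

/-- The position of the internal hom used by an uncurried simulation. -/
def uncurryPos : Z ⟶ (ihom P Q).D := homPos _ _ (u.uncurry_cond₂ h) d w

lemma uncurryPos_d : u.uncurryPos r x h d w ≫ (ihom P Q).d =
    u.act r (x ≫ fstA N P) (uncurry_cond₁ h) := homPos₁ _ _ _ _ _

/-- The response of an uncurried simulation. -/
def uncurryResp : Z ⟶ (N.tensor P).D := pairD
    (u.resp r (x ≫ fstA N P) (uncurry_cond₁ h) (u.uncurryPos r x h d w) (u.uncurryPos_d r x h d w))
    (homResp _ _ (u.uncurry_cond₂ h) d w)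

/-- The successor state of an uncurried simulation. -/
def uncurryNext : Z ⟶ S.R :=
  u.next r (x ≫ fstA N P) (uncurry_cond₁ h) (u.uncurryPos r x h d w) (u.uncurryPos_d r x h d w)

end

variable {r : Z ⟶ S.R} {x : Z ⟶ (N.tensor P).A} (h : r ≫ S.uncurry.l = x ≫ (N.tensor P).a)
  {d : Z ⟶ Q.D} (w : d ≫ Q.d = u.uncurryAct r x h) (t : Y ⟶ Z)
  (h' : (t ≫ r) ≫ S.uncurry.l = (t ≫ x) ≫ (N.tensor P).a)
  (w' : (t ≫ d) ≫ Q.d = u.uncurryAct (t ≫ r) (t ≫ x) h')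

lemma comp_act_fst : t ≫ u.act r (x ≫ fstA N P) (uncurry_cond₁ h) =
    u.act (t ≫ r) ((t ≫ x) ≫ fstA N P) (uncurry_cond₁ h') :=
  u.comp_act_eq t rfl (Category.assoc _ _ _).symm _ _

lemma comp_uncurryAct : t ≫ u.uncurryAct r x h = u.uncurryAct (t ≫ r) (t ≫ x) h' :=
  comp_homAct t (u.comp_act_fst h t h') (Category.assoc _ _ _).symm _ _

lemma comp_uncurryPos : t ≫ u.uncurryPos r x h d w =
    u.uncurryPos (t ≫ r) (t ≫ x) h' (t ≫ d) w' :=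
  comp_homPos t (u.comp_act_fst h t h') (Category.assoc _ _ _).symm rfl _ _ _ _

lemma comp_uncurryResp : t ≫ u.uncurryResp r x h d w =
    u.uncurryResp (t ≫ r) (t ≫ x) h' (t ≫ d) w' :=
  (comp_pairD _ _ _).trans (congrArg₂ pairD
    (u.comp_resp_eq t rfl (Category.assoc _ _ _).symm (u.comp_uncurryPos h w t h' w')
      (uncurry_cond₁ h) (uncurry_cond₁ h') (u.uncurryPos_d _ _ _ _ _) (u.uncurryPos_d _ _ _ _ _))
    (comp_homResp t (u.comp_act_fst h t h') (Category.assoc _ _ _).symm rfl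
      (u.uncurry_cond₂ h) (u.uncurry_cond₂ h') w w'))

lemma comp_uncurryNext : t ≫ u.uncurryNext r x h d w =
    u.uncurryNext (t ≫ r) (t ≫ x) h' (t ≫ d) w' :=
  u.comp_next_eq t rfl (Category.assoc _ _ _).symm (u.comp_uncurryPos h w t h' w')
    (uncurry_cond₁ h) (uncurry_cond₁ h') (u.uncurryPos_d _ _ _ _ _) (u.uncurryPos_d _ _ _ _ _)

lemma uncurryAct_a : u.uncurryAct r x h ≫ Q.a = r ≫ S.uncurry.r :=
  (homAct_a _ _ _).trans ((congrArg (fun k => k ≫ prod.snd) (u.act_a r _ (uncurry_cond₁ h))).trans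
    (Category.assoc _ _ _))

lemma uncurryResp_d : u.uncurryResp r x h d w ≫ (N.tensor P).d = x := by
  apply tensorA_ext
  · rw [Category.assoc, tensor_d_fst, ← Category.assoc, uncurryResp, pairD_fst, resp_d]
  · rw [Category.assoc, tensor_d_snd, ← Category.assoc, uncurryResp, pairD_snd]
    exact homResp_d _ _ _ _ _

lemma uncurryNext_l : u.uncurryNext r x h d w ≫ S.uncurry.l =
    u.uncurryResp r x h d w ≫ (N.tensor P).n := by
  have hr := u.next_r r (x ≫ fstA N P) (uncurry_cond₁ h) (u.uncurryPos r x h d w)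
    (u.uncurryPos_d r x h d w)
  have hl := u.next_l r (x ≫ fstA N P) (uncurry_cond₁ h) (u.uncurryPos r x h d w)
    (u.uncurryPos_d r x h d w)
  apply prod.hom_ext
  · rw [Category.assoc _ (N.tensor P).n, tensor_n_fst, ← Category.assoc _ (fstD N P), uncurryResp,
      pairD_fst, ← hl, Category.assoc]
    exact congrArg _ S.uncurry_l_fst
  · rw [Category.assoc _ (N.tensor P).n, tensor_n_snd, ← Category.assoc _ (sndD N P), uncurryResp,
      pairD_snd]
    refine Eq.trans ?_ (ihom_n_fst (u.uncurryPos r x h d w) (homPos₁ _ _ _ _ _)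
      (homPos₂ _ _ _ _ _) (homPos₃ _ _ _ _ _) _ _)
    rw [← hr, Category.assoc, Category.assoc]
    exact congrArg _ S.uncurry_l_snd

lemma uncurryNext_r : u.uncurryNext r x h d w ≫ S.uncurry.r = d ≫ Q.n := by
  have hr := u.next_r r (x ≫ fstA N P) (uncurry_cond₁ h) (u.uncurryPos r x h d w)
    (u.uncurryPos_d r x h d w)
  have e := ihom_n_snd (u.uncurryPos r x h d w)
  rw [show u.uncurryPos r x h d w ≫ homD₃ P Q = d from homPos₃ _ _ _ _ _, ← hr] at e
  rw [← e]
  exact (Category.assoc _ _ _).symm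

/-- Uncurrying of simulation data. -/
def uncurry : SimData (N.tensor P) Q S.uncurry where
  act := u.uncurryAct
  comp_act t _ _ h := u.comp_uncurryAct h t _
  act_a _ _ h := u.uncurryAct_a h
  resp := u.uncurryResp
  comp_resp t _ _ h _ w := u.comp_uncurryResp h w t _ _
  resp_d _ _ h _ w := u.uncurryResp_d h w
  next := u.uncurryNext
  comp_next t _ _ h _ w := u.comp_uncurryNext h w t _ _
  next_l _ _ h _ w := u.uncurryNext_l h w
  next_r _ _ h _ w := u.uncurryNext_r h w

end uncurry

end SimData

namespace SimData
open PolyDiagram LinSpan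

variable {L J K : C} {N : PolyDiagram L L} {P : PolyDiagram J J} {Q : PolyDiagram K K}
  {Y Z : C}

section uncurry
variable {S S' : LinSpan L (J ⨯ K)} {u : SimData N (ihom P Q) S} {u' : SimData N (ihom P Q) S'}

section
variable {r : Z ⟶ S.R} {x : Z ⟶ (N.tensor P).A} {b : Z ⟶ N.A} {a : Z ⟶ P.A}
  (h : r ≫ S.uncurry.l = x ≫ (N.tensor P).a) (hb : x ≫ fstA N P = b) (ha : x ≫ sndA N P = a)
  (h₁ : r ≫ S.l = b ≫ N.a) (h₂ : a ≫ P.a = (u.act r b h₁ ≫ homa P Q) ≫ prod.fst)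

include hb ha in
lemma uncurryAct_eq : u.uncurryAct r x h = homAct (u.act r b h₁) a h₂ := by
  subst hb ha; rfl

variable {d : Z ⟶ Q.D} (w : d ≫ Q.d = u.uncurryAct r x h) (w₁ : d ≫ Q.d = homAct (u.act r b h₁) a h₂)

include hb ha in
lemma uncurryResp_snd : u.uncurryResp r x h d w ≫ sndD N P = homResp (u.act r b h₁) a h₂ d w₁ := by
  subst hb ha; exact pairD_snd _ _

variable {δ : Z ⟶ (ihom P Q).D} (h₃ : δ ≫ homD₂ P Q = a) (h₄ : δ ≫ homD₃ P Q = d)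
  (w₂ : δ ≫ (ihom P Q).d = u.act r b h₁)

include hb ha h₃ h₄ w₂ in
/-- A position of the internal hom is recovered from its components. -/
lemma uncurryPos_eq : u.uncurryPos r x h d w = δ := by
  subst hb
  apply homD_ext
  · rw [w₂]; exact homPos₁ _ _ _ _ _
  · rw [h₃, ← ha]; exact homPos₂ _ _ _ _ _
  · rw [h₄]; exact homPos₃ _ _ _ _ _

include hb ha h₃ h₄ in
lemma uncurryResp_fst : u.uncurryResp r x h d w ≫ fstD N P = u.resp r b h₁ δ w₂ := by
  rw [uncurryResp, pairD_fst]
  exact u.resp_congr rfl hb (uncurryPos_eq h hb ha h₁ w h₃ h₄ w₂) _ _ _ _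

include hb ha h₃ h₄ in
lemma uncurryNext_eq : u.uncurryNext r x h d w = u.next r b h₁ δ w₂ :=
  u.next_congr rfl hb (uncurryPos_eq h hb ha h₁ w h₃ h₄ w₂) _ _ _ _

end

/-- Uncurrying is well-defined on equivalence classes. -/
lemma Along.uncurry {f : S.R ⟶ S'.R} (h : Along f u u') :
    Along (S := S.uncurry) (S' := S'.uncurry) f u.uncurry u'.uncurry where
  l := by
    apply prod.hom_ext
    · rw [Category.assoc, uncurry_l_fst, uncurry_l_fst]; exact h.l
    · rw [Category.assoc, uncurry_l_snd, uncurry_l_snd, ← Category.assoc, h.r]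
  r := by
    have := h.r
    exact (Category.assoc _ _ _).symm.trans (congrArg (fun k => k ≫ prod.snd) this)
  act r x k k' := homAct_congr (h.act _ _ (uncurry_cond₁ k) (uncurry_cond₁ k')) rfl
    (u.uncurry_cond₂ k) (u'.uncurry_cond₂ k')
  resp r x k k' d w w' := by
    have e := h.act r _ (uncurry_cond₁ k) (uncurry_cond₁ k')
    have eδ : u.uncurryPos r x k d w = u'.uncurryPos (r ≫ f) x k' d w' := homPos_congr e rfl rfl
      (u.uncurry_cond₂ k) (u'.uncurry_cond₂ k') w w'
    have w₁ : u.uncurryPos r x k d w ≫ (ihom P Q).d = u'.act (r ≫ f) _ (uncurry_cond₁ k') := by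
      rw [eδ]; exact u'.uncurryPos_d _ _ _ _ _
    refine congrArg₂ pairD ((h.resp r _ (uncurry_cond₁ k) (uncurry_cond₁ k') _
      (u.uncurryPos_d _ _ _ _ _) w₁).trans (u'.resp_congr rfl rfl eδ _ _ _ _)) ?_
    exact homResp_congr e rfl rfl (u.uncurry_cond₂ k) (u'.uncurry_cond₂ k') w w'
  next r x k k' d w w' := by
    have e := h.act r _ (uncurry_cond₁ k) (uncurry_cond₁ k')
    have eδ : u.uncurryPos r x k d w = u'.uncurryPos (r ≫ f) x k' d w' := homPos_congr e rfl rfl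
      (u.uncurry_cond₂ k) (u'.uncurry_cond₂ k') w w'
    have w₁ : u.uncurryPos r x k d w ≫ (ihom P Q).d = u'.act (r ≫ f) _ (uncurry_cond₁ k') := by
      rw [eδ]; exact u'.uncurryPos_d _ _ _ _ _
    exact (h.next r _ (uncurry_cond₁ k) (uncurry_cond₁ k') _
      (u.uncurryPos_d _ _ _ _ _) w₁).trans (u'.next_congr rfl rfl eδ _ _ _ _)

lemma pair_cond {r : Z ⟶ S.R} {b : Z ⟶ N.A} {a : Z ⟶ P.A} (h : r ≫ S.l = b ≫ N.a)
    (h₂ : a ≫ P.a = (u.act r b h ≫ homa P Q) ≫ prod.fst) :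
    r ≫ S.uncurry.l = pairA b a ≫ (N.tensor P).a := by
  apply prod.hom_ext
  · rw [Category.assoc, uncurry_l_fst, Category.assoc, tensor_a_fst, ← Category.assoc (pairA b a),
      pairA_fst, h]
  · rw [Category.assoc, uncurry_l_snd, Category.assoc, tensor_a_snd, ← Category.assoc (pairA b a),
      pairA_snd, h₂, ← Category.assoc]
    exact congrArg (fun k => k ≫ prod.fst) (u.act_a r b h).symm

/-- Uncurrying is injective on equivalence classes. -/
lemma Along.of_uncurry {f : S.R ⟶ S'.R}
    (h : Along (S := S.uncurry) (S' := S'.uncurry) f u.uncurry u'.uncurry) : Along f u u' := by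
  have hl : f ≫ S'.l = S.l := by
    rw [← uncurry_l_fst, ← uncurry_l_fst, ← Category.assoc]
    exact congrArg (fun k => k ≫ prod.fst) h.l
  have hr : f ≫ S'.r = S.r := by
    apply prod.hom_ext
    · rw [Category.assoc, ← uncurry_l_snd, ← uncurry_l_snd, ← Category.assoc]
      exact congrArg (fun k => k ≫ prod.snd) h.l
    · rw [Category.assoc]; exact h.r
  have hhact : ∀ {Z : C} (r : Z ⟶ S.R) (b : Z ⟶ N.A) (k : r ≫ S.l = b ≫ N.a)
      (k' : (r ≫ f) ≫ S'.l = b ≫ N.a), u.act r b k = u'.act (r ≫ f) b k' := by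
    intro Z r b k k'
    have hb : u.act r b k ≫ homa P Q = u'.act (r ≫ f) b k' ≫ homa P Q :=
      (u.act_a r b k).trans (((u'.act_a _ b k').trans (by rw [Category.assoc, hr])).symm)
    have c₁ : ∀ {Y : C} (t : Y ⟶ Z), (t ≫ r) ≫ S.l = (t ≫ b) ≫ N.a := fun t => by
      rw [Category.assoc, k, Category.assoc]
    have c₂ : ∀ {Y : C} (t : Y ⟶ Z), ((t ≫ r) ≫ f) ≫ S'.l = (t ≫ b) ≫ N.a := fun t => by
      rw [Category.assoc (t ≫ r), hl, c₁]
    have e₁ : ∀ {Y : C} (t : Y ⟶ Z), t ≫ u.act r b k = u.act (t ≫ r) (t ≫ b) (c₁ t) := fun t =>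
      u.comp_act _ _ _ _
    have e₂ : ∀ {Y : C} (t : Y ⟶ Z), t ≫ u'.act (r ≫ f) b k' =
        u'.act ((t ≫ r) ≫ f) (t ≫ b) (c₂ t) := fun t =>
      u'.comp_act_eq t (Category.assoc _ _ _).symm rfl _ _
    refine homA_ext hb ?_ ?_
    · intro Y t a m m'
      have m₁ : a ≫ P.a = (u.act (t ≫ r) (t ≫ b) (c₁ t) ≫ homa P Q) ≫ prod.fst := by rw [m, e₁]
      have m₂ : a ≫ P.a = (u'.act ((t ≫ r) ≫ f) (t ≫ b) (c₂ t) ≫ homa P Q) ≫ prod.fst := by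
        rw [m', e₂]
      exact (homAct_congr (e₁ t) rfl m m₁).trans ((uncurryAct_eq (pair_cond _ m₁) (pairA_fst _ _)
        (pairA_snd _ _) (c₁ t) m₁).symm.trans ((h.act (t ≫ r) (pairA (t ≫ b) a) (pair_cond _ m₁)
        (pair_cond _ m₂)).trans ((uncurryAct_eq (pair_cond _ m₂) (pairA_fst _ _)
        (pairA_snd _ _) (c₂ t) m₂).trans (homAct_congr (e₂ t).symm rfl _ _))))
    · intro Y t a m m' d w w'
      have m₁ : a ≫ P.a = (u.act (t ≫ r) (t ≫ b) (c₁ t) ≫ homa P Q) ≫ prod.fst := by rw [m, e₁]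
      have m₂ : a ≫ P.a = (u'.act ((t ≫ r) ≫ f) (t ≫ b) (c₂ t) ≫ homa P Q) ≫ prod.fst := by
        rw [m', e₂]
      have w₁ : d ≫ Q.d = homAct _ a m₁ := w.trans (homAct_congr (e₁ t) rfl m m₁)
      have w₂ : d ≫ Q.d = homAct _ a m₂ := w'.trans (homAct_congr (e₂ t) rfl m' m₂)
      have v₁ := w₁.trans (uncurryAct_eq (pair_cond _ m₁) (pairA_fst _ _)
        (pairA_snd _ _) (c₁ t) m₁).symm
      have v₂ := w₂.trans (uncurryAct_eq (pair_cond _ m₂) (pairA_fst _ _)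
        (pairA_snd _ _) (c₂ t) m₂).symm
      exact (homResp_congr (e₁ t) rfl rfl m m₁ w w₁).trans
        ((uncurryResp_snd (pair_cond _ m₁) (pairA_fst _ _) (pairA_snd _ _) (c₁ t) m₁ v₁ w₁).symm.trans
        ((congrArg (fun k => k ≫ sndD N P) (h.resp (t ≫ r) (pairA (t ≫ b) a) (pair_cond _ m₁)
        (pair_cond _ m₂) d v₁ v₂)).trans
        ((uncurryResp_snd (pair_cond _ m₂) (pairA_fst _ _) (pairA_snd _ _) (c₂ t) m₂ v₂ w₂).trans
        (homResp_congr (e₂ t).symm rfl rfl m₂ m' w₂ w'))))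
  have aux : ∀ {Z : C} (r : Z ⟶ S.R) (b : Z ⟶ N.A) (k : r ≫ S.l = b ≫ N.a)
      (k' : (r ≫ f) ≫ S'.l = b ≫ N.a) (δ : Z ⟶ (ihom P Q).D)
      (w : δ ≫ (ihom P Q).d = u.act r b k) (w' : δ ≫ (ihom P Q).d = u'.act (r ≫ f) b k'),
      u.resp r b k δ w = u'.resp (r ≫ f) b k' δ w' ∧
        u.next r b k δ w ≫ f = u'.next (r ≫ f) b k' δ w' := by
    intro Z r b k k' δ w w'
    have m₁ : (δ ≫ homD₂ P Q) ≫ P.a = (u.act r b k ≫ homa P Q) ≫ prod.fst := by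
      rw [← w]; exact homD_cond δ
    have m₂ : (δ ≫ homD₂ P Q) ≫ P.a = (u'.act (r ≫ f) b k' ≫ homa P Q) ≫ prod.fst := by
      rw [← w']; exact homD_cond δ
    have v₁ : (δ ≫ homD₃ P Q) ≫ Q.d = u.uncurryAct r (pairA b (δ ≫ homD₂ P Q)) (pair_cond _ m₁) :=
      ((homD_w δ).trans (homAct_congr w rfl (homD_cond δ) m₁)).trans
        (uncurryAct_eq _ (pairA_fst _ _) (pairA_snd _ _) k m₁).symm
    have v₂ : (δ ≫ homD₃ P Q) ≫ Q.d =
        u'.uncurryAct (r ≫ f) (pairA b (δ ≫ homD₂ P Q)) (pair_cond _ m₂) :=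
      ((homD_w δ).trans (homAct_congr w' rfl (homD_cond δ) m₂)).trans
        (uncurryAct_eq _ (pairA_fst _ _) (pairA_snd _ _) k' m₂).symm
    constructor
    · exact (uncurryResp_fst _ (pairA_fst _ _) (pairA_snd _ _) k v₁ rfl rfl w).symm.trans
        ((congrArg (fun k => k ≫ fstD N P) (h.resp _ _ _ _ _ v₁ v₂)).trans
        (uncurryResp_fst _ (pairA_fst _ _) (pairA_snd _ _) k' v₂ rfl rfl w'))
    · exact (congrArg (fun k => k ≫ f)
        (uncurryNext_eq _ (pairA_fst _ _) (pairA_snd _ _) k v₁ rfl rfl w).symm).trans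
        ((h.next _ _ _ _ _ v₁ v₂).trans
        (uncurryNext_eq _ (pairA_fst _ _) (pairA_snd _ _) k' v₂ rfl rfl w'))
  exact ⟨hl, hr, hhact, fun r b k k' δ w w' => (aux r b k k' δ w w').1,
    fun r b k k' δ w w' => (aux r b k k' δ w w').2⟩

end uncurry

end SimData

namespace SimData
open PolyDiagram LinSpan

variable {L J K : C} {N : PolyDiagram L L} {P : PolyDiagram J J} {Q : PolyDiagram K K}
  {S : LinSpan (L ⨯ J) K} {Y Z : C}

section curry

lemma curry_cond {r : Z ⟶ S.R} {b : Z ⟶ N.A} {a : Z ⟶ P.A} (h : r ≫ S.curry.l = b ≫ N.a)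
    (h' : a ≫ P.a = (r ≫ S.curry.r) ≫ prod.fst) : r ≫ S.l = pairA b a ≫ (N.tensor P).a := by
  apply prod.hom_ext
  · rw [Category.assoc, Category.assoc, tensor_a_fst, ← Category.assoc (pairA b a), pairA_fst, ← h]
  · rw [Category.assoc, Category.assoc, tensor_a_snd, ← Category.assoc (pairA b a), pairA_snd, h',
      Category.assoc, curry_r_fst]

lemma comp_curry_cond {r : Z ⟶ S.R} {b : Z ⟶ N.A} (h : r ≫ S.curry.l = b ≫ N.a) (t : Y ⟶ Z) :
    (t ≫ r) ≫ S.curry.l = (t ≫ b) ≫ N.a := by rw [Category.assoc, h, Category.assoc]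

variable (s : SimData (N.tensor P) Q S)

/-- The shape of the internal hom which sends a shape `a` of `P` to the action simulating `(b,
a)`. -/
lemma exists_curryAct (r : Z ⟶ S.R) (b : Z ⟶ N.A) (h : r ≫ S.curry.l = b ≫ N.a) :
    ∃ α : Z ⟶ homA P Q, α ≫ homa P Q = r ≫ S.curry.r ∧
      ∀ {Y : C} (t : Y ⟶ Z) (a : Y ⟶ P.A) (h₁ : (t ≫ r) ≫ S.l = pairA (t ≫ b) a ≫ (N.tensor P).a)
        (h' : a ≫ P.a = ((t ≫ α) ≫ homa P Q) ≫ prod.fst),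
      homAct (t ≫ α) a h' = s.act (t ≫ r) (pairA (t ≫ b) a) h₁ ∧
        ∀ (d : Y ⟶ Q.D) (w : d ≫ Q.d = s.act (t ≫ r) (pairA (t ≫ b) a) h₁)
        (w' : d ≫ Q.d = homAct (t ≫ α) a h'), homResp (t ≫ α) a h' d w' =
          s.resp (t ≫ r) (pairA (t ≫ b) a) h₁ d w ≫ sndD N P := by
  have c : ∀ {Y : C} (t : Y ⟶ Z) (a : Y ⟶ P.A), a ≫ P.a = (t ≫ r ≫ S.curry.r) ≫ prod.fst →
      (t ≫ r) ≫ S.l = pairA (t ≫ b) a ≫ (N.tensor P).a := fun t a k =>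
    curry_cond (comp_curry_cond h t) (by rw [k]; simp only [Category.assoc])
  have ep : ∀ {X Y : C} (y : X ⟶ Y) (t : Y ⟶ Z) (a : Y ⟶ P.A),
      y ≫ pairA (Q := P) (t ≫ b) a = pairA ((y ≫ t) ≫ b) (y ≫ a) := fun y t a => by
    rw [comp_pairA, Category.assoc]
  obtain ⟨α, hα, e⟩ := exists_homA (P := P) (Q := Q) (r ≫ S.curry.r)
    (fun {Y} t a k => s.act (t ≫ r) (pairA (t ≫ b) a) (c t a k))
    (fun {Y} t a k => by
      refine (s.act_a _ _ _).trans ?_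
      rw [Category.assoc, Category.assoc, Category.assoc, curry_r_snd])
    (fun y t a k k' => s.comp_act_eq y (Category.assoc _ _ _).symm (ep y t a) _ (c _ _ k'))
    (fun {Y} t a k d w => s.resp (t ≫ r) (pairA (t ≫ b) a) (c t a k) d w ≫ sndD N P)
    (fun t a k d w => by
      rw [Category.assoc, ← tensor_d_snd, ← Category.assoc, s.resp_d]; exact pairA_snd _ _)
    (fun y t a k k' d w w' => by
      rw [← Category.assoc]
      exact congrArg (fun k => k ≫ sndD N P) (s.comp_resp_eq y (Category.assoc _ _ _).symm
        (ep y t a) rfl _ (c _ _ k') _ w'))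
  refine ⟨α, hα, fun {Y} t a h₁ h' => ?_⟩
  have k : a ≫ P.a = (t ≫ r ≫ S.curry.r) ≫ prod.fst := by rw [h', Category.assoc t, hα]
  exact ⟨(e t a k h').1, (e t a k h').2⟩

section
variable (r : Z ⟶ S.R) (b : Z ⟶ N.A) (h : r ≫ S.curry.l = b ≫ N.a)

/-- The action of a curried simulation, which is unique by `homA_ext`. -/
def curryAct : Z ⟶ homA P Q := (s.exists_curryAct r b h).choose

lemma curryAct_homa : s.curryAct r b h ≫ homa P Q = r ≫ S.curry.r :=
  (s.exists_curryAct r b h).choose_spec.1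

variable {r b}
variable {α : Y ⟶ homA P Q} {r' : Y ⟶ S.R} {b' : Y ⟶ N.A} {a : Y ⟶ P.A} (t : Y ⟶ Z)
  (hα : α = t ≫ s.curryAct r b h) (hr : t ≫ r = r') (hb : t ≫ b = b')
  (h₁ : r' ≫ S.l = pairA b' a ≫ (N.tensor P).a)
  (h' : a ≫ P.a = (α ≫ homa P Q) ≫ prod.fst)

include hα hr hb in
lemma homAct_curryAct : homAct α a h' = s.act r' (pairA b' a) h₁ := by
  subst hα hr hb
  exact ((s.exists_curryAct r b h).choose_spec.2 t a h₁ h').1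

include hα hr hb in
lemma homResp_curryAct (d : Y ⟶ Q.D) (w : d ≫ Q.d = s.act r' (pairA b' a) h₁)
    (w' : d ≫ Q.d = homAct α a h') :
    homResp α a h' d w' = s.resp r' (pairA b' a) h₁ d w ≫ sndD N P := by
  subst hα hr hb
  exact ((s.exists_curryAct r b h).choose_spec.2 t a h₁ h').2 d w w'

end

lemma comp_curryAct {r : Z ⟶ S.R} {b : Z ⟶ N.A} (h : r ≫ S.curry.l = b ≫ N.a) (t : Y ⟶ Z)
    (h' : (t ≫ r) ≫ S.curry.l = (t ≫ b) ≫ N.a) :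
    t ≫ s.curryAct r b h = s.curryAct (t ≫ r) (t ≫ b) h' := by
  have c : ∀ {X : C} (y : X ⟶ Y) (a : X ⟶ P.A),
      a ≫ P.a = ((y ≫ s.curryAct (t ≫ r) (t ≫ b) h') ≫ homa P Q) ≫ prod.fst →
      (y ≫ t ≫ r) ≫ S.l = pairA (y ≫ t ≫ b) a ≫ (N.tensor P).a := fun y a k =>
    curry_cond (comp_curry_cond h' y) (by
      rw [k, Category.assoc y, curryAct_homa, ← Category.assoc y])
  refine homA_ext ?_ ?_ ?_
  · rw [Category.assoc, curryAct_homa, curryAct_homa, Category.assoc]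
  · intro X y a k k'
    rw [s.homAct_curryAct h' y rfl rfl rfl (c y a k') k']
    exact s.homAct_curryAct h (y ≫ t) (Category.assoc _ _ _).symm (Category.assoc _ _ _)
      (Category.assoc _ _ _) (c y a k') k
  · intro X y a k k' d w w'
    have w₁ := w'.trans (s.homAct_curryAct h' y rfl rfl rfl (c y a k') k')
    rw [s.homResp_curryAct h' y rfl rfl rfl (c y a k') k' d w₁ w']
    exact s.homResp_curryAct h (y ≫ t) (Category.assoc _ _ _).symm (Category.assoc _ _ _)
      (Category.assoc _ _ _) (c y a k') k d w₁ w

section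
variable {r : Z ⟶ S.R} {b : Z ⟶ N.A} (h : r ≫ S.curry.l = b ≫ N.a) {δ : Z ⟶ (ihom P Q).D}
  (w : δ ≫ (ihom P Q).d = s.curryAct r b h)

include w in
lemma curry_shape_cond : r ≫ S.l = pairA b (δ ≫ homD₂ P Q) ≫ (N.tensor P).a :=
  curry_cond h (by rw [← s.curryAct_homa r b h, ← w]; exact homD_cond δ)

lemma curry_position_cond :
    (δ ≫ homD₃ P Q) ≫ Q.d = s.act r (pairA b (δ ≫ homD₂ P Q)) (s.curry_shape_cond h w) :=
  (homD_w δ).trans (s.homAct_curryAct h (𝟙 _) (w.trans (Category.id_comp _).symm)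
    (Category.id_comp _) (Category.id_comp _) _ _)

end

section
variable (r : Z ⟶ S.R) (b : Z ⟶ N.A) (h : r ≫ S.curry.l = b ≫ N.a) (δ : Z ⟶ (ihom P Q).D)
  (w : δ ≫ (ihom P Q).d = s.curryAct r b h)

/-- The response of a curried simulation. -/
def curryResp : Z ⟶ N.D :=
  s.resp r _ (s.curry_shape_cond h w) _ (s.curry_position_cond h w) ≫ fstD N P

/-- The successor state of a curried simulation. -/
def curryNext : Z ⟶ S.R := s.next r _ (s.curry_shape_cond h w) _ (s.curry_position_cond h w)

end

section
variable {r : Z ⟶ S.R} {b : Z ⟶ N.A} (h : r ≫ S.curry.l = b ≫ N.a) {δ : Z ⟶ (ihom P Q).D}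
  (w : δ ≫ (ihom P Q).d = s.curryAct r b h)

lemma curryResp_d : s.curryResp r b h δ w ≫ N.d = b := by
  rw [curryResp, Category.assoc, ← tensor_d_fst, ← Category.assoc, resp_d]
  exact pairA_fst _ _

lemma curryNext_l : s.curryNext r b h δ w ≫ S.curry.l = s.curryResp r b h δ w ≫ N.n := by
  have e := s.next_l r _ (s.curry_shape_cond h w) _ (s.curry_position_cond h w)
  rw [curryResp, Category.assoc, ← tensor_n_fst]
  refine (Category.assoc _ _ _).symm.trans
    ((congrArg (fun k => k ≫ prod.fst) e).trans (Category.assoc _ _ _))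

lemma curryNext_r : s.curryNext r b h δ w ≫ S.curry.r = δ ≫ (ihom P Q).n := by
  have e := s.next_l r _ (s.curry_shape_cond h w) _ (s.curry_position_cond h w)
  apply prod.hom_ext
  · have c := homD_cond δ
    rw [ihom_n_fst δ rfl rfl rfl c (homD_w δ), Category.assoc, curry_r_fst]
    rw [s.homResp_curryAct h (𝟙 _) (w.trans (Category.id_comp _).symm) (Category.id_comp _)
      (Category.id_comp _) (s.curry_shape_cond h w) c _ (s.curry_position_cond h w) (homD_w δ),
      Category.assoc, ← tensor_n_snd, ← Category.assoc, ← Category.assoc, ← e]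
    rfl
  · rw [ihom_n_snd, Category.assoc, curry_r_snd]
    exact s.next_r _ _ _ _ _

variable (t : Y ⟶ Z) (h' : (t ≫ r) ≫ S.curry.l = (t ≫ b) ≫ N.a)
  (w' : (t ≫ δ) ≫ (ihom P Q).d = s.curryAct (t ≫ r) (t ≫ b) h')

lemma comp_curry_pair : t ≫ pairA b (δ ≫ homD₂ P Q) = pairA (t ≫ b) ((t ≫ δ) ≫ homD₂ P Q) := by
  rw [comp_pairA, Category.assoc]

lemma comp_curryResp : t ≫ s.curryResp r b h δ w = s.curryResp (t ≫ r) (t ≫ b) h' (t ≫ δ) w' :=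
  (Category.assoc _ _ _).symm.trans (congrArg (fun k => k ≫ fstD N P)
    (s.comp_resp_eq t rfl (comp_curry_pair t) (Category.assoc _ _ _).symm _
      (s.curry_shape_cond h' w') _ (s.curry_position_cond h' w')))

lemma comp_curryNext : t ≫ s.curryNext r b h δ w = s.curryNext (t ≫ r) (t ≫ b) h' (t ≫ δ) w' :=
  s.comp_next_eq t rfl (comp_curry_pair t) (Category.assoc _ _ _).symm _
      (s.curry_shape_cond h' w') _ (s.curry_position_cond h' w')

end

/-- Currying of simulation data. -/
def curry : SimData N (ihom P Q) S.curry where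
  act := s.curryAct
  comp_act t _ _ h := s.comp_curryAct h t _
  act_a _ _ h := s.curryAct_homa _ _ h
  resp := s.curryResp
  comp_resp t _ _ h _ w := s.comp_curryResp h w t _ _
  resp_d _ _ h _ w := s.curryResp_d h w
  next := s.curryNext
  comp_next t _ _ h _ w := s.comp_curryNext h w t _ _
  next_l _ _ h _ w := s.curryNext_l h w
  next_r _ _ h _ w := s.curryNext_r h w

lemma pairA_eta (x : Z ⟶ (N.tensor P).A) : pairA (x ≫ fstA N P) (x ≫ sndA N P) = x :=
  tensorA_ext (pairA_fst _ _) (pairA_snd _ _)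

lemma pairD_eta (x : Z ⟶ (N.tensor P).D) : pairD (x ≫ fstD N P) (x ≫ sndD N P) = x :=
  tensorD_ext (pairD_fst _ _) (pairD_snd _ _)

/-- Currying is a section of uncurrying. -/
lemma curry_uncurry :
    Along (S := S.curry.uncurry) (S' := S) (Iso.refl S.R).hom s.curry.uncurry s := by
  have e : ∀ {Z : C} (r : Z ⟶ S.R), r ≫ (Iso.refl S.R).hom = r := fun r => Category.comp_id r
  have c : ∀ {Z : C} {r : Z ⟶ S.R} {x : Z ⟶ (N.tensor P).A},
      (r ≫ (Iso.refl S.R).hom) ≫ S.l = x ≫ (N.tensor P).a →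
      r ≫ S.l = pairA (x ≫ fstA N P) (x ≫ sndA N P) ≫ (N.tensor P).a := fun k => by
    rw [pairA_eta, ← k, e]
  have hhact : ∀ {Z : C} (r : Z ⟶ S.R) (x : Z ⟶ (N.tensor P).A)
      (k : r ≫ S.curry.uncurry.l = x ≫ (N.tensor P).a)
      (k' : (r ≫ (Iso.refl S.R).hom) ≫ S.l = x ≫ (N.tensor P).a),
      s.curry.uncurryAct r x k = s.act r (pairA (x ≫ fstA N P) (x ≫ sndA N P)) (c k') :=
    fun r x k k' => s.homAct_curryAct (uncurry_cond₁ (S := S.curry) k) (𝟙 _)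
      (Category.id_comp _).symm (Category.id_comp _)
      (Category.id_comp _) _ _
  refine ⟨?_, ?_, ?_, ?_, ?_⟩
  · refine (Category.id_comp _).trans (prod.hom_ext ?_ ?_)
    · exact S.curry.uncurry_l_fst.symm
    · exact (S.curry.uncurry_l_snd.trans S.curry_r_fst).symm
  · exact (Category.id_comp _).trans S.curry_r_snd.symm
  · intro Z r x k k'
    exact (hhact r x k k').trans (s.act_congr (e r).symm (pairA_eta x) _ _)
  · intro Z r x k k' d w w'
    have k₁ : r ≫ S.curry.l = (x ≫ fstA N P) ≫ N.a := uncurry_cond₁ (S := S.curry) k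
    have w₀ : d ≫ Q.d = s.act r (pairA (x ≫ fstA N P) (x ≫ sndA N P)) (c k') :=
      w.trans (hhact r x k k')
    refine Eq.trans ?_ (s.resp_congr (e r).symm (pairA_eta x) rfl (c k') k' w₀ w')
    refine Eq.trans ?_ (pairD_eta _)
    refine congrArg₂ pairD ?_ ?_
    · refine congrArg (fun k => k ≫ fstD N P) (s.resp_congr rfl ?_ ?_ _ _ _ _)
      · exact congrArg (pairA _) (homPos₂ _ _ _ _ _)
      · exact homPos₃ _ _ _ _ _
    · exact s.homResp_curryAct k₁ (𝟙 _) (Category.id_comp _).symm (Category.id_comp _)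
        (Category.id_comp _) _ _ d w₀ _
  · intro Z r x k k' d w w'
    refine (e _).trans (s.next_congr (e r).symm ?_ ?_ _ _ _ _)
    · exact (congrArg (pairA _) (homPos₂ _ _ _ _ _)).trans (pairA_eta x)
    · exact homPos₃ _ _ _ _ _

end curry

end SimData

namespace SimData
open PolyDiagram LinSpan

section naturality
variable {H L J K : C} {M : PolyDiagram H H} {N : PolyDiagram L L} {P : PolyDiagram J J}
  {Q : PolyDiagram K K} {T : LinSpan H L} {S : LinSpan L (J ⨯ K)} {Z : C}

variable (T S) in
lemma graph_cond (P : PolyDiagram J J) : (T.prod (PolyIso.refl P).graphSpan).compSnd S.uncurry ≫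
      S.r ≫ Limits.prod.fst =
    (T.prod (PolyIso.refl P).graphSpan).compFst S.uncurry ≫ sndR _ _ ≫
      (PolyIso.refl P).graphSpan.r := by
  rw [← uncurry_l_snd, ← prod_r_snd, ← Category.assoc, ← Category.assoc, comp_condition]

variable (T S) in
/-- The comparison between the apexes of the two composites of the naturality of uncurrying. -/
def uncurryApex (P : PolyDiagram J J) :
    ((T.prod (PolyIso.refl P).graphSpan).comp S.uncurry).R ≅ (T.comp S).uncurry.R where
  hom := compPair ((T.prod (PolyIso.refl P).graphSpan).compFst S.uncurry ≫ fstR _ _)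
    ((T.prod (PolyIso.refl P).graphSpan).compSnd S.uncurry) (by
      rw [Category.assoc, ← prod_r_fst, ← Category.assoc, comp_condition, Category.assoc,
        uncurry_l_fst])
  inv := compPair (pairR (T.compFst S) (T.compSnd S ≫ S.r ≫ Limits.prod.fst ≫
    (PolyIso.refl P).toGraph)) (T.compSnd S) (by
      apply prod.hom_ext
      · rw [Category.assoc, prod_r_fst, ← Category.assoc, pairR_fst, Category.assoc,
          uncurry_l_fst, comp_condition]
      · rw [Category.assoc, prod_r_snd, ← Category.assoc, pairR_snd,
          Category.assoc _ _ Limits.prod.snd, uncurry_l_snd]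
        simp only [Category.assoc, PolyIso.toGraph_r]
        exact congrArg _ (congrArg _ (Category.comp_id _)))
  hom_inv_id := by
    apply comp_ext
    · rw [Category.assoc, compPair_fst, comp_pairR, compPair_fst, ← Category.assoc, compPair_snd,
        Category.id_comp]
      apply prodR_ext
      · rw [pairR_fst]
      · rw [pairR_snd]
        have e := congrArg (fun k => k ≫ (PolyIso.refl P).toGraph) (graph_cond T S P)
        simp only [Category.assoc] at e
        refine e.trans (congrArg _ ((congrArg _ ?_).trans (Category.comp_id _)))
        exact (PolyIso.refl P).l_toGraph
    · rw [Category.assoc, compPair_snd, compPair_snd, Category.id_comp]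
  inv_hom_id := by
    apply comp_ext
    · rw [Category.assoc, compPair_fst, ← Category.assoc, compPair_fst, pairR_fst]
      exact (Category.id_comp _).symm
    · rw [Category.assoc, compPair_snd, compPair_snd]
      exact (Category.id_comp _).symm

variable (t : SimData M N T) (u : SimData N (ihom P Q) S)

/-- Uncurrying is natural in the first variable. -/
lemma along_uncurry : Along (uncurryApex T S P).hom
    ((t.tensor (PolyIso.refl P).graph).comp u.uncurry) (t.comp u).uncurry := by
  have hF : ∀ {Z : C} (r : Z ⟶ ((T.prod (PolyIso.refl P).graphSpan).comp S.uncurry).R),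
      (r ≫ (uncurryApex T S P).hom) ≫ T.compFst S =
        (r ≫ (T.prod (PolyIso.refl P).graphSpan).compFst S.uncurry) ≫ fstR _ _ := fun r => by
    rw [Category.assoc, uncurryApex, compPair_fst, Category.assoc]
  have hS : ∀ {Z : C} (r : Z ⟶ ((T.prod (PolyIso.refl P).graphSpan).comp S.uncurry).R),
      (r ≫ (uncurryApex T S P).hom) ≫ T.compSnd S =
        r ≫ (T.prod (PolyIso.refl P).graphSpan).compSnd S.uncurry := fun r => by
    rw [Category.assoc, uncurryApex, compPair_snd]
  -- The two sides have the same intermediate action and the same action in the internal hom.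
  have hmid : ∀ {Z : C} (r : Z ⟶ ((T.prod (PolyIso.refl P).graphSpan).comp S.uncurry).R)
      (x : Z ⟶ (M.tensor P).A)
      (k : r ≫ ((T.prod (PolyIso.refl P).graphSpan).comp S.uncurry).l = x ≫ (M.tensor P).a)
      (k' : (r ≫ (uncurryApex T S P).hom) ≫ (T.comp S).uncurry.l = x ≫ (M.tensor P).a),
      (t.tensor (PolyIso.refl P).graph).midAct (T := S.uncurry) r x k ≫ fstA N P =
        t.midAct (r ≫ (uncurryApex T S P).hom) (x ≫ fstA M P) (uncurry_cond₁ k') :=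
    fun r x k k' => (pairA_fst _ _).trans (t.act_congr (hF r).symm rfl _ _)
  have hsnd : ∀ {Z : C} (r : Z ⟶ ((T.prod (PolyIso.refl P).graphSpan).comp S.uncurry).R)
      (x : Z ⟶ (M.tensor P).A)
      (k : r ≫ ((T.prod (PolyIso.refl P).graphSpan).comp S.uncurry).l = x ≫ (M.tensor P).a),
      (t.tensor (PolyIso.refl P).graph).midAct (T := S.uncurry) r x k ≫ sndA N P = x ≫ sndA M P :=
    fun r x k => (pairA_snd _ _).trans (Category.comp_id _)
  have hc : ∀ {Z : C} (r : Z ⟶ ((T.prod (PolyIso.refl P).graphSpan).comp S.uncurry).R)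
      (x : Z ⟶ (M.tensor P).A)
      (k' : (r ≫ (uncurryApex T S P).hom) ≫ (T.comp S).uncurry.l = x ≫ (M.tensor P).a),
      (r ≫ (T.prod (PolyIso.refl P).graphSpan).compSnd S.uncurry) ≫ S.l =
        t.midAct (r ≫ (uncurryApex T S P).hom) (x ≫ fstA M P) (uncurry_cond₁ k') ≫ N.a :=
    fun r x k' => by rw [← hS]; exact t.mid_cond _ _ _
  have ha : ∀ {Z : C} (r : Z ⟶ ((T.prod (PolyIso.refl P).graphSpan).comp S.uncurry).R)
      (x : Z ⟶ (M.tensor P).A)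
      (k' : (r ≫ (uncurryApex T S P).hom) ≫ (T.comp S).uncurry.l = x ≫ (M.tensor P).a),
      u.act _ _ (hc r x k') =
        (t.comp u).act (r ≫ (uncurryApex T S P).hom) (x ≫ fstA M P) (uncurry_cond₁ k') :=
    fun r x k' => u.act_congr (hS r).symm rfl _ _
  have hj : ∀ {Z : C} (r : Z ⟶ ((T.prod (PolyIso.refl P).graphSpan).comp S.uncurry).R)
      (x : Z ⟶ (M.tensor P).A)
      (k' : (r ≫ (uncurryApex T S P).hom) ≫ (T.comp S).uncurry.l = x ≫ (M.tensor P).a),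
      (x ≫ sndA M P) ≫ P.a = (u.act _ _ (hc r x k') ≫ homa P Q) ≫ prod.fst :=
    fun r x k' => by rw [ha r x k']; exact (t.comp u).uncurry_cond₂ k'
  have aux : ∀ {Z : C} (r : Z ⟶ ((T.prod (PolyIso.refl P).graphSpan).comp S.uncurry).R)
      (x : Z ⟶ (M.tensor P).A)
      (k : r ≫ ((T.prod (PolyIso.refl P).graphSpan).comp S.uncurry).l = x ≫ (M.tensor P).a)
      (k' : (r ≫ (uncurryApex T S P).hom) ≫ (T.comp S).uncurry.l = x ≫ (M.tensor P).a)
      (d : Z ⟶ Q.D)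
      (w : d ≫ Q.d = u.uncurryAct _ _ ((t.tensor (PolyIso.refl P).graph).mid_cond r x k))
      (w' : d ≫ Q.d = (t.comp u).uncurryAct _ x k'),
      u.uncurryResp _ _ _ d w ≫ sndD N P = homResp _ _ ((t.comp u).uncurry_cond₂ k') d w' ∧
      u.uncurryResp _ _ _ d w ≫ fstD N P =
        t.midResp u (r ≫ (uncurryApex T S P).hom) (x ≫ fstA M P) (uncurry_cond₁ k')
          ((t.comp u).uncurryPos _ x k' d w') ((t.comp u).uncurryPos_d _ x k' d w') ∧
      u.uncurryNext _ _ _ d w = u.next ((r ≫ (uncurryApex T S P).hom) ≫ T.compSnd S)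
        (t.midAct (r ≫ (uncurryApex T S P).hom) (x ≫ fstA M P) (uncurry_cond₁ k'))
        (t.mid_cond _ _ _) ((t.comp u).uncurryPos _ x k' d w')
          ((t.comp u).uncurryPos_d _ x k' d w') := by
    intro Z r x k k' d w w'
    have w₁ : d ≫ Q.d = homAct _ _ (hj r x k') :=
      w'.trans (homAct_congr (ha r x k').symm rfl ((t.comp u).uncurry_cond₂ k') _)
    have w₂ : (t.comp u).uncurryPos _ x k' d w' ≫ (ihom P Q).d = u.act _ _ (hc r x k') :=
      ((t.comp u).uncurryPos_d _ x k' d w').trans (ha r x k').symm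
    refine ⟨?_, ?_, ?_⟩
    · exact (uncurryResp_snd _ (hmid r x k k') (hsnd r x k) (hc r x k') (hj r x k') w w₁).trans
        (homResp_congr (ha r x k') rfl rfl _ ((t.comp u).uncurry_cond₂ k') w₁ w')
    · exact (uncurryResp_fst _ (hmid r x k k') (hsnd r x k) (hc r x k') w (homPos₂ _ _ _ _ _)
        (homPos₃ _ _ _ _ _) w₂).trans (u.resp_congr (hS r).symm rfl rfl _ _ _ _)
    · exact (uncurryNext_eq _ (hmid r x k k') (hsnd r x k) (hc r x k') w (homPos₂ _ _ _ _ _)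
        (homPos₃ _ _ _ _ _) w₂).trans (u.next_congr (hS r).symm rfl rfl _ _ _ _)
  have eF : (uncurryApex T S P).hom ≫ T.compFst S = _ ≫ fstR _ _ := compPair_fst _ _ _ _ _
  have eS : (uncurryApex T S P).hom ≫ T.compSnd S = _ := compPair_snd _ _ _ _ _
  refine ⟨?_, ?_, ?_, ?_, ?_⟩
  · apply prod.hom_ext
    · rw [Category.assoc, uncurry_l_fst, comp_l, ← Category.assoc, eF, comp_l, Category.assoc,
        Category.assoc, prod_l_fst]
    · rw [Category.assoc, uncurry_l_snd, comp_r, Category.assoc, ← Category.assoc, eS, graph_cond,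
        comp_l, Category.assoc, prod_l_snd]
      rfl
  · exact (congrArg (fun k => _ ≫ k) (Category.assoc _ _ _)).trans
      ((Category.assoc _ _ _).symm.trans (congrArg (fun k => k ≫ _) eS))
  · intro Z r x k k'
    exact (uncurryAct_eq ((t.tensor (PolyIso.refl P).graph).mid_cond r x k) (hmid r x k k')
      (hsnd r x k) (hc r x k') (hj r x k')).trans
      (homAct_congr (ha r x k') rfl _ ((t.comp u).uncurry_cond₂ k'))
  · intro Z r x k k' d w w'
    obtain ⟨h₁, h₂, -⟩ := aux r x k k' d w w'
    refine congrArg₂ pairD ?_ ?_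
    · exact t.resp_congr (hF r).symm rfl h₂ _ _ _ _
    · exact (Category.comp_id _).trans h₁
  · intro Z r x k k' d w w'
    obtain ⟨-, h₂, h₃⟩ := aux r x k k' d w w'
    apply comp_ext
    · rw [Category.assoc, eF, ← Category.assoc]
      refine (congrArg (fun k => k ≫ fstR _ _) (compPair_fst _ _ _ _ _)).trans
        ((pairR_fst _ _).trans (Eq.trans ?_ (compPair_fst _ _ _ _ _).symm))
      exact t.next_congr (hF r).symm rfl h₂ _ _ _ _
    · rw [Category.assoc, eS]
      exact (compPair_snd _ _ _ _ _).trans (h₃.trans (compPair_snd _ _ _ _ _).symm)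

end naturality

end SimData

namespace Diag
open SimData PolyDiagram MonoidalCategory

/-- The internal hom of diagrams. -/
def ihom (E F : Diag C) : Diag C := ⟨E.base ⨯ F.base, PolyDiagram.ihom E.diag F.diag⟩

variable {D D' E F : Diag C}

/-- Uncurrying of simulation data, as a morphism. -/
def uncurryData {S : LinSpan D.base (E.base ⨯ F.base)}
    (u : SimData D.diag (PolyDiagram.ihom E.diag F.diag) S) : D ⊗ E ⟶ F :=
  SimData.hom (D := D.tensor E) (E := F) u.uncurry

lemma uncurryData_congr {S S' : LinSpan D.base (E.base ⨯ F.base)}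
    {u : SimData D.diag (PolyDiagram.ihom E.diag F.diag) S}
    {u' : SimData D.diag (PolyDiagram.ihom E.diag F.diag) S'}
    (h : SimData.hom (E := ihom E F) u = SimData.hom (E := ihom E F) u') :
    uncurryData u = uncurryData u' := by
  obtain ⟨f, hf⟩ := exists_along (E := ihom E F) h
  exact SimData.hom_eq (D := D.tensor E) (f := f) hf.uncurry

/-- Uncurrying of morphisms of diagrams. -/
def uncurryHom (f : D ⟶ ihom E F) : D ⊗ E ⟶ F :=
  uncurryData (exists_hom_eq f).choose_spec.choose

lemma uncurryHom_hom {S : LinSpan D.base (E.base ⨯ F.base)}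
    (u : SimData D.diag (PolyDiagram.ihom E.diag F.diag) S) :
    uncurryHom (SimData.hom (E := ihom E F) u) = uncurryData u :=
  uncurryData_congr (exists_hom_eq (SimData.hom (E := ihom E F) u)).choose_spec.choose_spec

lemma uncurryHom_bijective : Function.Bijective (uncurryHom : (D ⟶ ihom E F) → (D ⊗ E ⟶ F)) := by
  constructor
  · intro f g h
    obtain ⟨S, u, rfl⟩ := exists_hom_eq f
    obtain ⟨S', u', rfl⟩ := exists_hom_eq g
    obtain ⟨f, hf⟩ := exists_along (D := D.tensor E)
      ((uncurryHom_hom u).symm.trans (h.trans (uncurryHom_hom u')))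
    exact SimData.hom_eq (E := ihom E F) (f := f) (Along.of_uncurry hf)
  · intro g
    obtain ⟨S, s, rfl⟩ := exists_hom_eq (D := D.tensor E) g
    exact ⟨SimData.hom (E := ihom E F) s.curry, (uncurryHom_hom s.curry).trans
      (SimData.hom_eq (D := D.tensor E) s.curry_uncurry)⟩

lemma uncurryHom_comp (t : D' ⟶ D) (f : D ⟶ ihom E F) :
    uncurryHom (t ≫ f) = t ▷ E ≫ uncurryHom f := by
  obtain ⟨T, t, rfl⟩ := exists_hom_eq t
  obtain ⟨S, u, rfl⟩ := exists_hom_eq f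
  rw [SimData.hom_comp (F := ihom E F)]
  refine (uncurryHom_hom (t.comp u)).trans ?_
  rw [uncurryHom_hom u]
  change _ = tensorHom t.hom (𝟙 E) ≫ _
  rw [← graph_refl, tensorHom_hom]
  refine (SimData.hom_eq (D := D'.tensor E) (f := uncurryApex _ _ _)
    (t.along_uncurry u)).symm.trans ?_
  exact (SimData.hom_comp (D := D'.tensor E) (E := D.tensor E) _ _).symm

end Diag

/-! ### Simulations induced by transformations of polynomial functors -/

section natHom
open StrongFunctor

variable {I J K : C}

lemma whisker_exchange {F F' : StrongFunctor I J} {G G' : StrongFunctor J K} (α : F ⟶ F')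
    (β : G ⟶ G') : whiskerRight α G ≫ whiskerLeft F' β = whiskerLeft F β ≫ whiskerRight α G' :=
  StrongFunctor.hom_ext fun x => StrongNat.naturality β (StrongNat.app α x)

lemma CellEquiv.precomp {F F' : StrongFunctor I I} {G : StrongFunctor J J} {L L' : StrongFunctor I J}
    (φ : F ⟶ F') {ρ : F'.comp L ⟶ L.comp G} {ρ' : F'.comp L' ⟶ L'.comp G} (h : CellEquiv ρ ρ') :
    CellEquiv (whiskerRight φ L ≫ ρ) (whiskerRight φ L' ≫ ρ') := by
  obtain ⟨ε, h⟩ := h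
  refine ⟨ε, ?_⟩
  rw [Category.assoc, h, ← Category.assoc, ← Category.assoc, whisker_exchange]

lemma CellEquiv.postcomp {F : StrongFunctor I I} {G G' : StrongFunctor J J}
    {L L' : StrongFunctor I J} (φ : G ⟶ G') {ρ : F.comp L ⟶ L.comp G} {ρ' : F.comp L' ⟶ L'.comp G}
    (h : CellEquiv ρ ρ') : CellEquiv (ρ ≫ whiskerLeft L φ) (ρ' ≫ whiskerLeft L' φ) := by
  obtain ⟨ε, h⟩ := h
  refine ⟨ε, ?_⟩
  rw [Category.assoc, ← whisker_exchange, ← Category.assoc, h, Category.assoc]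

lemma pasteCell_precomp {F F' : StrongFunctor I I} {G : StrongFunctor J J} {H : StrongFunctor K K}
    {L : StrongFunctor I J} {M : StrongFunctor J K} (φ : F ⟶ F') (ρ : F'.comp L ⟶ L.comp G)
    (σ : G.comp M ⟶ M.comp H) :
    pasteCell (whiskerRight φ L ≫ ρ) σ = whiskerRight φ (L.comp M) ≫ pasteCell ρ σ := by
  refine StrongFunctor.hom_ext fun x => ?_
  rw [CellEquiv.pasteCell_app, comp_app, comp_app, CellEquiv.pasteCell_app]
  exact (congrArg (fun k => k ≫ _) (M.toFunctor.map_comp _ _)).trans (Category.assoc _ _ _)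

lemma pasteCell_postcomp {F : StrongFunctor I I} {G : StrongFunctor J J} {H H' : StrongFunctor K K}
    {L : StrongFunctor I J} {M : StrongFunctor J K} (ψ : H ⟶ H') (ρ : F.comp L ⟶ L.comp G)
    (σ : G.comp M ⟶ M.comp H) :
    pasteCell ρ (σ ≫ whiskerLeft M ψ) = pasteCell ρ σ ≫ whiskerLeft (L.comp M) ψ := by
  refine StrongFunctor.hom_ext fun x => ?_
  rw [CellEquiv.pasteCell_app, comp_app, comp_app, CellEquiv.pasteCell_app]
  exact (Category.assoc _ _ _).symm

lemma transportCell_precomp {F F' : StrongFunctor I I} {G : StrongFunctor J J}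
    {L L' : StrongFunctor I J} (ε : L ≅ L') (φ : F ⟶ F') (ρ : F'.comp L' ⟶ L'.comp G) :
    transportCell ε (whiskerRight φ L' ≫ ρ) = whiskerRight φ L ≫ transportCell ε ρ := by
  rw [transportCell, transportCell, Category.assoc, ← Category.assoc, ← whisker_exchange,
    Category.assoc]

lemma transportCell_postcomp {F : StrongFunctor I I} {G G' : StrongFunctor J J}
    {L L' : StrongFunctor I J} (ε : L ≅ L') (ψ : G ⟶ G') (ρ : F.comp L' ⟶ L'.comp G) :
    transportCell ε (ρ ≫ whiskerLeft L' ψ) = transportCell ε ρ ≫ whiskerLeft L ψ := by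
  rw [transportCell, transportCell, Category.assoc, Category.assoc, Category.assoc,
    whisker_exchange]

lemma idCell_exchange {F G : StrongFunctor I I} (φ : F ⟶ G) :
    whiskerRight φ (StrongFunctor.id I) ≫ idCell G =
      idCell F ≫ whiskerLeft (StrongFunctor.id I) φ :=
  StrongFunctor.hom_ext fun _ => (Category.comp_id _).trans (Category.id_comp _).symm

namespace PFSim

variable {F G H : StrongFunctor I I} {hF : ∃ D : PolyDiagram I I, Nonempty (F ≅ D.ext)}
  {hG : ∃ D : PolyDiagram I I, Nonempty (G ≅ D.ext)}
  {hH : ∃ D : PolyDiagram I I, Nonempty (H ≅ D.ext)}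

/-- The morphism given by a strong natural transformation between polynomial functors on the same
slice, regarded as a simulation along the identity span. -/
def ofNat (φ : F ⟶ G) : (⟨I, F, hF⟩ : PFSim C) ⟶ ⟨I, G, hG⟩ :=
  homMk (P := ⟨I, F, hF⟩) (Q := ⟨I, G, hG⟩)
    ⟨LinSpan.id I, whiskerRight φ _ ≫ (Simulation.id G).cell⟩

lemma ofNat_eq (φ : F ⟶ G) : (ofNat φ : (⟨I, F, hF⟩ : PFSim C) ⟶ ⟨I, G, hG⟩) =
    homMk (P := ⟨I, F, hF⟩) (Q := ⟨I, G, hG⟩)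
      ⟨LinSpan.id I, (Simulation.id F).cell ≫ whiskerLeft _ φ⟩ :=
  congrArg (fun c => homMk (P := ⟨I, F, hF⟩) (Q := ⟨I, G, hG⟩) ⟨LinSpan.id I, c⟩)
    ((transportCell_precomp _ _ _).symm.trans ((congrArg _ (idCell_exchange φ)).trans
      (transportCell_postcomp _ _ _)))

lemma ofNat_comp_homMk (φ : F ⟶ G) {Q : PFSim C} (s : Simulation G Q.fn) :
    (ofNat φ : (⟨I, F, hF⟩ : PFSim C) ⟶ ⟨I, G, hG⟩) ≫ homMk s =
      homMk (P := ⟨I, F, hF⟩) ⟨s.span, whiskerRight φ _ ≫ s.cell⟩ := by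
  refine (congrArg (fun c => homMk (P := ⟨I, F, hF⟩) (Q := Q) ⟨(LinSpan.id I).comp s.span, c⟩)
    ((congrArg _ (pasteCell_precomp φ _ s.cell)).trans (transportCell_precomp _ _ _))).trans ?_
  exact Quotient.sound (CellEquiv.precomp φ (Simulation.id_comp s))

lemma homMk_comp_ofNat {P : PFSim C} (s : Simulation P.fn F) (φ : F ⟶ G) :
    homMk (Q := ⟨I, F, hF⟩) s ≫ (ofNat φ : (⟨I, F, hF⟩ : PFSim C) ⟶ ⟨I, G, hG⟩) =
      homMk (P := P) (Q := ⟨I, G, hG⟩) ⟨s.span, s.cell ≫ whiskerLeft _ φ⟩ := by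
  rw [ofNat_eq]
  refine (congrArg (fun c => homMk (P := P) (Q := ⟨I, G, hG⟩) ⟨s.span.comp (LinSpan.id I), c⟩)
    ((congrArg _ (pasteCell_postcomp φ s.cell _)).trans (transportCell_postcomp _ _ _))).trans ?_
  exact Quotient.sound (CellEquiv.postcomp φ (Simulation.comp_id s))

lemma ofNat_id : (ofNat (𝟙 F) : (⟨I, F, hF⟩ : PFSim C) ⟶ ⟨I, F, hF⟩) = 𝟙 _ :=
  congrArg (fun c => homMk (P := ⟨I, F, hF⟩) (Q := ⟨I, F, hF⟩) ⟨LinSpan.id I, c⟩)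
    ((congrArg (fun k => k ≫ _) (CellEquiv.whiskerRight_id F _)).trans (Category.id_comp _))

lemma ofNat_comp (φ : F ⟶ G) (ψ : G ⟶ H) :
    (ofNat φ : (⟨I, F, hF⟩ : PFSim C) ⟶ ⟨I, G, hG⟩) ≫
      (ofNat ψ : (⟨I, G, hG⟩ : PFSim C) ⟶ ⟨I, H, hH⟩) = ofNat (φ ≫ ψ) :=
  (ofNat_comp_homMk φ (Q := ⟨I, H, hH⟩) _).trans
    (congrArg (fun c => homMk (P := ⟨I, F, hF⟩) (Q := ⟨I, H, hH⟩) ⟨LinSpan.id I, c⟩)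
      ((Category.assoc _ _ _).symm.trans
        (congrArg (fun k => k ≫ _) (CellEquiv.whiskerRight_comp φ ψ _).symm)))

/-- The isomorphism of `PFSim` given by an isomorphism of strong functors. -/
def ofNatIso (φ : F ≅ G) : (⟨I, F, hF⟩ : PFSim C) ≅ ⟨I, G, hG⟩ where
  hom := ofNat φ.hom
  inv := ofNat φ.inv
  hom_inv_id := by rw [ofNat_comp, φ.hom_inv_id, ofNat_id]
  inv_hom_id := by rw [ofNat_comp, φ.inv_hom_id, ofNat_id]

end PFSim

end natHom

/-! ### Comparison of polynomial functors and diagrams -/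

namespace PFSim
open StrongFunctor

/-- The diagram representing a polynomial functor. -/
abbrev toDiag (P : PFSim C) : Diag C := ⟨P.base, P.rep⟩

/-- A polynomial functor is isomorphic to the extension of the diagram representing it. -/
def repHom (P : PFSim C) : P ≅ P.toDiag.fn :=
  ofNatIso (F := P.fn) (G := P.rep.ext) P.repIso

/-- Conjugation of a morphism of polynomial functors by the representations. -/
def repMap {P Q : PFSim C} (f : P ⟶ Q) : P.toDiag.fn ⟶ Q.toDiag.fn :=
  P.repHom.inv ≫ f ≫ Q.repHom.hom

lemma repMap_id (P : PFSim C) : repMap (𝟙 P) = 𝟙 P.toDiag.fn := by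
  rw [repMap, Category.id_comp, Iso.inv_hom_id]

lemma repMap_comp {P Q R : PFSim C} (f : P ⟶ Q) (g : Q ⟶ R) :
    repMap (f ≫ g) = repMap f ≫ repMap g := by simp [repMap]

variable (C) in
/-- The functor sending a polynomial functor to a diagram representing it. -/
def diagFunctor : PFSim C ⥤ Diag C where
  obj P := P.toDiag
  map f := repMap f
  map_id P := repMap_id P
  map_comp f g := repMap_comp f g

/-- The inverse of `repMap`. -/
def repPreimage {P Q : PFSim C} (f : P.toDiag.fn ⟶ Q.toDiag.fn) : P ⟶ Q :=
  P.repHom.hom ≫ f ≫ Q.repHom.inv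

lemma repMap_repPreimage {P Q : PFSim C} (f : P.toDiag.fn ⟶ Q.toDiag.fn) :
    repMap (repPreimage f) = f := by simp [repMap, repPreimage]

lemma repPreimage_repMap {P Q : PFSim C} (f : P ⟶ Q) : repPreimage (repMap f) = f := by
  simp [repMap, repPreimage]

variable (C) in
/-- `diagFunctor` is fully faithful. -/
def fullyFaithful : (diagFunctor C).FullyFaithful where
  preimage f := repPreimage f
  map_preimage f := repMap_repPreimage f
  preimage_map f := repPreimage_repMap f

/-- The extension of a diagram is represented by an isomorphic diagram. -/
def diagFn (D : Diag C) : (diagFunctor C).obj D.fn ≅ D where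
  hom := (D.fn).repHom.inv
  inv := (D.fn).repHom.hom
  hom_inv_id := (D.fn).repHom.inv_hom_id
  inv_hom_id := (D.fn).repHom.hom_inv_id

/-- The cell between the representing diagrams corresponding to the cell of a simulation. -/
def repCell {P Q : PFSim C} (s : Simulation P.fn Q.fn) :
    P.rep.ext.comp s.span.linear ⟶ s.span.linear.comp Q.rep.ext :=
  whiskerRight P.repIso.inv _ ≫ s.cell ≫ whiskerLeft _ Q.repIso.hom

lemma diagFunctor_map_homMk {P Q : PFSim C} (s : Simulation P.fn Q.fn) :
    (diagFunctor C).map (homMk s) = SimData.hom (D := P.toDiag) (E := Q.toDiag)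
      (SimData.ofCell (repCell s)) := by
  refine (congrArg (fun k => P.repHom.inv ≫ k) (homMk_comp_ofNat (P := P) s Q.repIso.hom)).trans ?_
  refine (ofNat_comp_homMk P.repIso.inv (Q := Q.toDiag.fn) _).trans ?_
  exact congrArg (fun c => homMk (P := P.toDiag.fn) (Q := Q.toDiag.fn) ⟨s.span, c⟩)
    ((SimData.ofCell_realizes (repCell s)).eq (SimData.cell_realizes _))

end PFSim

/-! ### Transport of monoidal closed structures along fully faithful functors -/

section transport
open MonoidalCategory

universe v₁ v₂ u₁ u₂

variable {A : Type u₁} [Category.{v₁} A] {B : Type u₂} [Category.{v₂} B] [MonoidalCategory B]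
  {F : A ⥤ B} (hF : F.FullyFaithful) (T : A → A → A)
  (μ : ∀ X Y, F.obj X ⊗ F.obj Y ≅ F.obj (T X Y)) (U : A) (ε : 𝟙_ B ≅ F.obj U)

/-- The operations of the monoidal structure obtained by transport along `F`, on prescribed tensor
products of objects. -/
@[reducible] def transportStruct : MonoidalCategoryStruct A where
  tensorObj := T
  whiskerLeft X _ _ f := hF.preimage ((μ _ _).inv ≫ (F.obj X ◁ F.map f) ≫ (μ _ _).hom)
  whiskerRight f X := hF.preimage ((μ _ _).inv ≫ (F.map f ▷ F.obj X) ≫ (μ _ _).hom)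
  tensorHom f g := hF.preimage ((μ _ _).inv ≫ (F.map f ⊗ₘ F.map g) ≫ (μ _ _).hom)
  tensorUnit := U
  associator X Y Z := hF.preimageIso (((μ _ _).symm ≪≫ ((μ _ _).symm ⊗ᵢ .refl _))
    ≪≫ α_ (F.obj X) (F.obj Y) (F.obj Z) ≪≫ ((.refl _ ⊗ᵢ μ _ _) ≪≫ μ _ _))
  leftUnitor X := hF.preimageIso (((μ _ _).symm ≪≫ (ε.symm ⊗ᵢ .refl _)) ≪≫ λ_ (F.obj X))
  rightUnitor X := hF.preimageIso (((μ _ _).symm ≪≫ (.refl _ ⊗ᵢ ε.symm)) ≪≫ ρ_ (F.obj X))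

/-- The transported structure is compatible with `F`. -/
def transportData :
    letI := transportStruct hF T μ U ε
    Monoidal.InducingFunctorData F :=
  letI := transportStruct hF T μ U ε
  { μIso := μ
    εIso := ε
    whiskerLeft_eq := fun _ _ _ _ => hF.map_preimage _
    whiskerRight_eq := fun _ _ => hF.map_preimage _
    tensorHom_eq := fun _ _ => hF.map_preimage _
    associator_eq := fun _ _ _ => hF.map_preimage _
    leftUnitor_eq := fun _ => hF.map_preimage _
    rightUnitor_eq := fun _ => hF.map_preimage _ }

/-- The monoidal structure obtained by transport along `F`. -/
@[reducible] def transportMonoidal : MonoidalCategory A :=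
  letI := transportStruct hF T μ U ε
  haveI := hF.faithful
  Monoidal.induced F (transportData hF T μ U ε)

/-- The symmetric structure obtained by transport along `F`. -/
@[reducible] def transportSymmetric [SymmetricCategory B] :
    letI := transportMonoidal hF T μ U ε
    SymmetricCategory A :=
  letI := transportStruct hF T μ U ε
  haveI := hF.faithful
  haveI := hF.full
  letI := transportMonoidal hF T μ U ε
  letI : F.Monoidal := Monoidal.fromInducedMonoidal F (transportData hF T μ U ε)
  SymmetricCategory.ofFullyFaithful F

/-- Representing objects for `X ↦ (F X ⊗ F Y ⟶ F Z)` give a bijection of currying for the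
transported structure. -/
def transportCurry (h : B → B → B) (e : ∀ X Y Z : B, (X ⊗ Y ⟶ Z) ≃ (X ⟶ h Y Z)) (k : A → A → A)
    (i : ∀ Y Z, F.obj (k Y Z) ≅ h (F.obj Y) (F.obj Z)) (X Y Z : A) : (T X Y ⟶ Z) ≃ (X ⟶ k Y Z) :=
  hF.homEquiv.trans (((μ X Y).symm.homFromEquiv).trans ((e _ _ _).trans
    ((i Y Z).symm.homToEquiv.trans hF.homEquiv.symm)))

/-- The transported bijections of currying are natural in the first variable. -/
lemma transportCurry_natural (h : B → B → B) (e : ∀ X Y Z : B, (X ⊗ Y ⟶ Z) ≃ (X ⟶ h Y Z))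
    (he : ∀ {X X' : B} (Y Z : B) (f : X' ⟶ X) (g : X ⊗ Y ⟶ Z), e _ _ _ (f ▷ Y ≫ g) = f ≫ e _ _ _ g)
    (k : A → A → A) (i : ∀ Y Z, F.obj (k Y Z) ≅ h (F.obj Y) (F.obj Z)) {X X' : A} (Y Z : A)
    (f : X' ⟶ X) (g : T X Y ⟶ Z) :
    letI := transportMonoidal hF T μ U ε
    transportCurry hF T μ h e k i X' Y Z (f ▷ Y ≫ g) =
      f ≫ transportCurry hF T μ h e k i X Y Z g := by
  let := transportMonoidal hF T μ U ε
  apply hF.map_injective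
  have e₁ : F.map (f ▷ Y) = (μ _ _).inv ≫ (F.map f ▷ F.obj Y) ≫ (μ _ _).hom := hF.map_preimage _
  have e₂ : ∀ {X : A} (g : T X Y ⟶ Z), F.map (transportCurry hF T μ h e k i X Y Z g) =
      e _ _ _ ((μ _ _).hom ≫ F.map g) ≫ (i Y Z).inv := fun g => hF.map_preimage _
  rw [F.map_comp, e₂, e₂, ← Category.assoc, ← he]
  refine congrArg (fun k => e _ _ _ k ≫ (i Y Z).inv) ?_
  refine (congrArg (fun k => (μ _ _).hom ≫ k) (F.map_comp _ _)).trans ?_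
  rw [e₁, Category.assoc, Iso.hom_inv_id_assoc, Category.assoc]

end transport

section internalHom
open MonoidalCategory Opposite

universe v₁ u₁

variable {A : Type u₁} [Category.{v₁} A] [MonoidalCategory A]

/-- Objects representing the presheaves `X ↦ (X ⊗ Y ⟶ Z)` assemble to a functor of `Y` and `Z`. -/
lemma exists_internalHom (h : A → A → A) (e : ∀ X Y Z : A, (X ⊗ Y ⟶ Z) ≃ (X ⟶ h Y Z))
    (he : ∀ {X X' : A} (Y Z : A) (f : X' ⟶ X) (g : X ⊗ Y ⟶ Z),
      e _ _ _ (f ▷ Y ≫ g) = f ≫ e _ _ _ g) :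
    ∃ (H : Aᵒᵖ × A ⥤ A) (e' : ∀ X Y Z : A, (X ⊗ Y ⟶ Z) ≃ (X ⟶ H.obj (op Y, Z))),
      (∀ {X X' : A} (Y Z : A) (f : X' ⟶ X) (g : X ⊗ Y ⟶ Z),
        e' X' Y Z (f ▷ Y ≫ g) = f ≫ e' X Y Z g) ∧
      (∀ (X Y : A) {Z Z' : A} (g : X ⊗ Y ⟶ Z) (k : Z ⟶ Z'),
        e' X Y Z' (g ≫ k) = e' X Y Z g ≫ H.map (CategoryTheory.Prod.mkHom (𝟙 (op Y)) k)) ∧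
      (∀ (X : A) {Y Y' : A} (Z : A) (k : Y' ⟶ Y) (g : X ⊗ Y ⟶ Z),
        e' X Y' Z (X ◁ k ≫ g) = e' X Y Z g ≫ H.map (CategoryTheory.Prod.mkHom k.op (𝟙 Z))) := by
  -- The evaluation morphism is the universal element of the presheaf.
  let ev : ∀ Y Z : A, h Y Z ⊗ Y ⟶ Z := fun Y Z => (e _ _ _).symm (𝟙 _)
  have he_ev : ∀ (X Y Z : A) (g : X ⊗ Y ⟶ Z), e _ _ _ g ▷ Y ≫ ev Y Z = g := fun X Y Z g => by
    apply (e _ _ _).injective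
    rw [he, Equiv.apply_symm_apply, Category.comp_id]
  let m : ∀ {Y Y' Z Z' : A} (k : Y' ⟶ Y) (l : Z ⟶ Z'), h Y Z ⟶ h Y' Z' := fun k l =>
    e _ _ _ (_ ◁ k ≫ ev _ _ ≫ l)
  have hm : ∀ {X Y Y' Z Z' : A} (k : Y' ⟶ Y) (l : Z ⟶ Z') (g : X ⊗ Y ⟶ Z),
      e _ _ _ g ≫ m k l = e _ _ _ (X ◁ k ≫ g ≫ l) := fun k l g => by
    rw [← he, ← whisker_exchange_assoc, ← Category.assoc (_ ▷ _), he_ev]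
  refine ⟨{ obj := fun p => h p.1.unop p.2
            map := fun f => m f.1.unop f.2
            map_id := fun p => ?_
            map_comp := fun f g => ?_ }, e, he, fun X Y Z Z' g k => ?_, fun X Y Y' Z k g => ?_⟩
  · change e _ _ _ (_ ◁ 𝟙 _ ≫ ev _ _ ≫ 𝟙 _) = _
    rw [whiskerLeft_id, Category.id_comp, Category.comp_id, Equiv.apply_symm_apply]
  · change e _ _ _ (_ ◁ (g.1.unop ≫ f.1.unop) ≫ ev _ _ ≫ f.2 ≫ g.2) = e _ _ _ _ ≫ m _ _
    rw [hm]
    simp only [whiskerLeft_comp, Category.assoc]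
  · change _ = e _ _ _ g ≫ m (𝟙 _) k
    rw [hm, whiskerLeft_id, Category.id_comp]
  · change _ = e _ _ _ g ≫ m k (𝟙 _)
    rw [hm, Category.comp_id]

end internalHom

/-! ### External products of generalized elements -/

open StrongFunctor

section boxPair
variable {I J : C} {x : Over I} {y : Over J} {Z : C}

/-- The generalized element `(u, v)` of `x × y`. -/
def boxPair (u : Z ⟶ x.left) (v : Z ⟶ y.left) : Z ⟶ (box x y).left := prod.lift u v

lemma boxPair_fst (u : Z ⟶ x.left) (v : Z ⟶ y.left) : boxPair u v ≫ boxFst x y = u :=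
  prod.lift_fst _ _

lemma boxPair_snd (u : Z ⟶ x.left) (v : Z ⟶ y.left) : boxPair u v ≫ boxSnd x y = v :=
  prod.lift_snd _ _

lemma box_ext {a b : Z ⟶ (box x y).left} (h₁ : a ≫ boxFst x y = b ≫ boxFst x y)
    (h₂ : a ≫ boxSnd x y = b ≫ boxSnd x y) : a = b := prod.hom_ext h₁ h₂

lemma comp_boxPair {Y : C} (t : Y ⟶ Z) (u : Z ⟶ x.left) (v : Z ⟶ y.left) :
    t ≫ boxPair u v = boxPair (t ≫ u) (t ≫ v) := prod.comp_lift _ _ _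

lemma boxPair_map {x' : Over I} {y' : Over J} (g : x ⟶ x') (h : y ⟶ y') (u : Z ⟶ x.left)
    (v : Z ⟶ y.left) :
    boxPair u v ≫ (boxMap g h).left = boxPair (u ≫ g.left) (v ≫ h.left) := prod.lift_map _ _ _ _

lemma boxPair_hom_fst (u : Z ⟶ x.left) (v : Z ⟶ y.left) :
    (boxPair u v ≫ (box x y).hom) ≫ prod.fst = u ≫ x.hom := by
  rw [Category.assoc, ← boxFst_hom, ← Category.assoc, boxPair_fst]

lemma boxPair_hom_snd (u : Z ⟶ x.left) (v : Z ⟶ y.left) :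
    (boxPair u v ≫ (box x y).hom) ≫ prod.snd = v ≫ y.hom := by
  rw [Category.assoc, ← boxSnd_hom, ← Category.assoc, boxPair_snd]

end boxPair

section delta
variable {I J K L : C} (f : K ⟶ I) (g : L ⟶ J) (x : Over I) (y : Over J)

lemma deltaBox_fst : (deltaBox f g x y).left ≫ pullFst (prod.map f g) (box x y) =
    prod.map (pullFst f x) (pullFst g y) := pullLift_fst _ _

lemma pullPair_deltaBoxInv {Z : C} (p : Z ⟶ x.left) (q : Z ⟶ y.left) (δ : Z ⟶ K ⨯ L)
    (h : δ ≫ prod.map f g = boxPair p q ≫ (box x y).hom)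
    (h₁ : (δ ≫ prod.fst) ≫ f = p ≫ x.hom) (h₂ : (δ ≫ prod.snd) ≫ g = q ≫ y.hom) :
    pullPair (prod.map f g) (boxPair p q) δ h ≫ (deltaBoxInv f g x y).left =
      boxPair (pullPair f p (δ ≫ prod.fst) h₁) (pullPair g q (δ ≫ prod.snd) h₂) := by
  have e₁ : (deltaBoxInv f g x y).left ≫ boxFst _ _ = _ := prod.lift_fst _ _
  have e₂ : (deltaBoxInv f g x y).left ≫ boxSnd _ _ = _ := prod.lift_snd _ _
  apply box_ext
  · rw [Category.assoc, e₁, boxPair_fst]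
    apply pullElt_ext
    · rw [pullPair_fst, Category.assoc]
      refine (congrArg (fun k => _ ≫ k) (pullback.lift_fst _ _ _)).trans ?_
      rw [← Category.assoc, pullPair_fst, boxPair_fst]
    · rw [pullPair_hom, Category.assoc]
      refine (congrArg (fun k => _ ≫ k) (pullback.lift_snd _ _ _)).trans ?_
      rw [← Category.assoc, pullPair_hom]
  · rw [Category.assoc, e₂, boxPair_snd]
    apply pullElt_ext
    · rw [pullPair_fst, Category.assoc]
      refine (congrArg (fun k => _ ≫ k) (pullback.lift_fst _ _ _)).trans ?_
      rw [← Category.assoc, pullPair_fst, boxPair_snd]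
    · rw [pullPair_hom, Category.assoc]
      refine (congrArg (fun k => _ ≫ k) (pullback.lift_snd _ _ _)).trans ?_
      rw [← Category.assoc, pullPair_hom]

end delta

/-- The values of a pair of sections at a pair of points are computed componentwise. -/
lemma piEv_box {I J K L : C} {f : I ⟶ K} {g : J ⟶ L} {x : Over I} {y : Over J} {Z : C}
    (p : Z ⟶ ((piFunctor f).obj x).left) (q : Z ⟶ ((piFunctor g).obj y).left) (δ : Z ⟶ I ⨯ J)
    (h : δ ≫ prod.map f g =
      (boxPair p q ≫ (piBox f g x y).left) ≫ ((piFunctor (prod.map f g)).obj (box x y)).hom)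
    (h₁ : (δ ≫ prod.fst) ≫ f = p ≫ ((piFunctor f).obj x).hom)
    (h₂ : (δ ≫ prod.snd) ≫ g = q ≫ ((piFunctor g).obj y).hom) :
    piEv (boxPair p q ≫ (piBox f g x y).left) δ h =
      boxPair (piEv p (δ ≫ prod.fst) h₁) (piEv q (δ ≫ prod.snd) h₂) := by
  have w : δ ≫ prod.map f g = boxPair p q ≫ (box ((piFunctor f).obj x) ((piFunctor g).obj y)).hom := by
    rw [h, Category.assoc, Over.w]
  refine (piEv_left (piBox f g x y) (boxPair p q) δ w).trans ?_
  have e : (Over.pullback (prod.map f g)).map (piBox f g x y) ≫ piCounit (prod.map f g) (box x y) =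
      deltaBoxInv f g ((piFunctor f).obj x) ((piFunctor g).obj y) ≫
        boxMap (piCounit f x) (piCounit g y) := by
    rw [← pi_transpose, piBox, Equiv.symm_apply_apply]
  rw [e, Over.comp_left, ← Category.assoc, pullPair_deltaBoxInv f g _ _ p q δ w h₁ h₂, boxPair_map]
  rfl

namespace PolyDiagram
variable {I J K L : C} {P : PolyDiagram I K} {Q : PolyDiagram J L} {x : Over I} {y : Over J}

variable (P Q x y) in
lemma polyBox_left : (polyBox P Q x y).left = (piBox P.d Q.d _ _).left ≫
    ((piFunctor (prod.map P.d Q.d)).map (deltaBox P.n Q.n x y)).left := Category.id_comp _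

variable {Z : C} (p : Z ⟶ (P.ext.toFunctor.obj x).left) (q : Z ⟶ (Q.ext.toFunctor.obj y).left)

lemma polyBox_shape : (boxPair p q ≫ (polyBox P Q x y).left) ≫ (P.tensor Q).shape (box x y) =
    pairA (p ≫ P.shape x) (q ≫ Q.shape y) := by
  have e : (polyBox P Q x y).left ≫ (P.tensor Q).shape (box x y) =
      prod.map (P.shape x) (Q.shape y) := by
    rw [polyBox_left]
    exact Over.w (piBox P.d Q.d _ _ ≫ (piFunctor (prod.map P.d Q.d)).map (deltaBox P.n Q.n x y))
  rw [Category.assoc, e]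
  exact prod.lift_map _ _ _ _

variable {p q}

/-- The values of a pair of generalized elements at a pair of positions are computed
componentwise. -/
lemma ev_polyBox (e : Z ⟶ ((P.tensor Q).ext.toFunctor.obj (box x y)).left)
    (he : e = boxPair p q ≫ (polyBox P Q x y).left) (δ : Z ⟶ (P.tensor Q).D)
    (h : δ ≫ (P.tensor Q).d = e ≫ (P.tensor Q).shape _)
    (h₁ : (δ ≫ fstD P Q) ≫ P.d = p ≫ P.shape x) (h₂ : (δ ≫ sndD P Q) ≫ Q.d = q ≫ Q.shape y) :
    ev e δ h = boxPair (ev p (δ ≫ fstD P Q) h₁) (ev q (δ ≫ sndD P Q) h₂) := by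
  let x' := (Over.pullback P.n).obj x
  let y' := (Over.pullback Q.n).obj y
  let p' : Z ⟶ ((piFunctor P.d).obj x').left := p
  let q' : Z ⟶ ((piFunctor Q.d).obj y').left := q
  let e₁ : Z ⟶ ((piFunctor (prod.map P.d Q.d)).obj (box x' y')).left :=
    boxPair p' q' ≫ (piBox P.d Q.d x' y').left
  have k : e = e₁ ≫ ((piFunctor (prod.map P.d Q.d)).map (deltaBox P.n Q.n x y)).left := by
    rw [he, polyBox_left]; exact (Category.assoc _ _ _).symm
  have w : δ ≫ prod.map P.d Q.d = e₁ ≫ ((piFunctor (prod.map P.d Q.d)).obj (box x' y')).hom := by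
    refine (h.trans (congrArg (fun k => k ≫ (P.tensor Q).shape _) k)).trans
      ((Category.assoc _ _ _).trans ?_)
    exact congrArg (fun k => e₁ ≫ k)
      (Over.w ((piFunctor (prod.map P.d Q.d)).map (deltaBox P.n Q.n x y)))
  have k₁ := piEv_map (f := prod.map P.d Q.d) (deltaBox P.n Q.n x y) e₁ e k δ h
  have k₂ : piEv e₁ δ w = _ := piEv_box p' q' δ w h₁ h₂
  refine (congrArg (fun k => k ≫ pullFst (P.tensor Q).n (box x y)) (k₁.trans
    (congrArg (fun k => k ≫ (deltaBox P.n Q.n x y).left) k₂))).trans ?_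
  refine (Category.assoc _ _ _).trans ((congrArg (fun k => _ ≫ k)
    (deltaBox_fst P.n Q.n x y)).trans ?_)
  exact prod.lift_map _ _ _ _

end PolyDiagram

namespace LinSpan
variable {I J K L : C} {S : LinSpan I K} {T : LinSpan J L} {x : Over I} {y : Over J} {Z : C}
  (u : Z ⟶ (S.linear.toFunctor.obj x).left) (v : Z ⟶ (T.linear.toFunctor.obj y).left)

lemma linearBox_fst : (boxPair u v ≫ (linearBox S T x y).left) ≫ (S.prod T).linFst (box x y) =
    boxPair (u ≫ S.linFst x) (v ≫ T.linFst y) := by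
  have e : (linearBox S T x y).left ≫ (S.prod T).linFst (box x y) =
      prod.map (S.linFst x) (T.linFst y) := 
    (congrArg (fun k => k ≫ (S.prod T).linFst (box x y)) (Category.id_comp _)).trans
      (deltaBox_fst S.l T.l x y)
  rw [Category.assoc, e]
  exact prod.lift_map _ _ _ _

lemma linearBox_mid : (boxPair u v ≫ (linearBox S T x y).left) ≫ (S.prod T).linMid (box x y) =
    pairR (u ≫ S.linMid x) (v ≫ T.linMid y) := by
  have e : (linearBox S T x y).left ≫ (S.prod T).linMid (box x y) =
      prod.map (S.linMid x) (T.linMid y) :=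
    (congrArg (fun k => k ≫ (S.prod T).linMid (box x y)) (Category.id_comp _)).trans
      (Over.w (deltaBox S.l T.l x y))
  rw [Category.assoc, e]
  exact prod.lift_map _ _ _ _

variable {u v} in
lemma linearBox_map {z : Over (I ⨯ J)} (g : box x y ⟶ z) (e : Z ⟶ z.left)
    (he : e = boxPair (u ≫ S.linFst x) (v ≫ T.linFst y) ≫ g.left)
    (w : e ≫ z.hom = pairR (u ≫ S.linMid x) (v ≫ T.linMid y) ≫ (S.prod T).l) :
    (boxPair u v ≫ (linearBox S T x y).left) ≫ ((S.prod T).linear.toFunctor.map g).left =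
      linPair e (pairR (u ≫ S.linMid x) (v ≫ T.linMid y)) w := by
  apply lin_ext
  · rw [Category.assoc, linMap_fst, ← Category.assoc, linearBox_fst, linPair_fst, he]
  · rw [Category.assoc, linMap_mid, linearBox_mid, linPair_mid]

end LinSpan

/-! ### The tensor product of cells on external products -/

open StrongFunctor

namespace SimData
open PolyDiagram LinSpan

variable {I J I' J' : C} {P : PolyDiagram I I} {Q : PolyDiagram J J} {S : LinSpan I J}
  {P' : PolyDiagram I' I'} {Q' : PolyDiagram J' J'} {T : LinSpan I' J'}

/-- The tensor product of simulation data restricts to the product of the transformations on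
external products of slices. -/
lemma val_tensor (s : SimData P Q S) (t : SimData P' Q' T) {x : Over I} {y : Over I'} {Z : C}
    (r : Z ⟶ S.R) (p : Z ⟶ (P.ext.toFunctor.obj x).left)
    (w : p ≫ (P.ext.toFunctor.obj x).hom = r ≫ S.l) (r' : Z ⟶ T.R)
    (q : Z ⟶ (P'.ext.toFunctor.obj y).left) (w' : q ≫ (P'.ext.toFunctor.obj y).hom = r' ≫ T.l)
    (k : (boxPair p q ≫ (polyBox P P' x y).left) ≫
      ((P.tensor P').ext.toFunctor.obj (box x y)).hom = pairR r r' ≫ (S.prod T).l) :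
    (boxPair (s.val r p w) (t.val r' q w') ≫ (polyBox Q Q' _ _).left) ≫
        ((Q.tensor Q').ext.toFunctor.map (linearBox S T x y)).left =
      (s.tensor t).val (pairR r r') (boxPair p q ≫ (polyBox P P' x y).left) k := by
  have c : ∀ {Y : C} (j : Y ⟶ Z), j ≫ boxPair (s.val r p w) (t.val r' q w') ≫ (polyBox Q Q' _ _).left =
      boxPair (j ≫ s.val r p w) (j ≫ t.val r' q w') ≫ (polyBox Q Q' _ _).left := fun j => by
    rw [← Category.assoc, comp_boxPair]
  have c₁ : ∀ {Y : C} (j : Y ⟶ Z), (j ≫ boxPair p q ≫ (polyBox P P' x y).left) ≫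
      (P.tensor P').shape _ = pairA ((j ≫ p) ≫ P.shape x) ((j ≫ q) ≫ P'.shape y) := fun j => by
    rw [← Category.assoc j, comp_boxPair, polyBox_shape]
  have f₁ : (boxPair p q ≫ (polyBox P P' x y).left) ≫ (P.tensor P').shape _ ≫ fstA P P' =
      p ≫ P.shape x := by rw [← Category.assoc, polyBox_shape, pairA_fst]
  have f₂ : (boxPair p q ≫ (polyBox P P' x y).left) ≫ (P.tensor P').shape _ ≫ sndA P P' =
      q ≫ P'.shape y := by rw [← Category.assoc, polyBox_shape, pairA_snd]
  have g₁ : ∀ {Y : C} (j : Y ⟶ Z), ((j ≫ boxPair p q ≫ (polyBox P P' x y).left) ≫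
      (P.tensor P').shape _) ≫ fstA P P' = (j ≫ p) ≫ P.shape x := fun j => by
    rw [c₁, pairA_fst]
  have g₂ : ∀ {Y : C} (j : Y ⟶ Z), ((j ≫ boxPair p q ≫ (polyBox P P' x y).left) ≫
      (P.tensor P').shape _) ≫ sndA P P' = (j ≫ q) ≫ P'.shape y := fun j => by
    rw [c₁, pairA_snd]
  have r₁ : ∀ {Y : C} (j : Y ⟶ Z), (j ≫ pairR r r') ≫ fstR S T = j ≫ r := fun j => by
    rw [Category.assoc, pairR_fst]
  have r₂ : ∀ {Y : C} (j : Y ⟶ Z), (j ≫ pairR r r') ≫ sndR S T = j ≫ r' := fun j => by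
    rw [Category.assoc, pairR_snd]
  -- the values of the left-hand side
  have key : ∀ {Y : C} (j : Y ⟶ Z) (d : Y ⟶ (Q.tensor Q').D)
      (h : d ≫ (Q.tensor Q').d = (j ≫ (boxPair (s.val r p w) (t.val r' q w') ≫
        (polyBox Q Q' _ _).left) ≫ ((Q.tensor Q').ext.toFunctor.map (linearBox S T x y)).left) ≫
          (Q.tensor Q').shape _)
      (h₁ : (d ≫ fstD Q Q') ≫ Q.d = s.val (j ≫ r) (j ≫ p) (by
        rw [Category.assoc, w, Category.assoc]) ≫ Q.shape _)
      (h₂ : (d ≫ sndD Q Q') ≫ Q'.d = t.val (j ≫ r') (j ≫ q) (by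
        rw [Category.assoc, w', Category.assoc]) ≫ Q'.shape _),
      ev (j ≫ (boxPair (s.val r p w) (t.val r' q w') ≫
        (polyBox Q Q' _ _).left) ≫ ((Q.tensor Q').ext.toFunctor.map (linearBox S T x y)).left) d h =
      boxPair (ev _ (d ≫ fstD Q Q') h₁) (ev _ (d ≫ sndD Q Q') h₂) ≫ (linearBox S T x y).left := by
    intro Y j d h h₁ h₂
    rw [ev_map (linearBox S T x y) (j ≫ boxPair (s.val r p w) (t.val r' q w') ≫
      (polyBox Q Q' _ _).left) _ (by simp only [Category.assoc]),
      ev_polyBox _ (by rw [c j, s.comp_val r p w j, t.comp_val r' q w' j]) d _ h₁ h₂]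
  apply eq_val
  · rw [Category.assoc, map_shape, polyBox_shape, val_shape, val_shape]
    exact congrArg₂ pairA
      (s.act_congr (pairR_fst _ _).symm (by rw [Category.assoc, f₁]) _ _)
      (t.act_congr (pairR_snd _ _).symm (by rw [Category.assoc, f₂]) _ _)
  · intro Y j d h w₁ w₂
    have h₁ : (d ≫ fstD Q Q') ≫ Q.d = s.val (j ≫ r) (j ≫ p) (by
        rw [Category.assoc, w, Category.assoc]) ≫ Q.shape _ := by
      rw [val_shape, d_fst_cond w₂]
      exact s.act_congr (r₁ j) (g₁ j) _ _
    have h₂ : (d ≫ sndD Q Q') ≫ Q'.d = t.val (j ≫ r') (j ≫ q) (by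
        rw [Category.assoc, w', Category.assoc]) ≫ Q'.shape _ := by
      rw [val_shape, d_snd_cond w₂]
      exact t.act_congr (r₂ j) (g₂ j) _ _
    rw [key j d h h₁ h₂, linearBox_mid, ev_val_mid, ev_val_mid]
    exact congrArg₂ pairR
      (s.next_congr (r₁ j).symm (g₁ j).symm rfl _ _ _ _)
      (t.next_congr (r₂ j).symm (g₂ j).symm rfl _ _ _ _)
  · intro Y j d h w₁ w₂
    have h₁ : (d ≫ fstD Q Q') ≫ Q.d = s.val (j ≫ r) (j ≫ p) (by
        rw [Category.assoc, w, Category.assoc]) ≫ Q.shape _ := by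
      rw [val_shape, d_fst_cond w₂]
      exact s.act_congr (r₁ j) (g₁ j) _ _
    have h₂ : (d ≫ sndD Q Q') ≫ Q'.d = t.val (j ≫ r') (j ≫ q) (by
        rw [Category.assoc, w', Category.assoc]) ≫ Q'.shape _ := by
      rw [val_shape, d_snd_cond w₂]
      exact t.act_congr (r₂ j) (g₂ j) _ _
    rw [key j d h h₁ h₂, linearBox_fst, ev_val_fst, ev_val_fst]
    have u₁ : (((s.tensor t).resp (j ≫ pairR r r') _ w₁ d w₂) ≫ fstD P P') ≫ P.d =
        (j ≫ p) ≫ P.shape x := by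
      rw [Category.assoc, ← tensor_d_fst, ← Category.assoc, resp_d, g₁]
    have u₂ : (((s.tensor t).resp (j ≫ pairR r r') _ w₁ d w₂) ≫ sndD P P') ≫ P'.d =
        (j ≫ q) ≫ P'.shape y := by
      rw [Category.assoc, ← tensor_d_snd, ← Category.assoc, resp_d, g₂]
    rw [ev_polyBox _ (by rw [← Category.assoc, comp_boxPair]) _ _ u₁ u₂]
    refine congrArg₂ boxPair (ev_congr rfl ?_) (ev_congr rfl ?_)
    · exact (s.resp_congr (r₁ j).symm (g₁ j).symm rfl _ _ _ _).trans (pairD_fst _ _).symm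
    · exact (t.resp_congr (r₂ j).symm (g₂ j).symm rfl _ _ _ _).trans (pairD_snd _ _).symm

end SimData

namespace PFSim
open StrongFunctor PolyDiagram LinSpan

/-- The cell of a simulation on generalized elements, in terms of the data it corresponds to between
the representing diagrams. -/
lemma val_repCell {P Q : PFSim C} (s : Simulation P.fn Q.fn) {x : Over P.base} {Z : C}
    (u : Z ⟶ (s.span.linear.toFunctor.obj (P.fn.toFunctor.obj x)).left)
    (w : ((u ≫ s.span.linFst _) ≫ (StrongNat.app P.repIso.hom x).left) ≫
      (P.rep.ext.toFunctor.obj x).hom = (u ≫ s.span.linMid _) ≫ s.span.l) :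
    (u ≫ (StrongNat.app s.cell x).left) ≫
        (StrongNat.app Q.repIso.hom (s.span.linear.toFunctor.obj x)).left =
      (SimData.ofCell (repCell s)).val (u ≫ s.span.linMid _)
        ((u ≫ s.span.linFst _) ≫ (StrongNat.app P.repIso.hom x).left) w := by
  rw [← SimData.ofCell_realizes (repCell s) x _ _ w]
  have e : (cellApp (repCell s) x).left =
      (s.span.linear.toFunctor.map (StrongNat.app P.repIso.inv x)).left ≫
        (StrongNat.app s.cell x).left ≫
          (StrongNat.app Q.repIso.hom (s.span.linear.toFunctor.obj x)).left := rfl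
  have k : linPair ((u ≫ s.span.linFst _) ≫ (StrongNat.app P.repIso.hom x).left)
      (u ≫ s.span.linMid _) w ≫
        (s.span.linear.toFunctor.map (StrongNat.app P.repIso.inv x)).left = u := by
    have i : StrongNat.app P.repIso.hom x ≫ StrongNat.app P.repIso.inv x = 𝟙 _ :=
      (StrongFunctor.comp_app _ _ _).symm.trans
        (congrArg (fun k => StrongNat.app k x) P.repIso.hom_inv_id)
    apply lin_ext
    · rw [Category.assoc, linMap_fst, ← Category.assoc, linPair_fst, Category.assoc,
        ← Over.comp_left, i]
      exact Category.comp_id _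
    · rw [Category.assoc, linMap_mid, linPair_mid]
  rw [e, ← Category.assoc, k, Category.assoc]

lemma boxPair_tensorBox (P Q : PFSim C) {x : Over P.base} {y : Over Q.base} {Z : C}
    (p : Z ⟶ (P.fn.toFunctor.obj x).left) (q : Z ⟶ (Q.fn.toFunctor.obj y).left) :
    boxPair p q ≫ (tensorBox P Q x y).left =
      boxPair (p ≫ (StrongNat.app P.repIso.hom x).left) (q ≫ (StrongNat.app Q.repIso.hom y).left) ≫
        (polyBox P.rep Q.rep x y).left :=
  (Category.assoc _ _ _).symm.trans (congrArg (fun k => k ≫ _) (boxPair_map _ _ _ _))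

/-- The tensor product of the cells of two simulations, encoded by the tensor product of the data
that the cells correspond to between the representing diagrams. -/
def tensorCell {P P' Q Q' : PFSim C} (s : Simulation P.fn P'.fn) (t : Simulation Q.fn Q'.fn) :
    (P.tensor Q).fn.comp (s.span.prod t.span).linear ⟶
      (s.span.prod t.span).linear.comp (P'.tensor Q').fn :=
  ((SimData.ofCell (repCell s)).tensor (SimData.ofCell (repCell t))).cell

lemma isTensorCell_tensorCell {P P' Q Q' : PFSim C} (s : Simulation P.fn P'.fn)
    (t : Simulation Q.fn Q'.fn) : IsTensorCell s t (tensorCell s t) := by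
  intro x y
  let u := boxFst (s.span.linear.toFunctor.obj (P.fn.toFunctor.obj x))
    (t.span.linear.toFunctor.obj (Q.fn.toFunctor.obj y))
  let v := boxSnd (s.span.linear.toFunctor.obj (P.fn.toFunctor.obj x))
    (t.span.linear.toFunctor.obj (Q.fn.toFunctor.obj y))
  have huv : boxPair u v = 𝟙 _ := box_ext
    ((boxPair_fst u v).trans (Category.id_comp _).symm)
    ((boxPair_snd u v).trans (Category.id_comp _).symm)
  have wu : ((u ≫ s.span.linFst _) ≫ (StrongNat.app P.repIso.hom x).left) ≫
      (P.rep.ext.toFunctor.obj x).hom = (u ≫ s.span.linMid _) ≫ s.span.l := by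
    rw [Category.assoc, Over.w, Category.assoc, lin_condition, Category.assoc]
  have wv : ((v ≫ t.span.linFst _) ≫ (StrongNat.app Q.repIso.hom y).left) ≫
      (Q.rep.ext.toFunctor.obj y).hom = (v ≫ t.span.linMid _) ≫ t.span.l := by
    rw [Category.assoc, Over.w, Category.assoc, lin_condition, Category.assoc]
  have k : (boxPair ((u ≫ s.span.linFst _) ≫ (StrongNat.app P.repIso.hom x).left)
      ((v ≫ t.span.linFst _) ≫ (StrongNat.app Q.repIso.hom y).left) ≫
        (polyBox P.rep Q.rep x y).left) ≫
      ((P.rep.tensor Q.rep).ext.toFunctor.obj (box x y)).hom =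
        pairR (u ≫ s.span.linMid _) (v ≫ t.span.linMid _) ≫ (s.span.prod t.span).l := by
    rw [Category.assoc, Over.w]
    apply prod.hom_ext
    · rw [boxPair_hom_fst, wu, Category.assoc _ _ prod.fst, prod_l_fst, ← Category.assoc _ _ s.span.l,
        pairR_fst]
    · rw [boxPair_hom_snd, wv, Category.assoc _ _ prod.snd, prod_l_snd, ← Category.assoc _ _ t.span.l,
        pairR_snd]
  have e₁ : (boxPair u v ≫ (linearBox s.span t.span _ _).left) ≫
      ((s.span.prod t.span).linear.toFunctor.map (tensorBox P Q x y)).left =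
        linPair _ (pairR (u ≫ s.span.linMid _) (v ≫ t.span.linMid _)) k :=
    linearBox_map (S := s.span) (T := t.span) (tensorBox P Q x y) _
      (boxPair_tensorBox P Q _ _).symm k
  have e₂ := SimData.cell_realizes
    ((SimData.ofCell (repCell s)).tensor (SimData.ofCell (repCell t))) (box x y) _ _ k
  have e₃ : (boxPair u v ≫ (boxMap (StrongNat.app s.cell x) (StrongNat.app t.cell y)).left) ≫
      (tensorBox P' Q' (s.span.linear.toFunctor.obj x) (t.span.linear.toFunctor.obj y)).left =
      boxPair ((SimData.ofCell (repCell s)).val _ _ wu) ((SimData.ofCell (repCell t)).val _ _ wv) ≫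
        (polyBox P'.rep Q'.rep _ _).left := by
    rw [← val_repCell s u wu, ← val_repCell t v wv, boxPair_map]
    exact boxPair_tensorBox P' Q' _ _
  have e₄ := SimData.val_tensor (SimData.ofCell (repCell s)) (SimData.ofCell (repCell t))
    _ _ wu _ _ wv k
  have key := ((congrArg (fun k => k ≫ (cellApp (tensorCell s t) (box x y)).left) e₁).trans e₂).trans
    (e₄.symm.trans (congrArg (fun k => k ≫ ((P'.tensor Q').fn.toFunctor.map
      (linearBox s.span t.span x y)).left) e₃).symm)
  rw [huv, Category.id_comp, Category.id_comp] at key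
  apply Over.OverMorphism.ext
  exact (Category.assoc _ _ _).symm.trans (key.trans (Category.assoc _ _ _))

end PFSim

/-! ### The symmetric monoidal closed structure on `PFSim` -/

namespace PFSim
open MonoidalCategory

/-- The tensor product of polynomial functors is represented by the tensor product of the
representing diagrams. -/
def tensorRep (P Q : PFSim C) :
    (diagFunctor C).obj P ⊗ (diagFunctor C).obj Q ≅ (diagFunctor C).obj (P.tensor Q) :=
  (diagFn (P.toDiag.tensor Q.toDiag)).symm

variable (C) in
/-- The unit object, the polynomial functor of the unit diagram. -/
def unit : PFSim C := (Diag.unit C).fn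

variable (C) in
/-- The unit object is represented by the unit diagram. -/
def unitRep : 𝟙_ (Diag C) ≅ (diagFunctor C).obj (unit C) := (diagFn (Diag.unit C)).symm

/-- The monoidal structure on `PFSim C` whose tensor product on objects is `PFSim.tensor`,
transported from `Diag C`. -/
@[reducible] def monoidal : MonoidalCategory (PFSim C) :=
  transportMonoidal (fullyFaithful C) tensor tensorRep (unit C) (unitRep C)

/-- Transport turns the tensor product of data into the tensor product of simulations. -/
lemma monoidal_tensorHom {P P' Q Q' : PFSim C} (s : Simulation P.fn P'.fn)
    (t : Simulation Q.fn Q'.fn) :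
    letI := monoidal (C := C)
    (homMk s ⊗ₘ homMk t : P.tensor Q ⟶ P'.tensor Q') =
      homMk (P := P.tensor Q) (Q := P'.tensor Q') ⟨s.span.prod t.span, tensorCell s t⟩ := by
  let := monoidal (C := C)
  apply (fullyFaithful C).map_injective
  refine ((fullyFaithful C).map_preimage _).trans ?_
  refine congrArg (fun k => (tensorRep P Q).inv ≫ k ≫ (tensorRep P' Q').hom) ?_
  rw [diagFunctor_map_homMk, diagFunctor_map_homMk]
  exact Diag.tensorHom_hom _ _

/-- The bijections of currying. The internal hom is formed on representing diagrams. -/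
def curry (P Q R : PFSim C) : (P.tensor Q ⟶ R) ≃ (P ⟶ (Diag.ihom Q.toDiag R.toDiag).fn) :=
  transportCurry (fullyFaithful C) tensor tensorRep Diag.ihom
    (fun _ _ _ => (Equiv.ofBijective _ Diag.uncurryHom_bijective).symm)
    (fun Q R => (Diag.ihom Q.toDiag R.toDiag).fn) (fun _ _ => diagFn _) P Q R

lemma curry_natural {P P' : PFSim C} (Q R : PFSim C) (f : P' ⟶ P) (g : P.tensor Q ⟶ R) :
    letI := monoidal (C := C)
    curry P' Q R (f ▷ Q ≫ g) = f ≫ curry P Q R g := by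
  refine transportCurry_natural (fullyFaithful C) tensor tensorRep (unit C) (unitRep C) _ _ ?_ _ _
    Q R f g
  intro X X' Y Z f g
  apply Diag.uncurryHom_bijective.injective
  rw [Diag.uncurryHom_comp]
  refine (Equiv.apply_symm_apply (Equiv.ofBijective _ Diag.uncurryHom_bijective) _).trans ?_
  exact congrArg (fun k => f ▷ Y ≫ k)
    (Equiv.apply_symm_apply (Equiv.ofBijective _ Diag.uncurryHom_bijective) g).symm

end PFSim

end PolySim

end

open CategoryTheory MonoidalCategory Opposite in
theorem proposition2p6 {C : Type u} [Category.{v} C] [PolySim.LCCC C] :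
    ∃ (_ : MonoidalCategory (PolySim.PFSim C)) (_ : SymmetricCategory (PolySim.PFSim C))
      (hobj : ∀ P Q : PolySim.PFSim C, P ⊗ Q = P.tensor Q),
      (∀ {P P' Q Q' : PolySim.PFSim C} (s : PolySim.Simulation P.fn P'.fn)
          (t : PolySim.Simulation Q.fn Q'.fn),
        ∃ ρ : (P.tensor Q).fn.comp (s.span.prod t.span).linear ⟶
            (s.span.prod t.span).linear.comp (P'.tensor Q').fn,
          PolySim.PFSim.IsTensorCell s t ρ ∧
          PolySim.PFSim.homMk s ⊗ₘ PolySim.PFSim.homMk t =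
            eqToHom (hobj P Q) ≫
              PolySim.PFSim.homMk (P := P.tensor Q) (Q := P'.tensor Q') ⟨s.span.prod t.span, ρ⟩ ≫
                eqToHom (hobj P' Q').symm) ∧
      ∃ (H : (PolySim.PFSim C)ᵒᵖ × PolySim.PFSim C ⥤ PolySim.PFSim C)
        (e : ∀ P₁ P₂ P₃ : PolySim.PFSim C, (P₁ ⊗ P₂ ⟶ P₃) ≃ (P₁ ⟶ H.obj (op P₂, P₃))),
        (∀ {P₁ P₁' : PolySim.PFSim C} (P₂ P₃ : PolySim.PFSim C) (f : P₁' ⟶ P₁) (g : P₁ ⊗ P₂ ⟶ P₃),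
          e P₁' P₂ P₃ (f ▷ P₂ ≫ g) = f ≫ e P₁ P₂ P₃ g) ∧
        (∀ (P₁ P₂ : PolySim.PFSim C) {P₃ P₃' : PolySim.PFSim C} (g : P₁ ⊗ P₂ ⟶ P₃) (h : P₃ ⟶ P₃'),
          e P₁ P₂ P₃' (g ≫ h) = e P₁ P₂ P₃ g ≫ H.map (CategoryTheory.Prod.mkHom (𝟙 (op P₂)) h)) ∧
        (∀ (P₁ : PolySim.PFSim C) {P₂ P₂' : PolySim.PFSim C} (P₃ : PolySim.PFSim C)
            (k : P₂' ⟶ P₂) (g : P₁ ⊗ P₂ ⟶ P₃),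
          e P₁ P₂' P₃ (P₁ ◁ k ≫ g) = e P₁ P₂ P₃ g ≫ H.map (CategoryTheory.Prod.mkHom k.op (𝟙 P₃))) := by
  let := PolySim.PFSim.monoidal (C := C)
  refine ⟨PolySim.PFSim.monoidal, PolySim.transportSymmetric (PolySim.PFSim.fullyFaithful C) _
    PolySim.PFSim.tensorRep _ (PolySim.PFSim.unitRep C), fun _ _ => rfl, fun s t => ?_, ?_⟩
  · refine ⟨PolySim.PFSim.tensorCell s t, PolySim.PFSim.isTensorCell_tensorCell s t, ?_⟩
    rw [eqToHom_refl, eqToHom_refl, Category.id_comp]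
    exact (PolySim.PFSim.monoidal_tensorHom s t).trans (Category.comp_id _).symm
  · exact PolySim.exists_internalHom _ PolySim.PFSim.curry PolySim.PFSim.curry_natural
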